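/- **Setting.** Let $\mathbb D\subset\mathbb C$ be the unit disc, $\mathbb S^1=\partial\mathbb D$, $k\in\mathbb N$, $\bar d=(d_1,\dots,d_k)\in\mathbb Z^k$, $d=\sum_j d_j$ and $0<\beta<1$. For a set $A$ let $A_*^k$ be the set of $k$-tuples of mutually distinct points of $A$. Let $X$ (resp. $X_\beta$) be the Banach space of functions holomorphic in $\mathbb D$ and $C^1$ (resp. $C^{1,\beta}$) on $\overline{\mathbb D}$, with the $C^1$ (resp. $C^{1,\beta}$) norm. Let $V\subset X$ (resp. $V_\beta\subset X_\beta$) be the set of those $f$ that are bijective from $\overline{\mathbb D}$ onto $f(\overline{\mathbb D})=\overline{f(\mathbb D)}$, with inverse holomorphic in $f(\mathbb D)$ and $C^1$ (resp. $C^{1,\beta}$) on $\overline{f(\mathbb D)}$. (The domains $f(\mathbb D)$ with $f\in V_\beta$ are exactly the bounded simply connected $C^{1,\beta}$ domains, and the elements of $V_\beta$ are their conformal representations.) For $f\in V$ and $\alpha\in\mathbb D^k_*$ write $f(\alpha)=(f(\alpha_1),\dots,f(\alpha_k))$. For $E\in\{\mathbb R,\mathbb C,\mathbb S^1\}$, $C^{1,\beta}(\partial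 f(\mathbb D);E)$ consists of the functions $u\circ f^{-1}$ with $u\in C^{1,\beta}(\mathbb S^1;E)$, $f\in V_\beta$, with the norm of $u$. For $\Omega=f(\mathbb D)$, $f\in V$, a map $g\in H^{1/2}(\partial\Omega;\mathbb S^1)$ of degree $d$ and $a\in\Omega^k_*$, let $\Phi_{a,g}$ be the (weak) solution of $$\Delta\Phi_{a,g}=2\pi\sum_{j}d_j\delta_{a_j}\ \text{in }\Omega,\qquad \frac{\partial\Phi_{a,g}}{\partial\nu}=g\wedge\frac{\partial g}{\partial\tau}\ \text{on }\partial\Omega,\qquad \int_{\partial\Omega}\Phi_{a,g}=0,$$ whose regular part $R_{a,g}=\Phi_{a,g}-\sum_j d_j\log|\cdot-a_j|$ is in $H^1(\Omega)$, and let $$W^\Omega(a,g)=-\pi\sum_{j\ne l}d_jd_l\log|a_j-a_l|+\frac12\int_{\partial\Omega}\Phi_{a,g}\Big(g\wedge\frac{\partial g}{\partial\tau}\Big)-\pi\sum_j d_jR_{a,g}(a_j)$$ be the renormalized energy (boundary integrals involving $g\wedge\partial g/\partial\tau$ are $H^{-1/2}$–$H^{1/2}$ duality brackets). A critical point of $W^\Omega(\cdot,g)$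 is nondegenerate if the Hessian there is a nondegenerate bilinear form on $(\mathbb R^2)^k$. **(1)** Let $f_0\in V$, $\Omega_0=f_0(\mathbb D)$, $\alpha^0\in\mathbb D_*^k$ and $g_0\in H^{1/2}(\mathbb S^1;\mathbb S^1)$ of degree $d$ be such that $a^0:=f_0(\alpha^0)$ is a nondegenerate critical point of $W^{\Omega_0}(\cdot,g_0\circ f_0^{-1})$. Then there exist an open neighborhood $\mathcal V$ of $(f_0,0)$ in $V\times H^{1/2}(\mathbb S^1;\mathbb R)$, a smooth ($C^\infty$) map $\alpha:\mathcal V\to\mathbb D_*^k$ and some $\delta>0$ such that, for all $(f,\psi)\in\mathcal V$, with $\Omega:=f(\mathbb D)$ and $g:=(g_0e^{\imath\psi})\circ f^{-1}\in H^{1/2}(\partial\Omega;\mathbb S^1)$: $W^\Omega(\cdot,g)$ has a unique critical point $a\in\Omega^k_*$ with $|f^{-1}(a)-\alpha^0|<\delta$; it is $a=f(\alpha(f,\psi))$; and it is nondegenerate. **(2)** Let $f_0\in V_\beta$, $\Omega_0=f_0(\mathbb D)$, $\alpha^0\in\mathbb D_*^k$ and $g_0\in C^{1,\beta}(\mathbb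 S^1;\mathbb S^1)$ of degree $d$ be such that $a^0:=f_0(\alpha^0)$ is a nondegenerate critical point of $W^{\Omega_0}(\cdot,g_0\circ f_0^{-1})$. Then the conclusion of (1) holds with $V$, $H^{1/2}(\mathbb S^1;\mathbb R)$ and $H^{1/2}(\partial\Omega;\mathbb S^1)$ replaced by $V_\beta$, $C^{1,\beta}(\mathbb S^1;\mathbb R)$ and $C^{1,\beta}(\partial\Omega;\mathbb S^1)$. **(3)** Let $\Omega=f(\mathbb D)$ with $f\in V_\beta$, let $g_0\in C^{1,\beta}(\partial\Omega;\mathbb S^1)$ have degree $d$, and let $a^0\in\Omega_*^k$ be a nondegenerate critical point of $W^\Omega(\cdot,g_0)$. Then there exist an open neighborhood $\mathfrak A$ of $g_0$ in $C^{1,\beta}(\partial\Omega;\mathbb C)$ and $\delta>0$ such that, for every $\mathbb S^1$-valued $g\in\mathfrak A$, $W^\Omega(\cdot,g)$ has a unique critical point $a(g)\in\Omega_*^k$ with $|a(g)-a^0|<\delta$, and $a(g)$ is nondegenerate. Moreover, there is an open neighborhood $\mathfrak B$ of $0$ in $C^{1,\beta}(\partial\Omega;\mathbb R)$ such that $g_0e^{\imath\psi}\in\mathfrak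 A$ for all $\psi\in\mathfrak B$, and $\psi\mapsto a(g_0e^{\imath\psi})$ is $C^\infty$ on $\mathfrak B$. -/

import Mathlib

open Real Set Filter Topology MeasureTheory
open scoped ContDiff

noncomputable section

namespace RenormEnergy

instance instFactTwoPiPos : Fact (0 < 2 * π) := ⟨Real.two_pi_pos⟩

/-- The unit circle `𝕊¹`, parametrised by the angle `θ ∈ ℝ / 2πℤ`. Its measure `volume` is the
arc length `dθ`, of total mass `2π`. -/
abbrev Torus : Type := AddCircle (2 * π)

/-- The point `e^{iθ}` of the unit circle. -/
def expi (θ : Torus) : ℂ := (AddCircle.toCircle θ : ℂ)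

/-- The open unit disc `𝔻`. -/
abbrev disc : Set ℂ := Metric.ball 0 1

/-- The closed unit disc. -/
abbrev cdisc : Set ℂ := Metric.closedBall 0 1

/-! ## Function spaces

Each space is the graph of a closed operator inside a product of complete normed spaces, with the
induced (graph) norm. -/

/-- The Sobolev space `H^{1/2}(𝕊¹; E)`: pairs `(u, q)` of an `L²` function `u` on the circle and its
difference quotient `q(x, y) = (u(x) - u(y)) / |x - y|`, required to be in `L²(𝕊¹ × 𝕊¹)`. The norm
is equivalent to the usual one, `‖u‖_{L²}` plus the Gagliardo seminorm
`(∬ |u(x) - u(y)|² / |x - y|² dx dy)^{1/2}`. -/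
def H12Graph (E : Type) [NormedAddCommGroup E] [NormedSpace ℝ E] :
    Submodule ℝ (Lp E 2 (volume : Measure Torus) ×
      Lp E 2 ((volume : Measure Torus).prod (volume : Measure Torus))) where
  carrier := {w | ∀ᵐ p : Torus × Torus ∂((volume : Measure Torus).prod (volume : Measure Torus)),
    w.2 p = ‖expi p.1 - expi p.2‖⁻¹ • (w.1 p.1 - w.1 p.2)}
  zero_mem' := by
    have h0 := Lp.coeFn_zero E 2 (volume : Measure Torus)
    have h1 := Lp.coeFn_zero E 2 ((volume : Measure Torus).prod (volume : Measure Torus))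
    have ha := (Measure.quasiMeasurePreserving_fst
      (μ := (volume : Measure Torus)) (ν := (volume : Measure Torus))).ae h0
    have hb := (Measure.quasiMeasurePreserving_snd
      (μ := (volume : Measure Torus)) (ν := (volume : Measure Torus))).ae h0
    filter_upwards [h1, ha, hb] with p hp hpa hpb
    simp only [Prod.fst_zero, Prod.snd_zero, hp, hpa, hpb, Pi.zero_apply, sub_self, smul_zero]
  add_mem' := by
    intro v w hv hw
    have h0 := Lp.coeFn_add v.1 w.1
    have h1 := Lp.coeFn_add v.2 w.2
    have ha := (Measure.quasiMeasurePreserving_fst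
      (μ := (volume : Measure Torus)) (ν := (volume : Measure Torus))).ae h0
    have hb := (Measure.quasiMeasurePreserving_snd
      (μ := (volume : Measure Torus)) (ν := (volume : Measure Torus))).ae h0
    filter_upwards [hv, hw, h1, ha, hb] with p hvp hwp hp hpa hpb
    simp only [Prod.fst_add, Prod.snd_add, hp, hpa, hpb, Pi.add_apply, hvp, hwp, ← smul_add]
    congr 1
    abel
  smul_mem' := by
    intro c v hv
    have h0 := Lp.coeFn_smul c v.1
    have h1 := Lp.coeFn_smul c v.2
    have ha := (Measure.quasiMeasurePreserving_fst
      (μ := (volume : Measure Torus)) (ν := (volume : Measure Torus))).ae h0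
    have hb := (Measure.quasiMeasurePreserving_snd
      (μ := (volume : Measure Torus)) (ν := (volume : Measure Torus))).ae h0
    filter_upwards [hv, h1, ha, hb] with p hvp hp hpa hpb
    simp only [Prod.smul_fst, Prod.smul_snd, hp, hpa, hpb, Pi.smul_apply, hvp, ← smul_sub]
    rw [smul_comm]

/-- The Banach space `H^{1/2}(𝕊¹; E)`. -/
abbrev H12 (E : Type) [NormedAddCommGroup E] [NormedSpace ℝ E] : Type := H12Graph E

/-- (A representative of) the function on the circle underlying an element of `H^{1/2}`. -/
def H12.fn {E : Type} [NormedAddCommGroup E] [NormedSpace ℝ E] (u : H12 E) : Torus → E :=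
  fun θ => u.1.1 θ

/-- The Hölder space `C^{1,β}(𝕊¹; E)`: triples of a continuous function `u`, its continuous
derivative `u'` with respect to `θ`, and the bounded function
`(u'(x) - u'(y)) / dist(x, y)^β` of `(x, y)`. The norm is the maximum of `sup |u|`, `sup |u'|` and
the `β`-Hölder seminorm of `u'`. -/
def C1HolderGraph (β : ℝ) (E : Type) [NormedAddCommGroup E] [NormedSpace ℝ E] :
    Submodule ℝ (C(Torus, E) × C(Torus, E) × lp (fun _ : Torus × Torus => E) ⊤) where
  carrier := {w | (∀ t : ℝ, HasDerivAt (fun s : ℝ => w.1 (s : Torus)) (w.2.1 (t : Torus)) t) ∧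
    ∀ p : Torus × Torus, w.2.2 p = (dist p.1 p.2 ^ β)⁻¹ • (w.2.1 p.1 - w.2.1 p.2)}
  zero_mem' := by
    refine ⟨fun t => ?_, fun p => ?_⟩
    · simpa using hasDerivAt_const t (0 : E)
    · simp
  add_mem' := by
    intro v w hv hw
    refine ⟨fun t => ?_, fun p => ?_⟩
    · exact (hv.1 t).add (hw.1 t)
    · simp only [Prod.fst_add, Prod.snd_add, lp.coeFn_add, Pi.add_apply, ContinuousMap.add_apply,
        hv.2 p, hw.2 p, ← smul_add]
      congr 1
      abel
  smul_mem' := by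
    intro c v hv
    refine ⟨fun t => ?_, fun p => ?_⟩
    · exact (hv.1 t).const_smul c
    · simp only [Prod.smul_fst, Prod.smul_snd, lp.coeFn_smul, Pi.smul_apply,
        ContinuousMap.smul_apply, hv.2 p, ← smul_sub]
      rw [smul_comm]

/-- The Banach space `C^{1,β}(𝕊¹; E)`. -/
abbrev C1Holder (β : ℝ) (E : Type) [NormedAddCommGroup E] [NormedSpace ℝ E] : Type :=
  C1HolderGraph β E

/-- The function on the circle underlying an element of `C^{1,β}(𝕊¹; E)`. -/
def C1Holder.fn {β : ℝ} {E : Type} [NormedAddCommGroup E] [NormedSpace ℝ E] (u : C1Holder β E) :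
    Torus → E := fun θ => u.1.1 θ

/-- Extension by zero of a function on the closed disc. -/
def extendZero (u : C(cdisc, ℂ)) : ℂ → ℂ :=
  open Classical in fun z => if h : z ∈ cdisc then u ⟨z, h⟩ else 0

theorem extendZero_zero : extendZero 0 = 0 := by
  funext z; simp [extendZero]

theorem extendZero_add (u v : C(cdisc, ℂ)) :
    extendZero (u + v) = extendZero u + extendZero v := by
  funext z; by_cases h : z ∈ cdisc <;> simp [extendZero, h]

theorem extendZero_smul (c : ℝ) (u : C(cdisc, ℂ)) :
    extendZero (c • u) = c • extendZero u := by
  funext z; by_cases h : z ∈ cdisc <;> simp [extendZero, h]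

/-- The space `X` of functions which are holomorphic in `𝔻` and `C¹` on the closed disc: pairs
`(f, f')` of continuous functions on the closed disc such that `f'` is the complex derivative of `f`
in `𝔻`. The norm is the `C¹` norm `max (sup |f|) (sup |f'|)`. -/
def HolC1Graph : Submodule ℝ (C(cdisc, ℂ) × C(cdisc, ℂ)) where
  carrier := {w | ∀ z ∈ disc, HasDerivAt (extendZero w.1) (extendZero w.2 z) z}
  zero_mem' := by
    intro z _
    simp [extendZero_zero]
  add_mem' := by
    intro v w hv hw z hz
    simpa [extendZero_add] using (hv z hz).add (hw z hz)
  smul_mem' := by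
    intro c v hv z hz
    simpa [extendZero_smul] using (hv z hz).const_smul c

/-- The Banach space `X`. -/
abbrev HolC1 : Type := HolC1Graph

/-- The function on the closed disc (extended by zero) underlying an element of `X`. -/
def HolC1.fn (f : HolC1) : ℂ → ℂ := extendZero f.1.1

/-- The space `X_β` of functions which are holomorphic in `𝔻` and `C^{1,β}` on the closed disc, with
its `C^{1,β}` norm. -/
def HolC1HolderGraph (β : ℝ) :
    Submodule ℝ (C(cdisc, ℂ) × C(cdisc, ℂ) × lp (fun _ : cdisc × cdisc => ℂ) ⊤) where
  carrier := {w | (∀ z ∈ disc, HasDerivAt (extendZero w.1) (extendZero w.2.1 z) z) ∧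
    ∀ p : cdisc × cdisc, w.2.2 p = (dist p.1 p.2 ^ β)⁻¹ • (w.2.1 p.1 - w.2.1 p.2)}
  zero_mem' := by
    refine ⟨fun z _ => ?_, fun p => ?_⟩
    · simp [extendZero_zero]
    · simp
  add_mem' := by
    intro v w hv hw
    refine ⟨fun z hz => ?_, fun p => ?_⟩
    · simpa [extendZero_add] using (hv.1 z hz).add (hw.1 z hz)
    · simp only [Prod.fst_add, Prod.snd_add, lp.coeFn_add, Pi.add_apply, ContinuousMap.add_apply,
        hv.2 p, hw.2 p, ← smul_add]
      congr 1
      abel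
  smul_mem' := by
    intro c v hv
    refine ⟨fun z hz => ?_, fun p => ?_⟩
    · simpa [extendZero_smul] using (hv.1 z hz).const_smul c
    · simp only [Prod.smul_fst, Prod.smul_snd, lp.coeFn_smul, Pi.smul_apply,
        ContinuousMap.smul_apply, hv.2 p, ← smul_sub]
      rw [smul_comm]

/-- The Banach space `X_β`. -/
abbrev HolC1Holder (β : ℝ) : Type := HolC1HolderGraph β

/-- The function on the closed disc (extended by zero) underlying an element of `X_β`. -/
def HolC1Holder.fn {β : ℝ} (f : HolC1Holder β) : ℂ → ℂ := extendZero f.1.1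

/-- The set `V ⊆ X` of the `f ∈ X` which are bijective from the closed disc onto its image, with an
inverse which is `C¹` on the closure `f(closed disc)` of `f(𝔻)` and holomorphic in `f(𝔻)`. -/
def confC1 : Set HolC1 :=
  {f | ∃ φ : ℂ → ℂ, (∀ z ∈ cdisc, φ (f.fn z) = z) ∧
    ContDiffOn ℝ 1 φ (f.fn '' cdisc) ∧ DifferentiableOn ℂ φ (f.fn '' disc)}

/-- The set `V_β ⊆ X_β` of the `f ∈ X_β` which are bijective from the closed disc onto its image,
with an inverse which is `C^{1,β}` on the closure `f(closed disc)` of `f(𝔻)` and holomorphic in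
`f(𝔻)`. -/
def confC1Holder (β : ℝ) : Set (HolC1Holder β) :=
  {f | ∃ φ : ℂ → ℂ, (∀ z ∈ cdisc, φ (f.fn z) = z) ∧
    ContDiffOn ℝ 1 φ (f.fn '' cdisc) ∧ DifferentiableOn ℂ φ (f.fn '' disc) ∧
    ∃ C : ℝ, ∀ z ∈ f.fn '' disc, ∀ w ∈ f.fn '' disc,
      ‖deriv φ z - deriv φ w‖ ≤ C * ‖z - w‖ ^ β}

/-- The restriction of `f` to the unit circle, `θ ↦ f(e^{iθ})`; for a conformal representation `f`
it is a positively oriented parametrisation of the boundary of `f(𝔻)`. -/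
def bdry (f : ℂ → ℂ) : Torus → ℂ := fun θ => f (expi θ)

/-- The function `u ∘ f⁻¹` on the boundary of `f(𝔻)`, for a function `u` on the circle. -/
def push {E : Type} (f : ℂ → ℂ) (u : Torus → E) : ℂ → E :=
  fun z => u (Function.invFun (bdry f) z)

/-- The inverse of `f` on the closed disc. -/
def discInv (f : ℂ → ℂ) : ℂ → ℂ := Function.invFunOn f cdisc

/-! ## The form `g ∧ ∂g/∂τ` on the circle and the degree -/

/-- The duality bracket `∫_{𝕊¹} u (∂v/∂θ) dθ` of `u, v ∈ H^{1/2}(𝕊¹; ℂ)`, in Fourier series. -/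
def bracket (u v : Torus → ℂ) : ℂ :=
  2 * π * ∑' n : ℤ, fourierCoeff u (-n) * (Complex.I * n * fourierCoeff v n)

/-- `⟨h ∧ ∂h/∂θ, e^{inθ}⟩`, where `h ∧ ∂h/∂θ = h₁ ∂h₂/∂θ - h₂ ∂h₁/∂θ` for `h = h₁ + i h₂`. -/
def wedgeCoeff (h : Torus → ℂ) (n : ℤ) : ℂ :=
  bracket (fun θ => ((h θ).re : ℂ) * fourier n θ) (fun θ => ((h θ).im : ℂ)) -
    bracket (fun θ => ((h θ).im : ℂ) * fourier n θ) (fun θ => ((h θ).re : ℂ))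

/-- The `H^{-1/2}`-`H^{1/2}` duality bracket `⟨h ∧ ∂h/∂θ, u⟩ = ∫_{𝕊¹} u (h ∧ ∂h/∂θ) dθ`, where
`u = ∑ û(n) e^{inθ}` is real valued. -/
def wedgePairing (h : Torus → ℂ) (u : Torus → ℝ) : ℝ :=
  (∑' n : ℤ, fourierCoeff (fun θ => (u θ : ℂ)) n * wedgeCoeff h n).re

/-- The degree `(1 / 2π) ∫_{𝕊¹} h ∧ ∂h/∂θ dθ` of `h ∈ H^{1/2}(𝕊¹; 𝕊¹)`. -/
def degree (h : Torus → ℂ) : ℝ := (2 * π)⁻¹ * wedgePairing h (fun _ => 1)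

/-! ## The renormalized energy -/

/-- `A_*^k`: the `k`-tuples of mutually distinct points of `A`. -/
def Config (A : Set ℂ) (k : ℕ) : Set (Fin k → ℂ) :=
  {a | (∀ j, a j ∈ A) ∧ ∀ j l, j ≠ l → a j ≠ a l}

/-- The trace on the boundary, parametrised by `γ`, of the `H¹` function `u` on `Ω` is `h`: there are
functions `vₙ`, continuous on the closure of `Ω` and `C¹` in `Ω`, with `vₙ → u` in `H¹(Ω)` and
`vₙ ∘ γ → h` in `L²`. -/
def HasTrace (Ω : Set ℂ) (γ : Torus → ℂ) (u : ℂ → ℝ) (h : Torus → ℝ) : Prop :=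
  ∃ v : ℕ → ℂ → ℝ, (∀ n, ContinuousOn (v n) (closure Ω) ∧ ContDiffOn ℝ 1 (v n) Ω) ∧
    Tendsto (fun n => ∫⁻ z in Ω, ‖v n z - u z‖ₑ ^ 2) atTop (𝓝 0) ∧
    Tendsto (fun n => ∫⁻ z in Ω, ‖gradient (v n) z - gradient u z‖ₑ ^ 2) atTop (𝓝 0) ∧
    Tendsto (fun n => ∫⁻ θ : Torus, ‖v n (γ θ) - h θ‖ₑ ^ 2) atTop (𝓝 0)

/-- `∑ⱼ dⱼ log |z - aⱼ|`. -/
def logSum {k : ℕ} (d : Fin k → ℤ) (a : Fin k → ℂ) (z : ℂ) : ℝ :=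
  ∑ j, (d j : ℝ) * Real.log ‖z - a j‖

/-- The speed `|γ'(θ)|` of a closed curve. -/
def speed (γ : Torus → ℂ) (θ : Torus) : ℝ := ‖deriv (fun t : ℝ => γ (θ + (t : Torus))) 0‖

/-- `R` is the regular part `Φ - ∑ⱼ dⱼ log |· - aⱼ|` of the solution `Φ = Φ_{a,g}` of
`ΔΦ = 2π ∑ⱼ dⱼ δ_{aⱼ}` in `Ω`, `∂Φ/∂ν = g ∧ ∂g/∂τ` on `∂Ω`, `∫_{∂Ω} Φ = 0`, and `ρ` is the trace
of `R` on `∂Ω`. Here `γ` is a positively oriented parametrisation of `∂Ω`, and the equations for `Φ`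
are meant in the weak sense: for all `φ ∈ C¹` on the closure of `Ω`,
`∫_Ω ∇Φ · ∇φ = ∫_{∂Ω} φ (g ∧ ∂g/∂τ) - 2π ∑ⱼ dⱼ φ(aⱼ)`. -/
structure IsRegularPart {k : ℕ} (Ω : Set ℂ) (γ : Torus → ℂ) (d : Fin k → ℤ) (g : ℂ → ℂ)
    (a : Fin k → ℂ) (R : ℂ → ℝ) (ρ : Torus → ℝ) : Prop where
  harmonic : InnerProductSpace.HarmonicOnNhd R Ω
  finite_energy : ∫⁻ z in Ω, ‖gradient R z‖ₑ ^ 2 < ⊤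
  trace_memLp : MemLp ρ 2 volume
  trace : HasTrace Ω γ R ρ
  weak : ∀ φ : ℂ → ℝ, ContDiffOn ℝ 1 φ (closure Ω) →
    ∫ z in Ω, inner ℝ (gradient (fun w => R w + logSum d a w) z) (gradient φ z) =
      wedgePairing (g ∘ γ) (φ ∘ γ) - 2 * π * ∑ j, (d j : ℝ) * φ (a j)
  normalized : ∫ θ : Torus, (ρ θ + logSum d a (γ θ)) * speed γ θ = 0

/-- The renormalized energy
`W^Ω(a, g) = -π ∑_{j ≠ l} dⱼ d_l log |aⱼ - a_l| + ½ ∫_{∂Ω} Φ_{a,g} (g ∧ ∂g/∂τ) - π ∑ⱼ dⱼ R_{a,g}(aⱼ)`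
of the singularities `a` with degrees `d` in the domain `Ω`, with boundary datum `g` on `∂Ω`; the
boundary is parametrised by `γ`. -/
def W {k : ℕ} (Ω : Set ℂ) (γ : Torus → ℂ) (d : Fin k → ℤ) (g : ℂ → ℂ) (a : Fin k → ℂ) : ℝ :=
  open Classical in
  if h : ∃ p : (ℂ → ℝ) × (Torus → ℝ), IsRegularPart Ω γ d g a p.1 p.2 then
    -π * (∑ j, ∑ l, if j ≠ l then (d j : ℝ) * (d l : ℝ) * Real.log ‖a j - a l‖ else 0)
      + 1 / 2 * wedgePairing (g ∘ γ) (fun θ => h.choose.2 θ + logSum d a (γ θ))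
      - π * ∑ j, (d j : ℝ) * h.choose.1 (a j)
  else 0

/-- The function `a ↦ W^{f(𝔻)}(a, u ∘ f⁻¹)`, for a conformal representation `f` and a boundary datum
`u` on the circle. -/
def WConf {k : ℕ} (d : Fin k → ℤ) (f : ℂ → ℂ) (u : Torus → ℂ) : (Fin k → ℂ) → ℝ :=
  W (f '' disc) (bdry f) d (push f u)

/-- `a` is a critical point of `F`. -/
def IsCritical {k : ℕ} (F : (Fin k → ℂ) → ℝ) (a : Fin k → ℂ) : Prop :=
  HasFDerivAt F (0 : (Fin k → ℂ) →L[ℝ] ℝ) a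

/-- `a` is a nondegenerate critical point of `F`: the Hessian exists at `a` and is a nondegenerate
bilinear form on `(ℝ²)^k`. -/
def IsNondegenerateCritical {k : ℕ} (F : (Fin k → ℂ) → ℝ) (a : Fin k → ℂ) : Prop :=
  IsCritical F a ∧ (∀ᶠ b in 𝓝 a, DifferentiableAt ℝ F b) ∧ DifferentiableAt ℝ (fderiv ℝ F) a ∧
    ∀ v, (∀ w, fderiv ℝ (fderiv ℝ F) a v w = 0) → v = 0

/-- The datum `g e^{iψ}`. -/
def twist (g : Torus → ℂ) (ψ : Torus → ℝ) : Torus → ℂ :=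
  fun θ => g θ * Complex.exp (Complex.I * ψ θ)

end RenormEnergy

end

open RenormEnergy

noncomputable section
namespace RenormEnergy
open AddCircle ENNReal

/-! A conformal representation `F` carries the problem to the unit disc, where the regular part is
explicit. Let `B` be the holomorphic function whose real part has Neumann datum `u ∧ ∂u`, up to the
mean of that datum. The pulled back regular part is then Re B, plus logarithms of 1 - ᾱ_j z and of
the difference quotients of `F` at α_j, plus a constant. When this is inserted in the energy, the
terms log|F(α_j) - F(α_l)| and the constant cancel. Up to a number independent of α, `WConf_eq`
leaves -π ∑_{j≠l} d_j d_l log|α_j - α_l| - 2π ∑ d_j Re B(α_j) + π ∑ d_j² log|F'(α_j)| - π ∑_{j,l}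
d_j d_l log|1 - ᾱ_l α_j|.

So the domain enters only through the numbers F'(α_j), and the datum only through Re B(α_j).
Multiplying the datum by e^{iψ} adds ∂ψ to the current (`wedgeCoeff_twist`). Hence it adds to `B`,
up to an imaginary constant, 2i times the Szegő projection of ψ (`bFun_twist`). Likewise F' is the
Szegő projection of its own boundary values (`szego_eq_of_diffContOnCl`). The Szegő projection is
evaluated by an L² kernel that depends smoothly on the point, so the energy is a smooth function
`confK` of two L² functions and of α (`contDiffAt_confK`). The implicit function theorem for its
α-gradient (`exists_critical_branch`) gives a smooth branch of nondegenerate critical points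
(`exists_vortex_branch`).

The Banach spaces of the statement map linearly and continuously into L² × L², so the first two
assertions follow by composition (`exists_smooth_critical`). The admissible `f` form an open set,
because they are exactly those with a lower Lipschitz bound (`mem_confC1_iff`). In a fixed domain,
unimodular data near g₀ are g₀ e^{iψ} with a small ψ given by the principal logarithm, which reduces
the third assertion to the same branch (`exists_critical_fixed_domain`).

Two points need care. The energy is defined through an arbitrary choice of weak solution, and
`IsRegularPart.pullback` with `HasTrace.unique` shows that every choice gives the same value. The
formula also needs the current to lie in H^{-1/2}. This is not deduced from g ∈ H^{1/2}: if it
failed, no weak solution would exist, the energy would be identically its default value 0, and for k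
> 0 it would have no nondegenerate critical point (`finiteEnergy_of_nondegenerate`). -/

/-! ### Fourier analysis on the circle and the current under a change of phase. -/

theorem memLp_haar_iff {E : Type*} [NormedAddCommGroup E] {u : Torus → E} {p : ℝ≥0∞} :
    MemLp u p haarAddCircle ↔ MemLp u p volume := by
  have h2 : (0:ℝ) < 2 * π := two_pi_pos
  rw [AddCircle.volume_eq_smul_haarAddCircle]
  refine ⟨fun h ↦ h.smul_measure (by finiteness), fun h ↦ ?_⟩
  have := h.smul_measure (c := (ENNReal.ofReal (2 * π))⁻¹) (by finiteness)
  rwa [smul_smul, ENNReal.inv_mul_cancel (by positivity) (by finiteness), one_smul] at this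

theorem norm_fourier_apply (n : ℤ) (θ : Torus) : ‖(fourier n θ : ℂ)‖ = 1 := Circle.norm_coe _

theorem integral_fourier (n : ℤ) :
    ∫ θ : Torus, fourier n θ ∂haarAddCircle = if n = 0 then 1 else 0 := by
  split_ifs with h
  · subst h; simp
  · exact integral_eq_zero_of_add_right_eq_neg (fourier_add_half_inv_index h two_pi_pos)

theorem fourierCoeff_fourier (k n : ℤ) :
    fourierCoeff (fourier k : Torus → ℂ) n = if k = n then 1 else 0 := by
  have : ∀ θ : Torus, fourier (-n) θ • fourier k θ = fourier (k - n) θ := fun θ => by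
    rw [smul_eq_mul, ← fourier_add]; congr 1; ring_nf
  simp only [fourierCoeff, this, integral_fourier, sub_eq_zero]

theorem fourierCoeff_mul_fourier (u : Torus → ℂ) (k n : ℤ) :
    fourierCoeff (fun θ => u θ * fourier k θ) n = fourierCoeff u (n - k) := by
  refine integral_congr_ae (.of_forall fun θ => ?_)
  have : (fourier (-(n - k)) θ : ℂ) = fourier (-n) θ * fourier k θ := by
    rw [← fourier_add]; congr 1; ring_nf
  simp only [smul_eq_mul, this]; ring

theorem fourierCoeff_conj (u : Torus → ℂ) (n : ℤ) :
    fourierCoeff (fun θ => (starRingEnd ℂ) (u θ)) n = (starRingEnd ℂ) (fourierCoeff u (-n)) := by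
  simp only [fourierCoeff, ← integral_conj, smul_eq_mul, map_mul, fourier_neg, neg_neg]

theorem fourierCoeff_ofReal_neg (u : Torus → ℝ) (n : ℤ) :
    fourierCoeff (fun θ => (u θ : ℂ)) (-n) =
      (starRingEnd ℂ) (fourierCoeff (fun θ => (u θ : ℂ)) n) := by
  have := fourierCoeff_conj (fun θ => (u θ : ℂ)) (-n)
  simpa using this

theorem fourierCoeff_add_right (u : Torus → ℂ) (t : Torus) (n : ℤ) :
    fourierCoeff (fun θ => u (θ + t)) n = fourier n t * fourierCoeff u n := by
  have h : ∀ θ : Torus, fourier (-n) θ • u (θ + t)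
      = fourier n t * (fun θ => fourier (-n) θ • u θ) (θ + t) := fun θ => by
    have h1 : (fourier (-n) (θ + t) : ℂ) = fourier (-n) θ * fourier (-n) t := by
      simp [fourier_apply, smul_add, AddCircle.toCircle_add]
    have h2 : (fourier n t : ℂ) * fourier (-n) t = 1 := by
      rw [← fourier_add]; simp
    simp only [smul_eq_mul, h1]
    linear_combination (-(fourier (-n) θ * u (θ + t))) * h2
  simp only [fourierCoeff, h]
  rw [integral_const_mul, integral_add_right_eq_self (μ := haarAddCircle)
    (fun θ => fourier (-n) θ • u θ)]

/-- Parseval in bilinear form: apply the Hermitian version to the conjugate of `u`, whose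
coefficients are the conjugates of those of `u` at opposite frequencies. -/
theorem hasSum_parseval {u v : Torus → ℂ} (hu : MemLp u 2 volume) (hv : MemLp v 2 volume) :
    HasSum (fun n : ℤ => fourierCoeff u (-n) * fourierCoeff v n)
      (∫ θ, u θ * v θ ∂haarAddCircle) := by
  have hu' : MemLp (fun θ => (starRingEnd ℂ) (u θ)) 2 haarAddCircle :=
    (memLp_haar_iff.2 hu).star
  have hv' := memLp_haar_iff.2 hv
  have := (fourierBasis (T := 2 * π)).hasSum_inner_mul_inner hu'.toLp hv'.toLp
  have e1 : (fun n : ℤ => fourierCoeff u (-n) * fourierCoeff v n) =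
      fun i => inner ℂ hu'.toLp (fourierBasis (T := 2 * π) i) *
        inner ℂ (fourierBasis (T := 2 * π) i) hv'.toLp := by
    funext n
    rw [← inner_conj_symm, ← HilbertBasis.repr_apply_apply, ← HilbertBasis.repr_apply_apply,
      fourierBasis_repr, fourierBasis_repr, fourierCoeff_congr_ae hu'.coeFn_toLp,
      fourierCoeff_congr_ae hv'.coeFn_toLp, fourierCoeff_conj, Complex.conj_conj]
  have e2 : ∫ θ, u θ * v θ ∂haarAddCircle = inner ℂ hu'.toLp hv'.toLp := by
    rw [L2.inner_def]
    refine integral_congr_ae ?_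
    filter_upwards [hu'.coeFn_toLp, hv'.coeFn_toLp] with θ h1 h2
    simp [h1, h2, mul_comm]
  rw [e1, e2]
  exact this

theorem hasSum_sq_fourierCoeff' {u : Torus → ℂ} (hu : MemLp u 2 volume) :
    HasSum (fun n : ℤ => ‖fourierCoeff u n‖ ^ 2) (∫ θ, ‖u θ‖ ^ 2 ∂haarAddCircle) := by
  have hu' := memLp_haar_iff.2 hu
  convert hasSum_sq_fourierCoeff hu'.toLp using 1
  · funext n; rw [fourierCoeff_congr_ae hu'.coeFn_toLp]
  · refine integral_congr_ae ?_
    filter_upwards [hu'.coeFn_toLp] with θ h1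
    rw [h1]

theorem MemLp.translate {u : Torus → ℂ} {p : ℝ≥0∞} (hu : MemLp u p volume) (t : Torus) :
    MemLp (fun θ => u (θ + t)) p volume :=
  hu.comp_measurePreserving (measurePreserving_add_right volume t)

theorem hasSum_sq_translate {u : Torus → ℂ} (hu : MemLp u 2 volume) (t : Torus) :
    HasSum (fun n : ℤ => ‖(fourier n t : ℂ) - 1‖ ^ 2 * ‖fourierCoeff u n‖ ^ 2)
      (∫ θ, ‖u (θ + t) - u θ‖ ^ 2 ∂haarAddCircle) := by
  have h := hasSum_sq_fourierCoeff' ((MemLp.translate hu t).sub hu)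
  convert (show HasSum _ (∫ θ, ‖u (θ + t) - u θ‖ ^ 2 ∂haarAddCircle) from h) using 1
  funext n
  have h1 : Integrable (fun θ => u (θ + t)) haarAddCircle :=
    (memLp_haar_iff.2 (MemLp.translate hu t)).integrable (by norm_num)
  have h2 : Integrable (-u) haarAddCircle := ((memLp_haar_iff.2 hu).integrable (by norm_num)).neg
  have := congrFun (fourierCoeff.add h1 h2) n
  rw [sub_eq_add_neg (fun θ => u (θ + t)) u, this, Pi.add_apply, fourierCoeff_add_right]
  have h3 : fourierCoeff (-u) n = - fourierCoeff u n := by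
    simp [fourierCoeff, integral_neg]
  rw [h3, ← mul_pow, ← norm_mul]; congr 2; ring

theorem norm_fourier_sub_one_le (n : ℤ) (t : ℝ) :
    ‖(fourier n (t : Torus) : ℂ) - 1‖ ≤ |(n : ℝ)| * |t| := by
  have : (fourier n (t : Torus) : ℂ) = Complex.exp (Complex.I * ((n * t : ℝ) : ℂ)) := by
    rw [fourier_coe_apply]; congr 1
    have : (π : ℂ) ≠ 0 := by exact_mod_cast pi_ne_zero
    push_cast; field_simp
  rw [this, ← abs_mul]
  simpa using Real.norm_exp_I_mul_ofReal_sub_one_le (x := (n * t : ℝ))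

/-- `u ∈ L²` and `∑ |n| |û(n)|² < ∞`. -/
structure MemH (u : Torus → ℂ) : Prop where
  memLp : MemLp u 2 volume
  summable : Summable fun n : ℤ => |(n : ℝ)| * ‖fourierCoeff u n‖ ^ 2

theorem summable_abs_shift {c : ℤ → ℂ} (h0 : Summable fun n : ℤ => ‖c n‖ ^ 2)
    (h1 : Summable fun n : ℤ => |(n : ℝ)| * ‖c n‖ ^ 2) (k : ℤ) :
    Summable fun n : ℤ => |(n : ℝ)| * ‖c (n - k)‖ ^ 2 := by
  rw [← (Equiv.addRight k).summable_iff]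
  refine Summable.of_nonneg_of_le (fun n => ?_) (fun n => ?_)
    (h1.add (h0.mul_left |(k : ℝ)|))
  · simp only [Function.comp_apply]; positivity
  simp only [Function.comp_apply, Equiv.coe_addRight, add_sub_cancel_right, ← add_mul]
  gcongr
  push_cast; exact abs_add_le _ _

theorem memLp_mul_fourier {u : Torus → ℂ} (hu : MemLp u 2 volume) (k : ℤ) :
    MemLp (fun θ => u θ * fourier k θ) 2 volume := by
  refine hu.of_le (hu.1.mul (fourier k).continuous.aestronglyMeasurable) (.of_forall fun θ => ?_)
  rw [norm_mul, norm_fourier_apply, mul_one]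

theorem MemH.mul_fourier {u : Torus → ℂ} (hu : MemH u) (k : ℤ) :
    MemH fun θ => u θ * fourier k θ := by
  refine ⟨memLp_mul_fourier hu.1 k, ?_⟩
  simp only [fourierCoeff_mul_fourier]
  exact summable_abs_shift (hasSum_sq_fourierCoeff' hu.1).summable hu.2 k

theorem MemH.summable_bracket {u v : Torus → ℂ} (hu : MemH u) (hv : MemH v) :
    Summable fun n : ℤ => |(n : ℝ)| * (‖fourierCoeff u (-n)‖ * ‖fourierCoeff v n‖) := by
  have h1 : Summable fun n : ℤ => |(n : ℝ)| * ‖fourierCoeff u (-n)‖ ^ 2 := by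
    have := (Equiv.neg ℤ).summable_iff.2 hu.2
    simpa [Function.comp_def] using this
  refine Summable.of_nonneg_of_le (fun n => by positivity) (fun n => ?_) (h1.add hv.2)
  rw [← mul_add]
  gcongr
  nlinarith [sq_nonneg (‖fourierCoeff u (-n)‖ - ‖fourierCoeff v n‖),
    norm_nonneg (fourierCoeff u (-n)), norm_nonneg (fourierCoeff v n)]

theorem hasDerivAt_fourier_zero (n : ℤ) :
    HasDerivAt (fun t : ℝ => (fourier n (t : Torus) : ℂ)) (Complex.I * n) 0 := by
  have := hasDerivAt_fourier (2 * π) n 0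
  have hpi : (π : ℂ) ≠ 0 := by exact_mod_cast pi_ne_zero
  convert this using 1
  rw [QuotientAddGroup.mk_zero, fourier_eval_zero]
  push_cast; field_simp

/-- The duality bracket is the limit of difference quotients. -/
theorem tendsto_bracket {u v : Torus → ℂ} (hu : MemH u) (hv : MemH v) :
    Tendsto (fun t : ℝ => 2 * π * ((t : ℂ)⁻¹ * ∫ θ, u θ * (v (θ + (t : Torus)) - v θ) ∂haarAddCircle))
      (𝓝[≠] 0) (𝓝 (bracket u v)) := by
  refine Tendsto.const_mul _ ?_
  -- By Parseval the difference quotient is the bracket series with (e_n(t) - 1)/t in place of the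
  -- factor i n; the bound |e_n(t) - 1| ≤ |n||t| then dominates it uniformly in t.
  have key : ∀ t : ℝ, (t : ℂ)⁻¹ * ∫ θ, u θ * (v (θ + (t : Torus)) - v θ) ∂haarAddCircle =
      ∑' n : ℤ, fourierCoeff u (-n) * ((t : ℂ)⁻¹ * ((fourier n (t : Torus) : ℂ) - 1)
        * fourierCoeff v n) := by
    intro t
    have h1 := hasSum_parseval hu.1 ((MemLp.translate hv.1 (t : Torus)).sub hv.1)
    have := h1.mul_left ((t : ℂ)⁻¹)
    simp only [Pi.sub_apply] at this
    rw [← this.tsum_eq]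
    congr 1; funext n
    have h1 : Integrable (fun θ => v (θ + (t : Torus))) haarAddCircle :=
      (memLp_haar_iff.2 (MemLp.translate hv.1 (t : Torus))).integrable (by norm_num)
    have h2 : Integrable (-v) haarAddCircle :=
      ((memLp_haar_iff.2 hv.1).integrable (by norm_num)).neg
    have h4 := congrFun (fourierCoeff.add h1 h2) n
    have h3 : fourierCoeff (-v) n = - fourierCoeff v n := by
      simp [fourierCoeff, integral_neg]
    rw [sub_eq_add_neg (fun θ => v (θ + (t : Torus))) v, h4, Pi.add_apply,
      fourierCoeff_add_right, h3]
    ring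
  simp only [key]
  refine tendsto_tsum_of_dominated_convergence (hu.summable_bracket hv) (fun n => ?_) ?_
  · refine Tendsto.const_mul _ (Tendsto.mul_const _ ?_)
    have := (hasDerivAt_fourier_zero n).tendsto_slope_zero
    simp only [zero_add, QuotientAddGroup.mk_zero, fourier_eval_zero, Complex.real_smul,
      Complex.ofReal_inv] at this
    exact this
  · filter_upwards [self_mem_nhdsWithin] with t ht n
    have ht' : 0 < |t| := abs_pos.2 ht
    have := norm_fourier_sub_one_le n t
    rw [norm_mul, norm_mul, norm_mul, norm_inv, Complex.norm_real, Real.norm_eq_abs]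
    have h5 : |t|⁻¹ * ‖(fourier n (t : Torus) : ℂ) - 1‖ ≤ |(n : ℝ)| := by
      rw [inv_mul_le_iff₀ ht']; linarith
    calc _ ≤ ‖fourierCoeff u (-n)‖ * (|(n : ℝ)| * ‖fourierCoeff v n‖) := by gcongr
      _ = _ := by ring

/-- The modulus of continuity of an `H^{1/2}` function in `L²` is `o(|t|^{1/2})`. -/
theorem MemH.tendsto_translate {u : Torus → ℂ} (hu : MemH u) :
    Tendsto (fun t : ℝ => |t|⁻¹ * ∫ θ, ‖u (θ + (t : Torus)) - u θ‖ ^ 2 ∂haarAddCircle)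
      (𝓝[≠] 0) (𝓝 0) := by
  have key : ∀ t : ℝ, |t|⁻¹ * ∫ θ, ‖u (θ + (t : Torus)) - u θ‖ ^ 2 ∂haarAddCircle =
      ∑' n : ℤ, |t|⁻¹ * (‖(fourier n (t : Torus) : ℂ) - 1‖ ^ 2 * ‖fourierCoeff u n‖ ^ 2) :=
    fun t => ((hasSum_sq_translate hu.1 (t : Torus)).mul_left _).tsum_eq.symm
  simp only [key]
  have z : (0 : ℝ) = ∑' _ : ℤ, (0 : ℝ) := tsum_zero.symm
  conv => arg 3; rw [z]
  refine tendsto_tsum_of_dominated_convergence (hu.2.mul_left 2) (fun n => ?_) ?_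
  · have h0 : Tendsto (fun t : ℝ => |(n : ℝ)| ^ 2 * |t| * ‖fourierCoeff u n‖ ^ 2) (𝓝[≠] 0) (𝓝 0) := by
      have : Continuous fun t : ℝ => |(n : ℝ)| ^ 2 * |t| * ‖fourierCoeff u n‖ ^ 2 := by fun_prop
      have := this.tendsto 0
      simp only [abs_zero, mul_zero, zero_mul] at this
      exact this.mono_left nhdsWithin_le_nhds
    refine squeeze_zero' (.of_forall fun t => by positivity) ?_ h0
    filter_upwards [self_mem_nhdsWithin] with t ht
    have ht' : 0 < |t| := abs_pos.2 ht
    calc _ ≤ |t|⁻¹ * ((|(n : ℝ)| * |t|) ^ 2 * ‖fourierCoeff u n‖ ^ 2) := by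
          gcongr; exact norm_fourier_sub_one_le n t
      _ = _ := by field_simp
  · filter_upwards [self_mem_nhdsWithin] with t ht n
    have ht' : 0 < |t| := abs_pos.2 ht
    rw [Real.norm_of_nonneg (by positivity)]
    have h2 : ‖(fourier n (t : Torus) : ℂ) - 1‖ ≤ 2 := by
      refine (norm_sub_le _ _).trans ?_
      rw [norm_fourier_apply]; norm_num
    -- One factor is bounded by 2 and the other by |n||t|, so division by |t| leaves a summable
    -- majorant. The termwise limit above used the quadratic bound instead.
    have h3 : ‖(fourier n (t : Torus) : ℂ) - 1‖ ^ 2 ≤ 2 * (|(n : ℝ)| * |t|) := by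
      rw [sq]; gcongr; exact norm_fourier_sub_one_le n t
    calc _ ≤ |t|⁻¹ * ((2 * (|(n : ℝ)| * |t|)) * ‖fourierCoeff u n‖ ^ 2) := by gcongr
      _ = _ := by field_simp

theorem memH_fourier (k : ℤ) : MemH (fourier k : Torus → ℂ) := by
  refine ⟨?_, ?_⟩
  · exact (memLp_top_of_bound (fourier k).continuous.aestronglyMeasurable 1
      (.of_forall fun θ => (norm_fourier_apply k θ).le)).mono_exponent le_top
  · refine summable_of_ne_finset_zero (s := {k}) fun n hn => ?_
    rw [Finset.mem_singleton] at hn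
    simp [fourierCoeff_fourier, Ne.symm hn]

theorem bracket_fourier (n : ℤ) (v : Torus → ℂ) :
    bracket (fourier n) v = 2 * π * (Complex.I * (-n) * fourierCoeff v (-n)) := by
  rw [bracket, tsum_eq_single (-n)]
  · simp [fourierCoeff_fourier]
  · intro m hm
    have : n ≠ -m := fun h => hm (by omega)
    simp [fourierCoeff_fourier, this]

theorem fourierCoeff_re {h : Torus → ℂ} (hh : MemLp h 2 volume) (n : ℤ) :
    fourierCoeff (fun θ => ((h θ).re : ℂ)) n =
      (1 / 2 : ℂ) * (fourierCoeff h n + (starRingEnd ℂ) (fourierCoeff h (-n))) := by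
  have h1 : Integrable h haarAddCircle := (memLp_haar_iff.2 hh).integrable (by norm_num)
  have h2 : Integrable (fun θ => (starRingEnd ℂ) (h θ)) haarAddCircle :=
    ((memLp_haar_iff.2 hh).star).integrable (by norm_num)
  rw [← fourierCoeff_conj]
  have := congrFun (fourierCoeff.add h1 h2) n
  rw [Pi.add_apply] at this
  rw [← this, ← fourierCoeff.const_mul]
  congr 1; funext θ
  simp only [Pi.add_apply, Complex.re_eq_add_conj]; ring

theorem MemH.re {h : Torus → ℂ} (hh : MemH h) : MemH fun θ => ((h θ).re : ℂ) := by
  refine ⟨hh.1.re.ofReal, ?_⟩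
  have h1 : Summable fun n : ℤ => |(n : ℝ)| * ‖fourierCoeff h (-n)‖ ^ 2 := by
    have := (Equiv.neg ℤ).summable_iff.2 hh.2
    simpa [Function.comp_def] using this
  refine Summable.of_nonneg_of_le (fun n => by positivity) (fun n => ?_) (hh.2.add h1)
  rw [← mul_add, fourierCoeff_re hh.1]
  gcongr
  have := norm_add_le (fourierCoeff h n) ((starRingEnd ℂ) (fourierCoeff h (-n)))
  rw [RCLike.norm_conj] at this
  rw [norm_mul, show ‖(1 / 2 : ℂ)‖ = 1 / 2 by norm_num]
  calc (1 / 2 * ‖fourierCoeff h n + (starRingEnd ℂ) (fourierCoeff h (-n))‖) ^ 2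
      ≤ (1 / 2 * (‖fourierCoeff h n‖ + ‖fourierCoeff h (-n)‖)) ^ 2 :=
        pow_le_pow_left₀ (by positivity) (by gcongr) 2
    _ ≤ _ := by
      nlinarith [sq_nonneg (‖fourierCoeff h n‖ - ‖fourierCoeff h (-n)‖),
        sq_nonneg (‖fourierCoeff h n‖ + ‖fourierCoeff h (-n)‖)]

theorem MemH.const_mul {h : Torus → ℂ} (hh : MemH h) (c : ℂ) : MemH fun θ => c * h θ := by
  refine ⟨hh.1.const_mul c, ?_⟩
  have := hh.2.mul_left (‖c‖ ^ 2)
  refine this.congr fun n => ?_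
  rw [fourierCoeff.const_mul, norm_mul]; ring

theorem MemH.im {h : Torus → ℂ} (hh : MemH h) : MemH fun θ => ((h θ).im : ℂ) := by
  have := (hh.const_mul (-Complex.I)).re
  simpa using this

/-- In h₁(θ)(h₂(θ+t) - h₂(θ)) - h₂(θ)(h₁(θ+t) - h₁(θ)) the products taken at θ alone cancel, which
leaves the imaginary part of conj h(θ) · h(θ+t). In this form multiplication by a phase is easy to
follow. -/
theorem tendsto_wedgeCoeff {h : Torus → ℂ} (hh : MemH h) (n : ℤ) :
    Tendsto (fun t : ℝ => 2 * π * ((t : ℂ)⁻¹ *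
        ∫ θ, fourier n θ * (((starRingEnd ℂ) (h θ) * h (θ + (t : Torus))).im : ℂ) ∂haarAddCircle))
      (𝓝[≠] 0) (𝓝 (wedgeCoeff h n)) := by
  have h1 := tendsto_bracket (hh.re.mul_fourier n) hh.im
  have h2 := tendsto_bracket (hh.im.mul_fourier n) hh.re
  refine (h1.sub h2).congr fun t => ?_
  have i1 : ∀ u v : Torus → ℂ, MemH u → MemH v → Integrable
      (fun θ => u θ * fourier n θ * (v (θ + (t : Torus)) - v θ)) haarAddCircle :=
    fun (u v : Torus → ℂ) (hu : MemH u) (hv : MemH v) => (memLp_haar_iff.2 (hu.mul_fourier n).1).integrable_mul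
      (memLp_haar_iff.2 ((MemLp.translate hv.1 (t : Torus)).sub hv.1))
  have i2 := i1 _ _ hh.re hh.im
  have i3 := i1 _ _ hh.im hh.re
  rw [← mul_sub, ← mul_sub, ← integral_sub i2 i3]
  congr 2
  refine integral_congr_ae (.of_forall fun θ => ?_)
  simp only [Complex.mul_im, Complex.conj_re, Complex.conj_im]
  push_cast; ring

/-- The identity A e^{iδ} - A - iδ = (A - 1)(e^{iδ} - 1) + (e^{iδ} - 1 - iδ) exhibits the error as
second order when A - 1 and δ are both small. -/
theorem abs_im_mul_exp_sub_le (A : ℂ) (δ : ℝ) :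
    |(A * Complex.exp (Complex.I * δ)).im - A.im - δ| ≤ ‖A - 1‖ * |δ| + 2 * δ ^ 2 := by
  have h1 : ‖Complex.exp (Complex.I * δ) - 1‖ ≤ |δ| := by
    simpa using Real.norm_exp_I_mul_ofReal_sub_one_le (x := δ)
  have h2 : ‖Complex.exp (Complex.I * δ) - 1 - Complex.I * δ‖ ≤ 2 * δ ^ 2 := by
    rcases le_or_gt |δ| 1 with h | h
    · have := Complex.norm_exp_sub_one_sub_id_le (x := Complex.I * δ) (by simpa using h)
      simp only [Complex.norm_mul, Complex.norm_I, one_mul, Complex.norm_real, Real.norm_eq_abs,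
        sq_abs] at this
      nlinarith [sq_nonneg δ]
    -- For |δ| > 1 no Taylor bound is needed: both terms are at most |δ|, and 2|δ| ≤ 2δ².
    · refine (norm_sub_le _ _).trans ?_
      have : ‖Complex.I * (δ : ℂ)‖ = |δ| := by simp
      rw [this, ← sq_abs δ]
      nlinarith
  have e : (A * Complex.exp (Complex.I * δ)).im - A.im - δ =
      ((A - 1) * (Complex.exp (Complex.I * δ) - 1) +
        (Complex.exp (Complex.I * δ) - 1 - Complex.I * δ)).im := by
    have : (δ : ℝ) = (Complex.I * δ).im := by simp
    rw [this, ← Complex.sub_im, ← Complex.sub_im]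
    simp only [← this]
    congr 1; ring
  rw [e]
  refine (Complex.abs_im_le_norm _).trans ((norm_add_le _ _).trans ?_)
  rw [norm_mul]
  gcongr

theorem ae_haar_iff {p : Torus → Prop} : (∀ᵐ θ ∂haarAddCircle, p θ) ↔ ∀ᵐ θ : Torus, p θ := by
  rw [AddCircle.volume_eq_smul_haarAddCircle, Measure.ae_ennreal_smul_measure_iff]
  simp [pi_pos]

/-- The second order remainder in the expansion of the current of `g e^{iψ}`. -/
def twistRemainder (g : Torus → ℂ) (ψ : Torus → ℝ) (t θ : Torus) : ℝ :=
  ((starRingEnd ℂ) (twist g ψ θ) * twist g ψ (θ + t)).im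
    - ((starRingEnd ℂ) (g θ) * g (θ + t)).im - (ψ (θ + t) - ψ θ)

/-- The twisted product is A e^{iδ} with A = conj g(θ) · g(θ+t) and δ = ψ(θ+t) - ψ(θ). Since |g(θ)|
= 1, also |A - 1| = |g(θ+t) - g(θ)|, so the remainder is quadratic in the increments. -/
theorem abs_twistRemainder_le {g : Torus → ℂ} (ψ : Torus → ℝ) {t θ : Torus} (h1 : ‖g θ‖ = 1) :
    |twistRemainder g ψ t θ| ≤ ‖g (θ + t) - g θ‖ ^ 2 + 3 * ‖(ψ (θ + t) : ℂ) - ψ θ‖ ^ 2 := by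
  have hc : (starRingEnd ℂ) (g θ) * g θ = 1 := by
    rw [mul_comm, Complex.mul_conj, Complex.normSq_eq_norm_sq, h1]; simp
  have e1 : (starRingEnd ℂ) (twist g ψ θ) * twist g ψ (θ + t) =
      ((starRingEnd ℂ) (g θ) * g (θ + t)) *
        Complex.exp (Complex.I * ((ψ (θ + t) - ψ θ : ℝ) : ℂ)) := by
    simp only [twist, map_mul, ← Complex.exp_conj, Complex.conj_I, Complex.conj_ofReal]
    rw [show Complex.I * ((ψ (θ + t) - ψ θ : ℝ) : ℂ) =
      -Complex.I * ψ θ + Complex.I * ψ (θ + t) by push_cast; ring, Complex.exp_add]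
    ring
  have e2 : ‖(starRingEnd ℂ) (g θ) * g (θ + t) - 1‖ = ‖g (θ + t) - g θ‖ := by
    rw [← hc, ← mul_sub, norm_mul, RCLike.norm_conj, h1, one_mul]
  rw [twistRemainder, e1]
  refine (abs_im_mul_exp_sub_le _ _).trans ?_
  rw [e2, ← Complex.ofReal_sub, Complex.norm_real, Real.norm_eq_abs, sq_abs]
  have := sq_abs (ψ (θ + t) - ψ θ)
  nlinarith [sq_nonneg (‖g (θ + t) - g θ‖ - |ψ (θ + t) - ψ θ|)]

theorem integrable_sq_translate {h : Torus → ℂ} (hh : MemLp h 2 volume) (t : Torus) :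
    Integrable (fun θ => ‖h (θ + t) - h θ‖ ^ 2) haarAddCircle :=
  (memLp_haar_iff.2 ((MemLp.translate hh t).sub hh)).integrable_norm_pow (by norm_num)

theorem norm_integral_twistRemainder_le {g : Torus → ℂ} {ψ : Torus → ℝ} (hg : MemLp g 2 volume)
    (hg1 : ∀ᵐ θ : Torus, ‖g θ‖ = 1) (hψ : MemLp (fun θ => (ψ θ : ℂ)) 2 volume) (n : ℤ) (t : Torus) :
    ‖∫ θ, fourier n θ * (twistRemainder g ψ t θ : ℂ) ∂haarAddCircle‖ ≤
      (∫ θ, ‖g (θ + t) - g θ‖ ^ 2 ∂haarAddCircle) +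
        3 * ∫ θ, ‖(ψ (θ + t) : ℂ) - ψ θ‖ ^ 2 ∂haarAddCircle := by
  rw [← integral_const_mul, ← integral_add (integrable_sq_translate hg t)
    ((integrable_sq_translate hψ t).const_mul 3)]
  refine norm_integral_le_of_norm_le
    ((integrable_sq_translate hg t).add ((integrable_sq_translate hψ t).const_mul 3)) ?_
  filter_upwards [ae_haar_iff.2 hg1] with θ h1
  rw [norm_mul, norm_fourier_apply, one_mul, Complex.norm_real, Real.norm_eq_abs]
  exact abs_twistRemainder_le ψ h1

theorem integral_twistRemainder {g : Torus → ℂ} {ψ : Torus → ℝ} (hg : MemLp g 2 volume)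
    (hψ : MemLp (fun θ => (ψ θ : ℂ)) 2 volume) (hh : MemLp (twist g ψ) 2 volume) (n : ℤ) (t : Torus) :
    ∫ θ, fourier n θ * (twistRemainder g ψ t θ : ℂ) ∂haarAddCircle =
      (∫ θ, fourier n θ * (((starRingEnd ℂ) (twist g ψ θ) * twist g ψ (θ + t)).im : ℂ)
        ∂haarAddCircle) -
      (∫ θ, fourier n θ * (((starRingEnd ℂ) (g θ) * g (θ + t)).im : ℂ) ∂haarAddCircle) -
      ∫ θ, fourier n θ * ((ψ (θ + t) : ℂ) - ψ θ) ∂haarAddCircle := by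
  have iw : ∀ h : Torus → ℂ, MemLp h 2 volume → Integrable (fun θ => fourier n θ *
      (((starRingEnd ℂ) (h θ) * h (θ + t)).im : ℂ)) haarAddCircle := by
    intro h hh
    have : Integrable (fun θ => (starRingEnd ℂ) (h θ) * h (θ + t)) haarAddCircle :=
      (memLp_haar_iff.2 hh).star.integrable_mul (memLp_haar_iff.2 (MemLp.translate hh _))
    have h2 := this.im.ofReal (𝕜 := ℂ)
    refine h2.bdd_mul (c := 1) (fourier n).continuous.aestronglyMeasurable
      (.of_forall fun θ => (norm_fourier_apply n θ).le)
  have iψ : Integrable (fun θ => fourier n θ * ((ψ (θ + t) : ℂ) - ψ θ)) haarAddCircle := by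
    have := (memLp_haar_iff.2 ((MemLp.translate hψ t).sub hψ)).integrable (by norm_num)
    exact this.bdd_mul (c := 1) (fourier n).continuous.aestronglyMeasurable
      (.of_forall fun θ => (norm_fourier_apply n θ).le)
  rw [← integral_sub (iw _ hh) (iw _ hg), ← integral_sub (by exact (iw _ hh).sub (iw _ hg)) iψ]
  refine integral_congr_ae (.of_forall fun θ => ?_)
  simp only [twistRemainder]
  push_cast; ring

/-- Multiplying the datum by `e^{iψ}` adds `∂ψ` to the current `g ∧ ∂g`. -/
theorem wedgeCoeff_twist {g : Torus → ℂ} {ψ : Torus → ℝ} (hg : MemH g)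
    (hg1 : ∀ᵐ θ : Torus, ‖g θ‖ = 1) (hψ : MemH fun θ => (ψ θ : ℂ)) (hh : MemH (twist g ψ)) (n : ℤ) :
    wedgeCoeff (twist g ψ) n = wedgeCoeff g n + bracket (fourier n) (fun θ => (ψ θ : ℂ)) := by
  have l4 := ((tendsto_wedgeCoeff hh n).sub (tendsto_wedgeCoeff hg n)).sub
    (tendsto_bracket (memH_fourier n) hψ)
  simp only [← mul_sub] at l4
  simp only [← integral_twistRemainder hg.1 hψ.1 hh.1 n] at l4
  -- The squared L² increments of an H^{1/2} function are o(|t|). The remainder, divided by t,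
  -- therefore disappears in the limit and only the first order terms survive.
  have hb := ((hg.tendsto_translate).const_mul (2 * π)).add
    ((hψ.tendsto_translate).const_mul (2 * π * 3))
  rw [mul_zero, mul_zero, add_zero] at hb
  have hz := tendsto_nhds_unique l4 (squeeze_zero_norm (fun t => ?_) hb)
  · linear_combination hz
  have h2 : ‖(2 * π : ℂ)‖ = 2 * π := by simp [abs_of_pos pi_pos]
  rw [norm_mul, h2, norm_mul, norm_inv, Complex.norm_real, Real.norm_eq_abs]
  have := pi_pos
  refine (mul_le_mul_of_nonneg_left (mul_le_mul_of_nonneg_left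
    (norm_integral_twistRemainder_le hg.1 hg1 hψ.1 n t) (by positivity))
      (by positivity)).trans_eq ?_
  ring

/-- `‖e_n - 1‖² / ‖e_1 - 1‖²` has mean `|n|`. -/
theorem lintegral_fourier_quotient (n : ℤ) :
    ∫⁻ t : Torus, (‖(fourier 1 t : ℂ) - 1‖ₑ ^ 2)⁻¹ * ‖(fourier n t : ℂ) - 1‖ₑ ^ 2 ∂haarAddCircle =
      ENNReal.ofReal |(n : ℝ)| := by
  have key : ∀ N : ℕ, ∫⁻ t : Torus, (‖(fourier 1 t : ℂ) - 1‖ₑ ^ 2)⁻¹ *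
      ‖(fourier (N : ℤ) t : ℂ) - 1‖ₑ ^ 2 ∂haarAddCircle = ENNReal.ofReal N := by
    intro N
    -- The quotient (e_N - 1)/(e_1 - 1) is the geometric sum of e_0, …, e_{N-1}, whose squared L²
    -- norm is N by Parseval.
    set u : Torus → ℂ := ∑ k ∈ Finset.range N, (fourier (k : ℤ) : Torus → ℂ) with hu
    have hint : ∀ k : ℤ, Integrable (fourier k : Torus → ℂ) haarAddCircle := fun k =>
      (memLp_haar_iff.2 (memH_fourier k).1).integrable (by norm_num)
    have hmem : MemLp u 2 volume := memLp_finsetSum' _ fun k _ => (memH_fourier k).1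
    have h1 := hasSum_sq_fourierCoeff' hmem
    have h2 : (∫ θ, ‖u θ‖ ^ 2 ∂haarAddCircle) = N := by
      rw [← h1.tsum_eq, tsum_eq_sum (s := (Finset.range N).map Nat.castEmbedding)]
      · rw [Finset.sum_map]
        have : ∀ k ∈ Finset.range N, ‖fourierCoeff u (Nat.castEmbedding k : ℤ)‖ ^ 2 = 1 := by
          intro k hk
          have : fourierCoeff u (k : ℤ) = 1 := by
            rw [hu, fourierCoeff.sum (Finset.range N) (fun k : ℕ => (fourier (k : ℤ) : Torus → ℂ))
              fun i _ => hint i]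
            simp only [Finset.sum_apply, fourierCoeff_fourier]
            rw [Finset.sum_eq_single k]
            · simp
            · intro b _ hb; simp [hb]
            · intro h; exact absurd hk h
          simp [this]
        rw [Finset.sum_congr rfl this]; simp
      · intro m hm
        have : fourierCoeff u m = 0 := by
          rw [hu, fourierCoeff.sum (Finset.range N) (fun k : ℕ => (fourier (k : ℤ) : Torus → ℂ))
              fun i _ => hint i]
          simp only [Finset.sum_apply, fourierCoeff_fourier]
          refine Finset.sum_eq_zero fun k hk => if_neg fun h => hm ?_
          exact Finset.mem_map.2 ⟨k, hk, h⟩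
        simp [this]
    rw [← h2, ofReal_integral_eq_lintegral_ofReal
      ((memLp_haar_iff.2 hmem).integrable_norm_pow (by norm_num)) (.of_forall fun _ => by positivity)]
    have h0 : ∀ᵐ t : Torus ∂haarAddCircle, t ≠ 0 := by
      rw [ae_iff]; simp only [ne_eq, not_not, ofPred_eq_eq_singleton]
      have : (volume : Measure Torus) {0} = 0 := by
        rw [← Metric.closedBall_zero, AddCircle.volume_closedBall]; simp [pi_nonneg]
      rw [AddCircle.volume_eq_smul_haarAddCircle, Measure.smul_apply, smul_eq_mul,
        mul_eq_zero] at this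
      exact this.resolve_left (by simp [pi_pos])
    refine lintegral_congr_ae ?_
    filter_upwards [h0] with t ht
    have hne : (fourier 1 t : ℂ) - 1 ≠ 0 := by
      rw [sub_ne_zero, fourier_one]
      intro h
      refine ht (AddCircle.injective_toCircle two_pi_pos.ne' ?_)
      rw [AddCircle.toCircle_zero]; exact Subtype.ext h
    have hg : (fourier (N : ℤ) t : ℂ) - 1 = u t * ((fourier 1 t : ℂ) - 1) := by
      have : ∀ k : ℕ, (fourier (k : ℤ) t : ℂ) = (fourier 1 t : ℂ) ^ k := fun k => by
        simp [fourier_apply, AddCircle.toCircle_nsmul]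
      rw [hu, Finset.sum_apply]
      simp only [this]
      rw [geom_sum_mul]
    rw [hg, enorm_mul, mul_pow, mul_comm, mul_assoc, ENNReal.mul_inv_cancel, mul_one,
      ← ofReal_norm, ENNReal.ofReal_pow (norm_nonneg _)]
    · simpa using hne
    · finiteness
  rcases Int.eq_nat_or_neg n with ⟨N, rfl | rfl⟩
  · simpa using key N
  · have := key N
    have e : ∀ t : Torus, ‖(fourier (-(N : ℤ)) t : ℂ) - 1‖ₑ = ‖(fourier (N : ℤ) t : ℂ) - 1‖ₑ := by
      intro t
      rw [← ofReal_norm, ← ofReal_norm, ← RCLike.norm_conj ((fourier (N : ℤ) t : ℂ) - 1),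
        fourier_neg, map_sub, map_one]
    simp only [e, this]; simp

theorem lintegral_sq_translate {u : Torus → ℂ} (hu : MemLp u 2 volume) (t : Torus) :
    ∫⁻ θ, ‖u (θ + t) - u θ‖ₑ ^ 2 ∂haarAddCircle =
      ∑' n : ℤ, ‖(fourier n t : ℂ) - 1‖ₑ ^ 2 * ‖fourierCoeff u n‖ₑ ^ 2 := by
  have h := hasSum_sq_translate hu t
  have e : ∀ z : ℂ, ‖z‖ₑ ^ 2 = ENNReal.ofReal (‖z‖ ^ 2) := fun z => by
    rw [ENNReal.ofReal_pow (norm_nonneg _), ofReal_norm]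
  simp only [e]
  have hi : Integrable (fun θ => ‖u (θ + t) - u θ‖ ^ 2) haarAddCircle :=
    (memLp_haar_iff.2 ((MemLp.translate hu t).sub hu)).integrable_norm_pow (by norm_num)
  rw [← ofReal_integral_eq_lintegral_ofReal hi (.of_forall fun _ => by positivity)]
  rw [← h.tsum_eq, ENNReal.ofReal_tsum_of_nonneg (fun n => by positivity) h.summable]
  exact tsum_congr fun n => ENNReal.ofReal_mul (by positivity)

/-- The Gagliardo seminorm. -/
def gagliardo (u : Torus → ℂ) : ℝ≥0∞ :=
  ∫⁻ t : Torus, (‖(fourier 1 t : ℂ) - 1‖ₑ ^ 2)⁻¹ *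
    ∫⁻ θ, ‖u (θ + t) - u θ‖ₑ ^ 2 ∂haarAddCircle ∂haarAddCircle

/-- Parseval in θ for each fixed t, then Tonelli: the average over t of |e_n(t) - 1|²/|e_1(t) - 1|²
is the weight |n|. -/
theorem gagliardo_eq_tsum {u : Torus → ℂ} (hu : MemLp u 2 volume) :
    gagliardo u = ∑' n : ℤ, ENNReal.ofReal |(n : ℝ)| * ‖fourierCoeff u n‖ₑ ^ 2 := by
  have hm : ∀ n : ℤ, Measurable fun t : Torus => ‖(fourier n t : ℂ) - 1‖ₑ ^ 2 := fun n => by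
    have := (fourier n : C(Torus, ℂ)).continuous
    have : Continuous fun t : Torus => (fourier n t : ℂ) - 1 := by fun_prop
    exact (this.enorm.measurable).pow_const 2
  simp only [gagliardo, lintegral_sq_translate hu, ← ENNReal.tsum_mul_left]
  rw [lintegral_tsum fun n => by exact (((hm 1).inv).mul ((hm n).mul_const _)).aemeasurable]
  refine tsum_congr fun n => ?_
  simp only [← mul_assoc]
  rw [lintegral_mul_const _ (by exact ((hm 1).inv).mul (hm n)), lintegral_fourier_quotient]

theorem memH_iff {u : Torus → ℂ} (hu : MemLp u 2 volume) : MemH u ↔ gagliardo u ≠ ⊤ := by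
  have e : ∀ n : ℤ, ENNReal.ofReal |(n : ℝ)| * ‖fourierCoeff u n‖ₑ ^ 2 =
      ENNReal.ofReal (|(n : ℝ)| * ‖fourierCoeff u n‖ ^ 2) := fun n => by
    rw [ENNReal.ofReal_mul (abs_nonneg _), ENNReal.ofReal_pow (norm_nonneg _), ofReal_norm]
  rw [gagliardo_eq_tsum hu]
  simp only [e]
  constructor
  · intro h
    exact h.2.tsum_ofReal_ne_top
  · intro h
    refine ⟨hu, ?_⟩
    have := ENNReal.summable_toReal h
    refine this.congr fun n => ?_
    rw [ENNReal.toReal_ofReal (by positivity)]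

/-! ### The Sobolev space H^{1/2} of the circle. -/

theorem expi_eq_fourier (θ : Torus) : expi θ = fourier 1 θ := fourier_one.symm

theorem continuous_expi : Continuous expi := by
  have : expi = (fourier 1 : Torus → ℂ) := funext expi_eq_fourier
  rw [this]; exact (fourier 1).continuous

theorem norm_expi (θ : Torus) : ‖expi θ‖ = 1 := Circle.norm_coe _

theorem expi_add (x y : Torus) : expi (x + y) = expi x * expi y := by
  simp [expi, AddCircle.toCircle_add]

theorem expi_injective : Function.Injective expi := fun _ _ h =>
  AddCircle.injective_toCircle two_pi_pos.ne' (Subtype.ext h)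

theorem expi_coe (t : ℝ) : expi (t : Torus) = Complex.exp (t * Complex.I) := by
  have : (π : ℂ) ≠ 0 := by exact_mod_cast pi_ne_zero
  rw [expi_eq_fourier, fourier_coe_apply]; congr 1; push_cast; field_simp

theorem fourier_eq_expi_zpow (n : ℤ) (θ : Torus) : (fourier n θ : ℂ) = expi θ ^ n := by
  rw [fourier_apply, AddCircle.toCircle_zsmul]; simp [expi]

theorem volume_torus : (volume : Measure Torus) = ENNReal.ofReal (2 * π) • haarAddCircle :=
  AddCircle.volume_eq_smul_haarAddCircle

/-- Substituting x = y + t makes the kernel depend on t alone, because |e^{iy}| = 1. The two factors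
2π convert arc length to normalized measure in each variable. -/
theorem lintegral_prod_quotient {u : Torus → ℂ} (hu : Measurable u) :
    ∫⁻ p : Torus × Torus, (‖expi p.1 - expi p.2‖ₑ ^ 2)⁻¹ * ‖u p.1 - u p.2‖ₑ ^ 2
      ∂((volume : Measure Torus).prod (volume : Measure Torus)) =
    ENNReal.ofReal (2 * π) * (ENNReal.ofReal (2 * π) * gagliardo u) := by
  have he : Measurable expi := continuous_expi.measurable
  have hF : Measurable fun p : Torus × Torus =>
      (‖expi p.1 - expi p.2‖ₑ ^ 2)⁻¹ * ‖u p.1 - u p.2‖ₑ ^ 2 := by fun_prop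
  have hG : Measurable fun p : Torus × Torus =>
      (‖expi (p.1 + p.2) - expi p.1‖ₑ ^ 2)⁻¹ * ‖u (p.1 + p.2) - u p.1‖ₑ ^ 2 := by fun_prop
  rw [lintegral_prod_symm _ hF.aemeasurable]
  have h1 : ∀ y : Torus, ∫⁻ x : Torus, (‖expi x - expi y‖ₑ ^ 2)⁻¹ * ‖u x - u y‖ₑ ^ 2 =
      ∫⁻ t : Torus, (‖expi (y + t) - expi y‖ₑ ^ 2)⁻¹ * ‖u (y + t) - u y‖ₑ ^ 2 := fun y =>
    (lintegral_add_left_eq_self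
      (fun x : Torus => (‖expi x - expi y‖ₑ ^ 2)⁻¹ * ‖u x - u y‖ₑ ^ 2) y).symm
  simp only [h1]
  rw [lintegral_lintegral_swap hG.aemeasurable]
  have h2 : ∀ y t : Torus, ‖expi (y + t) - expi y‖ₑ = ‖(fourier 1 t : ℂ) - 1‖ₑ := fun y t => by
    rw [expi_add, ← expi_eq_fourier, show expi y * expi t - expi y = expi y * (expi t - 1) by ring,
      enorm_mul, ← ofReal_norm, norm_expi]; simp
  simp only [h2]
  have h3 : ∀ t : Torus, ∫⁻ y : Torus, (‖(fourier 1 t : ℂ) - 1‖ₑ ^ 2)⁻¹ * ‖u (y + t) - u y‖ₑ ^ 2 =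
      (‖(fourier 1 t : ℂ) - 1‖ₑ ^ 2)⁻¹ * ∫⁻ y : Torus, ‖u (y + t) - u y‖ₑ ^ 2 := fun t =>
    lintegral_const_mul _ (by fun_prop)
  simp only [h3]
  simp only [volume_torus, lintegral_smul_measure, smul_eq_mul, gagliardo]
  congr 1
  rw [← lintegral_const_mul' _ _ (by finiteness)]
  refine lintegral_congr fun t => ?_
  ring

theorem enorm_quotient {E : Type*} [NormedAddCommGroup E] [NormedSpace ℝ E] (x y : Torus) (w : E)
    (h : x = y → w = 0) :
    ‖(‖expi x - expi y‖⁻¹ : ℝ) • w‖ₑ ^ 2 = (‖expi x - expi y‖ₑ ^ 2)⁻¹ * ‖w‖ₑ ^ 2 := by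
  by_cases hxy : x = y
  -- On the diagonal the real inverse is 0 while the extended one is ⊤; both products vanish because
  -- `w` does.
  · simp [h hxy]
  · have hne : ‖expi x - expi y‖ ≠ 0 := norm_ne_zero_iff.2 (sub_ne_zero.2 (expi_injective.ne hxy))
    rw [enorm_smul, mul_pow, enorm_inv hne, enorm_norm, ENNReal.inv_pow]

/-- Only the increments of `u` are compared with those of `w`, so the lemma also covers the
complexification of a real function. -/
theorem H12.memH {E : Type} [NormedAddCommGroup E] [NormedSpace ℝ E] (w : H12 E) {u : Torus → ℂ}
    (hu : Measurable u) (hm : MemLp u 2 volume)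
    (hn : ∀ x y, ‖u x - u y‖ = ‖w.fn x - w.fn y‖) : MemH u := by
  rw [memH_iff hm]
  have h1 := lintegral_prod_quotient hu
  have h2 : ∫⁻ p : Torus × Torus, ‖w.1.2 p‖ₑ ^ 2
      ∂((volume : Measure Torus).prod (volume : Measure Torus)) < ⊤ := by
    have := (Lp.memLp w.1.2).eLpNorm_lt_top
    have h := lintegral_rpow_enorm_lt_top_of_eLpNorm_lt_top (p := 2) (by norm_num) (by norm_num) this
    simpa using h
  have h3 : ∫⁻ p : Torus × Torus, ‖w.1.2 p‖ₑ ^ 2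
      ∂((volume : Measure Torus).prod (volume : Measure Torus)) =
      ∫⁻ p : Torus × Torus, (‖expi p.1 - expi p.2‖ₑ ^ 2)⁻¹ * ‖u p.1 - u p.2‖ₑ ^ 2
      ∂((volume : Measure Torus).prod (volume : Measure Torus)) := by
    refine lintegral_congr_ae ?_
    filter_upwards [w.2] with p hp
    rw [hp, enorm_quotient p.1 p.2 _ (fun h => by rw [h, sub_self])]
    rw [← ofReal_norm (u p.1 - u p.2), hn, ofReal_norm]; rfl
  rw [h3, h1] at h2
  intro htop
  rw [htop] at h2
  simp [ENNReal.mul_top, pi_pos] at h2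

theorem MemH.congr_ae {u v : Torus → ℂ} (hu : MemH u) (h : u =ᵐ[volume] v) : MemH v := by
  refine ⟨(memLp_congr_ae h).1 hu.1, ?_⟩
  have : ∀ n, fourierCoeff v n = fourierCoeff u n := fun n =>
    congrFun (fourierCoeff_congr_ae (ae_haar_iff.2 (h.symm))) n
  simpa only [this] using hu.2

/-- The graph space needs a jointly measurable difference quotient, hence a strongly measurable
representative; finiteness of the Gagliardo integral places the quotient in L². -/
theorem MemH.exists_H12 {u : Torus → ℂ} (hu : MemH u) : ∃ w : H12 ℂ, w.fn =ᵐ[volume] u := by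
  set v := hu.1.1.mk u with hv
  have huv : u =ᵐ[volume] v := hu.1.1.ae_eq_mk
  have hvs : StronglyMeasurable v := hu.1.1.stronglyMeasurable_mk
  have hvH : MemH v := hu.congr_ae huv
  set q : Torus × Torus → ℂ := fun p => (‖expi p.1 - expi p.2‖⁻¹ : ℝ) • (v p.1 - v p.2) with hq
  have hvm : Measurable v := hvs.measurable
  have he : Measurable expi := continuous_expi.measurable
  have hqm : Measurable q := by fun_prop
  have hqL : MemLp q 2 ((volume : Measure Torus).prod (volume : Measure Torus)) := by
    refine ⟨hqm.aestronglyMeasurable, ?_⟩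
    refine (eLpNorm_lt_top_iff_lintegral_rpow_enorm_lt_top (by norm_num) (by norm_num)).2 ?_
    have h1 := lintegral_prod_quotient hvm
    have h2 : ∀ p : Torus × Torus, ‖q p‖ₑ ^ (2 : ℝ≥0∞).toReal =
        (‖expi p.1 - expi p.2‖ₑ ^ 2)⁻¹ * ‖v p.1 - v p.2‖ₑ ^ 2 := fun p => by
      rw [← enorm_quotient p.1 p.2 _ (fun h => by rw [h, sub_self])]; simp [hq]
    simp only [h2, h1]
    have := (memH_iff hvH.1).1 hvH
    finiteness
  refine ⟨⟨(hvH.1.toLp, hqL.toLp), ?_⟩, ?_⟩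
  · have h1 := hvH.1.coeFn_toLp
    have ha := (Measure.quasiMeasurePreserving_fst
      (μ := (volume : Measure Torus)) (ν := (volume : Measure Torus))).ae h1
    have hb := (Measure.quasiMeasurePreserving_snd
      (μ := (volume : Measure Torus)) (ν := (volume : Measure Torus))).ae h1
    show ∀ᵐ p : Torus × Torus ∂((volume : Measure Torus).prod (volume : Measure Torus)), _
    filter_upwards [hqL.coeFn_toLp, ha, hb] with p h2 h3 h4
    rw [h2, h3, h4]
  · exact hvH.1.coeFn_toLp.trans huv.symm

theorem measurable_lintegral_sq_translate {u : Torus → ℂ} (hu : MemLp u 2 volume) :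
    Measurable fun t : Torus => ∫⁻ θ, ‖u (θ + t) - u θ‖ₑ ^ 2 ∂haarAddCircle := by
  simp only [lintegral_sq_translate hu]
  refine Measurable.tsum fun n => ?_
  have := (fourier n : C(Torus, ℂ)).continuous.measurable
  fun_prop

theorem gagliardo_le {h g ψ : Torus → ℂ} (hg : MemLp g 2 volume)
    (hle : ∀ t : Torus, ∀ᵐ θ : Torus,
      ‖h (θ + t) - h θ‖ ≤ ‖g (θ + t) - g θ‖ + ‖ψ (θ + t) - ψ θ‖) :
    gagliardo h ≤ 2 * (gagliardo g + gagliardo ψ) := by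
  have hm : Measurable fun t : Torus => (‖(fourier 1 t : ℂ) - 1‖ₑ ^ 2)⁻¹ := by
    have := (fourier 1 : C(Torus, ℂ)).continuous.measurable
    fun_prop
  have hmg : ∀ u : Torus → ℂ, MemLp u 2 volume → ∀ t : Torus,
      AEMeasurable (fun θ => ‖u (θ + t) - u θ‖ₑ ^ 2) haarAddCircle := fun u hu t =>
    (((memLp_haar_iff.2 (MemLp.translate hu t)).1.sub (memLp_haar_iff.2 hu).1).enorm).pow_const 2
  unfold gagliardo
  rw [← lintegral_add_left (by exact hm.mul (measurable_lintegral_sq_translate hg)),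
    ← lintegral_const_mul' _ _ (by finiteness)]
  refine lintegral_mono fun t => ?_
  simp only
  rw [← mul_add, mul_left_comm, ← lintegral_add_left' (hmg g hg t)]
  gcongr
  rw [← lintegral_const_mul' 2 _ (by finiteness)]
  refine lintegral_mono_ae ?_
  filter_upwards [ae_haar_iff.2 (hle t)] with θ hθ
  have e : ∀ z : ℂ, ‖z‖ₑ ^ 2 = ENNReal.ofReal (‖z‖ ^ 2) := fun z => by
    rw [ENNReal.ofReal_pow (norm_nonneg _), ofReal_norm]
  rw [e, e, e, ← ENNReal.ofReal_add (by positivity) (by positivity),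
    show (2 : ℝ≥0∞) = ENNReal.ofReal 2 by simp, ← ENNReal.ofReal_mul (by norm_num)]
  refine ENNReal.ofReal_le_ofReal ?_
  have := pow_le_pow_left₀ (norm_nonneg _) hθ 2
  nlinarith [sq_nonneg (‖g (θ + t) - g θ‖ - ‖ψ (θ + t) - ψ θ‖)]

theorem norm_exp_I_sub_exp_I_le (a b : ℝ) :
    ‖Complex.exp (Complex.I * a) - Complex.exp (Complex.I * b)‖ ≤ |a - b| := by
  have h := Real.norm_exp_I_mul_ofReal_sub_one_le (x := a - b)
  have e : Complex.exp (Complex.I * a) - Complex.exp (Complex.I * b) =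
      Complex.exp (Complex.I * b) * (Complex.exp (Complex.I * ((a - b : ℝ) : ℂ)) - 1) := by
    rw [mul_sub, ← Complex.exp_add]; push_cast; ring_nf
  rw [e, norm_mul, mul_comm Complex.I (b : ℂ), Complex.norm_exp_ofReal_mul_I, one_mul]
  simpa using h

theorem norm_exp_I_mul_ofReal (b : ℝ) : ‖Complex.exp (Complex.I * b)‖ = 1 := by
  rw [mul_comm, Complex.norm_exp_ofReal_mul_I]

theorem norm_twist (g : Torus → ℂ) (ψ : Torus → ℝ) (θ : Torus) : ‖twist g ψ θ‖ = ‖g θ‖ := by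
  rw [twist, norm_mul, norm_exp_I_mul_ofReal, mul_one]

theorem norm_twist_sub_le (g : Torus → ℂ) (ψ : Torus → ℝ) {x y : Torus} (hy : ‖g y‖ ≤ 1) :
    ‖twist g ψ x - twist g ψ y‖ ≤ ‖g x - g y‖ + |ψ x - ψ y| := by
  have e : twist g ψ x - twist g ψ y = (g x - g y) * Complex.exp (Complex.I * ψ x) +
      g y * (Complex.exp (Complex.I * ψ x) - Complex.exp (Complex.I * ψ y)) := by
    simp only [twist]; ring
  rw [e]
  refine (norm_add_le _ _).trans ?_
  rw [norm_mul, norm_mul, norm_exp_I_mul_ofReal, mul_one]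
  have := norm_exp_I_sub_exp_I_le (ψ x) (ψ y)
  gcongr
  calc _ ≤ 1 * |ψ x - ψ y| := by gcongr
    _ = _ := one_mul _

/-- The increment of g e^{iψ} is at most the sum of the increments of g and ψ, because |g| = 1 and s
↦ e^{is} is 1-Lipschitz. The Gagliardo seminorm is therefore controlled. -/
theorem MemH.twist {g : Torus → ℂ} {ψ : Torus → ℝ} (hg : MemH g)
    (hg1 : ∀ᵐ θ : Torus, ‖g θ‖ = 1) (hψ : MemH fun θ => (ψ θ : ℂ)) :
    MemH (RenormEnergy.twist g ψ) := by
  have hm : MemLp (RenormEnergy.twist g ψ) 2 volume := by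
    refine hg.1.of_le (hg.1.1.mul ?_) (.of_forall fun θ => (norm_twist g ψ θ).le)
    have : Continuous fun z : ℂ => Complex.exp (Complex.I * z) := by fun_prop
    exact this.comp_aestronglyMeasurable hψ.1.1
  rw [memH_iff hm]
  refine ((gagliardo_le (ψ := fun θ => (ψ θ : ℂ)) hg.1 fun t => ?_).trans_lt ?_).ne
  · filter_upwards [hg1] with θ h1
    refine (norm_twist_sub_le g ψ h1.le).trans_eq ?_
    rw [← Complex.ofReal_sub, Complex.norm_real, Real.norm_eq_abs]
  · have h1 := (memH_iff hg.1).1 hg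
    have h2 := (memH_iff hψ.1).1 hψ
    exact ENNReal.mul_lt_top (by finiteness) (ENNReal.add_lt_top.2 ⟨h1.lt_top, h2.lt_top⟩)

/-- Lipschitz functions have square summable differentiated Fourier series. -/
theorem summable_sq_of_lipschitz {u : Torus → ℂ} (hu : MemLp u 2 volume) {L : ℝ}
    (hL : ∀ (θ : Torus) (t : ℝ), ‖u (θ + (t : Torus)) - u θ‖ ≤ L * |t|) :
    Summable fun n : ℤ => (n : ℝ) ^ 2 * ‖fourierCoeff u n‖ ^ 2 := by
  -- Parseval for u(· + t) - u bounds any finite partial sum of |(e_n(t) - 1)/t|²|û(n)|² by L²; then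
  -- t → 0.
  refine summable_of_sum_le (c := L ^ 2) (fun n => by positivity) fun s => ?_
  have hlim : Tendsto (fun t : ℝ => ∑ n ∈ s,
      ‖(t : ℂ)⁻¹ * ((fourier n (t : Torus) : ℂ) - 1)‖ ^ 2 * ‖fourierCoeff u n‖ ^ 2) (𝓝[≠] 0)
      (𝓝 (∑ n ∈ s, ‖Complex.I * (n : ℂ)‖ ^ 2 * ‖fourierCoeff u n‖ ^ 2)) := by
    refine tendsto_finsetSum _ fun n _ => Tendsto.mul_const _ (Tendsto.pow (Tendsto.norm ?_) 2)
    have := (hasDerivAt_fourier_zero n).tendsto_slope_zero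
    simp only [zero_add, QuotientAddGroup.mk_zero, fourier_eval_zero, Complex.real_smul,
      Complex.ofReal_inv] at this
    exact this
  have e : ∀ n : ℤ, ‖Complex.I * (n : ℂ)‖ ^ 2 = (n : ℝ) ^ 2 := fun n => by simp
  simp only [e] at hlim
  refine le_of_tendsto hlim ?_
  filter_upwards [self_mem_nhdsWithin] with t ht
  have ht' : 0 < |t| := abs_pos.2 ht
  have h1 := hasSum_sq_translate hu (t : Torus)
  have h2 := (sum_le_hasSum s (fun n _ => by positivity) h1)
  have h3 : ∫ θ, ‖u (θ + (t : Torus)) - u θ‖ ^ 2 ∂haarAddCircle ≤ (L * |t|) ^ 2 := by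
    have : ∫ _ : Torus, (L * |t|) ^ 2 ∂haarAddCircle = (L * |t|) ^ 2 := by simp
    rw [← this]
    refine integral_mono_of_nonneg (.of_forall fun _ => by positivity) (integrable_const _)
      (.of_forall fun θ => ?_)
    exact pow_le_pow_left₀ (norm_nonneg _) (hL θ t) 2
  have h4 : ∑ n ∈ s, ‖(t : ℂ)⁻¹ * ((fourier n (t : Torus) : ℂ) - 1)‖ ^ 2 * ‖fourierCoeff u n‖ ^ 2 =
      (|t|⁻¹) ^ 2 * ∑ n ∈ s, ‖(fourier n (t : Torus) : ℂ) - 1‖ ^ 2 * ‖fourierCoeff u n‖ ^ 2 := by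
    rw [Finset.mul_sum]
    refine Finset.sum_congr rfl fun n _ => ?_
    rw [norm_mul, norm_inv, Complex.norm_real, Real.norm_eq_abs]; ring
  rw [h4]
  calc _ ≤ (|t|⁻¹) ^ 2 * (L * |t|) ^ 2 := by gcongr; exact h2.trans h3
    _ = L ^ 2 := by field_simp

theorem memH_of_lipschitz {u : Torus → ℂ} (hu : MemLp u 2 volume) {L : ℝ}
    (hL : ∀ (θ : Torus) (t : ℝ), ‖u (θ + (t : Torus)) - u θ‖ ≤ L * |t|) : MemH u := by
  refine ⟨hu, ?_⟩
  refine Summable.of_nonneg_of_le (fun n => by positivity) (fun n => ?_)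
    (summable_sq_of_lipschitz hu hL)
  gcongr
  rw [← sq_abs (n : ℝ), sq]
  rcases eq_or_ne n 0 with rfl | hn
  · simp
  · have : (1 : ℝ) ≤ |(n : ℝ)| := by exact_mod_cast Int.one_le_abs hn
    nlinarith

/-- The current is real, so its coefficients are Hermitian symmetric. Only the nonpositive
frequencies are used afterwards, and the zero one is 2π times the degree. -/
theorem wedgeCoeff_neg (h : Torus → ℂ) (n : ℤ) :
    wedgeCoeff h (-n) = (starRingEnd ℂ) (wedgeCoeff h n) := by
  have key : ∀ (u v : Torus → ℝ), bracket (fun θ => (u θ : ℂ) * fourier (-n) θ) (fun θ => (v θ : ℂ)) =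
      (starRingEnd ℂ) (bracket (fun θ => (u θ : ℂ) * fourier n θ) (fun θ => (v θ : ℂ))) := by
    intro u v
    simp only [bracket, map_mul, Complex.conj_tsum, fourierCoeff_mul_fourier]
    rw [← (Equiv.neg ℤ).tsum_eq]
    simp only [map_ofNat, Complex.conj_ofReal, Equiv.neg_apply, Complex.conj_I, map_intCast]
    congr 1
    refine tsum_congr fun m => ?_
    rw [← fourierCoeff_ofReal_neg, ← fourierCoeff_ofReal_neg]
    push_cast
    ring_nf
  simp only [wedgeCoeff, map_sub, key]

theorem degree_eq (h : Torus → ℂ) : degree h = (2 * π)⁻¹ * (wedgeCoeff h 0).re := by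
  unfold degree wedgePairing
  congr 2
  have e : (fun _ : Torus => ((1 : ℝ) : ℂ)) = (fourier 0 : Torus → ℂ) := by funext θ; simp
  rw [e, tsum_eq_single 0]
  · simp [fourierCoeff_fourier]
  · intro n hn; simp [fourierCoeff_fourier, hn.symm]

theorem wedgeCoeff_zero_im (h : Torus → ℂ) : (wedgeCoeff h 0).im = 0 := by
  have := wedgeCoeff_neg h 0
  rw [neg_zero] at this
  exact Complex.conj_eq_iff_im.1 this.symm

theorem wedgeCoeff_zero_of_degree {h : Torus → ℂ} {D : ℝ} (hd : degree h = D) :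
    wedgeCoeff h 0 = ((2 * π * D : ℝ) : ℂ) := by
  rw [degree_eq] at hd
  have := two_pi_pos
  apply Complex.ext
  · rw [Complex.ofReal_re, ← hd]; field_simp
  · rw [wedgeCoeff_zero_im, Complex.ofReal_im]

/-! ### Conformal representations that are C¹ up to the boundary. -/

/-- `F` is holomorphic in the disc with derivative `F'`, both continuous on the closed disc. -/
structure DiscC1 (F F' : ℂ → ℂ) : Prop where
  cont : ContinuousOn F cdisc
  cont' : ContinuousOn F' cdisc
  hasDerivAt : ∀ z ∈ disc, HasDerivAt F (F' z) z

theorem continuousOn_extendZero (u : C(cdisc, ℂ)) : ContinuousOn (extendZero u) cdisc := by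
  rw [continuousOn_iff_continuous_domRestrict]
  convert u.continuous using 1
  funext z
  simp [extendZero, z.2]

theorem HolC1.discC1 (f : HolC1) : DiscC1 f.fn (extendZero f.1.2) :=
  ⟨continuousOn_extendZero _, continuousOn_extendZero _, f.2⟩

theorem closure_disc : closure disc = cdisc := closure_ball 0 one_ne_zero

theorem disc_subset_cdisc : disc ⊆ cdisc := Metric.ball_subset_closedBall

theorem convex_cdisc : Convex ℝ cdisc := convex_closedBall 0 1

theorem expi_mem_cdisc (θ : Torus) : expi θ ∈ cdisc := by
  rw [mem_closedBall_zero_iff, norm_expi]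

theorem uniqueDiffOn_cdisc : UniqueDiffOn ℝ cdisc :=
  uniqueDiffOn_convex convex_cdisc ⟨0, by
    rw [interior_closedBall _ one_ne_zero]; exact Metric.mem_ball_self one_pos⟩

namespace DiscC1

variable {F F' : ℂ → ℂ}

/-- At a boundary point the derivative is the limit of the interior ones: on a convex open set, a
continuous function whose derivative extends continuously to a point of the closure is
differentiable there. -/
theorem hasFDerivWithinAt (h : DiscC1 F F') {z : ℂ} (hz : z ∈ cdisc) :
    HasFDerivWithinAt F (F' z • (1 : ℂ →L[ℝ] ℂ)) cdisc z := by
  have hcl : closure disc = cdisc := closure_ball 0 one_ne_zero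
  rw [← hcl]
  refine hasFDerivWithinAt_closure_of_tendsto_fderiv
    (fun w hw => (h.hasDerivAt w hw).complexToReal_fderiv.differentiableAt.differentiableWithinAt)
    (convex_ball 0 1) Metric.isOpen_ball
    (fun w hw => ((h.cont w (hcl ▸ hw)).mono disc_subset_cdisc)) ?_
  have h1 : Tendsto F' (𝓝[disc] z) (𝓝 (F' z)) := (h.cont' z hz).mono disc_subset_cdisc
  have h2 : Tendsto (fun w => F' w • (1 : ℂ →L[ℝ] ℂ)) (𝓝[disc] z) (𝓝 (F' z • (1 : ℂ →L[ℝ] ℂ))) :=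
    h1.smul_const _
  refine h2.congr' ?_
  filter_upwards [self_mem_nhdsWithin] with w hw
  exact (h.hasDerivAt w hw).complexToReal_fderiv.fderiv.symm

theorem hasDerivWithinAt (h : DiscC1 F F') {z : ℂ} (hz : z ∈ cdisc) :
    HasDerivWithinAt F (F' z) cdisc z := by
  have h1 := h.hasFDerivWithinAt hz
  have : HasFDerivWithinAt F (ContinuousLinearMap.toSpanSingleton ℂ (F' z)) cdisc z := by
    refine HasFDerivWithinAt.of_restrictScalars ℝ h1 ?_
    ext; simp [ContinuousLinearMap.toSpanSingleton, mul_comm]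
  simpa using this.hasDerivWithinAt

theorem differentiableOn (h : DiscC1 F F') : DifferentiableOn ℂ F disc :=
  fun z hz => (h.hasDerivAt z hz).differentiableAt.differentiableWithinAt

theorem norm_smul_one (c : ℂ) : ‖c • (1 : ℂ →L[ℝ] ℂ)‖ = ‖c‖ := by
  rw [norm_smul, norm_one, mul_one]

theorem lipschitz_of_bound (h : DiscC1 F F') {C : ℝ} (hC : ∀ z ∈ cdisc, ‖F' z‖ ≤ C) {z w : ℂ}
    (hz : z ∈ cdisc) (hw : w ∈ cdisc) : ‖F z - F w‖ ≤ C * ‖z - w‖ :=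
  convex_cdisc.norm_image_sub_le_of_norm_hasFDerivWithin_le
    (fun _ hx => h.hasFDerivWithinAt hx) (fun x hx => by rw [norm_smul_one]; exact hC x hx) hw hz

theorem exists_bound (h : DiscC1 F F') : ∃ C : ℝ, ∀ z ∈ cdisc, ‖F' z‖ ≤ C :=
  (isCompact_closedBall 0 1).exists_bound_of_continuousOn h.cont'

/-- Uniform continuity of F' on the compact disc together with the mean value inequality on the
convex intersection with a small ball. -/
theorem uniform_approx (h : DiscC1 F F') {ε : ℝ} (hε : 0 < ε) :
    ∃ δ > 0, ∀ z ∈ cdisc, ∀ w ∈ cdisc, ‖z - w‖ < δ → ‖F z - F w - F' w * (z - w)‖ ≤ ε * ‖z - w‖ := by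
  have hu := (isCompact_closedBall (0 : ℂ) 1).uniformContinuousOn_of_continuous h.cont'
  rw [Metric.uniformContinuousOn_iff] at hu
  obtain ⟨δ, hδ, hd⟩ := hu ε hε
  refine ⟨δ, hδ, fun z hz w hw hzw => ?_⟩
  have hconv : Convex ℝ (cdisc ∩ Metric.ball w δ) := convex_cdisc.inter (convex_ball w δ)
  have := hconv.norm_image_sub_le_of_norm_hasFDerivWithin_le' (f := F)
    (f' := fun x => F' x • (1 : ℂ →L[ℝ] ℂ)) (φ := F' w • (1 : ℂ →L[ℝ] ℂ)) (C := ε) (x := w) (y := z)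
    (fun x hx => (h.hasFDerivWithinAt hx.1).mono inter_subset_left)
    (fun x hx => by
      rw [← sub_smul, norm_smul_one, ← dist_eq_norm]
      exact (hd x hx.1 w hw hx.2).le)
    ⟨hw, Metric.mem_ball_self hδ⟩ ⟨hz, by rwa [Metric.mem_ball, dist_eq_norm]⟩
  simpa using this

/-- A uniform lower bound of the difference quotients of `F`. -/
def LowerLip (F : ℂ → ℂ) (c : ℝ) : Prop :=
  0 < c ∧ ∀ z ∈ cdisc, ∀ w ∈ cdisc, c * ‖z - w‖ ≤ ‖F z - F w‖

/-- Near the diagonal the first order approximation bounds |F z - F w| below by a multiple of the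
minimum of |F'|. Away from it, |F z - F w| has a positive minimum by compactness and injectivity. -/
theorem exists_lowerLip (h : DiscC1 F F') (hinj : InjOn F cdisc) (hne : ∀ z ∈ cdisc, F' z ≠ 0) :
    ∃ c, LowerLip F c := by
  have hK := isCompact_closedBall (0 : ℂ) 1
  obtain ⟨z₀, hz₀, hmin⟩ := hK.exists_isMinOn ⟨0, by simp⟩ h.cont'.norm
  set m := ‖F' z₀‖ with hm
  have hm0 : 0 < m := norm_pos_iff.2 (hne z₀ hz₀)
  obtain ⟨δ, hδ, happ⟩ := h.uniform_approx (half_pos hm0)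
  set K : Set (ℂ × ℂ) := (cdisc ×ˢ cdisc) ∩ {p | δ ≤ ‖p.1 - p.2‖} with hKdef
  have hKc : IsCompact K := (hK.prod hK).inter_right
    (isClosed_le continuous_const (by fun_prop))
  have hFc : ContinuousOn (fun p : ℂ × ℂ => ‖F p.1 - F p.2‖) K := by
    refine ContinuousOn.norm (ContinuousOn.sub ?_ ?_)
    · exact h.cont.comp continuousOn_fst fun p hp => hp.1.1
    · exact h.cont.comp continuousOn_snd fun p hp => hp.1.2
  have hfar : ∃ b > 0, ∀ p ∈ K, b ≤ ‖F p.1 - F p.2‖ := by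
    rcases K.eq_empty_or_nonempty with he | hne'
    · exact ⟨1, one_pos, fun p hp => by simp [he] at hp⟩
    · obtain ⟨p₀, hp₀, hpm⟩ := hKc.exists_isMinOn hne' hFc
      refine ⟨_, norm_pos_iff.2 (sub_ne_zero.2 fun he => ?_), fun p hp => hpm hp⟩
      have := hinj hp₀.1.1 hp₀.1.2 he
      have h2 : δ ≤ ‖p₀.1 - p₀.2‖ := hp₀.2
      rw [this] at h2; simp at h2; linarith
  obtain ⟨b, hb, hfar⟩ := hfar
  -- Half of m is lost to the approximation error; b is halved because |z - w| can be as large as 2.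
  refine ⟨min (m / 2) (b / 2), by positivity, fun z hz w hw => ?_⟩
  rcases lt_or_ge ‖z - w‖ δ with hlt | hge
  · have h1 := happ z hz w hw hlt
    have h2 : m ≤ ‖F' w‖ := hmin hw
    have h3 : ‖F' w * (z - w)‖ ≤ ‖F z - F w‖ + ‖F z - F w - F' w * (z - w)‖ := by
      have := norm_sub_le (F z - F w) (F z - F w - F' w * (z - w))
      simpa using this
    rw [norm_mul] at h3
    have h4 : min (m / 2) (b / 2) * ‖z - w‖ ≤ m / 2 * ‖z - w‖ := by gcongr; exact min_le_left _ _
    nlinarith [norm_nonneg (z - w)]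
  · have h1 := hfar (z, w) ⟨⟨hz, hw⟩, hge⟩
    have h2 : ‖z - w‖ ≤ 2 := by
      have a := mem_closedBall_zero_iff.1 hz
      have b := mem_closedBall_zero_iff.1 hw
      linarith [norm_sub_le z w]
    have h4 : min (m / 2) (b / 2) * ‖z - w‖ ≤ b / 2 * 2 := by
      gcongr
      exact min_le_right _ _
    linarith

theorem LowerLip.injOn {c : ℝ} (hl : LowerLip F c) : InjOn F cdisc := by
  intro z hz w hw he
  have := hl.2 z hz w hw
  rw [he, sub_self, norm_zero] at this
  have h0 : ‖z - w‖ ≤ 0 := by nlinarith [hl.1, norm_nonneg (z - w)]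
  exact sub_eq_zero.1 (norm_le_zero_iff.1 h0)

/-- Inside the disc the bound passes to the limit of difference quotients, and on the boundary it
follows by continuity of F'. -/
theorem LowerLip.le_norm_deriv {c : ℝ} (hl : LowerLip F c) (h : DiscC1 F F') {z : ℂ}
    (hz : z ∈ cdisc) : c ≤ ‖F' z‖ := by
  have hacc : ∀ w ∈ disc, c ≤ ‖F' w‖ := by
    intro w hw
    have h1 := (hasDerivAt_iff_tendsto_slope.1 (h.hasDerivAt w hw)).norm
    refine ge_of_tendsto h1 ?_
    have : ∀ᶠ y in 𝓝[≠] w, y ∈ disc := nhdsWithin_le_nhds (Metric.isOpen_ball.mem_nhds hw)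
    filter_upwards [this, self_mem_nhdsWithin] with y hy hne
    have h2 := hl.2 y (disc_subset_cdisc hy) w (disc_subset_cdisc hw)
    have h3 : 0 < ‖y - w‖ := norm_pos_iff.2 (sub_ne_zero.2 hne)
    rw [slope_def_field, norm_div, le_div_iff₀ h3]
    exact h2
  have hz' : z ∈ closure disc := by rwa [closure_disc]
  have hne : (𝓝[disc] z).NeBot := mem_closure_iff_nhdsWithin_neBot.1 hz'
  have ht : Tendsto (fun w => ‖F' w‖) (𝓝[disc] z) (𝓝 ‖F' z‖) :=
    ((h.cont' z hz).mono disc_subset_cdisc).norm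
  exact ge_of_tendsto ht (eventually_nhdsWithin_of_forall hacc)

theorem LowerLip.deriv_ne_zero {c : ℝ} (hl : LowerLip F c) (h : DiscC1 F F') {z : ℂ}
    (hz : z ∈ cdisc) : F' z ≠ 0 := fun h0 => by
  have := hl.le_norm_deriv h hz
  rw [h0, norm_zero] at this; linarith [hl.1]

/-- Differentiating φ ∘ F = id within the closed disc, where derivatives are unique even on the
boundary, excludes F'(z) = 0. -/
theorem lowerLip_of_leftInverse (h : DiscC1 F F') {φ : ℂ → ℂ} (hφ : ∀ z ∈ cdisc, φ (F z) = z)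
    (hd : ContDiffOn ℝ 1 φ (F '' cdisc)) : ∃ c, LowerLip F c := by
  refine h.exists_lowerLip (fun z hz w hw he => by rw [← hφ z hz, he, hφ w hw]) fun z hz h0 => ?_
  have h1 := ((hd.differentiableOn one_ne_zero) (F z) (mem_image_of_mem F hz)).hasFDerivWithinAt
  have h2 := h1.comp z (h.hasFDerivWithinAt hz) (mapsTo_image F cdisc)
  have h3 : HasFDerivWithinAt (φ ∘ F) (ContinuousLinearMap.id ℝ ℂ) cdisc z :=
    (hasFDerivWithinAt_id z cdisc).congr (fun w hw => hφ w hw) (hφ z hz)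
  have h4 := (uniqueDiffOn_cdisc z hz).eq h2 h3
  have h5 := congrArg (fun A : ℂ →L[ℝ] ℂ => A 1) h4
  simp [h0] at h5

theorem discInv_apply (hinj : InjOn F cdisc) {z : ℂ} (hz : z ∈ cdisc) : discInv F (F z) = z :=
  hinj.leftInvOn_invFunOn hz

theorem isOpen_image (h : DiscC1 F F') (hne : ∀ z ∈ disc, F' z ≠ 0) : IsOpen (F '' disc) := by
  rw [isOpen_iff_mem_nhds]
  rintro _ ⟨z, hz, rfl⟩
  have h1 : AnalyticAt ℂ F z := h.differentiableOn.analyticAt (Metric.isOpen_ball.mem_nhds hz)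
  have h2 := h1.hasStrictDerivAt
  rw [(h.hasDerivAt z hz).deriv] at h2
  rw [← h2.map_nhds_eq (hne z hz)]
  exact image_mem_map (Metric.isOpen_ball.mem_nhds hz)

theorem closure_image (h : DiscC1 F F') : closure (F '' disc) = F '' cdisc := by
  refine subset_antisymm ?_ ?_
  · exact closure_minimal (image_mono disc_subset_cdisc)
      ((isCompact_closedBall 0 1).image_of_continuousOn h.cont).isClosed
  · have := ContinuousOn.image_closure (f := F) (s := disc) (by rw [closure_disc]; exact h.cont)
    rwa [closure_disc] at this

theorem continuousOn_discInv {c : ℝ} (hl : LowerLip F c) : ContinuousOn (discInv F) (F '' cdisc) := by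
  have : LipschitzOnWith (Real.toNNReal c⁻¹) (discInv F) (F '' cdisc) := by
    refine LipschitzOnWith.of_dist_le_mul ?_
    rintro _ ⟨z, hz, rfl⟩ _ ⟨w, hw, rfl⟩
    rw [discInv_apply hl.injOn hz, discInv_apply hl.injOn hw, dist_eq_norm, dist_eq_norm,
      Real.coe_toNNReal _ (inv_nonneg.2 hl.1.le), ← div_eq_inv_mul, le_div_iff₀' hl.1]
    exact hl.2 z hz w hw
  exact this.continuousOn

theorem hasDerivAt_discInv {c : ℝ} (h : DiscC1 F F') (hl : LowerLip F c) {z : ℂ} (hz : z ∈ disc) :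
    HasDerivAt (discInv F) (F' z)⁻¹ (F z) := by
  have ho := h.isOpen_image fun z hz => hl.deriv_ne_zero h (disc_subset_cdisc hz)
  have hmem : F '' disc ∈ 𝓝 (F z) := ho.mem_nhds (mem_image_of_mem F hz)
  have hzi := discInv_apply hl.injOn (disc_subset_cdisc hz)
  refine HasDerivAt.of_local_left_inverse (f := F) ?_ ?_ (hl.deriv_ne_zero h (disc_subset_cdisc hz)) ?_
  · exact (continuousOn_discInv hl).continuousAt
      (mem_of_superset hmem (image_mono disc_subset_cdisc))
  · rw [hzi]; exact h.hasDerivAt z hz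
  · filter_upwards [hmem]
    rintro _ ⟨w, hw, rfl⟩
    rw [discInv_apply hl.injOn (disc_subset_cdisc hw)]

/-- The inverse function rule within the closed sets gives the derivative 1/F' composed with the
inverse. It is continuous because the inverse is Lipschitz and F' has no zero. -/
theorem contDiffOn_discInv {c : ℝ} (h : DiscC1 F F') (hl : LowerLip F c) :
    ContDiffOn ℝ 1 (discInv F) (F '' cdisc) := by
  rw [show (1 : WithTop ℕ∞) = 0 + 1 by norm_num, contDiffOn_succ_iff_hasFDerivWithinAt (by simp)]
  intro x hx
  refine ⟨F '' cdisc, by rw [insert_eq_of_mem hx]; exact self_mem_nhdsWithin, by simp,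
    fun y => (F' (discInv F y))⁻¹ • (1 : ℂ →L[ℝ] ℂ), ?_, ?_⟩
  · rintro _ ⟨z, hz, rfl⟩
    have hzi := discInv_apply hl.injOn hz
    simp only [hzi]
    have hne := hl.deriv_ne_zero h hz
    let e : ℂ ≃L[ℂ] ℂ := ContinuousLinearEquiv.unitsEquivAut ℂ (Units.mk0 (F' z) hne)
    have he : HasFDerivWithinAt F (e : ℂ →L[ℂ] ℂ) cdisc (discInv F (F z)) := by
      rw [hzi]
      have := (h.hasDerivWithinAt hz).hasFDerivWithinAt
      have h2 : (e : ℂ →L[ℂ] ℂ) = ContinuousLinearMap.toSpanSingleton ℂ (F' z) := by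
        ext; simp [e]
      rw [h2]; exact this
    have := HasFDerivWithinAt.of_local_left_inverse (s := F '' cdisc) (t := cdisc) (g := discInv F)
      (a := F z) (f := F) (f' := e) ?_ he (mem_image_of_mem F hz) ?_
    · have h2 : HasDerivWithinAt (discInv F) (F' z)⁻¹ (F '' cdisc) (F z) := by
        have h3 : (e.symm : ℂ →L[ℂ] ℂ) 1 = (F' z)⁻¹ := by
          rw [ContinuousLinearEquiv.coe_coe, ContinuousLinearEquiv.symm_apply_eq]
          simp [e, hne]
        rw [← h3]; exact this.hasDerivWithinAt
      exact h2.complexToReal_fderiv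
    · refine tendsto_nhdsWithin_iff.2 ⟨continuousOn_discInv hl _ (mem_image_of_mem F hz), ?_⟩
      filter_upwards [self_mem_nhdsWithin]
      rintro _ ⟨w, hw, rfl⟩
      rwa [discInv_apply hl.injOn hw]
    · filter_upwards [self_mem_nhdsWithin]
      rintro _ ⟨w, hw, rfl⟩
      rw [discInv_apply hl.injOn hw]
  · rw [contDiffOn_zero]
    have hmaps : MapsTo (discInv F) (F '' cdisc) cdisc := by
      rintro _ ⟨w, hw, rfl⟩
      rwa [discInv_apply hl.injOn hw]
    refine ContinuousOn.smul (ContinuousOn.inv₀ (h.cont'.comp (continuousOn_discInv hl) hmaps) ?_)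
      continuousOn_const
    intro y hy
    exact hl.deriv_ne_zero h (hmaps hy)

theorem differentiableOn_discInv {c : ℝ} (h : DiscC1 F F') (hl : LowerLip F c) :
    DifferentiableOn ℂ (discInv F) (F '' disc) := by
  rintro _ ⟨z, hz, rfl⟩
  exact (h.hasDerivAt_discInv hl hz).differentiableAt.differentiableWithinAt

end DiscC1

open DiscC1

/-- One quantitative inequality replaces injectivity and the regularity of the inverse, which makes
stability under small perturbations visible. -/
theorem mem_confC1_iff {f : HolC1} : f ∈ confC1 ↔ ∃ c, LowerLip f.fn c := by
  constructor
  · rintro ⟨φ, h1, h2, -⟩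
    exact f.discC1.lowerLip_of_leftInverse h1 h2
  · rintro ⟨c, hl⟩
    exact ⟨discInv f.fn, fun z hz => discInv_apply hl.injOn hz, f.discC1.contDiffOn_discInv hl,
      f.discC1.differentiableOn_discInv hl⟩

theorem norm_extendZero_le (u : C(cdisc, ℂ)) (z : ℂ) : ‖extendZero u z‖ ≤ ‖u‖ := by
  unfold extendZero
  split_ifs with h
  · exact u.norm_coe_le_norm _
  · simp

/-- A perturbation whose derivative is at most c/2 is c/2-Lipschitz on the convex disc, so half of
the lower Lipschitz constant survives. -/
theorem isOpen_confC1 : IsOpen confC1 := by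
  rw [Metric.isOpen_iff]
  intro f hf
  obtain ⟨c, hc, hl⟩ := mem_confC1_iff.1 hf
  refine ⟨c / 2, by positivity, fun g hg => mem_confC1_iff.2 ⟨c / 2, by positivity, fun z hz w hw => ?_⟩⟩
  have h1 : ‖g - f‖ < c / 2 := by rwa [← dist_eq_norm]
  have h2 : ∀ z ∈ cdisc, ‖extendZero (g - f : HolC1).1.2 z‖ ≤ c / 2 := fun z _ =>
    (norm_extendZero_le _ z).trans ((norm_snd_le (g - f : HolC1).1).trans h1.le)
  have h3 := (g - f : HolC1).discC1.lipschitz_of_bound h2 hz hw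
  have h4 : ∀ z ∈ cdisc, (g - f : HolC1).fn z = g.fn z - f.fn z := fun z hz => by
    have hz' : ‖z‖ ≤ 1 := by simpa using hz
    simp [HolC1.fn, extendZero, hz']
  rw [h4 z hz, h4 w hw] at h3
  have h5 := hl z hz w hw
  have h6 : ‖f.fn z - f.fn w‖ ≤ ‖g.fn z - g.fn w‖ + ‖g.fn z - f.fn z - (g.fn w - f.fn w)‖ := by
    have e : f.fn z - f.fn w = g.fn z - g.fn w - (g.fn z - f.fn z - (g.fn w - f.fn w)) := by ring
    rw [e]; exact norm_sub_le _ _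
  nlinarith [norm_nonneg (z - w)]

/-- The inclusion of `X_β` in `X`. -/
def HolC1Holder.toHolC1 {β : ℝ} : HolC1Holder β →L[ℝ] HolC1 where
  toFun f := ⟨(f.1.1, f.1.2.1), f.2.1⟩
  map_add' _ _ := rfl
  map_smul' _ _ := rfl
  cont := by fun_prop

/-- The Hölder bound on the inverse comes for free: 1/F'(z) - 1/F'(w) is controlled by the Hölder
seminorm of F' and the lower bound of |F'|, and |z - w| by |F z - F w|. -/
theorem mem_confC1Holder_iff {β : ℝ} (hβ : 0 < β) {f : HolC1Holder β} :
    f ∈ confC1Holder β ↔ HolC1Holder.toHolC1 f ∈ confC1 := by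
  constructor
  · rintro ⟨φ, h1, h2, h3, -⟩
    exact ⟨φ, h1, h2, h3⟩
  · intro h
    obtain ⟨c, hl⟩ := mem_confC1_iff.1 h
    set F' := extendZero f.1.2.1 with hF'
    have hD : DiscC1 f.fn F' := (HolC1Holder.toHolC1 f).discC1
    have hl' : LowerLip f.fn c := hl
    have hc := hl'.1
    refine ⟨discInv f.fn, fun z hz => discInv_apply hl'.injOn hz, hD.contDiffOn_discInv hl',
      hD.differentiableOn_discInv hl', (c ^ 2)⁻¹ * (‖f.1.2.2‖ * (c⁻¹) ^ β), ?_⟩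
    rintro _ ⟨z, hz, rfl⟩ _ ⟨w, hw, rfl⟩
    have hz' := disc_subset_cdisc hz
    have hw' := disc_subset_cdisc hw
    rw [(hD.hasDerivAt_discInv hl' hz).deriv, (hD.hasDerivAt_discInv hl' hw).deriv]
    have a1 := hl'.le_norm_deriv hD hz'
    have a2 := hl'.le_norm_deriv hD hw'
    have n1 := hl'.deriv_ne_zero hD hz'
    have n2 := hl'.deriv_ne_zero hD hw'
    have hH : ‖F' z - F' w‖ ≤ ‖f.1.2.2‖ * ‖z - w‖ ^ β := by
      rcases eq_or_ne z w with rfl | hne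
      · simp; positivity
      · have h1 := f.2.2 (⟨z, hz'⟩, ⟨w, hw'⟩)
        have h2 := lp.norm_apply_le_norm ENNReal.top_ne_zero f.1.2.2 (⟨z, hz'⟩, ⟨w, hw'⟩)
        rw [h1, norm_smul, norm_inv, Subtype.dist_eq, dist_eq_norm,
          Real.norm_of_nonneg (by positivity)] at h2
        have h3 : 0 < ‖z - w‖ ^ β := Real.rpow_pos_of_pos (norm_pos_iff.2 (sub_ne_zero.2 hne)) _
        rw [inv_mul_le_iff₀ h3] at h2
        have e1 : F' z = f.1.2.1 ⟨z, hz'⟩ := by rw [hF', extendZero, dif_pos hz']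
        have e2 : F' w = f.1.2.1 ⟨w, hw'⟩ := by rw [hF', extendZero, dif_pos hw']
        rw [e1, e2]; linarith
    have hzw : ‖z - w‖ ≤ c⁻¹ * ‖f.fn z - f.fn w‖ := by
      rw [← div_eq_inv_mul, le_div_iff₀' hc]
      exact hl'.2 z hz' w hw'
    have e : (F' z)⁻¹ - (F' w)⁻¹ = (F' z)⁻¹ * (F' w)⁻¹ * (F' w - F' z) := by
      field_simp
    rw [e, norm_mul, norm_mul, norm_inv, norm_inv, norm_sub_rev]
    have b1 : ‖F' z‖⁻¹ ≤ c⁻¹ := inv_anti₀ hc a1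
    have b2 : ‖F' w‖⁻¹ ≤ c⁻¹ := inv_anti₀ hc a2
    calc ‖F' z‖⁻¹ * ‖F' w‖⁻¹ * ‖F' z - F' w‖
        ≤ c⁻¹ * c⁻¹ * (‖f.1.2.2‖ * (c⁻¹ * ‖f.fn z - f.fn w‖) ^ β) := by
          gcongr
          exact hH.trans (by gcongr)
      _ = _ := by
          rw [Real.mul_rpow (by positivity) (norm_nonneg _)]
          field_simp

theorem isOpen_confC1Holder {β : ℝ} (hβ : 0 < β) : IsOpen (confC1Holder β) := by
  have : confC1Holder β = HolC1Holder.toHolC1 ⁻¹' confC1 := by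
    ext f; exact mem_confC1Holder_iff hβ
  rw [this]
  exact isOpen_confC1.preimage HolC1Holder.toHolC1.continuous

/-! ### Integration by parts in the disc through polar coordinates. -/

/-- Polar coordinates. -/
def pol (p : ℝ × ℝ) : ℂ := p.1 * Complex.exp (p.2 * Complex.I)

theorem pol_eq_expi (p : ℝ × ℝ) : pol p = p.1 * expi (p.2 : Torus) := by rw [expi_coe, pol]

theorem norm_pol (p : ℝ × ℝ) : ‖pol p‖ = |p.1| := by
  rw [pol, norm_mul, Complex.norm_exp_ofReal_mul_I, mul_one, Complex.norm_real, Real.norm_eq_abs]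

theorem pol_eq_polarCoord_symm (p : ℝ × ℝ) : Complex.polarCoord.symm p = pol p := by
  rw [Complex.polarCoord_symm_apply, pol, Complex.exp_mul_I]; push_cast; rfl

@[fun_prop]
theorem continuous_pol : Continuous pol := by unfold pol; fun_prop

theorem hasFDerivAt_pol (p : ℝ × ℝ) :
    HasFDerivAt pol ((ContinuousLinearMap.fst ℝ ℝ ℝ).smulRight (Complex.exp (p.2 * Complex.I)) +
      (ContinuousLinearMap.snd ℝ ℝ ℝ).smulRight (p.1 * Complex.exp (p.2 * Complex.I) * Complex.I)) p := by
  have h1 : HasFDerivAt (fun q : ℝ × ℝ => (q.1 : ℂ)) (Complex.ofRealCLM.comp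
    (ContinuousLinearMap.fst ℝ ℝ ℝ)) p :=
    Complex.ofRealCLM.hasFDerivAt.comp p hasFDerivAt_fst
  have h3 : HasDerivAt (fun t : ℝ => Complex.exp (t * Complex.I))
      (Complex.exp (p.2 * Complex.I) * Complex.I) p.2 := by
    have := ((Complex.ofRealCLM.hasDerivAt (x := p.2)).mul_const Complex.I).cexp
    simpa using this
  have h2 := h3.hasFDerivAt.comp p (hasFDerivAt_snd (𝕜 := ℝ) (p := p))
  refine (h1.mul h2).congr_fderiv ?_
  ext <;> simp [mul_assoc]

/-- The open rectangle of polar coordinates in the disc. -/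
theorem integral_disc_eq_polar {E : Type*} [NormedAddCommGroup E] [NormedSpace ℝ E] (F : ℂ → E) :
    ∫ z in disc, F z = ∫ p in Ioo (0 : ℝ) 1 ×ˢ Ioo (-π) π, p.1 • F (pol p) := by
  rw [← integral_indicator Metric.isOpen_ball.measurableSet, ← Complex.integral_comp_polarCoord_symm,
    polarCoord_target]
  have : ∀ p ∈ Ioi (0 : ℝ) ×ˢ Ioo (-π) π, p.1 • disc.indicator F (Complex.polarCoord.symm p) =
      (Iio (1 : ℝ) ×ˢ univ).indicator (fun p => p.1 • F (pol p)) p := by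
    rintro p ⟨hp, -⟩
    have hp : 0 < p.1 := hp
    rw [pol_eq_polarCoord_symm]
    by_cases h1 : p.1 < 1
    · rw [indicator_of_mem, indicator_of_mem]
      · exact ⟨h1, mem_univ _⟩
      · rw [mem_ball_zero_iff, norm_pol, abs_of_pos hp]; exact h1
    · rw [indicator_of_notMem, indicator_of_notMem, smul_zero]
      · exact fun h => h1 h.1
      · rw [mem_ball_zero_iff, norm_pol, abs_of_pos hp]; exact h1
  rw [setIntegral_congr_fun (measurableSet_Ioi.prod measurableSet_Ioo) this,
    setIntegral_indicator (measurableSet_Iio.prod MeasurableSet.univ)]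
  congr 2
  ext p; simp [and_assoc, and_comm]

theorem lintegral_disc_eq_polar (F : ℂ → ENNReal) :
    ∫⁻ z in disc, F z = ∫⁻ p in Ioo (0 : ℝ) 1 ×ˢ Ioo (-π) π, ENNReal.ofReal p.1 * F (pol p) := by
  rw [← lintegral_indicator Metric.isOpen_ball.measurableSet,
    ← Complex.lintegral_comp_polarCoord_symm, polarCoord_target]
  have : ∀ p ∈ Ioi (0 : ℝ) ×ˢ Ioo (-π) π,
      ENNReal.ofReal p.1 • disc.indicator F (Complex.polarCoord.symm p) =
      (Iio (1 : ℝ) ×ˢ univ).indicator (fun p => ENNReal.ofReal p.1 * F (pol p)) p := by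
    rintro p ⟨hp, -⟩
    have hp : 0 < p.1 := hp
    rw [pol_eq_polarCoord_symm]
    by_cases h1 : p.1 < 1
    · rw [indicator_of_mem, indicator_of_mem, smul_eq_mul]
      · exact ⟨h1, mem_univ _⟩
      · rw [mem_ball_zero_iff, norm_pol, abs_of_pos hp]; exact h1
    · rw [indicator_of_notMem, indicator_of_notMem, smul_zero]
      · exact fun h => h1 h.1
      · rw [mem_ball_zero_iff, norm_pol, abs_of_pos hp]; exact h1
  rw [setLIntegral_congr_fun (measurableSet_Ioi.prod measurableSet_Ioo) this,
    lintegral_indicator (measurableSet_Iio.prod MeasurableSet.univ),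
    Measure.restrict_restrict (measurableSet_Iio.prod MeasurableSet.univ)]
  congr 2
  ext p; simp [and_assoc, and_comm]

theorem intervalIntegral_torus {E : Type*} [NormedAddCommGroup E] [NormedSpace ℝ E] (f : Torus → E) :
    ∫ t in (-π)..π, f (t : Torus) = ∫ θ : Torus, f θ := by
  have := AddCircle.intervalIntegral_preimage (2 * π) (-π) f
  rwa [show -π + 2 * π = π by ring] at this

theorem lintegral_torus (f : Torus → ENNReal) :
    ∫⁻ t in Ioo (-π) π, f (t : Torus) = ∫⁻ θ : Torus, f θ := by
  have := AddCircle.lintegral_preimage (2 * π) (-π) f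
  rw [show -π + 2 * π = π by ring] at this
  rw [← this, restrict_Ioo_eq_restrict_Ioc]

/-- Continuous functions on the closed disc which are `C¹` with bounded gradient in the disc. -/
structure TestFn (η : ℂ → ℝ) : Prop where
  cont : ContinuousOn η cdisc
  smooth : ContDiffOn ℝ 1 η disc
  bounded : ∃ M : ℝ, ∀ z ∈ disc, ‖gradient η z‖ ≤ M

theorem TestFn.hasFDerivAt {η : ℂ → ℝ} (h : TestFn η) {z : ℂ} (hz : z ∈ disc) :
    HasFDerivAt η (fderiv ℝ η z) z :=
  ((h.smooth.differentiableOn one_ne_zero).differentiableAt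
    (Metric.isOpen_ball.mem_nhds hz)).hasFDerivAt

theorem fderiv_apply_eq (η : ℂ → ℝ) (z v : ℂ) :
    fderiv ℝ η z v = ((starRingEnd ℂ) (gradient η z) * v).re := by
  rw [← inner_gradient_left, Complex.inner, mul_comm]

theorem continuousOn_gradient {η : ℂ → ℝ} {s : Set ℂ} (hs : IsOpen s) (h : ContDiffOn ℝ 1 η s) :
    ContinuousOn (gradient η) s := by
  have := h.continuousOn_fderiv_of_isOpen hs le_rfl
  exact (InnerProductSpace.toDual ℝ ℂ).symm.continuous.comp_continuousOn this

theorem TestFn.continuousOn_gradient {η : ℂ → ℝ} (h : TestFn η) : ContinuousOn (gradient η) disc :=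
  RenormEnergy.continuousOn_gradient Metric.isOpen_ball h.smooth

theorem pol_mem_disc {p : ℝ × ℝ} (hp : p ∈ Ioo (0 : ℝ) 1 ×ˢ Ioo (-π) π) : pol p ∈ disc := by
  rw [mem_ball_zero_iff, norm_pol, abs_of_pos hp.1.1]; exact hp.1.2

theorem pol_mem_cdisc {p : ℝ × ℝ} (hp : p ∈ Icc ((0 : ℝ), -π) (1, π)) : pol p ∈ cdisc := by
  rw [mem_closedBall_zero_iff, norm_pol, abs_of_nonneg hp.1.1]; exact hp.2.1

theorem restrict_rectangle :
    (volume : Measure (ℝ × ℝ)).restrict (Icc ((0 : ℝ), -π) (1, π)) =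
      volume.restrict (Ioo (0 : ℝ) 1 ×ˢ Ioo (-π) π) := by
  rw [← Icc_prod_Icc, Measure.volume_eq_prod, ← Measure.prod_restrict, ← Measure.prod_restrict,
    restrict_Ioo_eq_restrict_Icc, restrict_Ioo_eq_restrict_Icc]

/-- The divergence theorem in polar coordinates. -/
theorem integral_polar_divergence {f g : ℝ × ℝ → ℂ} {f' g' : ℝ × ℝ → ℝ × ℝ →L[ℝ] ℂ} {D : ℝ × ℝ → ℂ}
    (hf : ContinuousOn f (Icc ((0 : ℝ), -π) (1, π))) (hg : ContinuousOn g (Icc ((0 : ℝ), -π) (1, π)))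
    (hf' : ∀ x ∈ Ioo (0 : ℝ) 1 ×ˢ Ioo (-π) π, HasFDerivAt f (f' x) x)
    (hg' : ∀ x ∈ Ioo (0 : ℝ) 1 ×ˢ Ioo (-π) π, HasFDerivAt g (g' x) x)
    (hD : ∀ x ∈ Ioo (0 : ℝ) 1 ×ˢ Ioo (-π) π, f' x (1, 0) + g' x (0, 1) = D x)
    (hDc : ContinuousOn D (Ioo (0 : ℝ) 1 ×ˢ Ioo (-π) π))
    {M : ℝ} (hDM : ∀ x ∈ Ioo (0 : ℝ) 1 ×ˢ Ioo (-π) π, ‖D x‖ ≤ M)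
    (hper : ∀ r, g (r, π) = g (r, -π)) :
    ∫ p in Ioo (0 : ℝ) 1 ×ˢ Ioo (-π) π, D p =
      (∫ y in (-π)..π, f (1, y)) - ∫ y in (-π)..π, f (0, y) := by
  have hms : MeasurableSet (Ioo (0 : ℝ) 1 ×ˢ Ioo (-π) π) := measurableSet_Ioo.prod measurableSet_Ioo
  have hpi := pi_pos
  have hint : IntegrableOn D (Ioo (0 : ℝ) 1 ×ˢ Ioo (-π) π) := by
    refine IntegrableOn.of_bound (C := M) ?_ (hDc.aestronglyMeasurable hms) ?_
    · rw [Measure.volume_eq_prod, Measure.prod_prod]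
      exact ENNReal.mul_lt_top (by simp) (by simp)
    · exact (ae_restrict_iff' hms).2 (.of_forall hDM)
  have key := integral_divergence_prod_Icc_of_hasFDerivAt_off_countable_of_le f g f' g'
    ((0 : ℝ), -π) (1, π) ⟨zero_le_one, by simp; linarith⟩ ∅ countable_empty hf hg
    (fun x hx => hf' x hx.1) (fun x hx => hg' x hx.1) (by
      rw [IntegrableOn, restrict_rectangle]
      exact hint.congr_fun (fun x hx => (hD x hx).symm) hms)
  rw [restrict_rectangle, setIntegral_congr_fun hms hD] at key
  rw [key]
  -- Periodicity in the angle cancels the contributions of the two sides t = π and t = -π; only r =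
  -- 0 and r = 1 remain.
  simp only [hper]
  ring

theorem pol_periodic (r : ℝ) : pol (r, π) = pol (r, -π) := by
  simp [pol, Complex.exp_neg]

theorem TestFn.hasFDerivAt_pol {η : ℂ → ℝ} (h : TestFn η) {p : ℝ × ℝ}
    (hp : p ∈ Ioo (0 : ℝ) 1 ×ˢ Ioo (-π) π) :
    HasFDerivAt (fun q => ((η (pol q) : ℝ) : ℂ)) (Complex.ofRealCLM.comp ((fderiv ℝ η (pol p)).comp
      ((ContinuousLinearMap.fst ℝ ℝ ℝ).smulRight (Complex.exp (p.2 * Complex.I)) +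
      (ContinuousLinearMap.snd ℝ ℝ ℝ).smulRight (p.1 * Complex.exp (p.2 * Complex.I) * Complex.I)))) p :=
  Complex.ofRealCLM.hasFDerivAt.comp p
    (HasFDerivAt.comp p (h.hasFDerivAt (pol_mem_disc hp)) (RenormEnergy.hasFDerivAt_pol p))

theorem TestFn.continuousOn_pol {η : ℂ → ℝ} (h : TestFn η) :
    ContinuousOn (fun q => ((η (pol q) : ℝ) : ℂ)) (Icc ((0 : ℝ), -π) (1, π)) :=
  Complex.continuous_ofReal.comp_continuousOn
    (h.cont.comp continuous_pol.continuousOn fun _ hp => pol_mem_cdisc hp)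

theorem TestFn.continuousOn_gradient_pol {η : ℂ → ℝ} (h : TestFn η) :
    ContinuousOn (fun q => gradient η (pol q)) (Ioo (0 : ℝ) 1 ×ˢ Ioo (-π) π) :=
  h.continuousOn_gradient.comp continuous_pol.continuousOn fun _ hp => pol_mem_disc hp

theorem exp_conj_mul_I (t : ℝ) : (starRingEnd ℂ) (Complex.exp (t * Complex.I)) *
    Complex.exp (t * Complex.I) = 1 := by
  rw [mul_comm, Complex.mul_conj, Complex.normSq_eq_norm_sq, Complex.norm_exp_ofReal_mul_I]; simp

/-- Integration by parts of `z^n` against a gradient. -/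
theorem TestFn.integral_pow_mul_gradient {η : ℂ → ℝ} (h : TestFn η) (n : ℕ) :
    ∫ z in disc, z ^ n * gradient η z = ∫ θ : Torus, (η (expi θ) : ℂ) * expi θ ^ (n + 1) := by
  obtain ⟨M, hM⟩ := h.bounded
  rw [integral_disc_eq_polar]
  have hpow := fun (m : ℕ) (p : ℝ × ℝ) => (RenormEnergy.hasFDerivAt_pol p).pow m
  have hexp : ∀ p : ℝ × ℝ, HasFDerivAt (fun q : ℝ × ℝ => Complex.exp (q.2 * Complex.I))
      ((ContinuousLinearMap.snd ℝ ℝ ℝ).smulRight (Complex.exp (p.2 * Complex.I) * Complex.I)) p := by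
    intro p
    have h3 : HasDerivAt (fun t : ℝ => Complex.exp (t * Complex.I))
        (Complex.exp (p.2 * Complex.I) * Complex.I) p.2 := by
      have := ((Complex.ofRealCLM.hasDerivAt (x := p.2)).mul_const Complex.I).cexp
      simpa using this
    refine (h3.hasFDerivAt.comp p (hasFDerivAt_snd (𝕜 := ℝ) (p := p))).congr_fderiv ?_
    ext <;> simp
  -- With z = r e^{it}, r zⁿ∇η = ∂_r(z^{n+1} η) + ∂_t(i zⁿ e^{it} η), as the two terms (n+1) zⁿ
  -- e^{it} η cancel. The first field vanishes at r = 0, so only the unit circle contributes.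
  have key := integral_polar_divergence
    (f := fun q => pol q ^ (n + 1) * (η (pol q) : ℂ))
    (g := fun q => Complex.I * (pol q ^ n * Complex.exp (q.2 * Complex.I)) * (η (pol q) : ℂ))
    (D := fun p => p.1 • (pol p ^ n * gradient η (pol p)))
    (((continuous_pol.pow _).continuousOn).mul h.continuousOn_pol)
    (((by fun_prop : Continuous fun q : ℝ × ℝ =>
      Complex.I * (pol q ^ n * Complex.exp (q.2 * Complex.I))).continuousOn).mul h.continuousOn_pol)
    (fun p hp => (hpow (n + 1) p).mul (h.hasFDerivAt_pol hp))
    (fun p hp => (((hpow n p).mul (hexp p)).const_mul Complex.I).mul (h.hasFDerivAt_pol hp))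
    (fun p hp => ?_) ?_ (M := M) (fun p hp => ?_) (fun r => ?_)
  · rw [key]
    have e0 : ∀ y : ℝ, pol (0, y) ^ (n + 1) * (η (pol (0, y)) : ℂ) = 0 := fun y => by simp [pol]
    have e1 : ∀ y : ℝ, pol (1, y) ^ (n + 1) * (η (pol (1, y)) : ℂ) =
      (fun θ : Torus => (η (expi θ) : ℂ) * expi θ ^ (n + 1)) (y : Torus) := fun y => by
        simp [pol_eq_expi, mul_comm]
    have e2 := intervalIntegral_torus (fun θ : Torus => (η (expi θ) : ℂ) * expi θ ^ (n + 1))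
    simp only [e0, e1, e2]; simp
  · set e := Complex.exp (p.2 * Complex.I) with he
    have hee : (starRingEnd ℂ) e * e = 1 := exp_conj_mul_I p.2
    have hpe : pol p = p.1 * e := rfl
    simp only [_root_.add_apply, _root_.smul_apply,
      ContinuousLinearMap.comp_apply, ContinuousLinearMap.smulRight_apply,
      ContinuousLinearMap.coe_fst', ContinuousLinearMap.coe_snd', Complex.ofRealCLM_apply,
      fderiv_apply_eq, one_smul, zero_smul, add_zero, zero_add, smul_eq_mul]
    set G := gradient η (pol p) with hG
    have hG2 : (p.1 : ℂ) * (pol p ^ n * G) = pol p ^ (n + 1) *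
        ((((starRingEnd ℂ) G * e).re : ℂ) - Complex.I * (((starRingEnd ℂ) G * e).im : ℂ)) := by
      have : ((((starRingEnd ℂ) G * e).re : ℂ) - Complex.I * (((starRingEnd ℂ) G * e).im : ℂ)) =
          (starRingEnd ℂ) ((starRingEnd ℂ) G * e) := by
        apply Complex.ext <;> simp; ring
      rw [this, map_mul, Complex.conj_conj, pow_succ, hpe]
      linear_combination (-(p.1 * e) ^ n * p.1 * G : ℂ) * hee
    have him : ((starRingEnd ℂ) G * (p.1 * e * Complex.I)).re = -(p.1 * ((starRingEnd ℂ) G * e).im) := by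
      simp only [Complex.mul_re, Complex.mul_im, Complex.I_re, Complex.I_im, Complex.ofReal_re,
        Complex.ofReal_im]
      ring
    rw [Complex.real_smul, hG2, him]
    simp only [Nat.add_sub_cancel]
    generalize ((starRingEnd ℂ) G * e).re = x
    generalize ((starRingEnd ℂ) G * e).im = y
    rcases n with _ | n
    · simp [hpe]
      linear_combination (η (p.1 * e) * e : ℂ) * Complex.I_sq
    · simp [hpe]
      linear_combination ((n + 2) * (p.1 * e) ^ (n + 1) * e * η (p.1 * e) : ℂ) * Complex.I_sq
  · have h1 : Continuous fun p : ℝ × ℝ => pol p ^ n := by fun_prop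
    exact continuous_fst.continuousOn.smul (h1.continuousOn.mul h.continuousOn_gradient_pol)
  · have hp0 := hp.1.1.le
    have hp1 := hp.1.2.le
    rw [norm_smul, norm_mul, norm_pow, norm_pol, Real.norm_eq_abs, abs_of_nonneg hp0]
    have := hM _ (pol_mem_disc hp)
    have h3 : p.1 ^ n ≤ 1 := pow_le_one₀ hp0 hp1
    calc p.1 * (p.1 ^ n * ‖gradient η (pol p)‖) ≤ 1 * (1 * M) := by gcongr
      _ = M := by ring
  · simp only [pol_periodic]
    simp [Complex.exp_neg]

/-- Integration by parts of `∇ log |z|` against a gradient. -/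
theorem TestFn.integral_inv_mul_gradient {η : ℂ → ℝ} (h : TestFn η) :
    ∫ z in disc, (z⁻¹ * gradient η z).re = (∫ θ : Torus, η (expi θ)) - 2 * π * η 0 := by
  obtain ⟨M, hM⟩ := h.bounded
  rw [integral_disc_eq_polar]
  have hms : MeasurableSet (Ioo (0 : ℝ) 1 ×ˢ Ioo (-π) π) := measurableSet_Ioo.prod measurableSet_Ioo
  have hDeq : ∀ p ∈ Ioo (0 : ℝ) 1 ×ˢ Ioo (-π) π, (fun p : ℝ × ℝ => p.1 • ((pol p)⁻¹ *
      gradient η (pol p)).re) p = ((starRingEnd ℂ) (gradient η (pol p)) *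
        Complex.exp (p.2 * Complex.I)).re := by
    intro p hp
    have hee := exp_conj_mul_I p.2
    have hp0 : (p.1 : ℂ) ≠ 0 := by exact_mod_cast hp.1.1.ne'
    have e1 : (Complex.exp (p.2 * Complex.I))⁻¹ = (starRingEnd ℂ) (Complex.exp (p.2 * Complex.I)) :=
      (eq_inv_of_mul_eq_one_left hee).symm
    have e2 : ∀ w : ℂ, p.1 • w.re = (p.1 * w).re := fun w => by simp
    simp only
    rw [e2, pol, mul_inv, e1, ← Complex.conj_re]
    congr 1
    rw [map_mul, map_mul, map_mul, Complex.conj_conj, map_inv₀, Complex.conj_ofReal]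
    field_simp
  rw [setIntegral_congr_fun hms hDeq]
  -- The real part of r z⁻¹∇η is just ∂_r η, so no angular field is needed. Here r = 0 does
  -- contribute, giving the term 2π η(0).
  have key := integral_polar_divergence (f := fun q => (η (pol q) : ℂ)) (g := fun _ => 0)
    (g' := fun _ => 0)
    (D := fun p => ((((starRingEnd ℂ) (gradient η (pol p)) * Complex.exp (p.2 * Complex.I)).re : ℝ) : ℂ))
    h.continuousOn_pol continuousOn_const (fun p hp => h.hasFDerivAt_pol hp)
    (fun p _ => hasFDerivAt_const _ _) (fun p hp => ?_) ?_ (M := M) (fun p hp => ?_) (fun r => rfl)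
  · have key2 := congrArg Complex.re key
    have hz : ∀ f : ℝ → ℝ, ((∫ y in (-π)..π, (f y : ℂ))).re = ∫ y in (-π)..π, f y := fun f => by
      rw [intervalIntegral.integral_ofReal, Complex.ofReal_re]
    have key3 : (∫ p in Ioo (0 : ℝ) 1 ×ˢ Ioo (-π) π, ((((starRingEnd ℂ) (gradient η (pol p)) *
        Complex.exp (p.2 * Complex.I)).re : ℝ) : ℂ)).re = ∫ p in Ioo (0 : ℝ) 1 ×ˢ Ioo (-π) π,
          ((starRingEnd ℂ) (gradient η (pol p)) * Complex.exp (p.2 * Complex.I)).re :=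
      (congrArg Complex.re integral_ofReal).trans (Complex.ofReal_re _)
    rw [Complex.sub_re, hz (fun y => η (pol (1, y))), hz (fun y => η (pol (0, y))), key3] at key2
    have e0 : ∀ y : ℝ, η (pol (0, y)) = η 0 := fun y => by simp [pol]
    have e1 : ∀ y : ℝ, η (pol (1, y)) = (fun θ : Torus => η (expi θ)) (y : Torus) := fun y => by
        simp [pol_eq_expi]
    simp only [e0, e1] at key2
    have e2 := intervalIntegral_torus (fun θ : Torus => η (expi θ))
    rw [key2, e2, intervalIntegral.integral_const, smul_eq_mul]
    ring
  · simp [fderiv_apply_eq]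
  · refine Complex.continuous_ofReal.comp_continuousOn (Complex.continuous_re.comp_continuousOn
      (ContinuousOn.mul (Complex.continuous_conj.comp_continuousOn h.continuousOn_gradient_pol)
        (by fun_prop)))
  · rw [Complex.norm_real, Real.norm_eq_abs]
    refine (Complex.abs_re_le_norm _).trans ?_
    rw [norm_mul, RCLike.norm_conj, Complex.norm_exp_ofReal_mul_I, mul_one]
    exact hM _ (pol_mem_disc hp)

/-- Absolute summability permits termwise integration, and orthogonality of characters selects one
term at each frequency. -/
theorem fourierCoeff_of_hasSum {ι : Type*} [Countable ι] {c : ι → ℂ} {k : ι → ℤ}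
    (hk : Function.Injective k) (hc : Summable fun i => ‖c i‖) {u : Torus → ℂ}
    (hu : ∀ θ, HasSum (fun i => c i * fourier (k i) θ) (u θ)) :
    (∀ i, fourierCoeff u (k i) = c i) ∧ ∀ m, m ∉ range k → fourierCoeff u m = 0 := by
  have key : ∀ m : ℤ, HasSum (fun i => c i * if k i = m then 1 else 0) (fourierCoeff u m) := by
    intro m
    have hI : ∀ i, Integrable (fun θ : Torus => fourier (-m) θ * (c i * fourier (k i) θ))
        haarAddCircle := fun i => by
      refine Integrable.mono' (integrable_const ‖c i‖) ?_ (.of_forall fun θ => ?_)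
      · exact Continuous.aestronglyMeasurable (by
          have := (fourier (-m) : C(Torus, ℂ)).continuous
          have := (fourier (k i) : C(Torus, ℂ)).continuous
          fun_prop)
      · rw [norm_mul, norm_mul, norm_fourier_apply, norm_fourier_apply]; simp
    have h1 := hasSum_integral_of_summable_integral_norm hI (by
      refine hc.congr fun i => ?_
      simp only [norm_mul, norm_fourier_apply]
      simp)
    have e1 : (fun i => c i * if k i = m then (1 : ℂ) else 0) = fun i =>
        ∫ θ : Torus, fourier (-m) θ * (c i * fourier (k i) θ) ∂haarAddCircle := by
      funext i
      have : ∀ θ : Torus, fourier (-m) θ * (c i * fourier (k i) θ) =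
          c i * (fourier (-m) θ • (fourier (k i) θ : ℂ)) := fun θ => by rw [smul_eq_mul]; ring
      simp only [this, integral_const_mul]
      congr 1
      exact (fourierCoeff_fourier (k i) m).symm
    have e2 : fourierCoeff u m =
        ∫ θ : Torus, ∑' i, fourier (-m) θ * (c i * fourier (k i) θ) ∂haarAddCircle := by
      refine integral_congr_ae (.of_forall fun θ => ?_)
      exact ((hu θ).mul_left _).tsum_eq.symm
    rw [e1, e2]
    exact h1
  constructor
  · intro i
    refine (key (k i)).unique ?_
    have := hasSum_single (f := fun j => c j * if k j = k i then (1 : ℂ) else 0) i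
      fun j hj => by simp [hk.ne hj]
    simpa using this
  · intro m hm
    refine (key m).unique ?_
    convert hasSum_zero using 2 with i
    have : k i ≠ m := fun h => hm ⟨i, h⟩
    simp [this]

theorem enorm_sq_eq_ofReal (z : ℂ) : ‖z‖ₑ ^ 2 = ENNReal.ofReal (‖z‖ ^ 2) := by
  rw [ENNReal.ofReal_pow (norm_nonneg _), ofReal_norm]

theorem lintegral_sq_eq_tsum {u : Torus → ℂ} (hu : MemLp u 2 volume) :
    ∫⁻ θ, ‖u θ‖ₑ ^ 2 ∂haarAddCircle = ∑' n : ℤ, ‖fourierCoeff u n‖ₑ ^ 2 := by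
  have h := hasSum_sq_fourierCoeff' hu
  simp only [enorm_sq_eq_ofReal]
  rw [← ofReal_integral_eq_lintegral_ofReal
    ((memLp_haar_iff.2 hu).integrable_norm_pow (by norm_num)) (.of_forall fun _ => by positivity),
    ← h.tsum_eq, ENNReal.ofReal_tsum_of_nonneg (fun n => by positivity) h.summable]

theorem lintegral_sq_of_hasSum {c : ℕ → ℂ} (hc : Summable fun i => ‖c i‖) {u : Torus → ℂ}
    (huc : Continuous u) (hu : ∀ θ, HasSum (fun i => c i * expi θ ^ i) (u θ)) :
    ∫⁻ θ, ‖u θ‖ₑ ^ 2 = ENNReal.ofReal (2 * π) * ∑' n, ‖c n‖ₑ ^ 2 := by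
  have hm : MemLp u 2 volume := by
    obtain ⟨C, hC⟩ := (isCompact_univ (X := Torus)).exists_bound_of_continuousOn huc.continuousOn
    exact (memLp_top_of_bound huc.aestronglyMeasurable C
      (.of_forall fun θ => hC θ (mem_univ _))).mono_exponent le_top
  have hk : Function.Injective (fun n : ℕ => (n : ℤ)) := Nat.cast_injective
  obtain ⟨h1, h2⟩ := fourierCoeff_of_hasSum hk hc (u := u) (fun θ => by
    simp only [fourier_eq_expi_zpow, zpow_natCast]
    exact hu θ)
  rw [volume_torus, lintegral_smul_measure, smul_eq_mul, lintegral_sq_eq_tsum hm,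
    ← hk.tsum_eq (f := fun m => ‖fourierCoeff u m‖ₑ ^ 2)]
  · simp only [h1]
  · intro m hm
    by_contra h
    exact hm (by simp [h2 m h])

theorem lintegral_pow (m : ℕ) :
    ∫⁻ r in Ioo (0 : ℝ) 1, ENNReal.ofReal (r ^ m) = ENNReal.ofReal (1 / (m + 1)) := by
  rw [restrict_Ioo_eq_restrict_Ioc, ← ofReal_integral_eq_lintegral_ofReal]
  · rw [← intervalIntegral.integral_of_le zero_le_one, integral_pow]; simp
  · exact (intervalIntegral.intervalIntegrable_pow (μ := volume) (a := 0) (b := 1) m).1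
  · exact (ae_restrict_iff' measurableSet_Ioc).2 (.of_forall fun r hr => pow_nonneg hr.1.le m)

/-! ### Power series in the disc and their L² energy. -/

/-- `F` is the sum of the power series `∑ aₙ zⁿ` in the disc. -/
def HasPower (a : ℕ → ℂ) (F : ℂ → ℂ) : Prop := ∀ z ∈ disc, HasSum (fun n => a n * z ^ n) (F z)

theorem HasPower.summable_norm {a : ℕ → ℂ} {F : ℂ → ℂ} (h : HasPower a F) {r : ℝ} (h0 : 0 ≤ r)
    (h1 : r < 1) : Summable fun n => ‖a n‖ * r ^ n := by
  have := (h (r : ℂ) (by simp [abs_of_nonneg h0, h1])).summable.norm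
  simpa [abs_of_nonneg h0] using this

theorem DiscSeries.hasFPowerSeriesOnBall {a : ℕ → ℂ} {F : ℂ → ℂ} (h : HasPower a F) :
    HasFPowerSeriesOnBall F (FormalMultilinearSeries.ofScalars ℂ a) 0 1 := by
  refine ⟨?_, one_pos, fun {y} hy => ?_⟩
  · refine ENNReal.le_of_forall_nnreal_lt fun r hr => ?_
    refine FormalMultilinearSeries.le_radius_of_summable_norm _ ?_
    have hr' : (r : ℝ) < 1 := by exact_mod_cast hr
    simpa [FormalMultilinearSeries.ofScalars_norm] using h.summable_norm r.2 hr'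
  · have hy' : y ∈ disc := by
      rw [mem_ball_zero_iff]
      have : ‖y‖ₑ < 1 := by simpa [edist_zero_right] using hy
      rw [← ofReal_norm, ENNReal.ofReal_lt_one] at this
      exact this
    have e : (fun n => FormalMultilinearSeries.ofScalars ℂ a n fun _ => y) =
        fun n => a n * y ^ n := by
      funext n; simp [FormalMultilinearSeries.ofScalars]
    rw [e, zero_add]
    exact h y hy'

theorem HasPower.analyticOnNhd {a : ℕ → ℂ} {F : ℂ → ℂ} (h : HasPower a F) : AnalyticOnNhd ℂ F disc := by
  have := (DiscSeries.hasFPowerSeriesOnBall h).analyticOnNhd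
  intro z hz
  refine this z ?_
  rw [Metric.mem_eball, edist_zero_right, ← ofReal_norm, ENNReal.ofReal_lt_one]
  exact mem_ball_zero_iff.1 hz

theorem HasPower.continuousOn {a : ℕ → ℂ} {F : ℂ → ℂ} (h : HasPower a F) : ContinuousOn F disc :=
  h.analyticOnNhd.continuousOn

/-- The area formula. -/
theorem HasPower.lintegral_sq {a : ℕ → ℂ} {F : ℂ → ℂ} (h : HasPower a F) :
    ∫⁻ z in disc, ‖F z‖ₑ ^ 2 = ∑' n : ℕ, ENNReal.ofReal (π / (n + 1)) * ‖a n‖ₑ ^ 2 := by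
  rw [lintegral_disc_eq_polar, Measure.volume_eq_prod, ← Measure.prod_restrict]
  have hms : MeasurableSet (Ioo (0 : ℝ) 1 ×ˢ Ioo (-π) π) := measurableSet_Ioo.prod measurableSet_Ioo
  have hcont : ContinuousOn (fun p : ℝ × ℝ => F (pol p)) (Ioo (0 : ℝ) 1 ×ˢ Ioo (-π) π) :=
    h.continuousOn.comp continuous_pol.continuousOn fun p hp => pol_mem_disc hp
  rw [lintegral_prod]
  swap
  · rw [Measure.prod_restrict, ← Measure.volume_eq_prod]
    refine AEMeasurable.mul (ENNReal.measurable_ofReal.comp measurable_fst).aemeasurable ?_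
    exact ((hcont.aestronglyMeasurable hms).enorm).pow_const 2
  -- Parseval on the circle of radius r; the extra factor r is the polar weight.
  have hin : ∀ r ∈ Ioo (0 : ℝ) 1, ∫⁻ t in Ioo (-π) π, ENNReal.ofReal r * ‖F (pol (r, t))‖ₑ ^ 2 =
      ∑' n : ℕ, ENNReal.ofReal (2 * π) * ‖a n‖ₑ ^ 2 * ENNReal.ofReal (r ^ (2 * n + 1)) := by
    intro r hr
    have hr0 : 0 ≤ r := hr.1.le
    have hmem : ∀ θ : Torus, (r : ℂ) * expi θ ∈ disc := fun θ => by
      rw [mem_ball_zero_iff, norm_mul, norm_expi, Complex.norm_real, Real.norm_eq_abs,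
        abs_of_nonneg hr0, mul_one]; exact hr.2
    have huc : Continuous fun θ : Torus => F (r * expi θ) :=
      h.continuousOn.comp_continuous (continuous_const.mul continuous_expi) hmem
    have hs := lintegral_sq_of_hasSum (c := fun n => a n * (r : ℂ) ^ n)
      (u := fun θ => F (r * expi θ)) (by
        simpa [abs_of_nonneg hr0] using h.summable_norm hr0 hr.2) huc (fun θ => by
        have := h _ (hmem θ)
        simpa [mul_pow, mul_assoc] using this)
    have e : ∀ t : ℝ, ‖F (pol (r, t))‖ₑ ^ 2 = (fun θ : Torus => ‖F (r * expi θ)‖ₑ ^ 2) (t : Torus) :=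
      fun t => by simp only [pol_eq_expi]
    simp only [e]
    have e2 := lintegral_torus (fun θ : Torus => ‖F (r * expi θ)‖ₑ ^ 2)
    rw [lintegral_const_mul' _ _ (by finiteness), e2, hs, ← ENNReal.tsum_mul_left,
      ← ENNReal.tsum_mul_left]
    refine tsum_congr fun n => ?_
    rw [enorm_mul, mul_pow, enorm_sq_eq_ofReal ((r : ℂ) ^ n), norm_pow, Complex.norm_real,
      Real.norm_eq_abs, abs_of_nonneg hr0, ← pow_mul, mul_comm n 2, pow_succ' r (2 * n), ENNReal.ofReal_mul hr0]
    ring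
  rw [setLIntegral_congr_fun measurableSet_Ioo hin, lintegral_tsum fun n => by fun_prop]
  refine tsum_congr fun n => ?_
  rw [lintegral_const_mul' _ _ (by finiteness), lintegral_pow, mul_right_comm,
    ← ENNReal.ofReal_mul (by positivity)]
  congr 2
  push_cast; field_simp; ring

theorem HasPower.summable_of_energy {a : ℕ → ℂ} {F : ℂ → ℂ} (h : HasPower a F)
    (hF : ∫⁻ z in disc, ‖F z‖ₑ ^ 2 < ⊤) : Summable fun n : ℕ => ‖a n‖ ^ 2 / (n + 1) := by
  rw [h.lintegral_sq] at hF
  have e : ∀ n : ℕ, ENNReal.ofReal (π / (n + 1)) * ‖a n‖ₑ ^ 2 =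
      ENNReal.ofReal (π * (‖a n‖ ^ 2 / (n + 1))) := fun n => by
    rw [enorm_sq_eq_ofReal, ← ENNReal.ofReal_mul (by positivity)]; congr 1; ring
  simp only [e] at hF
  have h2 := ENNReal.summable_toReal hF.ne
  have : Summable fun n : ℕ => π * (‖a n‖ ^ 2 / (n + 1)) :=
    h2.congr fun n => ENNReal.toReal_ofReal (by positivity)
  exact (summable_mul_left_iff pi_ne_zero).1 this

theorem HasPower.energy_eq {a : ℕ → ℂ} {F : ℂ → ℂ} (h : HasPower a F)
    (hs : Summable fun n : ℕ => ‖a n‖ ^ 2 / (n + 1)) :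
    ∫⁻ z in disc, ‖F z‖ₑ ^ 2 = ENNReal.ofReal (∑' n : ℕ, π * (‖a n‖ ^ 2 / (n + 1))) := by
  rw [h.lintegral_sq, ENNReal.ofReal_tsum_of_nonneg (fun n => by positivity) (hs.mul_left π)]
  refine tsum_congr fun n => ?_
  rw [enorm_sq_eq_ofReal, ← ENNReal.ofReal_mul (by positivity)]; congr 1; ring

/-- The tail of a power series. -/
theorem HasPower.tail {a : ℕ → ℂ} {F : ℂ → ℂ} (h : HasPower a F) (N : ℕ) :
    HasPower (fun n => if n < N then 0 else a n)
      (fun z => F z - ∑ n ∈ Finset.range N, a n * z ^ n) := by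
  intro z hz
  have h1 : HasSum (fun n => if n < N then a n * z ^ n else 0)
      (∑ n ∈ Finset.range N, a n * z ^ n) := by
    have := hasSum_sum_of_ne_finset_zero (f := fun n => if n < N then a n * z ^ n else 0)
      (s := Finset.range N) (L := .unconditional ℕ) (fun n hn => if_neg (by simpa using hn))
    rwa [Finset.sum_congr rfl fun n hn => if_pos (Finset.mem_range.1 hn)] at this
  have e : (fun n => (if n < N then 0 else a n) * z ^ n) =
      fun n => a n * z ^ n - if n < N then a n * z ^ n else 0 := by
    funext n
    by_cases hn : n < N <;> simp [hn]
  simp only [e]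
  exact (h z hz).sub h1

theorem tendsto_tsum_tail {c : ℕ → ℝ} (hc : Summable c) :
    Tendsto (fun N : ℕ => ∑' n, if n < N then 0 else c n) atTop (𝓝 0) := by
  have h := tendsto_tsum_of_dominated_convergence (f := fun (N : ℕ) n => if n < N then 0 else c n)
    (g := fun _ => (0 : ℝ)) (𝓕 := atTop) hc.norm (fun k => ?_) (.of_forall fun N k => ?_)
  · simpa using h
  · refine tendsto_const_nhds.congr' ?_
    filter_upwards [eventually_gt_atTop k] with N hN
    rw [if_pos hN]
  · split_ifs <;> simp

theorem HasPower.tendsto_energy_tail {a : ℕ → ℂ} {F : ℂ → ℂ} (h : HasPower a F)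
    (hs : Summable fun n : ℕ => ‖a n‖ ^ 2 / (n + 1)) :
    Tendsto (fun N : ℕ => ∫⁻ z in disc, ‖F z - ∑ n ∈ Finset.range N, a n * z ^ n‖ₑ ^ 2)
      atTop (𝓝 0) := by
  have e : ∀ N n : ℕ, π * (‖if n < N then (0 : ℂ) else a n‖ ^ 2 / (n + 1)) =
      if n < N then 0 else π * (‖a n‖ ^ 2 / (n + 1)) := fun N n => by split_ifs <;> simp
  have h1 : ∀ N : ℕ, ∫⁻ z in disc, ‖F z - ∑ n ∈ Finset.range N, a n * z ^ n‖ₑ ^ 2 =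
      ENNReal.ofReal (∑' n : ℕ, if n < N then 0 else π * (‖a n‖ ^ 2 / (n + 1))) := fun N => by
    rw [(h.tail N).energy_eq]
    · simp only [e]
    · refine Summable.of_nonneg_of_le (fun n => by positivity) (fun n => ?_) hs
      split_ifs
      · simp; positivity
      · exact le_rfl
  simp only [h1]
  have := (ENNReal.continuous_ofReal.tendsto 0).comp (tendsto_tsum_tail (hs.mul_left π))
  simpa [Function.comp_def] using this

theorem volume_disc_lt_top : (volume : Measure ℂ) disc < ⊤ := measure_ball_lt_top

/-- `L²` convergence in the disc implies convergence of the integral against bounded functions. -/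
theorem tendsto_integral_mul_of_energy {F : ℂ → ℂ} {Fn : ℕ → ℂ → ℂ} {G : ℂ → ℂ}
    (hF : ContinuousOn F disc) (hFn : ∀ n, ContinuousOn (Fn n) disc)
    (hint : IntegrableOn F disc) (hintn : ∀ n, IntegrableOn (Fn n) disc)
    (hG : ContinuousOn G disc) {M : ℝ}
    (hM : ∀ z ∈ disc, ‖G z‖ ≤ M)
    (h : Tendsto (fun N : ℕ => ∫⁻ z in disc, ‖F z - Fn N z‖ₑ ^ 2) atTop (𝓝 0)) :
    Tendsto (fun N => ∫ z in disc, Fn N z * G z) atTop (𝓝 (∫ z in disc, F z * G z)) := by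
  have hmd : MeasurableSet disc := Metric.isOpen_ball.measurableSet
  have hGm := hG.aestronglyMeasurable (μ := volume) hmd
  have hMae : ∀ᵐ z ∂(volume.restrict disc), ‖G z‖ ≤ M := (ae_restrict_iff' hmd).2 (.of_forall hM)
  refine tendsto_integral_of_L1 _ (hint.mul_bdd (c := M) hGm hMae).aestronglyMeasurable (.of_forall fun n =>
    (hintn n).mul_bdd (c := M) hGm hMae) ?_
  have hM0 : 0 ≤ M := (norm_nonneg _).trans (hM 0 (Metric.mem_ball_self one_pos))
  have hle : ∀ N, ∫⁻ z in disc, ‖Fn N z * G z - F z * G z‖ₑ ≤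
      ENNReal.ofReal M * ((∫⁻ z in disc, ‖F z - Fn N z‖ₑ ^ 2) ^ (1 / 2 : ℝ) *
        volume disc ^ (1 / 2 : ℝ)) := by
    intro N
    have h1 : ∫⁻ z in disc, ‖Fn N z * G z - F z * G z‖ₑ ≤
        ∫⁻ z in disc, ENNReal.ofReal M * ‖F z - Fn N z‖ₑ := by
      refine setLIntegral_mono_ae' hmd (.of_forall fun z hz => ?_)
      rw [← sub_mul, enorm_mul, mul_comm, ← ofReal_norm, ← ofReal_norm, ← ofReal_norm, norm_sub_rev]
      gcongr
      exact hM z hz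
    refine h1.trans ?_
    rw [lintegral_const_mul' _ _ (by finiteness)]
    gcongr
    have h2 := ENNReal.lintegral_mul_le_Lp_mul_Lq (volume.restrict disc) Real.HolderConjugate.two_two
      (f := fun z => ‖F z - Fn N z‖ₑ) (g := fun _ => 1)
      (((hF.sub (hFn N)).aestronglyMeasurable hmd).enorm) aemeasurable_const
    simpa using h2
  refine tendsto_of_tendsto_of_tendsto_of_le_of_le tendsto_const_nhds ?_ (fun N => zero_le) hle
  have h3 : Tendsto (fun N => (∫⁻ z in disc, ‖F z - Fn N z‖ₑ ^ 2) ^ (1 / 2 : ℝ)) atTop (𝓝 0) := by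
    have := (ENNReal.continuous_rpow_const (y := 1 / 2)).tendsto 0 |>.comp h
    simpa [Function.comp_def] using this
  have h4 := ENNReal.Tendsto.const_mul (a := ENNReal.ofReal M)
    (ENNReal.Tendsto.mul_const (b := volume disc ^ (1 / 2 : ℝ)) h3 (Or.inr (by
      exact ENNReal.rpow_ne_top_of_nonneg (by norm_num) volume_disc_lt_top.ne))) (Or.inr (by finiteness))
  simpa using h4

theorem integrableOn_disc_of_energy {F : ℂ → ℂ} (hF : ContinuousOn F disc)
    (h : ∫⁻ z in disc, ‖F z‖ₑ ^ 2 < ⊤) : IntegrableOn F disc := by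
  have hmd : MeasurableSet disc := Metric.isOpen_ball.measurableSet
  have : MemLp F 2 (volume.restrict disc) := by
    refine ⟨hF.aestronglyMeasurable hmd, ?_⟩
    refine (eLpNorm_lt_top_iff_lintegral_rpow_enorm_lt_top (by norm_num) (by norm_num)).2 ?_
    simpa using h
  have hfin : IsFiniteMeasure ((volume : Measure ℂ).restrict disc) :=
    ⟨by simp⟩
  exact this.integrable (by norm_num)

/-- Integration by parts of a Dirichlet-finite holomorphic function against a gradient. -/
theorem TestFn.tendsto_integral_power {η : ℂ → ℝ} (hη : TestFn η) {a : ℕ → ℂ} {F : ℂ → ℂ}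
    (h : HasPower a F) (hs : Summable fun n : ℕ => ‖a n‖ ^ 2 / (n + 1)) :
    Tendsto (fun N => ∑ n ∈ Finset.range N, a n * ∫ θ : Torus, (η (expi θ) : ℂ) * expi θ ^ (n + 1))
      atTop (𝓝 (∫ z in disc, F z * gradient η z)) := by
  obtain ⟨M, hM⟩ := hη.bounded
  have hmd : MeasurableSet disc := Metric.isOpen_ball.measurableSet
  have hG := hη.continuousOn_gradient
  have hfin : IsFiniteMeasure ((volume : Measure ℂ).restrict disc) :=
    ⟨by simp⟩
  have hpi : ∀ n : ℕ, IntegrableOn (fun z : ℂ => z ^ n) disc := fun n => by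
    refine IntegrableOn.of_bound (C := 1) volume_disc_lt_top (by fun_prop)
      ((ae_restrict_iff' hmd).2 (.of_forall fun z hz => ?_))
    rw [norm_pow]; exact pow_le_one₀ (norm_nonneg _) (mem_ball_zero_iff.1 hz).le
  have hFi := integrableOn_disc_of_energy h.continuousOn (by
    rw [h.energy_eq hs]; exact ENNReal.ofReal_lt_top)
  -- The Taylor polynomials converge to `F` in L² of the disc and the gradient is bounded, so the
  -- formula for monomials passes to the limit without absolute convergence on the boundary.
  have key := tendsto_integral_mul_of_energy (Fn := fun N z => ∑ n ∈ Finset.range N, a n * z ^ n)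
    h.continuousOn (fun N => by fun_prop) hFi
    (fun N => integrable_finsetSum _ fun n _ => (hpi n).const_mul _) hG hM
    (h.tendsto_energy_tail hs)
  refine key.congr fun N => ?_
  simp only [Finset.sum_mul]
  rw [integral_finsetSum]
  · refine Finset.sum_congr rfl fun n _ => ?_
    rw [← hη.integral_pow_mul_gradient n, ← integral_const_mul]
    simp only [mul_assoc]
  · intro n _
    exact ((hpi n).const_mul _).mul_bdd (c := M) (hG.aestronglyMeasurable hmd)
      ((ae_restrict_iff' hmd).2 (.of_forall hM))

/-! ### Conformal change of variables -/

theorem det_smul_one (c : ℂ) : (c • (1 : ℂ →L[ℝ] ℂ)).det = ‖c‖ ^ 2 := by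
  rw [← Complex.normSq_eq_norm_sq, ← Algebra.norm_complex_apply, Algebra.norm_apply]
  rfl

theorem measurableSet_disc : MeasurableSet disc := Metric.isOpen_ball.measurableSet

namespace DiscC1

variable {F F' : ℂ → ℂ}

theorem hasFDerivWithinAt_disc (h : DiscC1 F F') {z : ℂ} (hz : z ∈ disc) :
    HasFDerivWithinAt F (F' z • (1 : ℂ →L[ℝ] ℂ)) disc z :=
  (h.hasFDerivWithinAt (disc_subset_cdisc hz)).mono disc_subset_cdisc

theorem lintegral_image (h : DiscC1 F F') (hinj : InjOn F disc) (g : ℂ → ℝ≥0∞) :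
    ∫⁻ z in F '' disc, g z = ∫⁻ z in disc, ‖F' z‖ₑ ^ 2 * g (F z) := by
  rw [lintegral_image_eq_lintegral_abs_det_fderiv_mul volume measurableSet_disc
    (fun x hx => h.hasFDerivWithinAt_disc hx) hinj]
  refine lintegral_congr fun z => ?_
  rw [det_smul_one, abs_of_nonneg (by positivity), enorm_sq_eq_ofReal]

theorem integral_image (h : DiscC1 F F') (hinj : InjOn F disc) {E : Type*} [NormedAddCommGroup E]
    [NormedSpace ℝ E] (g : ℂ → E) :
    ∫ z in F '' disc, g z = ∫ z in disc, (‖F' z‖ ^ 2) • g (F z) := by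
  rw [integral_image_eq_integral_abs_det_fderiv_smul volume measurableSet_disc
    (fun x hx => h.hasFDerivWithinAt_disc hx) hinj]
  refine integral_congr_ae (.of_forall fun z => ?_)
  simp only [det_smul_one, abs_of_nonneg (sq_nonneg ‖F' z‖)]

/-- The differential of `F` is multiplication by F', with adjoint multiplication by its conjugate.
The factor |F'|² of the squared gradient is the Jacobian, whence conformal invariance of the
Dirichlet integral. -/
theorem gradient_comp (h : DiscC1 F F') {φ : ℂ → ℝ} {z : ℂ} (hz : z ∈ disc)
    (hφ : DifferentiableAt ℝ φ (F z)) :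
    gradient (φ ∘ F) z = (starRingEnd ℂ) (F' z) * gradient φ (F z) := by
  have h1 := (h.hasFDerivWithinAt_disc hz).hasFDerivAt (Metric.isOpen_ball.mem_nhds hz)
  have h2 := (hφ.hasFDerivAt.comp z h1).fderiv
  refine ext_inner_right ℝ fun v => ?_
  rw [inner_gradient_left, h2, ContinuousLinearMap.comp_apply, fderiv_apply_eq, Complex.inner]
  simp only [smul_apply, one_apply_eq_self, smul_eq_mul, map_mul,
    Complex.conj_conj]
  congr 1
  ring

end DiscC1

theorem hasGradientAt_re {G : ℂ → ℂ} {G' z : ℂ} (h : HasDerivAt G G' z) :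
    HasGradientAt (fun w => (G w).re) ((starRingEnd ℂ) G') z := by
  rw [hasGradientAt_iff_hasFDerivAt]
  have h1 := (Complex.reCLM.hasFDerivAt (x := G z)).comp z h.complexToReal_fderiv
  refine h1.congr_fderiv ?_
  ext v
  simp [InnerProductSpace.toDual_apply_apply, Complex.inner, mul_comm]

theorem gradient_re {G : ℂ → ℂ} {G' z : ℂ} (h : HasDerivAt G G' z) :
    gradient (fun w => (G w).re) z = (starRingEnd ℂ) G' := (hasGradientAt_re h).gradient

/-- Dividing by the value at z brings the argument near 1, where the principal logarithm is
differentiable; this changes log|u| only by a constant. -/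
theorem hasGradientAt_log_norm {u : ℂ → ℂ} {u' z : ℂ} (h : HasDerivAt u u' z) (h0 : u z ≠ 0) :
    HasGradientAt (fun w => Real.log ‖u w‖) ((starRingEnd ℂ) (u' / u z)) z := by
  have hu : HasDerivAt (fun w => u w / u z) (u' / u z) z := h.div_const _
  have h1 : HasDerivAt (fun w => Complex.log (u w / u z)) (u' / u z) z := by
    have := hu.clog (by rw [div_self h0]; exact Complex.one_mem_slitPlane)
    simpa [div_self h0] using this
  have h2 := hasGradientAt_re h1
  rw [hasGradientAt_iff_hasFDerivAt] at h2 ⊢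
  refine (h2.add_const (Real.log ‖u z‖)).congr_of_eventuallyEq ?_
  filter_upwards [h.continuousAt.eventually_ne h0] with w hw
  rw [Complex.log_re, norm_div, Real.log_div (norm_ne_zero_iff.2 hw) (norm_ne_zero_iff.2 h0)]
  ring

/-! ### The Poisson kernel and Möbius maps -/

theorem integral_torus_eq_circleAverage (f : ℂ → ℂ) :
    ∫ θ : Torus, f (expi θ) = 2 * π * circleAverage f 0 1 := by
  have := AddCircle.intervalIntegral_preimage (2 * π) 0 (fun θ : Torus => f (expi θ))
  rw [← this, circleAverage, zero_add]
  have e : ∀ t : ℝ, expi (t : Torus) = circleMap 0 1 t := fun t => by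
    rw [expi_coe, circleMap]; simp
  simp only [e]
  rw [Complex.real_smul]; push_cast
  field_simp

/-- The Möbius map `w ↦ (w + α) / (1 + ᾱ w)`. -/
def moeb (α w : ℂ) : ℂ := (w + α) / (1 + (starRingEnd ℂ) α * w)

theorem one_add_conj_mul_ne_zero {α w : ℂ} (hα : α ∈ disc) (hw : w ∈ cdisc) :
    1 + (starRingEnd ℂ) α * w ≠ 0 := by
  intro h
  have h1 : ‖(starRingEnd ℂ) α * w‖ = 1 := by
    rw [eq_neg_of_add_eq_zero_right h, norm_neg, norm_one]
  rw [norm_mul, RCLike.norm_conj] at h1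
  rw [mem_ball_zero_iff] at hα
  rw [mem_closedBall_zero_iff] at hw
  nlinarith [norm_nonneg α, norm_nonneg w]

theorem neg_mem_disc {α : ℂ} (hα : α ∈ disc) : -α ∈ disc := by
  rwa [mem_ball_zero_iff, norm_neg, ← mem_ball_zero_iff]

theorem one_sub_conj_mul_ne_zero {α w : ℂ} (hα : α ∈ disc) (hw : w ∈ cdisc) :
    1 - (starRingEnd ℂ) α * w ≠ 0 := by
  have := one_add_conj_mul_ne_zero (neg_mem_disc hα) hw
  simpa [sub_eq_add_neg] using this

theorem normSq_sub_moeb {α w : ℂ} :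
    Complex.normSq (1 + (starRingEnd ℂ) α * w) - Complex.normSq (w + α) =
      (1 - Complex.normSq α) * (1 - Complex.normSq w) := by
  simp [Complex.normSq_apply]; ring

theorem norm_lt_one_iff_normSq {w : ℂ} : ‖w‖ < 1 ↔ Complex.normSq w < 1 := by
  rw [Complex.normSq_eq_norm_sq, sq_lt_one_iff₀ (norm_nonneg _)]

theorem moeb_mem_disc {α w : ℂ} (hα : α ∈ disc) (hw : w ∈ disc) : moeb α w ∈ disc := by
  have h0 := one_add_conj_mul_ne_zero hα (disc_subset_cdisc hw)
  rw [mem_ball_zero_iff, norm_lt_one_iff_normSq] at *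
  rw [moeb, map_div₀, div_lt_one (Complex.normSq_pos.2 h0)]
  nlinarith [normSq_sub_moeb (α := α) (w := w)]

theorem norm_moeb {α w : ℂ} (hα : α ∈ disc) (hw : ‖w‖ = 1) : ‖moeb α w‖ = 1 := by
  have h0 := one_add_conj_mul_ne_zero hα (mem_closedBall_zero_iff.2 hw.le)
  have h1 : Complex.normSq w = 1 := by rw [Complex.normSq_eq_norm_sq, hw, one_pow]
  have h2 := normSq_sub_moeb (α := α) (w := w)
  rw [h1, sub_self, mul_zero, Complex.normSq_eq_norm_sq, Complex.normSq_eq_norm_sq] at h2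
  rw [moeb, norm_div, div_eq_one_iff_eq (norm_ne_zero_iff.2 h0)]
  exact (sq_eq_sq₀ (norm_nonneg _) (norm_nonneg _)).1 (by linarith)

theorem moeb_mem_cdisc {α w : ℂ} (hα : α ∈ disc) (hw : w ∈ cdisc) : moeb α w ∈ cdisc := by
  rcases lt_or_eq_of_le (mem_closedBall_zero_iff.1 hw) with h | h
  · exact disc_subset_cdisc (moeb_mem_disc hα (mem_ball_zero_iff.2 h))
  · exact mem_closedBall_zero_iff.2 (norm_moeb hα h).le

theorem moeb_neg_moeb {α w : ℂ} (hα : α ∈ disc) (hw : w ∈ cdisc) : moeb (-α) (moeb α w) = w := by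
  have h0 := one_add_conj_mul_ne_zero hα hw
  have h1 := one_add_conj_mul_ne_zero (neg_mem_disc hα) (moeb_mem_cdisc hα hw)
  have hm : moeb α w * (1 + (starRingEnd ℂ) α * w) = w + α := div_mul_cancel₀ _ h0
  rw [moeb, div_eq_iff h1, map_neg]
  linear_combination hm

theorem hasDerivAt_moeb {α w : ℂ} (hα : α ∈ disc) (hw : w ∈ cdisc) :
    HasDerivAt (moeb α) ((1 - α * (starRingEnd ℂ) α) / (1 + (starRingEnd ℂ) α * w) ^ 2) w := by
  have h0 := one_add_conj_mul_ne_zero hα hw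
  have h1 : HasDerivAt (fun w : ℂ => w + α) 1 w := (hasDerivAt_id w).add_const α
  have h2 : HasDerivAt (fun w : ℂ => 1 + (starRingEnd ℂ) α * w) ((starRingEnd ℂ) α) w := by
    simpa using ((hasDerivAt_id w).const_mul ((starRingEnd ℂ) α)).const_add 1
  refine (h1.div h2 h0).congr_deriv ?_
  congr 1; ring

theorem discC1_moeb {α : ℂ} (hα : α ∈ disc) :
    DiscC1 (moeb α) fun w => (1 - α * (starRingEnd ℂ) α) / (1 + (starRingEnd ℂ) α * w) ^ 2 :=
  ⟨fun w hw => (hasDerivAt_moeb hα hw).continuousAt.continuousWithinAt,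
    ContinuousOn.div (by fun_prop) (by fun_prop) fun w hw =>
      pow_ne_zero _ (one_add_conj_mul_ne_zero hα hw),
    fun w hw => hasDerivAt_moeb hα (disc_subset_cdisc hw)⟩

theorem injOn_moeb {α : ℂ} (hα : α ∈ disc) : InjOn (moeb α) cdisc :=
  Set.LeftInvOn.injOn (f₁' := moeb (-α)) fun _ hw => moeb_neg_moeb hα hw

theorem image_moeb {α : ℂ} (hα : α ∈ disc) : moeb α '' disc = disc := by
  refine subset_antisymm (image_subset_iff.2 fun w hw => moeb_mem_disc hα hw) fun w hw => ?_
  refine ⟨moeb (-α) w, moeb_mem_disc (neg_mem_disc hα) hw, ?_⟩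
  simpa using moeb_neg_moeb (neg_mem_disc hα) (disc_subset_cdisc hw)

/-- The Poisson kernel `P(α, e)`. -/
def poissonK (α e : ℂ) : ℂ := 1 / (1 - (starRingEnd ℂ) α * e) + 1 / (1 - α * (starRingEnd ℂ) e) - 1

theorem poissonK_conj (α e : ℂ) : (starRingEnd ℂ) (poissonK α e) = poissonK α e := by
  simp [poissonK]; ring

/-- On the circle P = (1/(1 - ᾱz) - 1) + z/(z - α). The first part times zⁿ is holomorphic and
vanishes at 0, so its average is 0; the second is Cauchy's formula. -/
theorem integral_pow_mul_poissonK {α : ℂ} (hα : α ∈ disc) (n : ℕ) :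
    ∫ θ : Torus, expi θ ^ n * poissonK α (expi θ) = 2 * π * α ^ n := by
  have h1 : circleAverage (fun z => z ^ n * (1 / (1 - (starRingEnd ℂ) α * z)) - z ^ n) 0 1 = 0 := by
    have hd : DiffContOnCl ℂ (fun z => z ^ n * (1 / (1 - (starRingEnd ℂ) α * z)) - z ^ n)
        (Metric.ball 0 |1|) := by
      refine DifferentiableOn.diffContOnCl fun z hz => ?_
      rw [abs_one, closure_disc] at hz
      have h0 := one_sub_conj_mul_ne_zero hα hz
      refine DifferentiableAt.differentiableWithinAt ?_
      fun_prop (disch := exact h0)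
    rw [hd.circleAverage]
    simp
  have h2 : circleAverage (fun z => ((z - 0) / (z - α)) • z ^ n) 0 1 = α ^ n := by
    refine DiffContOnCl.circleAverage_smul_div (f := fun z => z ^ n) (c := 0) (R := 1)
      (Differentiable.diffContOnCl (by fun_prop)) (by rwa [abs_one])
  have e : ∀ θ : Torus, expi θ ^ n * poissonK α (expi θ) =
      (expi θ ^ n * (1 / (1 - (starRingEnd ℂ) α * expi θ)) - expi θ ^ n) +
        ((expi θ - 0) / (expi θ - α)) • expi θ ^ n := by
    intro θ
    have hn : expi θ * (starRingEnd ℂ) (expi θ) = 1 := by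
      rw [Complex.mul_conj, Complex.normSq_eq_norm_sq, norm_expi]; simp
    have hne : expi θ ≠ 0 := by rw [← norm_ne_zero_iff, norm_expi]; exact one_ne_zero
    have h3 : (1 : ℂ) / (1 - α * (starRingEnd ℂ) (expi θ)) = expi θ / (expi θ - α) := by
      rw [← mul_div_mul_left _ _ hne, mul_one]
      congr 1
      linear_combination (-α) * hn
    rw [poissonK, h3, smul_eq_mul, sub_zero]; ring
  simp only [e]
  have hc1 : Continuous fun θ : Torus =>
      expi θ ^ n * (1 / (1 - (starRingEnd ℂ) α * expi θ)) - expi θ ^ n := by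
    have := continuous_expi
    fun_prop (disch := exact fun θ => one_sub_conj_mul_ne_zero hα (expi_mem_cdisc θ))
  have hc2 : Continuous fun θ : Torus => ((expi θ - 0) / (expi θ - α)) • expi θ ^ n := by
    have := continuous_expi
    have hne : ∀ θ, expi θ - α ≠ 0 := fun θ h => by
      rw [mem_ball_zero_iff, ← sub_eq_zero.1 h, norm_expi] at hα
      exact lt_irrefl _ hα
    fun_prop (disch := exact hne)
  rw [integral_add (hc1.integrable_of_hasCompactSupport (HasCompactSupport.of_compactSpace _))
    (hc2.integrable_of_hasCompactSupport (HasCompactSupport.of_compactSpace _)),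
    integral_torus_eq_circleAverage
      (fun z => z ^ n * (1 / (1 - (starRingEnd ℂ) α * z)) - z ^ n),
    integral_torus_eq_circleAverage (fun z => ((z - 0) / (z - α)) • z ^ n), h1, h2]
  ring

theorem integral_moeb_pow {α : ℂ} (hα : α ∈ disc) (n : ℕ) :
    ∫ θ : Torus, moeb α (expi θ) ^ n = 2 * π * α ^ n := by
  rw [integral_torus_eq_circleAverage (fun z => moeb α z ^ n)]
  have hd : DiffContOnCl ℂ (fun z => moeb α z ^ n) (Metric.ball 0 |1|) := by
    refine DifferentiableOn.diffContOnCl fun z hz => ?_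
    rw [abs_one, closure_disc] at hz
    exact ((hasDerivAt_moeb hα hz).differentiableAt.pow n).differentiableWithinAt
  rw [hd.circleAverage]
  simp [moeb]

theorem expi_ne_zero (θ : Torus) : expi θ ≠ 0 := by
  rw [← norm_ne_zero_iff, norm_expi]; exact one_ne_zero

theorem conj_expi (θ : Torus) : (starRingEnd ℂ) (expi θ) = (expi θ)⁻¹ := by
  refine eq_inv_of_mul_eq_one_right ?_
  rw [Complex.mul_conj, Complex.normSq_eq_norm_sq, norm_expi]
  simp

theorem exists_expi {z : ℂ} (hz : ‖z‖ = 1) : ∃ θ : Torus, expi θ = z := by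
  have h0 : z ≠ 0 := by rw [← norm_ne_zero_iff, hz]; exact one_ne_zero
  refine ⟨(Complex.arg z : Torus), ?_⟩
  rw [expi_coe]
  have := Complex.norm_mul_exp_arg_mul_I z
  rwa [hz, Complex.ofReal_one, one_mul] at this

theorem continuous_poissonK {α : ℂ} (hα : α ∈ disc) : Continuous fun θ : Torus => poissonK α (expi θ) := by
  have := continuous_expi
  have h1 : ∀ θ, 1 - α * (starRingEnd ℂ) (expi θ) ≠ 0 := fun θ h => by
    have h2 := one_sub_conj_mul_ne_zero hα (expi_mem_cdisc θ)
    apply h2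
    have := congrArg (starRingEnd ℂ) h
    simpa using this
  unfold poissonK
  fun_prop (disch := first
    | exact h1 | exact fun θ => one_sub_conj_mul_ne_zero hα (expi_mem_cdisc θ))

theorem integrable_of_continuous {E : Type*} [NormedAddCommGroup E] {u : Torus → E}
    (hu : Continuous u) : Integrable u :=
  hu.integrable_of_hasCompactSupport (HasCompactSupport.of_compactSpace _)

/-- The Möbius change of variables on the circle. -/
theorem integral_comp_moeb {α : ℂ} (hα : α ∈ disc) {u : ℂ → ℂ}
    (hu : ContinuousOn u (Metric.sphere 0 1)) :
    ∫ θ : Torus, u (moeb α (expi θ)) = ∫ θ : Torus, u (expi θ) * poissonK α (expi θ) := by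
  have hmc : Continuous fun θ : Torus => moeb α (expi θ) :=
    (discC1_moeb hα).cont.comp_continuous continuous_expi expi_mem_cdisc
  -- The map μ is the Möbius map read on angles; it is continuous because `expi` is an embedding.
  choose μ hμ using fun θ : Torus => exists_expi (norm_moeb hα (norm_expi θ))
  have hemb : Topology.IsEmbedding (expi : Torus → ℂ) :=
    (continuous_expi.isClosedEmbedding expi_injective).isEmbedding
  have hμc : Continuous μ := by
    rw [hemb.continuous_iff]
    exact hmc.congr fun θ => (hμ θ).symm
  -- The difference of the two sides is a bounded functional of the boundary function. It is enough
  -- to check that it vanishes on characters, whose span is dense.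
  let L : C(Torus, ℂ) →L[ℂ] ℂ := LinearMap.mkContinuous
    { toFun := fun v => ∫ θ : Torus, (v (μ θ) - v θ * poissonK α (expi θ))
      map_add' := fun v w => by
        rw [← integral_add]
        · congr 1; funext θ; simp only [ContinuousMap.add_apply]; ring
        · exact integrable_of_continuous ((v.continuous.comp hμc).sub
            (v.continuous.mul (continuous_poissonK hα)))
        · exact integrable_of_continuous ((w.continuous.comp hμc).sub
            (w.continuous.mul (continuous_poissonK hα)))
      map_smul' := fun c v => by
        rw [RingHom.id_apply, smul_eq_mul, ← integral_const_mul]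
        congr 1; funext θ; simp only [ContinuousMap.smul_apply, smul_eq_mul]; ring }
    (∫ θ : Torus, (1 + ‖poissonK α (expi θ)‖)) fun v => by
      rw [LinearMap.coe_mk, AddHom.coe_mk, ← integral_mul_const]
      refine norm_integral_le_of_norm_le (integrable_of_continuous ((continuous_const.add
        (continuous_poissonK hα).norm).mul continuous_const)) (.of_forall fun θ => ?_)
      refine (norm_sub_le _ _).trans ?_
      rw [norm_mul, add_mul, one_mul, mul_comm ‖v θ‖]
      gcongr <;> exact v.norm_coe_le_norm _
  have hLapp : ∀ v : C(Torus, ℂ), L v = ∫ θ : Torus, (v (μ θ) - v θ * poissonK α (expi θ)) :=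
    fun v => rfl
  have hpos : ∀ n : ℕ, ∫ θ : Torus, (expi (μ θ) ^ n - expi θ ^ n * poissonK α (expi θ)) = 0 := by
    intro n
    have i1 : Integrable fun θ => expi (μ θ) ^ n :=
      integrable_of_continuous ((continuous_expi.comp hμc).pow n)
    have i2 : Integrable fun θ => expi θ ^ n * poissonK α (expi θ) :=
      integrable_of_continuous ((continuous_expi.pow n).mul (continuous_poissonK hα))
    rw [integral_sub i1 i2, integral_pow_mul_poissonK hα]
    simp only [hμ]
    rw [integral_moeb_pow hα, sub_self]
  have hL : L = 0 := by
    refine ContinuousLinearMap.ext_on (s := range (fourier (T := 2 * π))) ?_ ?_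
    · have := span_fourier_closure_eq_top (T := 2 * π)
      rw [dense_iff_closure_eq, ← Submodule.topologicalClosure_coe, this]; rfl
    · rintro _ ⟨n, rfl⟩
      rw [hLapp, zero_apply]
      simp only [fourier_eq_expi_zpow]
      -- Negative frequencies are conjugates of positive ones, and the Poisson kernel is real.
      obtain ⟨m, rfl | rfl⟩ := n.eq_nat_or_neg
      · simpa using hpos m
      · have h1 := congrArg (starRingEnd ℂ) (hpos m)
        rw [← integral_conj, map_zero] at h1
        rw [← h1]
        congr 1; funext θ
        simp only [map_sub, map_mul, map_pow, conj_expi, poissonK_conj, zpow_neg, zpow_natCast,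
          inv_pow]
  let v : C(Torus, ℂ) := ⟨fun θ => u (expi θ), hu.comp_continuous continuous_expi fun θ => by simp [norm_expi]⟩
  have h1 := hLapp v
  have i1 : Integrable fun θ => v (μ θ) := integrable_of_continuous (v.continuous.comp hμc)
  have i2 : Integrable fun θ => v θ * poissonK α (expi θ) :=
    integrable_of_continuous (v.continuous.mul (continuous_poissonK hα))
  rw [hL, zero_apply, integral_sub i1 i2] at h1
  have h2 := sub_eq_zero.1 h1.symm
  simpa only [v, ContinuousMap.coe_mk, hμ] using h2

/-! ### The Neumann kernel of the disc -/

/-- When the coefficients are absolutely summable the series converges uniformly on the closed disc,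
so the limit of boundary integrals is the integral of the boundary values. -/
theorem TestFn.integral_power {η : ℂ → ℝ} (hη : TestFn η) {a : ℕ → ℂ} {F : ℂ → ℂ}
    (h : ∀ z ∈ cdisc, HasSum (fun n => a n * z ^ n) (F z)) (ha : Summable fun n => ‖a n‖) :
    ∫ z in disc, F z * gradient η z = ∫ θ : Torus, (η (expi θ) : ℂ) * (expi θ * F (expi θ)) := by
  have hs : Summable fun n : ℕ => ‖a n‖ ^ 2 / (n + 1) := by
    have h1 : ∀ᶠ n in atTop, ‖a n‖ < 1 := ha.tendsto_atTop_zero.eventually_lt_const one_pos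
    refine ha.of_norm_bounded_eventually_nat ?_
    filter_upwards [h1] with n hn
    rw [Real.norm_of_nonneg (by positivity)]
    have h2 : ‖a n‖ ^ 2 ≤ ‖a n‖ := by nlinarith [norm_nonneg (a n)]
    exact (div_le_self (by positivity) (by linarith [n.cast_nonneg (α := ℝ)])).trans h2
  have hηc : Continuous fun θ : Torus => (η (expi θ) : ℂ) :=
    Complex.continuous_ofReal.comp (hη.cont.comp_continuous continuous_expi expi_mem_cdisc)
  obtain ⟨C, hC⟩ := (isCompact_univ (X := Torus)).exists_bound_of_continuousOn hηc.continuousOn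
  have h1 := hasSum_integral_of_summable_integral_norm (μ := (volume : Measure Torus))
    (F := fun n θ => (η (expi θ) : ℂ) * (expi θ * (a n * expi θ ^ n)))
    (fun n => integrable_of_continuous (hηc.mul (continuous_expi.mul
      (continuous_const.mul (continuous_expi.pow n))))) (by
      refine Summable.of_nonneg_of_le (fun n => by positivity) (fun n => ?_)
        ((ha.mul_left C).mul_right (volume.real (univ : Set Torus)))
      have : ∀ θ : Torus, ‖(η (expi θ) : ℂ) * (expi θ * (a n * expi θ ^ n))‖ ≤ C * ‖a n‖ := by
        intro θ
        simp only [norm_mul, norm_pow, norm_expi, one_pow, one_mul, mul_one]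
        gcongr
        exact hC θ (mem_univ _)
      refine (integral_mono_of_nonneg (.of_forall fun θ => by positivity) (integrable_const _)
        (.of_forall this)).trans ?_
      rw [integral_const, smul_eq_mul, mul_comm])
  have e : ∀ θ : Torus, ∑' n, (η (expi θ) : ℂ) * (expi θ * (a n * expi θ ^ n)) =
      (η (expi θ) : ℂ) * (expi θ * F (expi θ)) := fun θ =>
    (((h _ (expi_mem_cdisc θ)).mul_left _).mul_left _).tsum_eq
  simp only [e] at h1
  refine tendsto_nhds_unique (hη.tendsto_integral_power
    (fun z hz => h z (disc_subset_cdisc hz)) hs) ?_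
  refine h1.tendsto_sum_nat.congr fun N => Finset.sum_congr rfl fun n _ => ?_
  rw [← integral_const_mul]
  congr 1; funext θ; ring

theorem TestFn.comp {η : ℂ → ℝ} (hη : TestFn η) {F F' : ℂ → ℂ} (h : DiscC1 F F')
    (hd : MapsTo F disc disc) (hc : MapsTo F cdisc cdisc) : TestFn (η ∘ F) := by
  obtain ⟨M, hM⟩ := hη.bounded
  obtain ⟨C, hC⟩ := h.exists_bound
  refine ⟨hη.cont.comp h.cont hc, hη.smooth.comp ?_ hd, C * M, fun z hz => ?_⟩
  · exact (h.differentiableOn.contDiffOn Metric.isOpen_ball).restrict_scalars ℝ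
  · rw [h.gradient_comp hz (hη.hasFDerivAt (hd hz)).differentiableAt, norm_mul, RCLike.norm_conj]
    have := hC z (disc_subset_cdisc hz)
    exact mul_le_mul this (hM _ (hd hz)) (norm_nonneg _) ((norm_nonneg _).trans this)

/-- The derivative of `log (z - α) + log (1 - ᾱ z)`. -/
def neumannK (α z : ℂ) : ℂ := 1 / (z - α) - (starRingEnd ℂ) α / (1 - (starRingEnd ℂ) α * z)

theorem integrableOn_inv_disc : IntegrableOn (fun z : ℂ => z⁻¹) disc := by
  refine ⟨measurable_inv.aestronglyMeasurable, ?_⟩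
  rw [HasFiniteIntegral, lintegral_disc_eq_polar]
  refine (setLIntegral_mono' (g := fun _ => 1) (measurableSet_Ioo.prod measurableSet_Ioo)
    fun p hp => ?_).trans_lt ?_
  · rw [← ofReal_norm, norm_inv, norm_pol, abs_of_pos hp.1.1, ← ENNReal.ofReal_mul hp.1.1.le,
      mul_inv_cancel₀ hp.1.1.ne', ENNReal.ofReal_one]
  · rw [setLIntegral_one, Measure.volume_eq_prod, Measure.prod_prod]
    simp

theorem moeb_mul_neumannK {α w : ℂ} (hα : α ∈ disc) (hw : w ∈ disc) (h0 : w ≠ 0) :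
    (1 - α * (starRingEnd ℂ) α) / (1 + (starRingEnd ℂ) α * w) ^ 2 * neumannK α (moeb α w) =
      w⁻¹ - 2 * (starRingEnd ℂ) α / (1 + (starRingEnd ℂ) α * w) := by
  have hD := one_add_conj_mul_ne_zero hα (disc_subset_cdisc hw)
  have hα1 : 1 - α * (starRingEnd ℂ) α ≠ 0 := by
    have := one_sub_conj_mul_ne_zero hα (disc_subset_cdisc hα)
    rwa [mul_comm] at this
  have e1 : moeb α w - α = w * (1 - α * (starRingEnd ℂ) α) / (1 + (starRingEnd ℂ) α * w) := by
    rw [moeb, eq_div_iff hD, sub_mul, div_mul_cancel₀ _ hD]; ring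
  have e2 : 1 - (starRingEnd ℂ) α * moeb α w =
      (1 - α * (starRingEnd ℂ) α) / (1 + (starRingEnd ℂ) α * w) := by
    rw [eq_div_iff hD, moeb, sub_mul, mul_assoc, div_mul_cancel₀ _ hD]; ring
  rw [neumannK, e1, e2]
  generalize (starRingEnd ℂ) α = β at *
  field_simp
  ring

/-- The Möbius map taking 0 to α turns the kernel into 1/w minus a function holomorphic and bounded
up to the boundary (`moeb_mul_neumannK`). The first part yields the value at α and the boundary mean
of η ∘ moeb; the second corrects that mean to the one of η. -/
theorem TestFn.integrable_neumannK {η : ℂ → ℝ} (hη : TestFn η) {α : ℂ} (hα : α ∈ disc) :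
    IntegrableOn (fun z => neumannK α z * gradient η z) disc ∧
    ∫ z in disc, (neumannK α z * gradient η z).re = (∫ θ : Torus, η (expi θ)) - 2 * π * η α := by
  set F' : ℂ → ℂ := fun w => (1 - α * (starRingEnd ℂ) α) / (1 + (starRingEnd ℂ) α * w) ^ 2 with hF'
  have hm : DiscC1 (moeb α) F' := discC1_moeb hα
  have hinj : InjOn (moeb α) disc := (injOn_moeb hα).mono disc_subset_cdisc
  set ξ := η ∘ moeb α with hξd
  have hξ : TestFn ξ := hη.comp hm (fun w hw => moeb_mem_disc hα hw) fun w hw => moeb_mem_cdisc hα hw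
  obtain ⟨M, hM⟩ := hξ.bounded
  have hGm := hξ.continuousOn_gradient.aestronglyMeasurable (μ := volume) measurableSet_disc
  have hMae : ∀ᵐ z ∂(volume.restrict disc), ‖gradient ξ z‖ ≤ M :=
    (ae_restrict_iff' measurableSet_disc).2 (.of_forall hM)
  set k : ℂ → ℂ := fun w => 2 * (starRingEnd ℂ) α / (1 + (starRingEnd ℂ) α * w) with hk
  have hkc : ContinuousOn k cdisc := by
    refine ContinuousOn.div (by fun_prop) (by fun_prop) fun w hw => one_add_conj_mul_ne_zero hα hw
  have hki : IntegrableOn k disc := (hkc.integrableOn_compact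
    (isCompact_closedBall 0 1)).mono_set disc_subset_cdisc
  have i1 : IntegrableOn (fun w => w⁻¹ * gradient ξ w) disc :=
    integrableOn_inv_disc.mul_bdd (c := M) hGm hMae
  have i2 : IntegrableOn (fun w => k w * gradient ξ w) disc := hki.mul_bdd (c := M) hGm hMae
  have hpt : ∀ w ∈ disc, w ≠ 0 → (‖F' w‖ ^ 2 : ℝ) • (neumannK α (moeb α w) * gradient η (moeb α w)) =
      w⁻¹ * gradient ξ w - k w * gradient ξ w := by
    intro w hw h0
    rw [hm.gradient_comp hw (hη.hasFDerivAt (moeb_mem_disc hα hw)).differentiableAt, ← sub_mul,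
      ← moeb_mul_neumannK hα hw h0, Complex.real_smul, ← Complex.normSq_eq_norm_sq, ← Complex.mul_conj]
    ring
  have hae : ∀ᵐ w ∂(volume.restrict disc),
      (‖F' w‖ ^ 2 : ℝ) • (neumannK α (moeb α w) * gradient η (moeb α w)) =
      w⁻¹ * gradient ξ w - k w * gradient ξ w := by
    rw [ae_restrict_iff' measurableSet_disc]
    filter_upwards [compl_mem_ae_iff.2 (measure_singleton (0 : ℂ))] with w h0 hw
    exact hpt w hw h0
  have hI : IntegrableOn (fun z => neumannK α z * gradient η z) disc := by
    have := (integrableOn_image_iff_integrableOn_abs_det_fderiv_smul volume measurableSet_disc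
      (fun x hx => hm.hasFDerivWithinAt_disc hx) hinj (fun z => neumannK α z * gradient η z)).2
    rw [image_moeb hα] at this
    refine this (Integrable.congr (i1.sub i2) ?_)
    filter_upwards [hae] with w hw
    rw [det_smul_one, abs_of_nonneg (by positivity), hw]; rfl
  refine ⟨hI, ?_⟩
  have h1 := hm.integral_image hinj (fun z => neumannK α z * gradient η z)
  rw [image_moeb hα, integral_congr_ae hae, integral_sub i1 i2] at h1
  have hre : ∀ {u : ℂ → ℂ}, IntegrableOn u disc → ∫ z in disc, (u z).re = (∫ z in disc, u z).re :=
    fun hu => integral_re hu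
  have hkp : ∀ z ∈ cdisc, HasSum (fun n => 2 * (starRingEnd ℂ) α * (-(starRingEnd ℂ) α) ^ n * z ^ n) (k z) := by
    intro z hz
    have hlt : ‖-(starRingEnd ℂ) α * z‖ < 1 := by
      rw [norm_mul, norm_neg, RCLike.norm_conj]
      rw [mem_ball_zero_iff] at hα
      rw [mem_closedBall_zero_iff] at hz
      nlinarith [norm_nonneg α, norm_nonneg z]
    have := (hasSum_geometric_of_norm_lt_one hlt).mul_left (2 * (starRingEnd ℂ) α)
    rw [show 1 - -(starRingEnd ℂ) α * z = 1 + (starRingEnd ℂ) α * z by ring, ← div_eq_mul_inv] at this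
    simpa only [mul_pow, mul_assoc] using this
  have h2 := hξ.integral_power hkp (by
    simp only [norm_mul, norm_pow, norm_neg, RCLike.norm_conj]
    exact (summable_geometric_of_lt_one (norm_nonneg _) (mem_ball_zero_iff.1 hα)).mul_left _)
  have h3 := integral_comp_moeb (neg_mem_disc hα) (u := fun z => (ξ z : ℂ))
    (Complex.continuous_ofReal.comp_continuousOn (hξ.cont.mono Metric.sphere_subset_closedBall))
  have h4 : ∀ θ : Torus, ((ξ (moeb (-α) (expi θ)) : ℝ) : ℂ) = (η (expi θ) : ℝ) := fun θ => by
    have := moeb_neg_moeb (neg_mem_disc hα) (expi_mem_cdisc θ)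
    rw [neg_neg] at this
    simp only [ξ, Function.comp_apply, this]
  simp only [h4] at h3
  have hξc : Continuous fun θ : Torus => ξ (expi θ) :=
    hξ.cont.comp_continuous continuous_expi expi_mem_cdisc
  have hkc' : Continuous fun θ : Torus => expi θ * k (expi θ) :=
    continuous_expi.mul (hkc.comp_continuous continuous_expi expi_mem_cdisc)
  -- By the Möbius change of variables the boundary integral of η is that of ξ against the Poisson
  -- kernel of -α, which on the circle equals 1 - Re(e^{iθ} k(e^{iθ})).
  have h5 : ∫ θ : Torus, η (expi θ) =
      (∫ θ : Torus, ξ (expi θ)) - (∫ θ : Torus, (ξ (expi θ) : ℂ) * (expi θ * k (expi θ))).re := by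
    have hP : ∀ θ : Torus, ((ξ (expi θ) : ℂ) * poissonK (-α) (expi θ)).re =
        ξ (expi θ) - ((ξ (expi θ) : ℂ) * (expi θ * k (expi θ))).re := by
      intro θ
      rw [Complex.re_ofReal_mul, Complex.re_ofReal_mul, ← mul_one_sub]
      congr 1
      have hD := one_add_conj_mul_ne_zero hα (expi_mem_cdisc θ)
      have hq : (1 : ℂ) / (1 - -α * (starRingEnd ℂ) (expi θ)) =
          (starRingEnd ℂ) (1 / (1 + (starRingEnd ℂ) α * expi θ)) := by simp
      have hk1 : expi θ * k (expi θ) = 2 - 2 * (1 / (1 + (starRingEnd ℂ) α * expi θ)) := by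
        have : expi θ * (2 * (starRingEnd ℂ) α / (1 + (starRingEnd ℂ) α * expi θ)) =
            2 - 2 * (1 / (1 + (starRingEnd ℂ) α * expi θ)) := by
          rw [mul_one_div, eq_sub_iff_add_eq, ← mul_div_assoc, ← add_div, div_eq_iff hD]; ring
        exact this
      rw [hk1, poissonK, hq, map_neg, neg_mul, sub_neg_eq_add]
      simp only [Complex.sub_re, Complex.add_re, Complex.conj_re, Complex.one_re, Complex.mul_re,
        Complex.re_ofNat, Complex.im_ofNat, zero_mul, sub_zero]
      ring
    have h6 := congrArg Complex.re h3
    have hreT : ∀ {u : Torus → ℂ}, Continuous u → ∫ θ, (u θ).re = (∫ θ, u θ).re :=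
      fun hu => integral_re (integrable_of_continuous hu)
    have c1 : Continuous fun θ : Torus => (ξ (expi θ) : ℂ) := Complex.continuous_ofReal.comp hξc
    have c2 : Continuous fun θ : Torus => (η (expi θ) : ℂ) := Complex.continuous_ofReal.comp
        (hη.cont.comp_continuous continuous_expi expi_mem_cdisc)
    have c3 : Continuous fun θ : Torus => (ξ (expi θ) : ℂ) * poissonK (-α) (expi θ) :=
      c1.mul (continuous_poissonK (neg_mem_disc hα))
    have c4 : Continuous fun θ : Torus => (ξ (expi θ) : ℂ) * (expi θ * k (expi θ)) := c1.mul hkc'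
    have c5 : Continuous fun θ : Torus => ((ξ (expi θ) : ℂ) * (expi θ * k (expi θ))).re :=
      Complex.continuous_re.comp c4
    rw [← hreT c2, ← hreT c3] at h6
    simp only [hP, Complex.ofReal_re] at h6
    rw [h6, integral_sub (integrable_of_continuous hξc) (integrable_of_continuous c5), hreT c4]
  rw [hre hI, h1, h2, Complex.sub_re, ← hre i1, hξ.integral_inv_mul_gradient, h5]
  have : ξ 0 = η α := by simp [ξ, moeb]
  rw [this]; ring

/-! ### Traces and their uniqueness. -/

theorem enorm_add_sq_le {E : Type*} [NormedAddCommGroup E] (x y : E) :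
    ‖x + y‖ₑ ^ 2 ≤ 2 * ‖x‖ₑ ^ 2 + 2 * ‖y‖ₑ ^ 2 := by
  have e : ∀ v : E, ‖v‖ₑ ^ 2 = ENNReal.ofReal (‖v‖ ^ 2) := fun v => by
    rw [ENNReal.ofReal_pow (norm_nonneg _), ofReal_norm]
  rw [e, e, e, show (2 : ℝ≥0∞) = ENNReal.ofReal 2 by simp, ← ENNReal.ofReal_mul (by norm_num),
    ← ENNReal.ofReal_mul (by norm_num), ← ENNReal.ofReal_add (by positivity) (by positivity)]
  refine ENNReal.ofReal_le_ofReal ?_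
  have h := norm_add_le x y
  nlinarith [sq_nonneg (‖x‖ - ‖y‖), norm_nonneg (x + y), norm_nonneg x, norm_nonneg y]

theorem tendsto_lintegral_sq_trans {X E : Type*} [MeasurableSpace X] [NormedAddCommGroup E]
    {μ : Measure X} {a b c : ℕ → X → E} (ha : ∀ n, AEStronglyMeasurable (a n) μ)
    (hb : ∀ n, AEStronglyMeasurable (b n) μ)
    (hab : Tendsto (fun n => ∫⁻ x, ‖a n x - b n x‖ₑ ^ 2 ∂μ) atTop (𝓝 0))
    (hbc : Tendsto (fun n => ∫⁻ x, ‖b n x - c n x‖ₑ ^ 2 ∂μ) atTop (𝓝 0)) :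
    Tendsto (fun n => ∫⁻ x, ‖a n x - c n x‖ₑ ^ 2 ∂μ) atTop (𝓝 0) := by
  have h : Tendsto (fun n => 2 * (∫⁻ x, ‖a n x - b n x‖ₑ ^ 2 ∂μ) +
      2 * ∫⁻ x, ‖b n x - c n x‖ₑ ^ 2 ∂μ) atTop (𝓝 0) := by
    have := (ENNReal.Tendsto.const_mul (a := 2) hab (Or.inr (by simp))).add
      (ENNReal.Tendsto.const_mul (a := 2) hbc (Or.inr (by simp)))
    simpa using this
  refine tendsto_of_tendsto_of_tendsto_of_le_of_le tendsto_const_nhds h (fun _ => zero_le) fun n => ?_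
  dsimp only
  rw [← lintegral_const_mul' _ _ (by simp), ← lintegral_const_mul' _ _ (by simp), ← lintegral_add_left']
  · refine lintegral_mono fun x => ?_
    have := enorm_add_sq_le (a n x - b n x) (b n x - c n x)
    rwa [sub_add_sub_cancel] at this
  · exact ((((ha n).sub (hb n)).enorm).pow_const 2).const_mul 2

theorem enorm_le_add_lintegral_deriv {φ φ' : ℝ → ℝ} {r : ℝ} (hr : r ≤ 1)
    (hc : ContinuousOn φ (Icc r 1)) (hd : ∀ s ∈ Ioo r 1, HasDerivAt φ (φ' s) s)
    (hc' : ContinuousOn φ' (Ioo r 1)) :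
    ‖φ 1‖ₑ ≤ ‖φ r‖ₑ + ∫⁻ s in Ioo r 1, ‖φ' s‖ₑ := by
  by_cases htop : ∫⁻ s in Ioo r 1, ‖φ' s‖ₑ = ⊤
  · simp [htop]
  have hint : IntegrableOn φ' (Ioo r 1) :=
    ⟨hc'.aestronglyMeasurable measurableSet_Ioo, lt_top_iff_ne_top.2 htop⟩
  have hii : IntervalIntegrable φ' volume r 1 := by
    rw [intervalIntegrable_iff_integrableOn_Ioo_of_le hr]; exact hint
  have h := intervalIntegral.integral_eq_sub_of_hasDerivAt_of_le hr hc hd hii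
  rw [intervalIntegral.integral_of_le hr, integral_Ioc_eq_integral_Ioo] at h
  calc ‖φ 1‖ₑ = ‖φ r + ∫ s in Ioo r 1, φ' s‖ₑ := by rw [h]; congr 1; ring
    _ ≤ ‖φ r‖ₑ + ‖∫ s in Ioo r 1, φ' s‖ₑ := enorm_add_le _ _
    _ ≤ _ := by gcongr; exact enorm_integral_le_lintegral_enorm _

/-- The trace inequality in the disc. -/
theorem lintegral_trace_le {y : ℂ → ℝ} (hc : ContinuousOn y cdisc) (hs : ContDiffOn ℝ 1 y disc) :
    ∫⁻ θ : Torus, ‖y (expi θ)‖ₑ ^ 2 ≤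
      6 * ((∫⁻ z in disc, ‖y z‖ₑ ^ 2) + ∫⁻ z in disc, ‖gradient y z‖ₑ ^ 2) := by
  set G : ℂ → ℝ≥0∞ := fun z => ‖y z‖ₑ ^ 2 + ‖gradient y z‖ₑ ^ 2 with hG
  have hgc : ContinuousOn (gradient y) disc := continuousOn_gradient Metric.isOpen_ball hs
  have hyd : ContinuousOn y disc := hc.mono disc_subset_cdisc
  have hsum : (∫⁻ z in disc, ‖y z‖ₑ ^ 2) + ∫⁻ z in disc, ‖gradient y z‖ₑ ^ 2 = ∫⁻ z in disc, G z := by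
    have hm : AEMeasurable (fun z => ‖y z‖ₑ ^ 2) (volume.restrict disc) :=
      ((hyd.aestronglyMeasurable measurableSet_disc).enorm).pow_const 2
    exact (lintegral_add_left' hm _).symm
  have hms : MeasurableSet (Ioo (0 : ℝ) 1 ×ˢ Ioo (-π) π) := measurableSet_Ioo.prod measurableSet_Ioo
  have hmaps : MapsTo pol (Ioo (0 : ℝ) 1 ×ˢ Ioo (-π) π) disc := fun p hp => pol_mem_disc hp
  have hmeas : AEMeasurable (fun p : ℝ × ℝ => ENNReal.ofReal p.1 * G (pol p))
      ((volume.restrict (Ioo (0 : ℝ) 1)).prod (volume.restrict (Ioo (-π) π))) := by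
    rw [Measure.prod_restrict, ← Measure.volume_eq_prod]
    refine AEMeasurable.mul (ENNReal.measurable_ofReal.comp measurable_fst).aemeasurable ?_
    change AEMeasurable (fun p => ‖y (pol p)‖ₑ ^ 2 + ‖gradient y (pol p)‖ₑ ^ 2) _
    refine AEMeasurable.add (f := fun p => ‖y (pol p)‖ₑ ^ 2)
      (g := fun p => ‖gradient y (pol p)‖ₑ ^ 2) ?_ ?_
    · exact (((hyd.comp continuous_pol.continuousOn hmaps).aestronglyMeasurable hms).enorm).pow_const 2
    · exact (((hgc.comp continuous_pol.continuousOn hmaps).aestronglyMeasurable hms).enorm).pow_const 2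
  -- On a ray, y² at radius 1 is bounded through the fundamental theorem by y² at radius r plus an
  -- integral of y² + |∇y|². Averaging over r in (1/2, 1) costs a factor 3, and inserting the polar
  -- weight, at least 1/2 there, a factor 2.
  have hray : ∀ t ∈ Ioo (-π) π, ‖y (expi (t : Torus))‖ₑ ^ 2 ≤
      6 * ∫⁻ s in Ioo (0 : ℝ) 1, ENNReal.ofReal s * G (pol (s, t)) := by
    intro t ht
    set e : ℂ := Complex.exp (t * Complex.I) with he
    have hne : ‖e‖ = 1 := Complex.norm_exp_ofReal_mul_I t
    have hpol : ∀ s : ℝ, pol (s, t) = s * e := fun s => rfl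
    have hin : ∀ s ∈ Ioo (0 : ℝ) 1, (s : ℂ) * e ∈ disc := fun s hs' =>
      pol_mem_disc (p := (s, t)) ⟨hs', ht⟩
    have hcm : ContinuousOn (fun s : ℝ => y (s * e)) (Icc 0 1) := by
      refine hc.comp (by fun_prop) fun s hs' => ?_
      rw [mem_closedBall_zero_iff, norm_mul, hne, mul_one, Complex.norm_real, Real.norm_eq_abs,
        abs_of_nonneg hs'.1]
      exact hs'.2
    have hgs : ContinuousOn (fun s : ℝ => gradient y (s * e)) (Ioo 0 1) :=
      hgc.comp (by fun_prop) hin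
    have hder : ∀ s ∈ Ioo (0 : ℝ) 1, HasDerivAt (fun s : ℝ => y (s * e))
        (((starRingEnd ℂ) (gradient y (s * e)) * e).re) s := by
      intro s hs'
      have h1 : HasDerivAt (fun s : ℝ => (s : ℂ) * e) e s := by
        simpa using (Complex.ofRealCLM.hasDerivAt (x := s)).mul_const e
      have h2 := ((hs.differentiableOn one_ne_zero).differentiableAt
        (Metric.isOpen_ball.mem_nhds (hin s hs'))).hasFDerivAt
      have h3 := h2.comp_hasDerivAt s h1
      rwa [fderiv_apply_eq] at h3
    have hpt : ∀ r ∈ Ioo (1 / 2 : ℝ) 1, ‖y e‖ₑ ^ 2 ≤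
        ‖y (r * e)‖ₑ ^ 2 + ∫⁻ s in Ioo (1 / 2 : ℝ) 1, G (s * e) := by
      intro r hr
      have hr0 : 0 < r := by linarith [hr.1]
      have hsub : Ioo r 1 ⊆ Ioo (0 : ℝ) 1 := Ioo_subset_Ioo_left hr0.le
      have hsub2 : Icc r 1 ⊆ Icc (0 : ℝ) 1 := Icc_subset_Icc_left hr0.le
      have := enorm_le_add_lintegral_deriv (φ := fun s => y (s * e) ^ 2)
        (φ' := fun s => 2 * y (s * e) * ((starRingEnd ℂ) (gradient y (s * e)) * e).re) hr.2.le
        ((hcm.mono hsub2).pow 2) (fun s hs' => by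
          simpa only [Nat.cast_ofNat, Nat.add_one_sub_one, pow_one] using (hder s (hsub hs')).fun_pow 2) (by
          refine ContinuousOn.mul (continuousOn_const.mul
            (hcm.mono (hsub.trans Ioo_subset_Icc_self))) ?_
          exact Complex.continuous_re.comp_continuousOn ((Complex.continuous_conj.comp_continuousOn
            (hgs.mono hsub)).mul continuousOn_const))
      simp only [Complex.ofReal_one, one_mul, enorm_pow] at this
      refine this.trans ?_
      refine add_le_add_right ?_ _
      refine (setLIntegral_mono_ae' measurableSet_Ioo (.of_forall fun s _ => ?_)).trans
        (lintegral_mono_set (Ioo_subset_Ioo_left hr.1.le))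
      have e' : ∀ {E : Type} [NormedAddCommGroup E] (v : E), ‖v‖ₑ ^ 2 = ENNReal.ofReal (‖v‖ ^ 2) :=
        fun v => by rw [ENNReal.ofReal_pow (norm_nonneg _), ofReal_norm]
      rw [hG]
      simp only
      rw [e', e', ← ofReal_norm, ← ENNReal.ofReal_add (by positivity) (by positivity)]
      refine ENNReal.ofReal_le_ofReal ?_
      have h1 : ‖((starRingEnd ℂ) (gradient y (s * e)) * e).re‖ ≤ ‖gradient y (s * e)‖ := by
        refine (Complex.abs_re_le_norm _).trans ?_
        rw [norm_mul, hne, mul_one, RCLike.norm_conj]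
      rw [norm_mul, norm_mul, Real.norm_ofNat]
      nlinarith [sq_nonneg (‖y (s * e)‖ - ‖gradient y (s * e)‖), norm_nonneg (y (s * e)),
        mul_le_mul_of_nonneg_left h1 (norm_nonneg (y (s * e)))]
    set I := ∫⁻ s in Ioo (1 / 2 : ℝ) 1, G (s * e) with hI
    have hvol : volume (Ioo (1 / 2 : ℝ) 1) = ENNReal.ofReal (1 / 2) := by
      rw [Real.volume_Ioo]; norm_num
    have hy1 : ∫⁻ r in Ioo (1 / 2 : ℝ) 1, ‖y (r * e)‖ₑ ^ 2 ≤ I :=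
      lintegral_mono fun s => le_self_add
    have hav : ENNReal.ofReal (1 / 2) * ‖y e‖ₑ ^ 2 ≤ I + ENNReal.ofReal (1 / 2) * I := by
      have h1 : ∫⁻ _ in Ioo (1 / 2 : ℝ) 1, ‖y e‖ₑ ^ 2 ≤
          ∫⁻ r in Ioo (1 / 2 : ℝ) 1, (‖y (r * e)‖ₑ ^ 2 + I) :=
        setLIntegral_mono_ae' measurableSet_Ioo (.of_forall hpt)
      rw [setLIntegral_const, lintegral_add_right _ measurable_const, setLIntegral_const, hvol,
        mul_comm, mul_comm I] at h1
      exact h1.trans (by gcongr)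
    have hI2 : I ≤ 2 * ∫⁻ s in Ioo (0 : ℝ) 1, ENNReal.ofReal s * G (pol (s, t)) := by
      rw [← lintegral_const_mul' _ _ (by simp)]
      refine (setLIntegral_mono_ae' measurableSet_Ioo (.of_forall fun s hs' => ?_)).trans
        (lintegral_mono_set (Ioo_subset_Ioo_left (by norm_num : (0 : ℝ) ≤ 1 / 2)))
      rw [← mul_assoc, hpol]
      refine le_mul_of_one_le_left' ?_
      rw [show (2 : ℝ≥0∞) = ENNReal.ofReal 2 by simp, ← ENNReal.ofReal_mul (by norm_num),
        ENNReal.one_le_ofReal]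
      linarith [hs'.1]
    have h3 : ‖y e‖ₑ ^ 2 ≤ 3 * I := by
      have := mul_le_mul_right hav (2 : ℝ≥0∞)
      have h2 : (2 : ℝ≥0∞) * ENNReal.ofReal (1 / 2) = 1 := by
        rw [show (2 : ℝ≥0∞) = ENNReal.ofReal 2 by simp, ← ENNReal.ofReal_mul (by norm_num)]; norm_num
      rw [← mul_assoc, h2, one_mul, mul_add, ← mul_assoc, h2, one_mul] at this
      refine this.trans (le_of_eq ?_)
      rw [show (3 : ℝ≥0∞) = 2 + 1 by norm_num, add_mul, one_mul]
    rw [expi_coe, ← he]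
    refine h3.trans ((mul_le_mul_right hI2 3).trans (le_of_eq ?_))
    rw [← mul_assoc]; norm_num
  rw [hsum, lintegral_disc_eq_polar, Measure.volume_eq_prod, ← Measure.prod_restrict,
    lintegral_prod_symm _ hmeas, ← lintegral_torus (fun θ : Torus => ‖y (expi θ)‖ₑ ^ 2),
    ← lintegral_const_mul' _ _ (by simp)]
  exact setLIntegral_mono_ae' measurableSet_Ioo (.of_forall hray)

theorem LowerLip.lintegral_le {F F' : ℂ → ℂ} {c : ℝ} (hl : DiscC1.LowerLip F c) (h : DiscC1 F F')
    (g : ℂ → ℝ≥0∞) : ∫⁻ z in disc, g (F z) ≤ ENNReal.ofReal (c⁻¹ ^ 2) * ∫⁻ z in F '' disc, g z := by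
  rw [h.lintegral_image (hl.injOn.mono disc_subset_cdisc), ← lintegral_const_mul' _ _ (by finiteness)]
  refine setLIntegral_mono_ae' measurableSet_disc (.of_forall fun z hz => ?_)
  rw [← mul_assoc]
  refine le_mul_of_one_le_left' ?_
  rw [enorm_sq_eq_ofReal, ← ENNReal.ofReal_mul (by positivity), ENNReal.one_le_ofReal, ← mul_pow]
  refine one_le_pow₀ ?_
  rw [← div_eq_inv_mul, one_le_div hl.1]
  exact hl.le_norm_deriv h (disc_subset_cdisc hz)

theorem DiscC1.lintegral_gradient {F F' : ℂ → ℂ} (h : DiscC1 F F') (hinj : InjOn F disc) {φ : ℂ → ℝ}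
    (hφ : ∀ z ∈ disc, DifferentiableAt ℝ φ (F z)) :
    ∫⁻ z in F '' disc, ‖gradient φ z‖ₑ ^ 2 = ∫⁻ z in disc, ‖gradient (φ ∘ F) z‖ₑ ^ 2 := by
  rw [h.lintegral_image hinj]
  refine setLIntegral_congr_fun measurableSet_disc fun z hz => ?_
  rw [h.gradient_comp hz (hφ z hz), enorm_mul, mul_pow]
  congr 2
  rw [← ofReal_norm, ← ofReal_norm, RCLike.norm_conj]

/-- Uniqueness of the trace. -/
theorem HasTrace.unique {F F' : ℂ → ℂ} {c : ℝ} (h : DiscC1 F F') (hl : DiscC1.LowerLip F c)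
    {R₁ R₂ : ℂ → ℝ} {ρ₁ ρ₂ : Torus → ℝ} (h₁ : HasTrace (F '' disc) (bdry F) R₁ ρ₁)
    (h₂ : HasTrace (F '' disc) (bdry F) R₂ ρ₂) (hR : ContDiffOn ℝ 1 R₁ (F '' disc))
    (heq : EqOn R₁ R₂ (F '' disc)) (hm₁ : AEStronglyMeasurable ρ₁ volume)
    (hm₂ : AEStronglyMeasurable ρ₂ volume) : ρ₁ =ᵐ[volume] ρ₂ := by
  obtain ⟨v, hv, hv1, hv2, hv3⟩ := h₁
  obtain ⟨w, hw, hw1, hw2, hw3⟩ := h₂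
  have hinj := hl.injOn.mono disc_subset_cdisc
  have ho : IsOpen (F '' disc) := h.isOpen_image fun z hz => hl.deriv_ne_zero h (disc_subset_cdisc hz)
  have hmo : MeasurableSet (F '' disc) := ho.measurableSet
  rw [h.closure_image] at hv hw
  have hsub : F '' disc ⊆ F '' cdisc := image_mono disc_subset_cdisc
  have hgeq : EqOn (gradient R₁) (gradient R₂) (F '' disc) := fun z hz => by
    have : R₁ =ᶠ[𝓝 z] R₂ := heq.eventuallyEq_of_mem (ho.mem_nhds hz)
    simp only [gradient, this.fderiv_eq]
  have hsymm : ∀ {X E : Type} [MeasurableSpace X] [NormedAddCommGroup E] {μ : Measure X}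
      {a b : ℕ → X → E}, Tendsto (fun n => ∫⁻ x, ‖a n x - b n x‖ₑ ^ 2 ∂μ) atTop (𝓝 0) →
      Tendsto (fun n => ∫⁻ x, ‖b n x - a n x‖ₑ ^ 2 ∂μ) atTop (𝓝 0) := by
    intro X E _ _ μ a b hab
    refine hab.congr fun n => lintegral_congr fun x => ?_
    rw [← neg_sub, enorm_neg]
  have hw1' : Tendsto (fun n => ∫⁻ z in F '' disc, ‖w n z - R₁ z‖ₑ ^ 2) atTop (𝓝 0) :=
    hw1.congr fun n => setLIntegral_congr_fun hmo fun z hz => by simp only [heq hz]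
  have hw2' : Tendsto (fun n => ∫⁻ z in F '' disc, ‖gradient (w n) z - gradient R₁ z‖ₑ ^ 2)
      atTop (𝓝 0) :=
    hw2.congr fun n => setLIntegral_congr_fun hmo fun z hz => by simp only [hgeq hz]
  have hvm : ∀ n, AEStronglyMeasurable (v n) (volume.restrict (F '' disc)) := fun n =>
    ((hv n).1.mono hsub).aestronglyMeasurable hmo
  have hvg : ∀ n, AEStronglyMeasurable (gradient (v n)) (volume.restrict (F '' disc)) := fun n =>
    (continuousOn_gradient ho (hv n).2).aestronglyMeasurable hmo
  have t1 := tendsto_lintegral_sq_trans (c := w) hvm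
    (fun n => hR.continuousOn.aestronglyMeasurable hmo) hv1 (hsymm hw1')
  have t2 := tendsto_lintegral_sq_trans (c := fun n => gradient (w n)) hvg
    (fun n => (continuousOn_gradient ho hR).aestronglyMeasurable hmo) hv2 (hsymm hw2')
  have hyc : ∀ n, ContinuousOn ((fun z => v n z - w n z) ∘ F) cdisc := fun n =>
    ((hv n).1.sub (hw n).1).comp h.cont (mapsTo_image F cdisc)
  have hFs : ContDiffOn ℝ 1 F disc :=
    (h.differentiableOn.contDiffOn Metric.isOpen_ball).restrict_scalars ℝ
  have hys : ∀ n, ContDiffOn ℝ 1 ((fun z => v n z - w n z) ∘ F) disc := fun n =>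
    ((hv n).2.sub (hw n).2).comp hFs (mapsTo_image F disc)
  have hdiff : ∀ (u : ℂ → ℝ), ContDiffOn ℝ 1 u (F '' disc) → ∀ z ∈ F '' disc, DifferentiableAt ℝ u z :=
    fun u hu z hz => (hu.differentiableOn one_ne_zero).differentiableAt (ho.mem_nhds hz)
  -- The difference of two approximations is pulled back to the disc and the trace inequality
  -- applied: the L² norm is controlled by the lower bound of |F'|, and the Dirichlet integral is
  -- conformally invariant.
  have t3 : Tendsto (fun n => ∫⁻ θ : Torus, ‖v n (bdry F θ) - w n (bdry F θ)‖ₑ ^ 2) atTop (𝓝 0) := by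
    have hb : Tendsto (fun n => 6 * (ENNReal.ofReal (c⁻¹ ^ 2) * (∫⁻ z in F '' disc, ‖v n z - w n z‖ₑ ^ 2) +
        ∫⁻ z in F '' disc, ‖gradient (v n) z - gradient (w n) z‖ₑ ^ 2)) atTop (𝓝 0) := by
      have := ENNReal.Tendsto.const_mul (a := 6) ((ENNReal.Tendsto.const_mul
        (a := ENNReal.ofReal (c⁻¹ ^ 2)) t1 (Or.inr (by finiteness))).add t2) (Or.inr (by simp))
      simpa using this
    refine tendsto_of_tendsto_of_tendsto_of_le_of_le tendsto_const_nhds hb (fun _ => zero_le) fun n => ?_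
    refine (lintegral_trace_le (hyc n) (hys n)).trans ?_
    refine mul_le_mul_right (add_le_add ?_ ?_) 6
    · exact LowerLip.lintegral_le hl h fun z => ‖v n z - w n z‖ₑ ^ 2
    · rw [← h.lintegral_gradient (φ := fun z => v n z - w n z) hinj fun z hz =>
        (hdiff _ (hv n).2 _ (mem_image_of_mem F hz)).sub (hdiff _ (hw n).2 _ (mem_image_of_mem F hz))]
      refine le_of_eq (setLIntegral_congr_fun hmo fun z hz => ?_)
      have : gradient (fun z => v n z - w n z) z = gradient (v n) z - gradient (w n) z := by
        simp only [gradient]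
        rw [← map_sub, ← fderiv_fun_sub (hdiff _ (hv n).2 z hz) (hdiff _ (hw n).2 z hz)]
      simp only [this]
  have hγ : ∀ u : ℂ → ℝ, ContinuousOn u (F '' cdisc) →
      AEStronglyMeasurable (fun θ : Torus => u (bdry F θ)) volume := fun u hu =>
    ((hu.comp h.cont (mapsTo_image F cdisc)).comp_continuous continuous_expi
      expi_mem_cdisc).aestronglyMeasurable
  have t4 := tendsto_lintegral_sq_trans (c := fun _ => ρ₂) (fun n => hγ _ (hv n).1)
    (fun n => hγ _ (hw n).1) t3 hw3
  have t5 := tendsto_lintegral_sq_trans (c := fun _ => ρ₂) (fun _ => hm₁) (fun n => hγ _ (hv n).1)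
    (hsymm hv3) t4
  have h0 := tendsto_nhds_unique tendsto_const_nhds t5
  have hm0 : AEMeasurable (fun θ => ‖ρ₁ θ - ρ₂ θ‖ₑ ^ 2) volume := ((hm₁.sub hm₂).enorm).pow_const 2
  rw [lintegral_eq_zero_iff' hm0] at h0
  filter_upwards [h0] with θ hθ
  have : ‖ρ₁ θ - ρ₂ θ‖ₑ = 0 := by simpa using hθ
  exact sub_eq_zero.1 (enorm_eq_zero.1 this)

theorem hasPower_taylor {G : ℂ → ℂ} (h : DifferentiableOn ℂ G disc) :
    HasPower (fun n => ((n.factorial : ℂ))⁻¹ * iteratedDeriv n G 0) G := by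
  intro z hz
  have := Complex.hasSum_taylorSeries_on_ball h hz
  have e : (fun n : ℕ => ((n.factorial : ℂ))⁻¹ * iteratedDeriv n G 0 * z ^ n) =
      fun n : ℕ => ((n.factorial : ℂ))⁻¹ • (z - 0) ^ n • iteratedDeriv n G 0 := by
    funext n; rw [smul_eq_mul, smul_eq_mul, sub_zero]; ring
  rwa [e]

theorem HasPower.iteratedDeriv_eq {b : ℕ → ℂ} {B : ℂ → ℂ} (h : HasPower b B) (n : ℕ) :
    iteratedDeriv n B 0 = n.factorial * b n := by
  have h1 := (DiscSeries.hasFPowerSeriesOnBall h).factorial_smul 1 n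
  rw [iteratedDeriv_eq_iteratedFDeriv, ← h1]
  simp [FormalMultilinearSeries.ofScalars]

theorem HasPower.deriv {b : ℕ → ℂ} {B : ℂ → ℂ} (h : HasPower b B) :
    HasPower (fun n => (n + 1) * b (n + 1)) (_root_.deriv B) := by
  have h1 := hasPower_taylor (G := _root_.deriv B)
    (h.analyticOnNhd.differentiableOn.deriv Metric.isOpen_ball)
  have e : (fun n : ℕ => ((n.factorial : ℂ))⁻¹ * iteratedDeriv n (_root_.deriv B) 0) =
      fun n => (n + 1) * b (n + 1) := by
    funext n
    rw [← iteratedDeriv_succ', h.iteratedDeriv_eq, Nat.factorial_succ]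
    have : (n.factorial : ℂ) ≠ 0 := by exact_mod_cast n.factorial_ne_zero
    push_cast; field_simp
  rwa [e] at h1

/-! ### The smooth part -/

section smooth

variable {F F' : ℂ → ℂ} {c : ℝ} {α : ℂ}

theorem DiscC1.continuousOn_dslope (h : DiscC1 F F') (hα : α ∈ disc) :
    ContinuousOn (dslope F α) cdisc :=
  (_root_.continuousOn_dslope (mem_of_superset (Metric.isOpen_ball.mem_nhds hα) disc_subset_cdisc)).2
    ⟨h.cont, (h.hasDerivAt α hα).differentiableAt⟩

theorem DiscC1.differentiableOn_dslope (h : DiscC1 F F') (hα : α ∈ disc) :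
    DifferentiableOn ℂ (dslope F α) disc :=
  (Complex.differentiableOn_dslope (Metric.isOpen_ball.mem_nhds hα)).2 h.differentiableOn

theorem DiscC1.le_norm_dslope (h : DiscC1 F F') (hl : DiscC1.LowerLip F c) (hα : α ∈ disc) {z : ℂ}
    (hz : z ∈ cdisc) : c ≤ ‖dslope F α z‖ := by
  by_cases hne : z = α
  · rw [hne, dslope_same, (h.hasDerivAt α hα).deriv]
    exact hl.le_norm_deriv h (disc_subset_cdisc hα)
  · rw [dslope_of_ne _ hne, slope_def_field, norm_div, le_div_iff₀ (norm_pos_iff.2 (sub_ne_zero.2 hne))]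
    exact hl.2 z hz α (disc_subset_cdisc hα)

theorem DiscC1.dslope_ne_zero (h : DiscC1 F F') (hl : DiscC1.LowerLip F c) (hα : α ∈ disc) {z : ℂ}
    (hz : z ∈ cdisc) : dslope F α z ≠ 0 :=
  norm_pos_iff.1 (hl.1.trans_le (h.le_norm_dslope hl hα hz))

theorem sub_eq_dslope_mul (F : ℂ → ℂ) (α z : ℂ) : F z - F α = (z - α) * dslope F α z :=
  (sub_smul_dslope F α z).symm

/-- F'' need not be bounded, but the derivative of the difference quotient is. On a smaller closed
disc containing α use compactness; outside it the derivative equals (F' - dslope)/(z - α), with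
bounded numerator and |z - α| bounded below. -/
theorem DiscC1.exists_bound_deriv_dslope (h : DiscC1 F F') (hα : α ∈ disc) :
    ∃ M : ℝ, ∀ z ∈ disc, ‖deriv (dslope F α) z‖ ≤ M := by
  obtain ⟨r, hr1, hr2⟩ := exists_between (mem_ball_zero_iff.1 hα)
  have hsub : Metric.closedBall (0 : ℂ) r ⊆ disc := Metric.closedBall_subset_ball hr2
  have hD := h.differentiableOn_dslope hα
  obtain ⟨M, hM⟩ := (isCompact_closedBall (0 : ℂ) r).exists_bound_of_continuousOn
    ((hD.deriv Metric.isOpen_ball).continuousOn.mono hsub)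
  obtain ⟨C, hC⟩ := h.exists_bound
  have hC0 : 0 ≤ C := (norm_nonneg _).trans (hC 0 (by simp))
  refine ⟨max M (2 * C / (r - ‖α‖)), fun z hz => ?_⟩
  by_cases hzr : z ∈ Metric.closedBall (0 : ℂ) r
  · exact (hM z hzr).trans (le_max_left _ _)
  refine le_trans ?_ (le_max_right _ _)
  rw [mem_closedBall_zero_iff, not_le] at hzr
  have hza : r - ‖α‖ ≤ ‖z - α‖ := by linarith [norm_sub_norm_le z α]
  have hpos : 0 < r - ‖α‖ := by linarith
  have hne : z - α ≠ 0 := norm_pos_iff.1 (hpos.trans_le hza)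
  have hd : HasDerivAt (dslope F α) (_root_.deriv (dslope F α) z) z :=
    (hD.differentiableAt (Metric.isOpen_ball.mem_nhds hz)).hasDerivAt
  have h1 : HasDerivAt (fun w => (w - α) * dslope F α w)
      (1 * dslope F α z + (z - α) * _root_.deriv (dslope F α) z) z :=
    ((hasDerivAt_id z).sub_const α).mul hd
  have h2 : HasDerivAt (fun w => (w - α) * dslope F α w) (F' z) z := by
    simp only [← sub_eq_dslope_mul]
    exact (h.hasDerivAt z hz).sub_const _
  have h3 := h1.unique h2
  have h4 : _root_.deriv (dslope F α) z = (F' z - dslope F α z) / (z - α) := by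
    rw [eq_div_iff hne, ← h3]; ring
  have h5 : ‖dslope F α z‖ ≤ C := by
    have e : dslope F α z = (F z - F α) / (z - α) := by
      rw [eq_div_iff hne, sub_eq_dslope_mul]; ring
    rw [e, norm_div, div_le_iff₀ (norm_pos_iff.2 hne)]
    exact h.lipschitz_of_bound hC (disc_subset_cdisc hz) (disc_subset_cdisc hα)
  rw [h4, norm_div]
  refine div_le_div₀ (by positivity) ?_ hpos hza
  linarith [norm_sub_le (F' z) (dslope F α z), hC z (disc_subset_cdisc hz)]

/-- The smooth part of the pull-back of the regular part to the disc. -/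
def smoothPart {k : ℕ} (F : ℂ → ℂ) (d : Fin k → ℤ) (α : Fin k → ℂ) (z : ℂ) : ℝ :=
  ∑ j, (d j : ℝ) * (Real.log ‖1 - (starRingEnd ℂ) (α j) * z‖ - Real.log ‖dslope F (α j) z‖)

/-- The complex derivative of the smooth part. -/
def smoothDeriv {k : ℕ} (F : ℂ → ℂ) (d : Fin k → ℤ) (α : Fin k → ℂ) (z : ℂ) : ℂ :=
  ∑ j, (d j : ℂ) * (-(starRingEnd ℂ) (α j) / (1 - (starRingEnd ℂ) (α j) * z) -
    deriv (dslope F (α j)) z / dslope F (α j) z)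

end smooth

section smoothk

variable {F F' : ℂ → ℂ} {c : ℝ} {k : ℕ} {α : Fin k → ℂ} (d : Fin k → ℤ)

theorem hasGradientAt_sum {ι : Type*} (s : Finset ι) {f : ι → ℂ → ℝ} {f' : ι → ℂ} {z : ℂ}
    (h : ∀ i ∈ s, HasGradientAt (f i) (f' i) z) :
    HasGradientAt (fun w => ∑ i ∈ s, f i w) (∑ i ∈ s, f' i) z := by
  rw [hasGradientAt_iff_hasFDerivAt, map_sum]
  exact HasFDerivAt.fun_sum fun i hi => (h i hi).hasFDerivAt

theorem hasGradientAt_add {f g : ℂ → ℝ} {f' g' z : ℂ} (hf : HasGradientAt f f' z)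
    (hg : HasGradientAt g g' z) : HasGradientAt (fun w => f w + g w) (f' + g') z := by
  rw [hasGradientAt_iff_hasFDerivAt, map_add]
  exact hf.hasFDerivAt.add hg.hasFDerivAt

theorem hasGradientAt_sub {f g : ℂ → ℝ} {f' g' z : ℂ} (hf : HasGradientAt f f' z)
    (hg : HasGradientAt g g' z) : HasGradientAt (fun w => f w - g w) (f' - g') z := by
  rw [hasGradientAt_iff_hasFDerivAt, map_sub]
  exact hf.hasFDerivAt.sub hg.hasFDerivAt

theorem hasGradientAt_const_mul (a : ℝ) {f : ℂ → ℝ} {f' z : ℂ} (hf : HasGradientAt f f' z) :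
    HasGradientAt (fun w => a * f w) (a * f') z := by
  rw [hasGradientAt_iff_hasFDerivAt, ← Complex.real_smul, map_smul]
  exact hf.hasFDerivAt.const_mul a

theorem DiscC1.hasGradientAt_smoothPart (h : DiscC1 F F') (hl : DiscC1.LowerLip F c)
    (hα : ∀ j, α j ∈ disc) {z : ℂ} (hz : z ∈ disc) :
    HasGradientAt (smoothPart F d α) ((starRingEnd ℂ) (smoothDeriv F d α z)) z := by
  have hz' := disc_subset_cdisc hz
  rw [smoothDeriv, map_sum]
  refine hasGradientAt_sum _ fun j _ => ?_
  rw [map_mul, map_sub]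
  have h1 : HasDerivAt (fun z => 1 - (starRingEnd ℂ) (α j) * z) (-(starRingEnd ℂ) (α j)) z := by
    simpa using ((hasDerivAt_id z).const_mul ((starRingEnd ℂ) (α j))).const_sub 1
  have h2 := ((h.differentiableOn_dslope (hα j)).differentiableAt
    (Metric.isOpen_ball.mem_nhds hz)).hasDerivAt
  have := hasGradientAt_const_mul (d j : ℝ) (hasGradientAt_sub
    (hasGradientAt_log_norm h1 (one_sub_conj_mul_ne_zero (hα j) hz'))
    (hasGradientAt_log_norm h2 (h.dslope_ne_zero hl (hα j) hz')))
  simpa using this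

theorem DiscC1.continuousOn_smoothPart (h : DiscC1 F F') (hl : DiscC1.LowerLip F c)
    (hα : ∀ j, α j ∈ disc) : ContinuousOn (smoothPart F d α) cdisc := by
  unfold smoothPart
  refine continuousOn_finsetSum _ fun j _ => continuousOn_const.mul (ContinuousOn.sub ?_ ?_)
  · exact ContinuousOn.log (by fun_prop) fun z hz =>
      norm_ne_zero_iff.2 (one_sub_conj_mul_ne_zero (hα j) hz)
  · exact ContinuousOn.log (h.continuousOn_dslope (hα j)).norm fun z hz =>
      norm_ne_zero_iff.2 (h.dslope_ne_zero hl (hα j) hz)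

theorem DiscC1.differentiableOn_smoothDeriv (h : DiscC1 F F') (hl : DiscC1.LowerLip F c)
    (hα : ∀ j, α j ∈ disc) : DifferentiableOn ℂ (smoothDeriv F d α) disc := by
  unfold smoothDeriv
  refine DifferentiableOn.fun_sum fun j _ => DifferentiableOn.const_mul (DifferentiableOn.sub ?_ ?_) _
  · exact DifferentiableOn.div (by fun_prop) (by fun_prop) fun z hz =>
      one_sub_conj_mul_ne_zero (hα j) (disc_subset_cdisc hz)
  · exact ((h.differentiableOn_dslope (hα j)).deriv Metric.isOpen_ball).div
      (h.differentiableOn_dslope (hα j)) fun z hz => h.dslope_ne_zero hl (hα j) (disc_subset_cdisc hz)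

theorem DiscC1.exists_bound_smoothDeriv (h : DiscC1 F F') (hl : DiscC1.LowerLip F c)
    (hα : ∀ j, α j ∈ disc) : ∃ M : ℝ, ∀ z ∈ disc, ‖smoothDeriv F d α z‖ ≤ M := by
  choose M hM using fun j => h.exists_bound_deriv_dslope (hα j)
  refine ⟨∑ j, ‖(d j : ℂ)‖ * (‖α j‖ / (1 - ‖α j‖) + M j / c), fun z hz => ?_⟩
  refine (norm_sum_le _ _).trans (Finset.sum_le_sum fun j _ => ?_)
  rw [norm_mul]
  gcongr
  refine (norm_sub_le _ _).trans (add_le_add ?_ ?_)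
  · rw [norm_div, norm_neg, RCLike.norm_conj]
    have hz1 := mem_ball_zero_iff.1 hz
    have ha := mem_ball_zero_iff.1 (hα j)
    refine div_le_div_of_nonneg_left (norm_nonneg _) (by linarith) ?_
    have := norm_sub_norm_le 1 ((starRingEnd ℂ) (α j) * z)
    rw [norm_one, norm_mul, RCLike.norm_conj] at this
    nlinarith [norm_nonneg (α j), norm_nonneg z]
  · rw [norm_div]
    exact div_le_div₀ ((norm_nonneg _).trans (hM j z hz)) (hM j z hz) hl.1
      (h.le_norm_dslope hl (hα j) (disc_subset_cdisc hz))

/-- This makes the test functions of the weak formulation, which are C¹ only within a closed set,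
usable in the integration by parts on the disc. -/
theorem DiscC1.testFn (h : DiscC1 F F') (hl : DiscC1.LowerLip F c) {φ : ℂ → ℝ}
    (hφ : ContDiffOn ℝ 1 φ (F '' cdisc)) : TestFn (φ ∘ F) := by
  have ho : IsOpen (F '' disc) := h.isOpen_image fun z hz => hl.deriv_ne_zero h (disc_subset_cdisc hz)
  have hsub : F '' disc ⊆ F '' cdisc := image_mono disc_subset_cdisc
  -- Unique differentiability is inherited from the closed disc because F' is invertible up to the
  -- boundary; the derivative within the compact image is then continuous, hence bounded.
  have hu : UniqueDiffOn ℝ (F '' cdisc) := by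
    rintro _ ⟨z, hz, rfl⟩
    refine (h.hasFDerivWithinAt hz).uniqueDiffWithinAt (uniqueDiffOn_cdisc z hz) ?_
    refine Function.Surjective.denseRange fun w => ⟨(F' z)⁻¹ * w, ?_⟩
    have := hl.deriv_ne_zero h hz
    simp [this]
  have hcpt : IsCompact (F '' cdisc) := (isCompact_closedBall 0 1).image_of_continuousOn h.cont
  obtain ⟨M, hM⟩ := hcpt.exists_bound_of_continuousOn (hφ.continuousOn_fderivWithin hu le_rfl)
  obtain ⟨C, hC⟩ := h.exists_bound
  refine ⟨hφ.continuousOn.comp h.cont (mapsTo_image F cdisc), (hφ.mono hsub).comp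
    ((h.differentiableOn.contDiffOn Metric.isOpen_ball).restrict_scalars ℝ) (mapsTo_image F disc),
    C * M, fun z hz => ?_⟩
  have hmem := ho.mem_nhds (mem_image_of_mem F hz)
  have hd : DifferentiableAt ℝ φ (F z) :=
    ((hφ.mono hsub).differentiableOn one_ne_zero).differentiableAt hmem
  rw [h.gradient_comp hz hd, norm_mul, RCLike.norm_conj]
  have h1 : ‖gradient φ (F z)‖ ≤ M := by
    have := hM (F z) (hsub (mem_image_of_mem F hz))
    rw [fderivWithin_of_mem_nhds (mem_of_superset hmem hsub)] at this
    rwa [gradient, LinearIsometryEquiv.norm_map]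
  have h2 := hC z (disc_subset_cdisc hz)
  exact mul_le_mul h2 h1 (norm_nonneg _) ((norm_nonneg _).trans h2)

/-- The left-hand side of the weak formulation, in the disc. -/
theorem DiscC1.integral_inner_gradient (h : DiscC1 F F') (hl : DiscC1.LowerLip F c)
    (hα : ∀ j, α j ∈ disc) {R φ : ℂ → ℝ} {G' : ℂ → ℂ}
    (hR : ∀ z ∈ disc, DifferentiableAt ℝ R (F z))
    (hg : ∀ z ∈ disc, gradient (R ∘ F) z = (starRingEnd ℂ) (smoothDeriv F d α z + G' z))
    (hG : IntegrableOn G' disc) (hφ : ContDiffOn ℝ 1 φ (F '' cdisc)) :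
    ∫ z in F '' disc, inner ℝ (gradient (fun w => R w + logSum d (F ∘ α) w) z) (gradient φ z) =
      ∑ j, (d j : ℝ) * ((∫ θ : Torus, φ (F (expi θ))) - 2 * π * φ (F (α j))) +
        (∫ z in disc, G' z * gradient (φ ∘ F) z).re := by
  have hη := h.testFn hl hφ
  obtain ⟨M, hM⟩ := hη.bounded
  have hinj := hl.injOn.mono disc_subset_cdisc
  have ho : IsOpen (F '' disc) := h.isOpen_image fun z hz => hl.deriv_ne_zero h (disc_subset_cdisc hz)
  have hsub : F '' disc ⊆ F '' cdisc := image_mono disc_subset_cdisc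
  have iG : IntegrableOn (fun z => G' z * gradient (φ ∘ F) z) disc :=
    hG.mul_bdd (c := M) (hη.continuousOn_gradient.aestronglyMeasurable measurableSet_disc)
      ((ae_restrict_iff' measurableSet_disc).2 (.of_forall hM))
  have hre : ∀ {u : ℂ → ℂ}, IntegrableOn u disc → ∫ z in disc, (u z).re = (∫ z in disc, u z).re :=
    fun hu => integral_re hu
  have hreI : ∀ {u : ℂ → ℂ}, IntegrableOn u disc → IntegrableOn (fun z => (u z).re) disc :=
    fun hu => hu.re
  have hpt : ∀ z ∈ disc, (∀ j, z ≠ α j) →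
      (‖F' z‖ ^ 2) • inner ℝ (gradient (fun w => R w + logSum d (F ∘ α) w) (F z)) (gradient φ (F z)) =
      ∑ j, (d j : ℝ) * (neumannK (α j) z * gradient (φ ∘ F) z).re +
        (G' z * gradient (φ ∘ F) z).re := by
    intro z hz hne
    have hz' := disc_subset_cdisc hz
    have hF0 := hl.deriv_ne_zero h hz'
    have hFne : ∀ j, F z - F (α j) ≠ 0 := fun j =>
      sub_ne_zero.2 fun he => hne j (hinj hz (hα j) he)
    have g1 : HasGradientAt (fun w => R w + logSum d (F ∘ α) w)
        (gradient R (F z) + ∑ j, (d j : ℝ) * (starRingEnd ℂ) (1 / (F z - F (α j)))) (F z) := by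
      refine hasGradientAt_add (hR z hz).hasGradientAt (hasGradientAt_sum _ fun j _ =>
        hasGradientAt_const_mul _ ?_)
      exact hasGradientAt_log_norm ((hasDerivAt_id (F z)).sub_const (F (α j))) (hFne j)
    have g2 : (starRingEnd ℂ) (F' z) * gradient R (F z) =
        (starRingEnd ℂ) (smoothDeriv F d α z + G' z) := by
      rw [← hg z hz, h.gradient_comp hz (hR z hz)]
    have g3 : (starRingEnd ℂ) (F' z) * gradient φ (F z) = gradient (φ ∘ F) z := by
      rw [h.gradient_comp hz]
      exact ((hφ.mono hsub).differentiableOn one_ne_zero).differentiableAt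
        (ho.mem_nhds (mem_image_of_mem F hz))
    -- From F - F(α_j) = (z - α_j) dslope one gets F'/(F - F(α_j)) = 1/(z - α_j) + dslope'/dslope.
    -- The last term cancels in `smoothDeriv`, leaving exactly the Neumann kernels.
    have g4 : smoothDeriv F d α z + ∑ j, (d j : ℂ) * (F' z / (F z - F (α j))) =
        ∑ j, (d j : ℂ) * neumannK (α j) z := by
      rw [smoothDeriv, ← Finset.sum_add_distrib]
      refine Finset.sum_congr rfl fun j _ => ?_
      rw [← mul_add]
      congr 1
      have hza : z - α j ≠ 0 := sub_ne_zero.2 (hne j)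
      have hD := h.dslope_ne_zero hl (hα j) hz'
      have hd : HasDerivAt (dslope F (α j)) (_root_.deriv (dslope F (α j)) z) z :=
        ((h.differentiableOn_dslope (hα j)).differentiableAt (Metric.isOpen_ball.mem_nhds hz)).hasDerivAt
      have h1 : HasDerivAt (fun w => (w - α j) * dslope F (α j) w)
          (1 * dslope F (α j) z + (z - α j) * _root_.deriv (dslope F (α j)) z) z :=
        ((hasDerivAt_id z).sub_const (α j)).mul hd
      have h2 : HasDerivAt (fun w => (w - α j) * dslope F (α j) w) (F' z) z := by
        simp only [← sub_eq_dslope_mul]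
        exact (h.hasDerivAt z hz).sub_const _
      rw [← h1.unique h2, sub_eq_dslope_mul, neumannK]
      have : (1 * dslope F (α j) z + (z - α j) * _root_.deriv (dslope F (α j)) z) /
          ((z - α j) * dslope F (α j) z) =
          1 / (z - α j) + _root_.deriv (dslope F (α j)) z / dslope F (α j) z := by
        field_simp
      rw [this]; ring
    have g5 : (starRingEnd ℂ) (F' z) * (gradient R (F z) +
        ∑ j, (d j : ℝ) * (starRingEnd ℂ) (1 / (F z - F (α j)))) =
        (starRingEnd ℂ) (∑ j, (d j : ℂ) * neumannK (α j) z + G' z) := by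
      rw [mul_add, g2, ← g4, Finset.mul_sum]
      simp only [map_add, map_sum, map_mul, map_div₀, map_one, map_intCast,
        Complex.ofReal_intCast]
      have : ∀ j, (starRingEnd ℂ) (F' z) * ((d j : ℂ) * (1 / (starRingEnd ℂ) (F z - F (α j)))) =
          (d j : ℂ) * ((starRingEnd ℂ) (F' z) / (starRingEnd ℂ) (F z - F (α j))) := fun j => by ring
      simp only [this]
      ring
    rw [g1.gradient]
    set V := gradient R (F z) + ∑ j, (d j : ℝ) * (starRingEnd ℂ) (1 / (F z - F (α j))) with hV
    have g6 : (‖F' z‖ ^ 2) • inner ℝ V (gradient φ (F z)) =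
        inner ℝ ((starRingEnd ℂ) (F' z) * V) ((starRingEnd ℂ) (F' z) * gradient φ (F z)) := by
      rw [Complex.inner, Complex.inner, smul_eq_mul, ← Complex.re_ofReal_mul]
      congr 1
      rw [← Complex.normSq_eq_norm_sq, ← Complex.mul_conj]
      simp only [map_mul, Complex.conj_conj]
      ring
    rw [g6, g3, g5, Complex.inner, Complex.conj_conj, mul_comm, add_mul, Complex.add_re, Finset.sum_mul,
      Complex.re_sum]
    congr 1
    refine Finset.sum_congr rfl fun j _ => ?_
    rw [mul_assoc, ← Complex.ofReal_intCast, Complex.re_ofReal_mul]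
  have hae : ∀ᵐ z ∂(volume.restrict disc),
      (‖F' z‖ ^ 2) • inner ℝ (gradient (fun w => R w + logSum d (F ∘ α) w) (F z)) (gradient φ (F z)) =
      ∑ j, (d j : ℝ) * (neumannK (α j) z * gradient (φ ∘ F) z).re +
        (G' z * gradient (φ ∘ F) z).re := by
    rw [ae_restrict_iff' measurableSet_disc]
    have hfin : volume (range α) = 0 := (finite_range α).measure_zero _
    filter_upwards [compl_mem_ae_iff.2 hfin] with z h0 hz
    exact hpt z hz fun j he => h0 ⟨j, he.symm⟩
  have iN := fun j => hη.integrable_neumannK (hα j)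
  rw [h.integral_image hinj, integral_congr_ae hae, integral_add
    (integrable_finsetSum _ fun j _ => (hreI (iN j).1).const_mul _) (hreI iG), hre iG,
    integral_finsetSum _ fun j _ => (hreI (iN j).1).const_mul _]
  congr 1
  refine Finset.sum_congr rfl fun j _ => ?_
  rw [integral_const_mul, (iN j).2]
  rfl

end smoothk

/-! ### The holomorphic function attached to the current. -/

/-- The coefficients of the holomorphic function with Neumann datum `h ∧ ∂h/∂τ`. -/
def bCoeff (h : Torus → ℂ) (n : ℕ) : ℂ := wedgeCoeff h (-n) / (π * n)

/-- The holomorphic function in the disc with Neumann datum `h ∧ ∂h/∂τ`. -/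
def bFun (h : Torus → ℂ) (z : ℂ) : ℂ := ∑' n, bCoeff h n * z ^ n

/-- The form `h ∧ ∂h/∂τ` is in `H^{-1/2}`. -/
def FiniteEnergy (h : Torus → ℂ) : Prop := Summable fun n : ℕ => (n : ℝ) * ‖bCoeff h n‖ ^ 2

theorem bCoeff_zero (h : Torus → ℂ) : bCoeff h 0 = 0 := by simp [bCoeff]

theorem wedgeCoeff_neg_eq (h : Torus → ℂ) {n : ℕ} (hn : n ≠ 0) :
    wedgeCoeff h (-n) = π * (n * bCoeff h n) := by
  have h1 : (π : ℂ) ≠ 0 := by exact_mod_cast pi_ne_zero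
  have h2 : (n : ℂ) ≠ 0 := by exact_mod_cast hn
  rw [bCoeff]; field_simp

theorem FiniteEnergy.summable_sq {h : Torus → ℂ} (he : FiniteEnergy h) :
    Summable fun n : ℕ => ‖bCoeff h n‖ ^ 2 := by
  refine Summable.of_nonneg_of_le (fun n => by positivity) (fun n => ?_) he
  rcases Nat.eq_zero_or_pos n with rfl | hn
  · simp [bCoeff_zero]
  · exact le_mul_of_one_le_left (by positivity) (by exact_mod_cast hn)

theorem hasPower_of_sq {b : ℕ → ℂ} (hb : Summable fun n => ‖b n‖ ^ 2) :
    HasPower b fun z => ∑' n, b n * z ^ n := by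
  intro z hz
  have hz1 := mem_ball_zero_iff.1 hz
  refine Summable.hasSum (Summable.of_norm ?_)
  have hg : Summable fun n : ℕ => (‖z‖ ^ 2) ^ n :=
    summable_geometric_of_lt_one (by positivity) (by nlinarith [norm_nonneg z])
  refine Summable.of_nonneg_of_le (fun n => norm_nonneg _) (fun n => ?_) (hb.add hg)
  rw [norm_mul, norm_pow, ← pow_mul, mul_comm 2 n, pow_mul]
  nlinarith [sq_nonneg (‖b n‖ - ‖z‖ ^ n), sq_nonneg (‖b n‖), sq_nonneg (‖z‖ ^ n)]

theorem FiniteEnergy.hasPower {h : Torus → ℂ} (he : FiniteEnergy h) : HasPower (bCoeff h) (bFun h) :=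
  hasPower_of_sq he.summable_sq

theorem FiniteEnergy.summable_deriv {h : Torus → ℂ} (he : FiniteEnergy h) :
    Summable fun n : ℕ => ‖((n : ℂ) + 1) * bCoeff h (n + 1)‖ ^ 2 / (n + 1) := by
  refine ((summable_nat_add_iff 1).2 he).congr fun n => ?_
  have : ‖(n : ℂ) + 1‖ = n + 1 := by
    rw [← Nat.cast_add_one, Complex.norm_natCast]; push_cast; rfl
  rw [norm_mul, this, mul_pow]; push_cast; field_simp

theorem finiteEnergy_of_summable_deriv {h : Torus → ℂ}
    (hs : Summable fun n : ℕ => ‖((n : ℂ) + 1) * bCoeff h (n + 1)‖ ^ 2 / (n + 1)) :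
    FiniteEnergy h := by
  refine (summable_nat_add_iff 1).1 (hs.congr fun n => ?_)
  have : ‖(n : ℂ) + 1‖ = n + 1 := by
    rw [← Nat.cast_add_one, Complex.norm_natCast]; push_cast; rfl
  rw [norm_mul, this, mul_pow]; push_cast; field_simp

theorem integral_mul_expi_pow (u : Torus → ℂ) (m : ℕ) :
    ∫ θ : Torus, u θ * expi θ ^ m = 2 * π * fourierCoeff u (-m) := by
  have e : ∀ θ : Torus, u θ * expi θ ^ m = fourier (-(-m : ℤ)) θ • u θ := fun θ => by
    rw [neg_neg, fourier_eq_expi_zpow, zpow_natCast, smul_eq_mul, mul_comm]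
  simp only [e]
  rw [volume_torus, integral_smul_measure, ENNReal.toReal_ofReal two_pi_pos.le, fourierCoeff,
    Complex.real_smul]
  push_cast; rfl

theorem fourierCoeff_re_mul (l : ℂ) (m : ℕ) (n : ℤ) :
    fourierCoeff (fun θ : Torus => (((l * expi θ ^ m).re : ℝ) : ℂ)) n =
      (1 / 2 : ℂ) * (l * (if (m : ℤ) = n then 1 else 0) +
        (starRingEnd ℂ) l * (if (m : ℤ) = -n then 1 else 0)) := by
  have e : ∀ θ : Torus, l * expi θ ^ m = l * fourier (m : ℤ) θ := fun θ => by
    rw [fourier_eq_expi_zpow, zpow_natCast]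
  have h1 : ∀ n, fourierCoeff (fun θ : Torus => l * fourier (m : ℤ) θ) n =
      l * (if (m : ℤ) = n then 1 else 0) := fun n => by
    rw [← fourierCoeff_fourier]
    exact fourierCoeff.const_mul _ _ _
  simp only [e]
  rw [fourierCoeff_re (h := fun θ => l * fourier (m : ℤ) θ) ((memH_fourier m).1.const_mul l), h1, h1,
    map_mul]
  congr 4
  split_ifs <;> simp

/-- Only the frequencies m and -m occur, and their contributions are conjugate to each other. These
test functions therefore isolate one coefficient of the current. -/
theorem wedgePairing_re_mul (h : Torus → ℂ) (l : ℂ) {m : ℕ} (hm : m ≠ 0) :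
    wedgePairing h (fun θ => (l * expi θ ^ m).re) = ((starRingEnd ℂ) l * wedgeCoeff h (-m)).re := by
  have hm' : (m : ℤ) ≠ 0 := by exact_mod_cast hm
  unfold wedgePairing
  rw [tsum_eq_sum (s := {(m : ℤ), -(m : ℤ)})]
  · rw [Finset.sum_pair (by omega), fourierCoeff_re_mul, fourierCoeff_re_mul, neg_neg, if_pos rfl,
      if_neg (by omega)]
    have := wedgeCoeff_neg h m
    have h2 : wedgeCoeff h m = (starRingEnd ℂ) (wedgeCoeff h (-m)) := by rw [this, Complex.conj_conj]
    rw [h2]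
    simp [Complex.mul_re]
    ring
  · intro n hn
    rw [Finset.mem_insert, Finset.mem_singleton, not_or] at hn
    rw [fourierCoeff_re_mul, if_neg (fun h => hn.1 h.symm), if_neg (fun h => hn.2 (by omega))]
    simp

/-! ### Uniqueness of the regular part in conformal coordinates. -/

section pullback

variable {F F' : ℂ → ℂ} {c : ℝ} {k : ℕ} {α : Fin k → ℂ} {d : Fin k → ℤ}

theorem bdry_injective (hl : DiscC1.LowerLip F c) : Function.Injective (bdry F) := fun x y hxy =>
  expi_injective (hl.injOn (expi_mem_cdisc x) (expi_mem_cdisc y) hxy)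

theorem push_comp_bdry (hl : DiscC1.LowerLip F c) {E : Type} (u : Torus → E) :
    push F u ∘ bdry F = u := by
  funext θ
  simp only [push, Function.comp_apply]
  rw [Function.leftInverse_invFun (bdry_injective hl)]

theorem harmonicOnNhd_comp (h : DiscC1 F F') {R : ℂ → ℝ}
    (hR : InnerProductSpace.HarmonicOnNhd R (F '' disc)) :
    InnerProductSpace.HarmonicOnNhd (R ∘ F) disc := by
  intro z hz
  obtain ⟨ε, hε, hb⟩ := Metric.isOpen_iff.1
    (InnerProductSpace.isOpen_setOfPred_harmonicAt (f := R)) _ (hR _ (mem_image_of_mem F hz))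
  obtain ⟨g, hg, hgR⟩ := InnerProductSpace.HarmonicOnNhd.exists_analyticOnNhd_ball_re_eq
    (f := R) (z := F z) (R := ε) fun y hy => hb hy
  have hFa : AnalyticAt ℂ F z := h.differentiableOn.analyticAt (Metric.isOpen_ball.mem_nhds hz)
  have h1 : AnalyticAt ℂ (fun w => g (F w)) z := (hg _ (Metric.mem_ball_self hε)).comp hFa
  refine (InnerProductSpace.harmonicAt_congr_nhds ?_).2 h1.harmonicAt_re
  have := hFa.continuousAt.preimage_mem_nhds (Metric.ball_mem_nhds (F z) hε)
  filter_upwards [this] with w hw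
  exact (hgR hw).symm

theorem HarmonicOn.contDiffOn {R : ℂ → ℝ} {Ω : Set ℂ} (hR : InnerProductSpace.HarmonicOnNhd R Ω) :
    ContDiffOn ℝ 1 R Ω := fun z hz => ((hR z hz).1.of_le (by norm_num)).contDiffWithinAt

/-- R ∘ F is the real part of a holomorphic g. The weak equation, tested with harmonic polynomials
in the disc coordinate, fixes all Taylor coefficients of g' - smoothDeriv to be those of the
derivative of `bFun u`. So `R` is known up to a constant, and its finite Dirichlet integral forces
the current to have finite energy. -/
theorem IsRegularPart.pullback (h : DiscC1 F F') (hl : DiscC1.LowerLip F c) (hα : ∀ j, α j ∈ disc)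
    {u : Torus → ℂ} {R : ℂ → ℝ} {ρ : Torus → ℝ}
    (hR : IsRegularPart (F '' disc) (bdry F) d (push F u) (F ∘ α) R ρ) :
    FiniteEnergy u ∧ ∃ c₀ : ℝ, ∀ z ∈ disc, R (F z) = smoothPart F d α z + (bFun u z).re + c₀ := by
  have ho : IsOpen (F '' disc) := h.isOpen_image fun z hz => hl.deriv_ne_zero h (disc_subset_cdisc hz)
  have hinj := hl.injOn.mono disc_subset_cdisc
  obtain ⟨g, hg, hgR⟩ := InnerProductSpace.HarmonicOnNhd.exists_analyticOnNhd_ball_re_eq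
    (harmonicOnNhd_comp h hR.harmonic)
  have hRd : ∀ z ∈ disc, DifferentiableAt ℝ R (F z) := fun z hz =>
    (hR.harmonic _ (mem_image_of_mem F hz)).1.differentiableAt (by norm_num)
  have hsd := h.differentiableOn_smoothDeriv d hl hα
  set G' : ℂ → ℂ := fun z => deriv g z - smoothDeriv F d α z with hG'
  have hgd : DifferentiableOn ℂ (deriv g) disc := hg.differentiableOn.deriv Metric.isOpen_ball
  have hG'd : DifferentiableOn ℂ G' disc := hgd.sub hsd
  have hgrad : ∀ z ∈ disc, gradient (R ∘ F) z = (starRingEnd ℂ) (deriv g z) := by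
    intro z hz
    rw [← gradient_re (hg z hz).differentiableAt.hasDerivAt]
    have : (fun w => (g w).re) =ᶠ[𝓝 z] R ∘ F :=
      hgR.eventuallyEq_of_mem (Metric.isOpen_ball.mem_nhds hz)
    simp only [gradient, this.fderiv_eq]
  have hpow := hasPower_taylor hG'd
  set a : ℕ → ℂ := fun n => ((n.factorial : ℂ))⁻¹ * iteratedDeriv n G' 0 with ha
  -- The Dirichlet integral is conformally invariant and `smoothDeriv` is bounded, so the unknown
  -- part has finite energy.
  have hE : ∫⁻ z in disc, ‖G' z‖ₑ ^ 2 < ⊤ := by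
    obtain ⟨M, hM⟩ := h.exists_bound_smoothDeriv d hl hα
    have h1 : ∫⁻ z in disc, ‖deriv g z‖ₑ ^ 2 < ⊤ := by
      have := hR.finite_energy
      rw [h.lintegral_gradient hinj hRd] at this
      convert this using 1
      refine setLIntegral_congr_fun measurableSet_disc fun z hz => ?_
      rw [hgrad z hz, ← ofReal_norm, ← ofReal_norm, RCLike.norm_conj]
    have h2 : ∫⁻ z in disc, ‖smoothDeriv F d α z‖ₑ ^ 2 < ⊤ := by
      refine (setLIntegral_mono_ae' (g := fun _ => ENNReal.ofReal (M ^ 2)) measurableSet_disc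
        (.of_forall fun z hz => ?_)).trans_lt ?_
      · rw [enorm_sq_eq_ofReal]
        exact ENNReal.ofReal_le_ofReal (pow_le_pow_left₀ (norm_nonneg _) (hM z hz) 2)
      · rw [setLIntegral_const]
        exact ENNReal.mul_lt_top ENNReal.ofReal_lt_top volume_disc_lt_top
    refine (lintegral_mono (g := fun z => 2 * ‖deriv g z‖ₑ ^ 2 + 2 * ‖smoothDeriv F d α z‖ₑ ^ 2)
      fun z => ?_).trans_lt ?_
    · have := enorm_add_sq_le (deriv g z) (-smoothDeriv F d α z)
      rwa [enorm_neg, ← sub_eq_add_neg] at this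
    · have hm : AEMeasurable (fun z => 2 * ‖deriv g z‖ₑ ^ 2) (volume.restrict disc) :=
        ((hgd.continuousOn.aestronglyMeasurable measurableSet_disc).enorm.pow_const 2).const_mul 2
      rw [lintegral_add_left' hm, lintegral_const_mul' _ _ (by simp), lintegral_const_mul' _ _ (by simp)]
      exact ENNReal.add_lt_top.2 ⟨ENNReal.mul_lt_top (by simp) h1, ENNReal.mul_lt_top (by simp) h2⟩
  have hsum := hpow.summable_of_energy hE
  have hGi := integrableOn_disc_of_energy hG'd.continuousOn hE
  have hcoef : ∀ n : ℕ, a n = (n + 1) * bCoeff u (n + 1) := by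
    intro n
    have key : ∀ l : ℂ, ((starRingEnd ℂ) l * (π * a n)).re =
        ((starRingEnd ℂ) l * wedgeCoeff u (-((n + 1 : ℕ) : ℤ))).re := by
      intro l
      -- In the disc this test function is Re(l z^{n+1}), which sees only the coefficient a_n; its
      -- boundary mean is zero, so the Neumann kernels contribute only the point values that the
      -- weak equation removes.
      set φ : ℂ → ℝ := fun w => (l * discInv F w ^ (n + 1)).re with hφ
      have hφs : ContDiffOn ℝ 1 φ (F '' cdisc) :=
        Complex.reCLM.contDiff.comp_contDiffOn
          (contDiffOn_const.mul ((h.contDiffOn_discInv hl).pow (n + 1)))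
      have hφF : ∀ z ∈ cdisc, φ (F z) = (l * z ^ (n + 1)).re := fun z hz => by
        rw [hφ]; simp only [DiscC1.discInv_apply hl.injOn hz]
      have hw := hR.weak φ (by rwa [h.closure_image])
      have hφb : φ ∘ bdry F = fun θ => (l * expi θ ^ (n + 1)).re := by
        funext θ; exact hφF _ (expi_mem_cdisc θ)
      rw [push_comp_bdry hl, hφb, wedgePairing_re_mul u l n.succ_ne_zero,
        h.integral_inner_gradient d hl hα hRd (fun z hz => by
          rw [hgrad z hz, hG']; simp only [add_sub_cancel]) hGi hφs] at hw
      have hη := h.testFn hl hφs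
      have e1 : ∀ θ : Torus, φ (F (expi θ)) = (l * expi θ ^ (n + 1)).re := fun θ =>
        hφF _ (expi_mem_cdisc θ)
      have e2 : ∀ m : ℕ, ∫ θ : Torus, (((φ ∘ F) (expi θ) : ℝ) : ℂ) * expi θ ^ m =
          π * ((starRingEnd ℂ) l * if n + 1 = m then 1 else 0) ∨ m = 0 := by
        intro m
        rcases Nat.eq_zero_or_pos m with hm | hm
        · exact Or.inr hm
        left
        simp only [Function.comp_apply, e1]
        rw [integral_mul_expi_pow (fun θ : Torus => (((l * expi θ ^ (n + 1)).re : ℝ) : ℂ)),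
          fourierCoeff_re_mul, if_neg (by omega), neg_neg]
        by_cases hnm : n + 1 = m
        · rw [if_pos (by exact_mod_cast hnm), if_pos hnm]; ring
        · rw [if_neg (by exact_mod_cast hnm), if_neg hnm]; ring
      have e3 : ∫ θ : Torus, φ (F (expi θ)) = 0 := by
        have h1 := integral_mul_expi_pow (fun θ : Torus => (((l * expi θ ^ (n + 1)).re : ℝ) : ℂ)) 0
        rw [fourierCoeff_re_mul, if_neg (by simp; omega), if_neg (by simp; omega)] at h1
        simp only [pow_zero, mul_one, mul_zero, add_zero] at h1
        rw [integral_complex_ofReal] at h1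
        simp only [e1]
        exact_mod_cast h1
      have hlim := hη.tendsto_integral_power hpow hsum
      have e4 : ∫ z in disc, G' z * gradient (φ ∘ F) z = (starRingEnd ℂ) l * (π * a n) := by
        refine tendsto_nhds_unique hlim (tendsto_const_nhds.congr' ?_)
        filter_upwards [eventually_gt_atTop n] with N hN
        rw [Finset.sum_eq_single n]
        · rw [(e2 (n + 1)).resolve_right n.succ_ne_zero, if_pos rfl]; ring
        · intro m _ hm
          rw [(e2 (m + 1)).resolve_right m.succ_ne_zero, if_neg (by omega)]; simp
        · intro hn; exact absurd (Finset.mem_range.2 hN) hn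
      rw [e3, e4] at hw
      have e5 : ∑ j, (d j : ℝ) * (0 - 2 * π * φ (F (α j))) =
          -(2 * π * ∑ j, (d j : ℝ) * φ ((F ∘ α) j)) := by
        rw [Finset.mul_sum, ← Finset.sum_neg_distrib]
        refine Finset.sum_congr rfl fun j _ => ?_
        simp only [Function.comp_apply]; ring
      rw [e5] at hw
      linarith
    -- The choices l = 1 and l = i give the real and imaginary parts.
    have h1 : (π : ℂ) * a n = wedgeCoeff u (-((n + 1 : ℕ) : ℤ)) := by
      apply Complex.ext
      · simpa using key 1
      · simpa using key Complex.I
    rw [wedgeCoeff_neg_eq u n.succ_ne_zero] at h1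
    have hπ : (π : ℂ) ≠ 0 := by exact_mod_cast pi_ne_zero
    have := mul_left_cancel₀ hπ h1
    rw [this]; push_cast; rfl
  have hfe : FiniteEnergy u := finiteEnergy_of_summable_deriv (by
    simpa only [hcoef] using hsum)
  refine ⟨hfe, ?_⟩
  have hbp := hfe.hasPower
  have hGb : ∀ z ∈ disc, G' z = deriv (bFun u) z := by
    intro z hz
    have h1 := hpow z hz
    have h2 := hbp.deriv z hz
    simp only [hcoef] at h1
    exact h1.unique h2
  have hbd : ∀ z ∈ disc, HasDerivAt (bFun u) (deriv (bFun u) z) z := fun z hz =>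
    (hbp.analyticOnNhd z hz).differentiableAt.hasDerivAt
  have hsg : ∀ z ∈ disc, HasGradientAt (fun z => smoothPart F d α z + (bFun u z).re)
      ((starRingEnd ℂ) (smoothDeriv F d α z) + (starRingEnd ℂ) (deriv (bFun u) z)) z := fun z hz =>
    hasGradientAt_add (h.hasGradientAt_smoothPart d hl hα hz) (hasGradientAt_re (hbd z hz))
  have hRF : ∀ z ∈ disc, DifferentiableAt ℝ (R ∘ F) z := fun z hz =>
    (hRd z hz).comp z (h.hasDerivAt z hz).complexToReal_fderiv.differentiableAt
  obtain ⟨c₀, hc₀⟩ := Metric.isOpen_ball.exists_eq_add_of_fderiv_eq (𝕜 := ℝ)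
    (s := disc) (f := R ∘ F) (g := fun z => smoothPart F d α z + (bFun u z).re)
    (convex_ball (0 : ℂ) 1).isPreconnected
    (fun z hz => (hRF z hz).differentiableWithinAt)
    (fun z hz => (hsg z hz).hasFDerivAt.differentiableAt.differentiableWithinAt) (fun z hz => by
      have h1 : gradient (R ∘ F) z = gradient (fun z => smoothPart F d α z + (bFun u z).re) z := by
        rw [(hsg z hz).gradient, hgrad z hz, ← map_add, ← hGb z hz, hG']
        simp only [add_sub_cancel]
      exact (InnerProductSpace.toDual ℝ ℂ).symm.injective h1)
  exact ⟨c₀, fun z hz => hc₀ hz⟩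

end pullback

/-! ### Boundary values of power series and the pairing with the current. -/

theorem integrable_haar_fourier_mul {u : Torus → ℂ} (hu : MemLp u 2 volume) (n : ℤ) :
    Integrable (fun θ => fourier n θ • u θ) haarAddCircle := by
  have h1 : Integrable u haarAddCircle := (memLp_haar_iff.2 hu).integrable (by norm_num)
  exact h1.bdd_mul (c := 1) (fourier n).continuous.aestronglyMeasurable
    (.of_forall fun θ => (norm_fourier_apply n θ).le)

theorem fourierCoeff_add {u v : Torus → ℂ} (hu : MemLp u 2 volume) (hv : MemLp v 2 volume) (n : ℤ) :
    fourierCoeff (fun θ => u θ + v θ) n = fourierCoeff u n + fourierCoeff v n := by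
  simp only [fourierCoeff, smul_add]
  exact integral_add (integrable_haar_fourier_mul hu _) (integrable_haar_fourier_mul hv _)

theorem fourierCoeff_sub {u v : Torus → ℂ} (hu : MemLp u 2 volume) (hv : MemLp v 2 volume) (n : ℤ) :
    fourierCoeff (fun θ => u θ - v θ) n = fourierCoeff u n - fourierCoeff v n := by
  simp only [fourierCoeff, smul_sub]
  exact integral_sub (integrable_haar_fourier_mul hu _) (integrable_haar_fourier_mul hv _)

theorem fourierCoeff_sum {ι : Type*} (s : Finset ι) {u : ι → Torus → ℂ}
    (hu : ∀ i ∈ s, MemLp (u i) 2 volume) (n : ℤ) :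
    fourierCoeff (fun θ => ∑ i ∈ s, u i θ) n = ∑ i ∈ s, fourierCoeff (u i) n := by
  simp only [fourierCoeff, Finset.smul_sum]
  exact integral_finsetSum _ fun i hi => integrable_haar_fourier_mul (hu i hi) _

theorem memLp_of_continuous {u : Torus → ℂ} (hu : Continuous u) : MemLp u 2 volume := by
  obtain ⟨C, hC⟩ := (isCompact_univ (X := Torus)).exists_bound_of_continuousOn hu.continuousOn
  exact (memLp_top_of_bound hu.aestronglyMeasurable C
    (.of_forall fun θ => hC θ (mem_univ _))).mono_exponent le_top

theorem lintegral_sq_volume {u : Torus → ℂ} (hu : MemLp u 2 volume) :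
    ∫⁻ θ, ‖u θ‖ₑ ^ 2 = ENNReal.ofReal (2 * π) * ∑' n : ℤ, ‖fourierCoeff u n‖ₑ ^ 2 := by
  rw [volume_torus, lintegral_smul_measure, smul_eq_mul, lintegral_sq_eq_tsum hu]

/-- Riesz–Fischer for the coefficients extended by zero to negative frequencies. The function `v` is
the L² boundary value of the power series, and the polynomial approximations will furnish the trace
of the regular part. -/
theorem exists_boundary_function {b : ℕ → ℂ} (hb : Summable fun n => ‖b n‖ ^ 2) :
    ∃ v : Torus → ℂ, MemLp v 2 volume ∧ (∀ n : ℕ, fourierCoeff v n = b n) ∧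
      (∀ n : ℕ, n ≠ 0 → fourierCoeff v (-n) = 0) ∧
      Tendsto (fun N => ∫⁻ θ, ‖(∑ n ∈ Finset.range N, b n * expi θ ^ n) - v θ‖ₑ ^ 2) atTop (𝓝 0) := by
  set e : ℤ → ℂ := fun m => if 0 ≤ m then b m.toNat else 0 with he
  have hinj : Function.Injective (fun n : ℕ => (n : ℤ)) := Nat.cast_injective
  have hes : Summable fun m => ‖e m‖ ^ 2 := by
    rw [← hinj.summable_iff]
    · simpa [Function.comp_def, he] using hb
    · intro m hm
      have : ¬ 0 ≤ m := fun h => hm ⟨m.toNat, by simp [h]⟩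
      simp [he, this]
  have hem : Memℓp e 2 := by
    rw [memℓp_gen_iff (by norm_num)]
    simpa using hes
  set f := (fourierBasis (T := 2 * π)).repr.symm ⟨e, hem⟩ with hf
  have hfc : ∀ m, fourierCoeff f m = e m := fun m => by
    rw [← fourierBasis_repr, hf, LinearIsometryEquiv.apply_symm_apply]
  have hv : MemLp (f : Torus → ℂ) 2 volume := memLp_haar_iff.1 (Lp.memLp f)
  refine ⟨f, hv, fun n => by simp [hfc, he], fun n hn => ?_, ?_⟩
  · have : ¬ (0 : ℤ) ≤ -n := by omega
    rw [hfc, he]; simp only [this, if_false]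
  have key : ∀ N, ∫⁻ θ, ‖(∑ n ∈ Finset.range N, b n * expi θ ^ n) - f θ‖ₑ ^ 2 =
      ENNReal.ofReal (2 * π) * ENNReal.ofReal (∑' n, if n < N then 0 else ‖b n‖ ^ 2) := by
    intro N
    have hP : MemLp (fun θ : Torus => ∑ n ∈ Finset.range N, b n * expi θ ^ n) 2 volume :=
      memLp_of_continuous (continuous_finsetSum _ fun n _ => continuous_const.mul (continuous_expi.pow n))
    have hPc : ∀ m : ℤ, fourierCoeff (fun θ : Torus => ∑ n ∈ Finset.range N, b n * expi θ ^ n) m =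
        if m < N then e m else 0 := by
      intro m
      rw [fourierCoeff_sum (u := fun n θ => b n * expi θ ^ n) _ fun n _ => memLp_of_continuous
        (continuous_const.mul (continuous_expi.pow n))]
      have : ∀ n : ℕ, fourierCoeff (fun θ : Torus => b n * expi θ ^ n) m = b n * if (n : ℤ) = m then 1 else 0 := by
        intro n
        rw [← fourierCoeff_fourier]
        have h2 : (fun θ : Torus => b n * expi θ ^ n) = fun θ => b n * fourier (n : ℤ) θ := by
          funext θ; rw [fourier_eq_expi_zpow, zpow_natCast]
        rw [h2]; exact fourierCoeff.const_mul _ _ _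
      simp only [this]
      by_cases hm : 0 ≤ m
      · lift m to ℕ using hm
        by_cases hN : m < N
        · rw [Finset.sum_eq_single m]
          · simp [he, hN]
          · intro n _ hn; simp [hn]
          · intro h; exact absurd (Finset.mem_range.2 hN) h
        · rw [if_neg (by exact_mod_cast hN)]
          refine Finset.sum_eq_zero fun n hn => ?_
          have : n ≠ m := fun h => hN (h ▸ Finset.mem_range.1 hn)
          simp [this]
      · have h0 : e m = 0 := by simp [he, hm]
        rw [h0, ite_self]
        refine Finset.sum_eq_zero fun n _ => ?_
        have : (n : ℤ) ≠ m := fun h => hm (h ▸ Int.natCast_nonneg n)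
        simp [this]
    have hPv : MemLp (fun θ => (∑ n ∈ Finset.range N, b n * expi θ ^ n) - f θ) 2 volume := hP.sub hv
    rw [lintegral_sq_volume hPv]
    congr 1
    have hc : ∀ m, fourierCoeff (fun θ => (∑ n ∈ Finset.range N, b n * expi θ ^ n) - f θ) m =
        if m < N then 0 else - e m := fun m => by
      rw [fourierCoeff_sub hP hv, hPc, hfc]; split_ifs <;> simp
    have hs : Summable fun n => if n < N then 0 else ‖b n‖ ^ 2 := by
      refine Summable.of_nonneg_of_le (fun n => ?_) (fun n => ?_) hb <;> split_ifs <;>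
        first | positivity | exact le_rfl
    rw [ENNReal.ofReal_tsum_of_nonneg (fun n => by split_ifs <;> positivity) hs]
    simp only [hc]
    rw [← hinj.tsum_eq (f := fun m => ‖if m < N then (0 : ℂ) else - e m‖ₑ ^ 2)]
    · refine tsum_congr fun n => ?_
      rw [enorm_sq_eq_ofReal]
      by_cases hn : n < N <;> simp [hn, he]
    · intro m hm
      by_contra h
      have h0 : ¬ 0 ≤ m := fun h' => h ⟨m.toNat, by simp [h']⟩
      apply hm
      simp [he, h0]
  simp only [key]
  have h1 := (ENNReal.continuous_ofReal.tendsto 0).comp (tendsto_tsum_tail hb)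
  have := ENNReal.Tendsto.const_mul (a := ENNReal.ofReal (2 * π)) h1 (Or.inr (by finiteness))
  simpa [Function.comp_def] using this

theorem lintegral_sq_add_lt_top {X E : Type*} [MeasurableSpace X] [NormedAddCommGroup E] {μ : Measure X}
    {f g : X → E} (hfm : AEStronglyMeasurable f μ)
    (hf : ∫⁻ x, ‖f x‖ₑ ^ 2 ∂μ < ⊤) (hg : ∫⁻ x, ‖g x‖ₑ ^ 2 ∂μ < ⊤) :
    ∫⁻ x, ‖f x + g x‖ₑ ^ 2 ∂μ < ⊤ := by
  refine (lintegral_mono fun x => enorm_add_sq_le (f x) (g x)).trans_lt ?_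
  have hm : AEMeasurable (fun x => 2 * ‖f x‖ₑ ^ 2) μ := (hfm.enorm.pow_const 2).const_mul 2
  rw [lintegral_add_left' hm, lintegral_const_mul' _ _ (by simp), lintegral_const_mul' _ _ (by simp)]
  exact ENNReal.add_lt_top.2 ⟨ENNReal.mul_lt_top (by simp) hf, ENNReal.mul_lt_top (by simp) hg⟩

theorem lintegral_disc_sq_lt_top_of_bound {f : ℂ → ℂ} {M : ℝ} (hM : ∀ z ∈ disc, ‖f z‖ ≤ M) :
    ∫⁻ z in disc, ‖f z‖ₑ ^ 2 < ⊤ := by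
  refine (setLIntegral_mono_ae' (g := fun _ => ENNReal.ofReal (M ^ 2)) measurableSet_disc
    (.of_forall fun z hz => ?_)).trans_lt ?_
  · rw [enorm_sq_eq_ofReal]
    exact ENNReal.ofReal_le_ofReal (pow_le_pow_left₀ (norm_nonneg _) (hM z hz) 2)
  · rw [setLIntegral_const]
    exact ENNReal.mul_lt_top ENNReal.ofReal_lt_top volume_disc_lt_top

/-- Both `w` and the current are real, so opposite frequencies give conjugate terms. The two-sided
series is the zero mode plus twice the real part of one half, with wedgeCoeff(-n) = π n b_n. -/
theorem wedgePairing_eq {h : Torus → ℂ} {D : ℝ} (h0 : wedgeCoeff h 0 = ((2 * π * D : ℝ) : ℂ))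
    {w : Torus → ℝ}
    (hs : Summable fun n : ℕ => (n : ℂ) * (fourierCoeff (fun θ => (w θ : ℂ)) (-n) * bCoeff h n)) :
    wedgePairing h w = 2 * π * (D * (fourierCoeff (fun θ => (w θ : ℂ)) 0).re +
      (∑' n : ℕ, (n : ℂ) * (fourierCoeff (fun θ => (w θ : ℂ)) (-n) * bCoeff h n)).re) := by
  set S := ∑' n : ℕ, (n : ℂ) * (fourierCoeff (fun θ => (w θ : ℂ)) (-n) * bCoeff h n) with hS
  set f : ℤ → ℂ := fun n => fourierCoeff (fun θ => (w θ : ℂ)) n * wedgeCoeff h n with hf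
  have hneg : ∀ n : ℕ, n ≠ 0 → f (-n) =
      π * ((n : ℂ) * (fourierCoeff (fun θ => (w θ : ℂ)) (-n) * bCoeff h n)) := fun n hn => by
    simp only [hf]; rw [wedgeCoeff_neg_eq h hn]; ring
  have hconj : ∀ n : ℤ, f n = (starRingEnd ℂ) (f (-n)) := fun n => by
    simp only [hf, map_mul]
    rw [wedgeCoeff_neg, fourierCoeff_ofReal_neg, Complex.conj_conj, Complex.conj_conj]
  have h1 : HasSum (fun n : ℕ => f (-(n + 1 : ℕ))) (π * S) := by
    have := (hasSum_nat_add_iff' 1).2 (hs.hasSum.mul_left (π : ℂ))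
    simp only [Finset.range_one, Finset.sum_singleton, Nat.cast_zero, zero_mul, mul_zero, sub_zero] at this
    rwa [funext fun n : ℕ => hneg (n + 1) n.succ_ne_zero]
  have h2 : HasSum (fun n : ℕ => f n) ((starRingEnd ℂ) (π * S) + f 0) := by
    have h3 : HasSum (fun n : ℕ => f ((n + 1 : ℕ) : ℤ)) ((starRingEnd ℂ) (π * S)) := by
      have := Complex.hasSum_conj'.2 h1
      simpa only [← hconj] using this
    have := (hasSum_nat_add_iff (f := fun n : ℕ => f n) 1).1 h3
    simpa using this
  have h4 := (HasSum.of_nat_of_neg_add_one (f := f) h2 (by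
    simpa using h1)).tsum_eq
  unfold wedgePairing
  rw [h4]
  have h5 : f 0 = fourierCoeff (fun θ => (w θ : ℂ)) 0 * ((2 * π * D : ℝ) : ℂ) := by
    simp only [hf, h0]
  rw [h5]
  simp only [Complex.add_re, map_mul, Complex.conj_ofReal, Complex.re_ofReal_mul, Complex.conj_re,
    Complex.re_mul_ofReal]
  ring

/-! ### Existence of the regular part. -/

section existence

variable {F F' : ℂ → ℂ} {c : ℝ} {k : ℕ} {α : Fin k → ℂ} {d : Fin k → ℤ}

/-- A primitive of `smoothDeriv` exists on the disc; its real part has the same gradient as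
`smoothPart`, so the two differ by a constant. Harmonicity follows without choosing branches of
logarithms. -/
theorem DiscC1.exists_analytic_smoothPart (h : DiscC1 F F') (hl : DiscC1.LowerLip F c)
    (hα : ∀ j, α j ∈ disc) :
    ∃ T : ℂ → ℂ, AnalyticOnNhd ℂ T disc ∧ ∀ z ∈ disc, (T z).re = smoothPart F d α z := by
  obtain ⟨T, hT⟩ := (h.differentiableOn_smoothDeriv d hl hα).isExactOn_ball
  have hgT : ∀ z ∈ disc, HasGradientAt (fun z => (T z).re) ((starRingEnd ℂ) (smoothDeriv F d α z)) z :=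
    fun z hz => hasGradientAt_re (hT z hz)
  obtain ⟨a, ha⟩ := Metric.isOpen_ball.exists_eq_add_of_fderiv_eq (𝕜 := ℝ)
    (s := disc) (f := smoothPart F d α) (g := fun z => (T z).re)
    (convex_ball (0 : ℂ) 1).isPreconnected
    (fun z hz => (h.hasGradientAt_smoothPart d hl hα hz).hasFDerivAt.differentiableAt.differentiableWithinAt)
    (fun z hz => (hgT z hz).hasFDerivAt.differentiableAt.differentiableWithinAt) (fun z hz => by
      rw [(hgT z hz).hasFDerivAt.fderiv, (h.hasGradientAt_smoothPart d hl hα hz).hasFDerivAt.fderiv])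
  refine ⟨fun z => T z + a, DifferentiableOn.analyticOnNhd (fun z hz =>
    ((hT z hz).differentiableAt.add_const _).differentiableWithinAt) Metric.isOpen_ball, fun z hz => ?_⟩
  rw [Complex.add_re, Complex.ofReal_re, ha hz]

/-- The regular part, up to the additive constant `c₀`. -/
def regPart (F : ℂ → ℂ) (d : Fin k → ℤ) (α : Fin k → ℂ) (B : ℂ → ℂ) (c₀ : ℝ) (w : ℂ) : ℝ :=
  smoothPart F d α (discInv F w) + (B (discInv F w)).re + c₀

/-- The boundary values of the regular part. -/
def regTrace (F : ℂ → ℂ) (d : Fin k → ℤ) (α : Fin k → ℂ) (v : Torus → ℂ) (c₀ : ℝ) (θ : Torus) : ℝ :=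
  smoothPart F d α (expi θ) + (v θ).re + c₀

theorem regPart_apply (hl : DiscC1.LowerLip F c) (B : ℂ → ℂ) (c₀ : ℝ) {z : ℂ} (hz : z ∈ cdisc) :
    regPart F d α B c₀ (F z) = smoothPart F d α z + (B z).re + c₀ := by
  rw [regPart, DiscC1.discInv_apply hl.injOn hz]

theorem harmonicOnNhd_regPart (h : DiscC1 F F') (hl : DiscC1.LowerLip F c) (hα : ∀ j, α j ∈ disc)
    {B : ℂ → ℂ} (hB : AnalyticOnNhd ℂ B disc) (c₀ : ℝ) :
    InnerProductSpace.HarmonicOnNhd (regPart F d α B c₀) (F '' disc) := by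
  obtain ⟨T, hT, hTe⟩ := h.exists_analytic_smoothPart (d := d) hl hα
  have ho : IsOpen (F '' disc) := h.isOpen_image fun z hz => hl.deriv_ne_zero h (disc_subset_cdisc hz)
  rintro _ ⟨z, hz, rfl⟩
  have hzi := DiscC1.discInv_apply hl.injOn (disc_subset_cdisc hz)
  have hia : AnalyticAt ℂ (discInv F) (F z) :=
    (h.differentiableOn_discInv hl).analyticAt (ho.mem_nhds (mem_image_of_mem F hz))
  have h1 : AnalyticAt ℂ (fun w => T w + B w + (c₀ : ℂ)) (discInv F (F z)) := by
    rw [hzi]; exact ((hT z hz).add (hB z hz)).add analyticAt_const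
  have h2 := (h1.comp hia).harmonicAt_re
  refine (InnerProductSpace.harmonicAt_congr_nhds ?_).2 h2
  filter_upwards [ho.mem_nhds (mem_image_of_mem F hz)] with w hw
  obtain ⟨y, hy, rfl⟩ := hw
  rw [regPart_apply hl B c₀ (disc_subset_cdisc hy)]
  simp only [Function.comp_apply, DiscC1.discInv_apply hl.injOn (disc_subset_cdisc hy),
    Complex.add_re, Complex.ofReal_re, hTe y hy]

theorem gradient_regPart_comp (h : DiscC1 F F') (hl : DiscC1.LowerLip F c) (hα : ∀ j, α j ∈ disc)
    {B B' : ℂ → ℂ} (hB : ∀ z ∈ disc, HasDerivAt B (B' z) z) (c₀ : ℝ) {z : ℂ} (hz : z ∈ disc) :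
    gradient (regPart F d α B c₀ ∘ F) z = (starRingEnd ℂ) (smoothDeriv F d α z + B' z) := by
  have h1 : HasGradientAt (fun z => smoothPart F d α z + (B z).re + c₀)
      ((starRingEnd ℂ) (smoothDeriv F d α z) + (starRingEnd ℂ) (B' z) + 0) z :=
    hasGradientAt_add (hasGradientAt_add (h.hasGradientAt_smoothPart d hl hα hz)
      (hasGradientAt_re (hB z hz))) (hasGradientAt_const _ _)
  have h2 : regPart F d α B c₀ ∘ F =ᶠ[𝓝 z] fun z => smoothPart F d α z + (B z).re + c₀ := by
    filter_upwards [Metric.isOpen_ball.mem_nhds hz] with y hy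
    exact regPart_apply hl B c₀ (disc_subset_cdisc hy)
  rw [map_add, ← add_zero ((starRingEnd ℂ) (smoothDeriv F d α z) + _), ← h1.gradient]
  simp only [gradient, h2.fderiv_eq]

theorem regPart_sub (B P : ℂ → ℂ) (c₀ : ℝ) (w : ℂ) :
    regPart F d α P c₀ w - regPart F d α B c₀ w = (P (discInv F w) - B (discInv F w)).re := by
  rw [regPart, regPart, Complex.sub_re]; ring

/-- The approximations replace `bFun u` by its Taylor polynomials. Interior and gradient convergence
are tail estimates on the disc, while boundary convergence is assumed of `v`. -/
theorem hasTrace_regPart (h : DiscC1 F F') (hl : DiscC1.LowerLip F c) (hα : ∀ j, α j ∈ disc)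
    {u : Torus → ℂ} (he : FiniteEnergy u) {v : Torus → ℂ}
    (hv : Tendsto (fun N => ∫⁻ θ, ‖(∑ n ∈ Finset.range N, bCoeff u n * expi θ ^ n) - v θ‖ₑ ^ 2)
      atTop (𝓝 0)) (c₀ : ℝ) :
    HasTrace (F '' disc) (bdry F) (regPart F d α (bFun u) c₀) (regTrace F d α v c₀) := by
  have hinj := hl.injOn.mono disc_subset_cdisc
  have ho : IsOpen (F '' disc) := h.isOpen_image fun z hz => hl.deriv_ne_zero h (disc_subset_cdisc hz)
  have hsub : F '' disc ⊆ F '' cdisc := image_mono disc_subset_cdisc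
  have hbp := he.hasPower
  -- The polynomial has N + 1 terms so that its derivative is exactly the partial sum with N terms
  -- of the derivative series.
  set P : ℕ → ℂ → ℂ := fun N z => ∑ n ∈ Finset.range (N + 1), bCoeff u n * z ^ n with hP
  set P' : ℕ → ℂ → ℂ := fun N z => ∑ n ∈ Finset.range N, (n + 1) * bCoeff u (n + 1) * z ^ n with hP'
  have hPd : ∀ N z, HasDerivAt (P N) (P' N z) z := by
    intro N z
    have h1 : P N = fun z => (∑ n ∈ Finset.range N, bCoeff u (n + 1) * z ^ (n + 1)) + bCoeff u 0 := by
      funext z; simpa using Finset.sum_range_succ' (fun n => bCoeff u n * z ^ n) N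
    rw [h1]
    refine HasDerivAt.add_const _ ?_
    refine HasDerivAt.fun_sum fun n _ => ?_
    have := (hasDerivAt_pow (n + 1) z).const_mul (bCoeff u (n + 1))
    refine this.congr_deriv ?_
    push_cast; ring
  have hPa : ∀ N, AnalyticOnNhd ℂ (P N) disc := fun N =>
    DifferentiableOn.analyticOnNhd (fun z _ => (hPd N z).differentiableAt.differentiableWithinAt)
      Metric.isOpen_ball
  have hBd : ∀ z ∈ disc, HasDerivAt (bFun u) (deriv (bFun u) z) z := fun z hz =>
    (hbp.analyticOnNhd z hz).differentiableAt.hasDerivAt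
  obtain ⟨C, hC⟩ := h.exists_bound
  have hcomp : ∀ N, ContDiffOn ℝ 1 (regPart F d α (P N) c₀) (F '' disc) := fun N =>
    HarmonicOn.contDiffOn (harmonicOnNhd_regPart h hl hα (hPa N) c₀)
  have hcompB : ContDiffOn ℝ 1 (regPart F d α (bFun u) c₀) (F '' disc) :=
    HarmonicOn.contDiffOn (harmonicOnNhd_regPart h hl hα hbp.analyticOnNhd c₀)
  refine ⟨fun N => regPart F d α (P N) c₀, fun N => ⟨?_, hcomp N⟩, ?_, ?_, ?_⟩
  · rw [h.closure_image]
    have hmaps : MapsTo (discInv F) (F '' cdisc) cdisc := by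
      rintro _ ⟨z, hz, rfl⟩; rwa [DiscC1.discInv_apply hl.injOn hz]
    have hPc : Continuous (P N) := continuous_iff_continuousAt.2 fun z => (hPd N z).continuousAt
    exact (((h.continuousOn_smoothPart d hl hα).comp (DiscC1.continuousOn_discInv hl) hmaps).add
      ((Complex.continuous_re.comp hPc).comp_continuousOn (DiscC1.continuousOn_discInv hl))).add
      continuousOn_const
  · have htail := (hbp.tendsto_energy_tail (by
      refine Summable.of_nonneg_of_le (fun n => by positivity) (fun n => ?_) he.summable_sq
      exact div_le_self (by positivity) (by linarith [n.cast_nonneg (α := ℝ)]))).comp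
        (tendsto_add_atTop_nat 1)
    have hb := ENNReal.Tendsto.const_mul (a := ENNReal.ofReal (C ^ 2)) htail (Or.inr (by finiteness))
    rw [mul_zero] at hb
    refine tendsto_of_tendsto_of_tendsto_of_le_of_le tendsto_const_nhds hb (fun _ => zero_le) fun N => ?_
    rw [Function.comp_apply, h.lintegral_image hinj, ← lintegral_const_mul' _ _ (by finiteness)]
    refine setLIntegral_mono_ae' measurableSet_disc (.of_forall fun z hz => ?_)
    rw [regPart_sub, DiscC1.discInv_apply hl.injOn (disc_subset_cdisc hz)]
    refine mul_le_mul' ?_ ?_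
    · rw [enorm_sq_eq_ofReal]
      exact ENNReal.ofReal_le_ofReal (pow_le_pow_left₀ (norm_nonneg _) (hC z (disc_subset_cdisc hz)) 2)
    · refine pow_le_pow_left' ?_ 2
      rw [← ofReal_norm, ← ofReal_norm, norm_sub_rev (bFun u z)]
      exact ENNReal.ofReal_le_ofReal (Complex.abs_re_le_norm _)
  · have htail := hbp.deriv.tendsto_energy_tail he.summable_deriv
    refine htail.congr fun N => ?_
    rw [h.lintegral_image hinj]
    refine setLIntegral_congr_fun measurableSet_disc fun z hz => ?_
    have hmem := ho.mem_nhds (mem_image_of_mem F hz)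
    have g1 := gradient_regPart_comp (d := d) (c₀ := c₀) h hl hα (fun z _ => hPd N z) hz
    have g2 := gradient_regPart_comp (d := d) (c₀ := c₀) h hl hα hBd hz
    rw [h.gradient_comp hz (((hcomp N).differentiableOn one_ne_zero).differentiableAt hmem)] at g1
    rw [h.gradient_comp hz ((hcompB.differentiableOn one_ne_zero).differentiableAt hmem)] at g2
    have e : ‖F' z‖ₑ ^ 2 * ‖gradient (regPart F d α (P N) c₀) (F z) -
        gradient (regPart F d α (bFun u) c₀) (F z)‖ₑ ^ 2 =
        ‖(starRingEnd ℂ) (F' z) * gradient (regPart F d α (P N) c₀) (F z) -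
        (starRingEnd ℂ) (F' z) * gradient (regPart F d α (bFun u) c₀) (F z)‖ₑ ^ 2 := by
      rw [← mul_sub, enorm_mul, mul_pow]
      congr 2
      rw [← ofReal_norm, ← ofReal_norm, RCLike.norm_conj]
    rw [e, g1, g2, ← map_sub, add_sub_add_left_eq_sub, ← ofReal_norm, ← ofReal_norm, RCLike.norm_conj,
      norm_sub_rev]
  · refine tendsto_of_tendsto_of_tendsto_of_le_of_le tendsto_const_nhds
      (hv.comp (tendsto_add_atTop_nat 1)) (fun _ => zero_le) fun N => ?_
    refine lintegral_mono fun θ => ?_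
    refine pow_le_pow_left' ?_ 2
    change ‖regPart F d α (P N) c₀ (F (expi θ)) - _‖ₑ ≤ ‖P N (expi θ) - v θ‖ₑ
    rw [regPart_apply hl _ _ (expi_mem_cdisc θ), regTrace, ← ofReal_norm, ← ofReal_norm]
    refine ENNReal.ofReal_le_ofReal ?_
    have e : smoothPart F d α (expi θ) + (P N (expi θ)).re + c₀ -
        (smoothPart F d α (expi θ) + (v θ).re + c₀) = (P N (expi θ) - v θ).re := by
      rw [Complex.sub_re]; ring
    rw [e]
    exact Complex.abs_re_le_norm _

theorem speed_bdry (h : DiscC1 F F') (θ : Torus) : speed (bdry F) θ = ‖F' (expi θ)‖ := by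
  have h1 : HasDerivAt (fun t : ℝ => expi (θ + (t : Torus))) (expi θ * Complex.I) 0 := by
    have e : (fun t : ℝ => expi (θ + (t : Torus))) = fun t : ℝ => expi θ * Complex.exp (t * Complex.I) := by
      funext t; rw [expi_add, expi_coe]
    rw [e]
    have h2 : HasDerivAt (fun t : ℝ => Complex.exp (t * Complex.I)) Complex.I 0 := by
      have := ((Complex.ofRealCLM.hasDerivAt (x := 0)).mul_const Complex.I).cexp
      simpa using this
    exact h2.const_mul _
  have h3 := (h.hasFDerivWithinAt (expi_mem_cdisc (θ + ((0 : ℝ) : Torus)))).comp_hasDerivAt (0 : ℝ) h1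
    (.of_forall fun t => expi_mem_cdisc _)
  have h4 : deriv (fun t : ℝ => bdry F (θ + (t : Torus))) 0 = _ := h3.deriv
  rw [speed, h4]
  simp [norm_expi]

/-- The explicit candidate is verified. Its Neumann kernels produce the mean of φ weighted by ∑ d_j,
which matches the zero mode of the current precisely because the degree is ∑ d_j; the other modes
match by the choice of `bFun`. -/
theorem exists_isRegularPart (h : DiscC1 F F') (hl : DiscC1.LowerLip F c) (hα : ∀ j, α j ∈ disc)
    {u : Torus → ℂ} (he : FiniteEnergy u)
    (h0 : wedgeCoeff u 0 = ((2 * π * ∑ j, (d j : ℝ) : ℝ) : ℂ)) {v : Torus → ℂ}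
    (hvm : MemLp v 2 volume)
    (hv : Tendsto (fun N => ∫⁻ θ, ‖(∑ n ∈ Finset.range N, bCoeff u n * expi θ ^ n) - v θ‖ₑ ^ 2)
      atTop (𝓝 0)) :
    ∃ c₀ : ℝ, IsRegularPart (F '' disc) (bdry F) d (push F u) (F ∘ α)
      (regPart F d α (bFun u) c₀) (regTrace F d α v c₀) := by
  have hinj := hl.injOn.mono disc_subset_cdisc
  have ho : IsOpen (F '' disc) := h.isOpen_image fun z hz => hl.deriv_ne_zero h (disc_subset_cdisc hz)
  have hbp := he.hasPower
  have hBd : ∀ z ∈ disc, HasDerivAt (bFun u) (deriv (bFun u) z) z := fun z hz =>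
    (hbp.analyticOnNhd z hz).differentiableAt.hasDerivAt
  have hSc : Continuous fun θ : Torus => smoothPart F d α (expi θ) :=
    (h.continuousOn_smoothPart d hl hα).comp_continuous continuous_expi expi_mem_cdisc
  have hFne : ∀ j θ, F (expi θ) - F (α j) ≠ 0 := fun j θ he => by
    have := hl.injOn (expi_mem_cdisc θ) (disc_subset_cdisc (hα j)) (sub_eq_zero.1 he)
    have h1 := mem_ball_zero_iff.1 (hα j)
    rw [← this, norm_expi] at h1
    exact lt_irrefl _ h1
  have hlc : Continuous fun θ : Torus => logSum d (F ∘ α) (bdry F θ) := by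
    unfold logSum
    refine continuous_finsetSum _ fun j _ => continuous_const.mul (Continuous.log ?_ fun θ =>
      norm_ne_zero_iff.2 (hFne j θ))
    exact ((h.cont.comp_continuous continuous_expi expi_mem_cdisc).sub continuous_const).norm
  have hspc : Continuous fun θ : Torus => ‖F' (expi θ)‖ :=
    (h.cont'.comp_continuous continuous_expi expi_mem_cdisc).norm
  obtain ⟨C, hC⟩ := h.exists_bound
  have hgm : ∀ c₀, MemLp (regTrace F d α v c₀) 2 volume := fun c₀ => by
    have h1 : Continuous fun θ : Torus => ((smoothPart F d α (expi θ) + c₀ : ℝ) : ℂ) :=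
      Complex.continuous_ofReal.comp (hSc.add continuous_const)
    have h2 := ((memLp_of_continuous h1).add hvm).re
    convert h2 using 2 with θ
    simp [regTrace]; ring
  set X : Torus → ℝ := fun θ => regTrace F d α v 0 θ + logSum d (F ∘ α) (bdry F θ) with hX
  have hXi : Integrable fun θ => X θ * ‖F' (expi θ)‖ := by
    have h1 : Integrable X := ((hgm 0).integrable (by norm_num)).add (integrable_of_continuous hlc)
    exact h1.mul_bdd (c := C) hspc.aestronglyMeasurable (.of_forall fun θ => by
      rw [norm_norm]; exact hC _ (expi_mem_cdisc θ))
  have hsi : Integrable fun θ : Torus => ‖F' (expi θ)‖ := integrable_of_continuous hspc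
  have hpos : ∫ θ : Torus, ‖F' (expi θ)‖ ≠ 0 := by
    have h1 : ∫ _ : Torus, c ≤ ∫ θ : Torus, ‖F' (expi θ)‖ :=
      integral_mono (integrable_const c) hsi fun θ => hl.le_norm_deriv h (expi_mem_cdisc θ)
    rw [integral_const, smul_eq_mul, measureReal_def, AddCircle.measure_univ,
      ENNReal.toReal_ofReal two_pi_pos.le] at h1
    have := mul_pos two_pi_pos hl.1
    linarith
  -- The normalization is affine in c₀, with slope the length of the boundary, which is positive.
  set c₀ : ℝ := -(∫ θ : Torus, X θ * ‖F' (expi θ)‖) / ∫ θ : Torus, ‖F' (expi θ)‖ with hc₀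
  have hharm := harmonicOnNhd_regPart (d := d) h hl hα hbp.analyticOnNhd c₀
  have hRd : ∀ z ∈ disc, DifferentiableAt ℝ (regPart F d α (bFun u) c₀) (F z) := fun z hz =>
    (hharm _ (mem_image_of_mem F hz)).1.differentiableAt (by norm_num)
  have hBe : ∫⁻ z in disc, ‖deriv (bFun u) z‖ₑ ^ 2 < ⊤ := by
    rw [hbp.deriv.energy_eq he.summable_deriv]; exact ENNReal.ofReal_lt_top
  refine ⟨c₀, hharm, ?_, hgm c₀, hasTrace_regPart h hl hα he hv c₀, ?_, ?_⟩
  · rw [h.lintegral_gradient hinj hRd]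
    have e : ∫⁻ z in disc, ‖gradient (regPart F d α (bFun u) c₀ ∘ F) z‖ₑ ^ 2 =
        ∫⁻ z in disc, ‖smoothDeriv F d α z + deriv (bFun u) z‖ₑ ^ 2 := by
      refine setLIntegral_congr_fun measurableSet_disc fun z hz => ?_
      rw [gradient_regPart_comp h hl hα hBd c₀ hz, ← ofReal_norm, ← ofReal_norm, RCLike.norm_conj]
    rw [e]
    obtain ⟨M, hM⟩ := h.exists_bound_smoothDeriv d hl hα
    exact lintegral_sq_add_lt_top
      ((h.differentiableOn_smoothDeriv d hl hα).continuousOn.aestronglyMeasurable measurableSet_disc)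
      (lintegral_disc_sq_lt_top_of_bound hM) hBe
  · intro φ hφ
    rw [h.closure_image] at hφ
    have hη := h.testFn hl hφ
    obtain ⟨M, hM⟩ := hη.bounded
    rw [h.integral_inner_gradient d hl hα hRd
      (fun z hz => gradient_regPart_comp h hl hα hBd c₀ hz)
      (integrableOn_disc_of_energy hbp.deriv.continuousOn hBe) hφ, push_comp_bdry hl]
    set w : Torus → ℝ := φ ∘ bdry F with hw
    have hwc : Continuous w := hη.cont.comp_continuous continuous_expi expi_mem_cdisc
    have hwC : Continuous fun θ => (w θ : ℂ) := Complex.continuous_ofReal.comp hwc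
    -- The bounded gradient makes φ ∘ F Lipschitz in the disc and, by continuity, up to the circle;
    -- its boundary values then lie in H^{1/2} and the pairing series converges.
    have hwH : MemH fun θ => (w θ : ℂ) := by
      have hlip : ∀ z ∈ cdisc, ∀ y ∈ cdisc, ‖(φ ∘ F) z - (φ ∘ F) y‖ ≤ M * ‖z - y‖ := by
        have h1 : ∀ z ∈ disc, ∀ y ∈ disc, ‖(φ ∘ F) z - (φ ∘ F) y‖ ≤ M * ‖z - y‖ := by
          intro z hz y hy
          refine (convex_ball (0 : ℂ) 1).norm_image_sub_le_of_norm_fderiv_le (𝕜 := ℝ)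
            (fun x hx => (hη.hasFDerivAt hx).differentiableAt) (fun x hx => ?_) hy hz
          have := hM x hx
          rwa [gradient, LinearIsometryEquiv.norm_map] at this
        intro z hz y hy
        have hz' : z ∈ closure disc := by rwa [closure_disc]
        have hy' : y ∈ closure disc := by rwa [closure_disc]
        have hp : (z, y) ∈ closure (disc ×ˢ disc) := by rw [closure_prod_eq]; exact ⟨hz', hy'⟩
        refine ContinuousWithinAt.closure_le (s := disc ×ˢ disc) (x := (z, y))
          (f := fun p : ℂ × ℂ => ‖(φ ∘ F) p.1 - (φ ∘ F) p.2‖) (g := fun p : ℂ × ℂ => M * ‖p.1 - p.2‖)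
          hp ?_ (by fun_prop) fun p hp => h1 _ hp.1 _ hp.2
        have c1 : ContinuousWithinAt (φ ∘ F) disc z := (hη.cont z hz).mono disc_subset_cdisc
        have c2 : ContinuousWithinAt (φ ∘ F) disc y := (hη.cont y hy).mono disc_subset_cdisc
        refine ContinuousWithinAt.norm (ContinuousWithinAt.sub ?_ ?_)
        · exact ContinuousWithinAt.comp (f := Prod.fst) (g := φ ∘ F) (t := disc) c1
            continuousWithinAt_fst fun p hp => hp.1
        · exact ContinuousWithinAt.comp (f := Prod.snd) (g := φ ∘ F) (t := disc) c2
            continuousWithinAt_snd fun p hp => hp.2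
      refine memH_of_lipschitz (memLp_of_continuous hwC) (L := M) fun θ t => ?_
      rw [← Complex.ofReal_sub, Complex.norm_real]
      have h2 := hlip _ (expi_mem_cdisc (θ + t)) _ (expi_mem_cdisc θ)
      have hM0 : 0 ≤ M := (norm_nonneg _).trans (hM 0 (Metric.mem_ball_self one_pos))
      refine h2.trans (mul_le_mul_of_nonneg_left ?_ hM0)
      rw [expi_add, expi_coe, ← mul_sub_one, norm_mul, norm_expi, one_mul, mul_comm (t : ℂ)]
      exact Real.norm_exp_I_mul_ofReal_sub_one_le
    have hsum : Summable fun n : ℕ => (n : ℂ) * (fourierCoeff (fun θ => (w θ : ℂ)) (-n) * bCoeff u n) := by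
      have h1 : Summable fun n : ℕ => (n : ℝ) * ‖fourierCoeff (fun θ => (w θ : ℂ)) (-n)‖ ^ 2 := by
        have := hwH.2.comp_injective (i := fun n : ℕ => -(n : ℤ))
          (neg_injective.comp Nat.cast_injective)
        refine this.congr fun n => ?_
        simp
      refine Summable.of_norm (Summable.of_nonneg_of_le (fun n => norm_nonneg _) (fun n => ?_)
        (h1.add he))
      rw [norm_mul, norm_mul, Complex.norm_natCast, ← mul_add]
      gcongr
      nlinarith [sq_nonneg (‖fourierCoeff (fun θ => (w θ : ℂ)) (-n)‖ - ‖bCoeff u n‖),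
        sq_nonneg (‖fourierCoeff (fun θ => (w θ : ℂ)) (-n)‖), sq_nonneg ‖bCoeff u n‖]
    have hlim := hη.tendsto_integral_power hbp.deriv he.summable_deriv
    have e1 : ∫ z in disc, deriv (bFun u) z * gradient (φ ∘ F) z = 2 * π *
        ∑' n : ℕ, (n : ℂ) * (fourierCoeff (fun θ => (w θ : ℂ)) (-n) * bCoeff u n) := by
      refine tendsto_nhds_unique hlim ?_
      have h1 := (hasSum_nat_add_iff' 1).2 (hsum.hasSum.mul_left (2 * π : ℂ))
      simp only [Finset.range_one, Finset.sum_singleton, Nat.cast_zero, zero_mul, mul_zero, sub_zero] at h1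
      refine h1.tendsto_sum_nat.congr fun N => Finset.sum_congr rfl fun n _ => ?_
      have := integral_mul_expi_pow (fun θ => (w θ : ℂ)) (n + 1)
      have e2 : ∀ θ : Torus, (((φ ∘ F) (expi θ) : ℝ) : ℂ) = (w θ : ℂ) := fun θ => rfl
      simp only [e2, this]
      push_cast; ring
    have e3 : ∫ θ : Torus, φ (F (expi θ)) = 2 * π * (fourierCoeff (fun θ => (w θ : ℂ)) 0).re := by
      have h1 := integral_mul_expi_pow (fun θ => (w θ : ℂ)) 0
      simp only [pow_zero, mul_one, Nat.cast_zero, neg_zero] at h1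
      rw [integral_complex_ofReal] at h1
      have h2 := congrArg Complex.re h1
      rw [Complex.ofReal_re] at h2
      rw [show (2 * π * (fourierCoeff (fun θ => (w θ : ℂ)) 0).re : ℝ) =
        ((2 * π : ℂ) * fourierCoeff (fun θ => (w θ : ℂ)) 0).re by
          rw [show (2 * π : ℂ) = ((2 * π : ℝ) : ℂ) by push_cast; rfl, Complex.re_ofReal_mul], ← h2]
      rfl
    rw [wedgePairing_eq h0 hsum, e1, e3]
    have e4 : ((2 * π : ℂ) * ∑' n : ℕ, (n : ℂ) * (fourierCoeff (fun θ => (w θ : ℂ)) (-n) * bCoeff u n)).re =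
        2 * π * (∑' n : ℕ, (n : ℂ) * (fourierCoeff (fun θ => (w θ : ℂ)) (-n) * bCoeff u n)).re := by
      rw [show (2 * π : ℂ) = ((2 * π : ℝ) : ℂ) by push_cast; rfl, Complex.re_ofReal_mul]
    rw [e4]
    have e5 : ∑ j, (d j : ℝ) * (2 * π * φ (F (α j))) = 2 * π * ∑ j, (d j : ℝ) * φ ((F ∘ α) j) := by
      rw [Finset.mul_sum]
      exact Finset.sum_congr rfl fun j _ => by rw [Function.comp_apply]; ring
    simp only [mul_sub, Finset.sum_sub_distrib, ← Finset.sum_mul]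
    rw [e5]
    ring
  · simp only [speed_bdry h]
    have e : ∀ θ : Torus, (regTrace F d α v c₀ θ + logSum d (F ∘ α) (bdry F θ)) * ‖F' (expi θ)‖ =
        X θ * ‖F' (expi θ)‖ + c₀ * ‖F' (expi θ)‖ := fun θ => by
      simp only [hX, regTrace]; ring
    simp only [e]
    rw [integral_add hXi (hsi.const_mul _), integral_const_mul, hc₀, div_mul_cancel₀ _ hpos]
    ring

end existence

/-! ### The renormalized energy in the disc. -/

section formula

variable {F F' : ℂ → ℂ} {c : ℝ} {k : ℕ} {α : Fin k → ℂ} {d : Fin k → ℤ}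

/-- The renormalized energy in conformal coordinates, up to an additive constant. -/
def confEnergy (d : Fin k → ℤ) (F' B : ℂ → ℂ) (α : Fin k → ℂ) : ℝ :=
  -π * (∑ j, ∑ l, if j ≠ l then (d j : ℝ) * d l * Real.log ‖α j - α l‖ else 0)
    - 2 * π * ∑ j, (d j : ℝ) * (B (α j)).re + π * ∑ j, (d j : ℝ) * d j * Real.log ‖F' (α j)‖
    - π * ∑ j, ∑ l, (d j : ℝ) * d l * Real.log ‖1 - (starRingEnd ℂ) (α l) * α j‖

theorem norm_conj_mul_expi_lt {a : ℂ} (ha : a ∈ disc) (θ : Torus) :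
    ‖(starRingEnd ℂ) a * expi θ‖ < 1 := by
  rw [norm_mul, norm_expi, mul_one, RCLike.norm_conj]
  exact mem_ball_zero_iff.1 ha

theorem continuous_log_one_sub {a : ℂ} (ha : a ∈ disc) :
    Continuous fun θ : Torus => -Complex.log (1 - (starRingEnd ℂ) a * expi θ) := by
  refine (Continuous.clog (continuous_const.sub (continuous_const.mul continuous_expi))
    fun θ => ?_).neg
  rw [sub_eq_add_neg]
  refine Complex.mem_slitPlane_of_norm_lt_one ?_
  change ‖-((starRingEnd ℂ) a * expi θ)‖ < 1
  rw [norm_neg]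
  exact norm_conj_mul_expi_lt ha θ

theorem fourierCoeff_log_one_sub {a : ℂ} (ha : a ∈ disc) :
    (∀ n : ℕ, fourierCoeff (fun θ : Torus => -Complex.log (1 - (starRingEnd ℂ) a * expi θ)) n =
      (starRingEnd ℂ) a ^ n / n) ∧
    ∀ n : ℕ, n ≠ 0 →
      fourierCoeff (fun θ : Torus => -Complex.log (1 - (starRingEnd ℂ) a * expi θ)) (-n) = 0 := by
  have hs : Summable fun n : ℕ => ‖(starRingEnd ℂ) a ^ n / n‖ := by
    refine Summable.of_nonneg_of_le (fun n => norm_nonneg _) (fun n => ?_)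
      (summable_geometric_of_lt_one (norm_nonneg a) (mem_ball_zero_iff.1 ha))
    rw [norm_div, norm_pow, RCLike.norm_conj, Complex.norm_natCast]
    rcases Nat.eq_zero_or_pos n with rfl | hn
    · simp
    · exact div_le_self (by positivity) (by exact_mod_cast hn)
  have h := fourierCoeff_of_hasSum (k := fun n : ℕ => (n : ℤ)) Nat.cast_injective hs
    (u := fun θ => -Complex.log (1 - (starRingEnd ℂ) a * expi θ)) fun θ => by
      have h1 := Complex.hasSum_taylorSeries_neg_log (norm_conj_mul_expi_lt ha θ)
      have e : (fun n : ℕ => (starRingEnd ℂ) a ^ n / n * (fourier (n : ℤ) θ : ℂ)) =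
          fun n : ℕ => ((starRingEnd ℂ) a * expi θ) ^ n / n := by
        funext n; rw [fourier_eq_expi_zpow, zpow_natCast, mul_pow]; ring
      rw [e]; exact h1
  refine ⟨h.1, fun n hn => h.2 _ ?_⟩
  rintro ⟨m, hm⟩
  simp only at hm
  omega

theorem re_neg_log (x : ℂ) : (-Complex.log x).re = -Real.log ‖x‖ := by
  rw [Complex.neg_re, Complex.log_re]

theorem norm_expi_sub (a : ℂ) (θ : Torus) : ‖expi θ - a‖ = ‖1 - (starRingEnd ℂ) a * expi θ‖ := by
  have h1 : (starRingEnd ℂ) (expi θ) * expi θ = 1 := by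
    rw [mul_comm, Complex.mul_conj, Complex.normSq_eq_norm_sq, norm_expi]; simp
  have h2 : 1 - (starRingEnd ℂ) a * expi θ = (starRingEnd ℂ) (expi θ - a) * expi θ := by
    rw [map_sub, sub_mul, h1]
  rw [h2, norm_mul, norm_expi, mul_one, RCLike.norm_conj]

/-- The logarithms of the difference quotients cancel, and on the circle |e - α| = |1 - ᾱe|. This
part of the boundary trace of Φ is thus the same for every `F`. -/
theorem logSum_bdry (hl : DiscC1.LowerLip F c) (h : DiscC1 F F') (hα : ∀ j, α j ∈ disc) (θ : Torus) :
    smoothPart F d α (expi θ) + logSum d (F ∘ α) (bdry F θ) =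
      ∑ j, (d j : ℝ) * (2 * Real.log ‖1 - (starRingEnd ℂ) (α j) * expi θ‖) := by
  rw [smoothPart, logSum, ← Finset.sum_add_distrib]
  refine Finset.sum_congr rfl fun j _ => ?_
  have h1 : expi θ - α j ≠ 0 := fun he => by
    have h1 := mem_ball_zero_iff.1 (hα j)
    rw [← sub_eq_zero.1 he, norm_expi] at h1
    exact lt_irrefl _ h1
  have h2 := h.dslope_ne_zero hl (hα j) (expi_mem_cdisc θ)
  rw [bdry, Function.comp_apply, sub_eq_dslope_mul, norm_mul,
    Real.log_mul (norm_ne_zero_iff.2 h1) (norm_ne_zero_iff.2 h2), norm_expi_sub]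
  ring

/-- The trace is the real part of a function with no negative frequencies, with coefficients -2∑ d_j
ᾱ_jⁿ/n + b_n for n ≥ 1. Paired with n b_n, the first summand gives -∑ d_j B(α_j) and the second
gives half of ∑ n|b_n|². -/
theorem wedgePairing_trace (h : DiscC1 F F') (hl : DiscC1.LowerLip F c) (hα : ∀ j, α j ∈ disc)
    {u : Torus → ℂ} (he : FiniteEnergy u)
    (h0 : wedgeCoeff u 0 = ((2 * π * ∑ j, (d j : ℝ) : ℝ) : ℂ)) {v : Torus → ℂ}
    (hvm : MemLp v 2 volume) (hv : ∀ n : ℕ, fourierCoeff v n = bCoeff u n)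
    (hv' : ∀ n : ℕ, n ≠ 0 → fourierCoeff v (-n) = 0) (c₀ : ℝ) {w : Torus → ℝ}
    (hw : w =ᵐ[volume] fun θ => regTrace F d α v c₀ θ + logSum d (F ∘ α) (bdry F θ)) :
    wedgePairing u w = 2 * π * ((∑ j, (d j : ℝ)) * c₀ - (∑ j, (d j : ℝ) * (bFun u (α j)).re) +
      (∑' n : ℕ, (n : ℝ) * ‖bCoeff u n‖ ^ 2) / 2) := by
  set L : Fin k → Torus → ℂ := fun j θ => -Complex.log (1 - (starRingEnd ℂ) (α j) * expi θ) with hL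
  have hLm : ∀ j, MemLp (fun θ => (-2 * d j : ℂ) * L j θ) 2 volume := fun j =>
    (memLp_of_continuous (continuous_log_one_sub (hα j))).const_mul _
  set U : Torus → ℂ := fun θ => ∑ j, (-2 * d j : ℂ) * L j θ with hU
  have hUm : MemLp U 2 volume := memLp_finsetSum _ fun j _ => hLm j
  have hcm : MemLp (fun _ : Torus => (c₀ : ℂ)) 2 volume := memLp_of_continuous continuous_const
  set V : Torus → ℂ := fun θ => U θ + v θ + c₀ with hV
  have hVm : MemLp V 2 volume := (hUm.add hvm).add hcm
  have hVc : ∀ n : ℤ, fourierCoeff V n = (∑ j, (-2 * d j : ℂ) * fourierCoeff (L j) n) +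
      fourierCoeff v n + if n = 0 then (c₀ : ℂ) else 0 := fun n => by
    have h1 : fourierCoeff (fun _ : Torus => (c₀ : ℂ)) n = if n = 0 then (c₀ : ℂ) else 0 := by
      have := fourierCoeff.const_mul (fourier 0 : Torus → ℂ) (c₀ : ℂ) n
      rw [fourierCoeff_fourier] at this
      simp only [fourier_zero, mul_one] at this
      rw [this]
      split_ifs with a b b
      · simp
      · exact absurd a.symm b
      · exact absurd b.symm a
      · simp
    have hUv : MemLp (fun θ => U θ + v θ) 2 volume := hUm.add hvm
    rw [hV, fourierCoeff_add hUv hcm, fourierCoeff_add hUm hvm, h1, hU,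
      fourierCoeff_sum _ fun j _ => hLm j]
    simp only [fourierCoeff.const_mul]
  have hwV : (fun θ => (w θ : ℂ)) =ᵐ[haarAddCircle] fun θ => ((V θ).re : ℂ) := by
    refine ae_haar_iff.2 ?_
    filter_upwards [hw] with θ hθ
    rw [hθ, regTrace, show ∀ a b c e : ℝ, a + b + c + e = a + e + b + c from fun _ _ _ _ => by ring,
      logSum_bdry hl h hα]
    congr 1
    simp only [hV, hU, Complex.add_re, Complex.ofReal_re, Complex.re_sum]
    congr 2
    refine Finset.sum_congr rfl fun j _ => ?_
    rw [show (-2 * d j : ℂ) = ((-2 * d j : ℝ) : ℂ) by push_cast; rfl, Complex.re_ofReal_mul, hL, re_neg_log]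
    ring
  have hwc : ∀ n : ℤ, fourierCoeff (fun θ => (w θ : ℂ)) n =
      (1 / 2 : ℂ) * (fourierCoeff V n + (starRingEnd ℂ) (fourierCoeff V (-n))) := fun n => by
    rw [← fourierCoeff_re hVm]
    exact congrFun (fourierCoeff_congr_ae hwV) n
  have hw0 : fourierCoeff (fun θ => (w θ : ℂ)) 0 = c₀ := by
    have h1 := (fun j => (fourierCoeff_log_one_sub (hα j)).1 0)
    have h2 := hv 0
    simp only [Nat.cast_zero, _root_.div_zero, bCoeff_zero] at h1 h2
    rw [hwc, neg_zero, hVc]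
    simp only [hL, h1, h2]
    simp
    ring
  have hsB : ∀ j, HasSum (fun n => bCoeff u n * α j ^ n) (bFun u (α j)) := fun j =>
    he.hasPower _ (hα j)
  have hterm : ∀ n : ℕ, (n : ℂ) * (fourierCoeff (fun θ => (w θ : ℂ)) (-n) * bCoeff u n) =
      -(∑ j, (d j : ℂ) * (bCoeff u n * α j ^ n)) + (((n : ℝ) * ‖bCoeff u n‖ ^ 2 : ℝ) : ℂ) / 2 := by
    intro n
    rcases Nat.eq_zero_or_pos n with rfl | hn
    · simp [bCoeff_zero]
    have hn0 : n ≠ 0 := hn.ne'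
    have hnz : (n : ℂ) ≠ 0 := by exact_mod_cast hn0
    rw [hwc, neg_neg, hVc, hVc, hv, hv' n hn0]
    simp only [hL, (fourierCoeff_log_one_sub (hα _)).1, (fourierCoeff_log_one_sub (hα _)).2 n hn0]
    have h1 : (-(n : ℤ)) ≠ 0 := by omega
    have h2 : (n : ℤ) ≠ 0 := by omega
    rw [if_neg h1, if_neg h2]
    simp only [mul_zero, Finset.sum_const_zero, zero_add, add_zero, map_add, map_sum, map_mul, map_neg,
      map_div₀, map_pow, Complex.conj_conj, map_ofNat, map_intCast, map_natCast]
    have h3 : (((n : ℝ) * ‖bCoeff u n‖ ^ 2 : ℝ) : ℂ) = n * ((starRingEnd ℂ) (bCoeff u n) * bCoeff u n) := by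
      rw [mul_comm ((starRingEnd ℂ) _), Complex.mul_conj, Complex.normSq_eq_norm_sq]
      push_cast; ring
    rw [h3, mul_add, add_mul, mul_add]
    congr 1
    · rw [Finset.mul_sum, Finset.sum_mul, Finset.mul_sum, ← Finset.sum_neg_distrib]
      refine Finset.sum_congr rfl fun j _ => ?_
      field_simp
    · ring
  have hsum : HasSum (fun n : ℕ => (n : ℂ) * (fourierCoeff (fun θ => (w θ : ℂ)) (-n) * bCoeff u n))
      (-(∑ j, (d j : ℂ) * bFun u (α j)) + ((∑' n : ℕ, (n : ℝ) * ‖bCoeff u n‖ ^ 2 : ℝ) : ℂ) / 2) := by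
    simp only [hterm]
    refine HasSum.add (HasSum.neg (hasSum_sum fun j _ => (hsB j).mul_left _)) (HasSum.div_const ?_ _)
    exact Complex.hasSum_ofReal.2 he.hasSum
  rw [wedgePairing_eq h0 hsum.summable, hsum.tsum_eq, hw0]
  congr 1
  rw [Complex.ofReal_re, Complex.add_re, Complex.neg_re, Complex.re_sum, sub_eq_add_neg, add_assoc]
  congr 3
  · congr 1
    funext j
    rw [show (d j : ℂ) = ((d j : ℝ) : ℂ) by push_cast; rfl, Complex.re_ofReal_mul]
  · rw [show (2 : ℂ) = ((2 : ℝ) : ℂ) by push_cast; rfl, Complex.div_ofReal_re, Complex.ofReal_re]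

/-- On the diagonal the difference quotient is F'(α_j). Off it, log|dslope| = log|F(α_j) - F(α_l)| -
log|α_j - α_l|, and the former will cancel the interaction term of the energy. -/
theorem sum_smoothPart (h : DiscC1 F F') (hl : DiscC1.LowerLip F c) (hα : α ∈ Config disc k) :
    ∑ j, (d j : ℝ) * smoothPart F d α (α j) =
      (∑ j, ∑ l, (d j : ℝ) * d l * Real.log ‖1 - (starRingEnd ℂ) (α l) * α j‖) -
      (∑ j, ∑ l, if j ≠ l then (d j : ℝ) * d l * Real.log ‖F (α j) - F (α l)‖ else 0) +
      (∑ j, ∑ l, if j ≠ l then (d j : ℝ) * d l * Real.log ‖α j - α l‖ else 0) -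
      ∑ j, (d j : ℝ) * d j * Real.log ‖F' (α j)‖ := by
  have hdiag : ∀ j, (d j : ℝ) * d j * Real.log ‖F' (α j)‖ =
      ∑ l, if j ≠ l then 0 else (d j : ℝ) * d l * Real.log ‖F' (α l)‖ := fun j => by
    simp
  simp only [hdiag]
  rw [← Finset.sum_sub_distrib, ← Finset.sum_add_distrib, ← Finset.sum_sub_distrib]
  refine Finset.sum_congr rfl fun j _ => ?_
  rw [← Finset.sum_sub_distrib, ← Finset.sum_add_distrib, ← Finset.sum_sub_distrib, smoothPart,
    Finset.mul_sum]
  refine Finset.sum_congr rfl fun l _ => ?_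
  by_cases hjl : j = l
  · subst hjl
    simp only [ne_eq, not_true_eq_false, if_false, sub_zero, add_zero, dslope_same]
    rw [(h.hasDerivAt _ (hα.1 j)).deriv]
    ring
  · have h1 : α j - α l ≠ 0 := sub_ne_zero.2 (hα.2 j l hjl)
    have h2 := h.dslope_ne_zero hl (hα.1 l) (disc_subset_cdisc (hα.1 j))
    simp only [ne_eq, hjl, not_false_eq_true, if_true]
    rw [sub_eq_dslope_mul F (α l), norm_mul, Real.log_mul (norm_ne_zero_iff.2 h1) (norm_ne_zero_iff.2 h2)]
    ring

/-- The renormalized energy in conformal coordinates. -/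
theorem WConf_eq (h : DiscC1 F F') (hl : DiscC1.LowerLip F c) (hα : α ∈ Config disc k)
    {u : Torus → ℂ} (he : FiniteEnergy u)
    (h0 : wedgeCoeff u 0 = ((2 * π * ∑ j, (d j : ℝ) : ℝ) : ℂ)) :
    WConf d F u (F ∘ α) =
      confEnergy d F' (bFun u) α + π / 2 * ∑' n : ℕ, (n : ℝ) * ‖bCoeff u n‖ ^ 2 := by
  obtain ⟨v, hvm, hv, hv', hvt⟩ := exists_boundary_function he.summable_sq
  have hex : ∃ p : (ℂ → ℝ) × (Torus → ℝ), IsRegularPart (F '' disc) (bdry F) d (push F u) (F ∘ α)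
      p.1 p.2 := by
    obtain ⟨c₀, hc₀⟩ := exists_isRegularPart h hl hα.1 he h0 hvm hvt
    exact ⟨(_, _), hc₀⟩
  rw [WConf, W, dif_pos hex]
  -- The chosen pair is arbitrary: `R` is determined inside up to c₀, and ρ almost everywhere by
  -- uniqueness of the trace. The value of c₀ is irrelevant, since π(∑ d_j) c₀ from the boundary
  -- term cancels the same quantity in the point term.
  have hR := hex.choose_spec
  set R := hex.choose.1
  set ρ := hex.choose.2
  obtain ⟨-, c₀, hc₀⟩ := hR.pullback h hl hα.1
  have hρ : ρ =ᵐ[volume] regTrace F d α v c₀ := by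
    refine HasTrace.unique h hl hR.trace (hasTrace_regPart h hl hα.1 he hvt c₀)
      (HarmonicOn.contDiffOn hR.harmonic) ?_ hR.trace_memLp.1 ?_
    · rintro _ ⟨z, hz, rfl⟩
      rw [hc₀ z hz, regPart_apply hl _ _ (disc_subset_cdisc hz)]
    · have hSc : Continuous fun θ : Torus => smoothPart F d α (expi θ) :=
        (h.continuousOn_smoothPart d hl hα.1).comp_continuous continuous_expi expi_mem_cdisc
      exact (hSc.aestronglyMeasurable.add (Complex.continuous_re.comp_aestronglyMeasurable hvm.1)).add
        aestronglyMeasurable_const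
  have hw : (fun θ => ρ θ + logSum d (F ∘ α) (bdry F θ)) =ᵐ[volume]
      fun θ => regTrace F d α v c₀ θ + logSum d (F ∘ α) (bdry F θ) := by
    filter_upwards [hρ] with θ hθ
    rw [hθ]
  rw [push_comp_bdry hl, wedgePairing_trace h hl hα.1 he h0 hvm hv hv' c₀ hw]
  have e1 : ∑ j, (d j : ℝ) * R ((F ∘ α) j) = (∑ j, (d j : ℝ) * smoothPart F d α (α j)) +
      (∑ j, (d j : ℝ) * (bFun u (α j)).re) + (∑ j, (d j : ℝ)) * c₀ := by
    rw [Finset.sum_mul, ← Finset.sum_add_distrib, ← Finset.sum_add_distrib]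
    refine Finset.sum_congr rfl fun j _ => ?_
    rw [Function.comp_apply, hc₀ _ (hα.1 j)]
    ring
  rw [e1, sum_smoothPart h hl hα, confEnergy]
  simp only [Function.comp_apply]
  ring

end formula

/-! ### Critical points depending on parameters. -/

section branch

variable {E A : Type*} [NormedAddCommGroup E] [NormedSpace ℝ E] [CompleteSpace E]
  [NormedAddCommGroup A] [NormedSpace ℝ A] [FiniteDimensional ℝ A]

/-- A finite-dimensional space and its dual have equal dimension, so nondegeneracy of the Hessian is
invertibility. -/
theorem isInvertible_of_injective {T : A →L[ℝ] A →L[ℝ] ℝ} (hT : ∀ v, (∀ w, T v w = 0) → v = 0) :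
    T.IsInvertible := by
  have hinj : Function.Injective (T : A →ₗ[ℝ] A →L[ℝ] ℝ) := by
    rw [injective_iff_map_eq_zero]
    intro v hv
    refine hT v fun w => ?_
    have := congrArg (fun S : A →L[ℝ] ℝ => S w) hv
    simpa using this
  have hd : Module.finrank ℝ A = Module.finrank ℝ (A →L[ℝ] ℝ) := by
    rw [← (LinearMap.toContinuousLinearMap (𝕜 := ℝ) (E := A) (F' := ℝ)).finrank_eq]
    exact (Subspace.dual_finrank_eq (K := ℝ) (V := A)).symm
  have : FiniteDimensional ℝ (A →L[ℝ] ℝ) :=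
    (LinearMap.toContinuousLinearMap (𝕜 := ℝ) (E := A) (F' := ℝ)).finiteDimensional
  exact ⟨(LinearEquiv.ofInjectiveOfFinrankEq _ hinj hd).toContinuousLinearEquiv,
    by ext v w; rfl⟩

/-- A nondegenerate critical point of a smooth function depends smoothly on parameters. -/
theorem exists_critical_branch {K : E → A → ℝ} {O : Set (E × A)} {p₀ : E} {α₀ : A} (hO : IsOpen O)
    (hK : ∀ q ∈ O, ContDiffAt ℝ ∞ (Function.uncurry K) q) (h₀ : (p₀, α₀) ∈ O)
    (hc : fderiv ℝ (K p₀) α₀ = 0)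
    (hn : ∀ v, (∀ w, fderiv ℝ (fderiv ℝ (K p₀)) α₀ v w = 0) → v = 0) :
    ∃ (𝒰 : Set E) (a : E → A) (δ : ℝ), IsOpen 𝒰 ∧ p₀ ∈ 𝒰 ∧ a p₀ = α₀ ∧ 0 < δ ∧ ContDiffOn ℝ ∞ a 𝒰 ∧
      ∀ p ∈ 𝒰, a p ∈ Metric.ball α₀ δ ∧
        (∀ α ∈ Metric.ball α₀ δ, (p, α) ∈ O ∧ (fderiv ℝ (K p) α = 0 ↔ α = a p)) ∧
        ∀ v, (∀ w, fderiv ℝ (fderiv ℝ (K p)) (a p) v w = 0) → v = 0 := by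
  have : CompleteSpace A := FiniteDimensional.complete ℝ A
  -- Critical points of `K p` are the zeros of D(p, ·), whose partial derivative in the second
  -- variable is the Hessian; nondegeneracy is exactly the hypothesis of the implicit function
  -- theorem.
  set D : E × A → A →L[ℝ] ℝ := fun q => fderiv ℝ (K q.1) q.2 with hD
  have hDs : ∀ q ∈ O, ContDiffAt ℝ ∞ D q := fun q hq => by
    have h1 : ContDiffAt ℝ ∞ (Function.uncurry fun (q : E × A) (α : A) => K q.1 α) (q, q.2) := by
      have : (Function.uncurry fun (q : E × A) (α : A) => K q.1 α) =
          Function.uncurry K ∘ fun x : (E × A) × A => (x.1.1, x.2) := rfl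
      rw [this]
      exact (hK q hq).comp (q, q.2) (by fun_prop : ContDiffAt ℝ ∞ (fun x : (E × A) × A => (x.1.1, x.2)) (q, q.2))
    exact ContDiffAt.fderiv h1 contDiffAt_snd (by simp)
  have hDr : ∀ q ∈ O, fderiv ℝ D q ∘L .inr ℝ E A = fderiv ℝ (fderiv ℝ (K q.1)) q.2 := fun q hq => by
    have h1 : HasFDerivAt D (fderiv ℝ D q) (q.1, q.2) := ((hDs q hq).differentiableAt (by simp)).hasFDerivAt
    have h2 := h1.comp q.2 (hasFDerivAt_prodMk_right q.1 q.2)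
    exact h2.fderiv.symm
  set u₀ : E × A := (p₀, α₀)
  have h0 : D u₀ = 0 := hc
  have hinv₀ : (fderiv ℝ D u₀ ∘L .inr ℝ E A).IsInvertible := by
    rw [hDr u₀ h₀]; exact isInvertible_of_injective hn
  set a : E → A := (hDs u₀ h₀).implicitFunction (by simp) hinv₀ with ha
  have ha0 : a p₀ = α₀ := (hDs u₀ h₀).implicitFunction_apply_self (by simp) hinv₀
  have hac : ContDiffAt ℝ ∞ a p₀ := (hDs u₀ h₀).contDiffAt_implicitFunction (by simp) hinv₀
  have hev : ∀ᶠ q in 𝓝 u₀, q ∈ O ∧ (fderiv ℝ D q ∘L .inr ℝ E A).IsInvertible ∧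
      (D q = 0 ↔ a q.1 = q.2) := by
    have h1 : ∀ᶠ q in 𝓝 u₀, (fderiv ℝ D q ∘L .inr ℝ E A).IsInvertible := by
      have hcont : ContinuousAt (fun q => fderiv ℝ D q ∘L .inr ℝ E A) u₀ :=
        (((hDs u₀ h₀).fderiv_right (m := 0) (by simp)).continuousAt).clm_comp continuousAt_const
      obtain ⟨e, he⟩ := hinv₀
      have := hcont.preimage_mem_nhds (by rw [← he]; exact ContinuousLinearEquiv.nhds e)
      filter_upwards [this] with q hq
      exact hq
    have h2 := (hDs u₀ h₀).eventually_apply_eq_iff_implicitFunction (by simp) hinv₀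
    filter_upwards [hO.mem_nhds h₀, h1, h2] with q hq1 hq2 hq3
    rw [h0] at hq3
    exact ⟨hq1, hq2, hq3⟩
  obtain ⟨T, hTs, hTo, hT0⟩ := mem_nhds_iff.1 hev
  obtain ⟨U, hU, V, hV, hUV⟩ := mem_nhds_prod_iff.1 (hTo.mem_nhds hT0)
  obtain ⟨δ, hδ, hδV⟩ := Metric.mem_nhds_iff.1 hV
  have h3 : {p | p ∈ U ∧ a p ∈ Metric.ball α₀ δ} ∈ 𝓝 p₀ := by
    have h4 : ∀ᶠ p in 𝓝 p₀, a p ∈ Metric.ball α₀ δ := hac.continuousAt.eventually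
      (Metric.isOpen_ball.mem_nhds (by rw [ha0]; exact Metric.mem_ball_self hδ))
    exact inter_mem hU h4
  obtain ⟨𝒰, h𝒰s, h𝒰o, h𝒰0⟩ := mem_nhds_iff.1 h3
  have hmem : ∀ p ∈ 𝒰, ∀ α ∈ Metric.ball α₀ δ, (p, α) ∈ T := fun p hp α hα =>
    hUV ⟨(h𝒰s hp).1, hδV hα⟩
  refine ⟨𝒰, a, δ, h𝒰o, h𝒰0, ha0, hδ, fun p hp => ContDiffAt.contDiffWithinAt ?_, fun p hp =>
    ⟨(h𝒰s hp).2, fun α hα => ⟨(hTs (hmem p hp α hα)).1, ?_⟩, fun v hv => ?_⟩⟩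
  -- The implicit function theorem at p₀ gives smoothness of `a` only at p₀, and C^∞ at a point need
  -- not spread to a neighborhood. It is applied again at (p, a p), and local uniqueness identifies
  -- the new implicit function with `a` near p.
  · have hpT := hmem p hp _ (h𝒰s hp).2
    obtain ⟨q1, q2, q3⟩ := hTs hpT
    have hDp : D (p, a p) = 0 := q3.2 rfl
    have hs := (hDs _ q1).contDiffAt_implicitFunction (by simp) q2
    set b := (hDs _ q1).implicitFunction (by simp) q2
    have hb : b p = a p := (hDs _ q1).implicitFunction_apply_self (by simp) q2
    have hbT : ∀ᶠ x in 𝓝 p, (x, b x) ∈ T := by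
      have : ContinuousAt (fun x => (x, b x)) p := continuousAt_id.prodMk hs.continuousAt
      exact this.preimage_mem_nhds (hTo.mem_nhds (by rw [hb]; exact hpT))
    refine hs.congr_of_eventuallyEq ?_
    filter_upwards [hbT, (hDs _ q1).eventually_apply_implicitFunction (by simp) q2] with x hx1 hx2
    exact (hTs hx1).2.2.1 (hx2.trans hDp)
  · exact (hTs (hmem p hp α hα)).2.2.trans eq_comm
  · obtain ⟨q1, ⟨e, he⟩, -⟩ := hTs (hmem p hp _ (h𝒰s hp).2)
    have h4 : fderiv ℝ (fderiv ℝ (K p)) (a p) = (e : A →L[ℝ] A →L[ℝ] ℝ) := by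
      rw [he, hDr _ q1]
    refine e.injective ?_
    rw [map_zero]
    ext w
    have := hv w
    rw [h4] at this
    exact this

end branch

/-! ### Invariance of nondegeneracy under local diffeomorphisms. -/

section transfer

variable {k : ℕ} {G Q : (Fin k → ℂ) → ℝ} {Ψ : (Fin k → ℂ) → Fin k → ℂ} {α : Fin k → ℂ}

theorem IsCritical.congr (hG : IsCritical G α) (h : Q =ᶠ[𝓝 α] G) : IsCritical Q α :=
  HasFDerivAt.congr_of_eventuallyEq hG h

theorem IsNondegenerateCritical.congr (hG : IsNondegenerateCritical G α) (h : Q =ᶠ[𝓝 α] G) :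
    IsNondegenerateCritical Q α := by
  obtain ⟨h1, h2, h3, h4⟩ := hG
  refine ⟨h1.congr h, ?_, h3.congr_of_eventuallyEq h.fderiv, fun v hv => h4 v fun w => ?_⟩
  · filter_upwards [h2, h.eventually_nhds] with b hb hb'
    exact hb.congr_of_eventuallyEq hb'
  · rw [← h.fderiv.fderiv_eq]; exact hv w

theorem isNondegenerateCritical_iff (hQ : ContDiffAt ℝ ∞ Q α) :
    IsNondegenerateCritical Q α ↔
      fderiv ℝ Q α = 0 ∧ ∀ v, (∀ w, fderiv ℝ (fderiv ℝ Q) α v w = 0) → v = 0 := by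
  refine ⟨fun h => ⟨h.1.fderiv, h.2.2.2⟩, fun h => ⟨?_, ?_, ?_, h.2⟩⟩
  · rw [IsCritical, ← h.1]
    exact (hQ.differentiableAt (by simp)).hasFDerivAt
  · have := (hQ.of_le (m := 1) (by exact_mod_cast le_top)).eventually (by simp)
    filter_upwards [this] with b hb
    exact hb.differentiableAt (by simp)
  · exact (hQ.fderiv_right (m := ∞) (by simp)).differentiableAt (by simp)

theorem IsCritical.comp (hG : IsCritical G (Ψ α)) (hΨ : DifferentiableAt ℝ Ψ α) :
    IsCritical (G ∘ Ψ) α := by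
  have := HasFDerivAt.comp α hG hΨ.hasFDerivAt
  rwa [ContinuousLinearMap.zero_comp] at this

/-- Nondegenerate critical points are invariant under local diffeomorphisms. -/
theorem IsNondegenerateCritical.comp (hG : IsNondegenerateCritical G (Ψ α)) (hΨ : ContDiffAt ℝ 2 Ψ α)
    (hinj : Function.Injective (fderiv ℝ Ψ α)) : IsNondegenerateCritical (G ∘ Ψ) α := by
  obtain ⟨h1, h2, h3, h4⟩ := hG
  have e1 : ∀ᶠ β in 𝓝 α, DifferentiableAt ℝ Ψ β := by
    filter_upwards [hΨ.eventually (by simp)] with β hβ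
    exact hβ.differentiableAt (by simp)
  have e2 : ∀ᶠ β in 𝓝 α, DifferentiableAt ℝ G (Ψ β) := hΨ.continuousAt.eventually h2
  have e3 : fderiv ℝ (G ∘ Ψ) =ᶠ[𝓝 α] fun β => (fderiv ℝ G (Ψ β)).comp (fderiv ℝ Ψ β) := by
    filter_upwards [e1, e2] with β hβ1 hβ2
    exact fderiv_comp β hβ2 hβ1
  have hd1 : HasFDerivAt (fun β => fderiv ℝ G (Ψ β))
      ((fderiv ℝ (fderiv ℝ G) (Ψ α)).comp (fderiv ℝ Ψ α)) α :=
    h3.hasFDerivAt.comp α e1.self_of_nhds.hasFDerivAt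
  have hd2 : HasFDerivAt (fderiv ℝ Ψ) (fderiv ℝ (fderiv ℝ Ψ) α) α :=
    ((hΨ.fderiv_right (m := 1) (by norm_num)).differentiableAt (by simp)).hasFDerivAt
  -- In the product rule the term with the second derivative of Ψ is multiplied by the differential
  -- of `G` at Ψ α, which is zero; only the Hessian conjugated by the invertible differential of Ψ
  -- remains.
  have hd := (hd1.clm_comp hd2).congr_of_eventuallyEq e3
  refine ⟨h1.comp e1.self_of_nhds, ?_, hd.differentiableAt, fun v hv => ?_⟩
  · filter_upwards [e1, e2] with β hβ1 hβ2
    exact hβ2.comp β hβ1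
  · have hsurj : Function.Surjective (fderiv ℝ Ψ α) :=
      LinearMap.injective_iff_surjective.1 hinj
    refine hinj ?_
    rw [map_zero]
    refine h4 _ fun w => ?_
    obtain ⟨w, rfl⟩ := hsurj w
    have := hv w
    rw [hd.fderiv] at this
    simpa [h1.fderiv] using this

end transfer

/-! ### The Szegő projection of square integrable functions. -/

/-- The function `1 - z̄ e^{iθ}` on the circle. -/
def szegoDenom (z : ℂ) : C(Torus, ℂ) := 1 - (starRingEnd ℂ) z • (⟨expi, continuous_expi⟩ : C(Torus, ℂ))

/-- The space of complex square integrable functions on the circle. -/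
abbrev L2C : Type := Lp ℂ 2 (volume : Measure Torus)

/-- The Szegő kernel `1 / (1 - z̄ e^{iθ})`. -/
def szegoKernel (z : ℂ) : L2C := ContinuousMap.toLp 2 volume ℂ (Ring.inverse (szegoDenom z))

/-- The Szegő projection of a square integrable function, as a function in the disc. -/
def szego (p : L2C) (z : ℂ) : ℂ := (2 * π : ℂ)⁻¹ * inner ℂ (szegoKernel z) p

theorem norm_conj_smul_expi_lt {z : ℂ} (hz : z ∈ disc) :
    ‖(starRingEnd ℂ) z • (⟨expi, continuous_expi⟩ : C(Torus, ℂ))‖ < 1 := by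
  have h1 : ‖(⟨expi, continuous_expi⟩ : C(Torus, ℂ))‖ ≤ 1 :=
    (ContinuousMap.norm_le _ zero_le_one).2 fun θ => (norm_expi θ).le
  refine (norm_smul_le _ _).trans_lt ?_
  rw [RCLike.norm_conj]
  have h2 := mem_ball_zero_iff.1 hz
  nlinarith [norm_nonneg z, norm_nonneg (⟨expi, continuous_expi⟩ : C(Torus, ℂ))]

theorem isUnit_szegoDenom {z : ℂ} (hz : z ∈ disc) : IsUnit (szegoDenom z) :=
  (Units.oneSub _ (norm_conj_smul_expi_lt hz)).isUnit

/-- The denominator is real affine in z, with values in the Banach algebra of continuous functions;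
inversion is smooth on its units, and the inclusion in L² is linear. Differentiability is over ℝ
because the kernel is antiholomorphic in z. -/
theorem contDiffAt_szegoKernel {z : ℂ} (hz : z ∈ disc) : ContDiffAt ℝ ∞ szegoKernel z := by
  have h1 : ContDiff ℝ ∞ szegoDenom :=
    contDiff_const.sub (Complex.conjCLE.contDiff.smul contDiff_const)
  obtain ⟨x, hx⟩ := isUnit_szegoDenom hz
  have h2 : ContDiffAt ℝ ∞ Ring.inverse (szegoDenom z) := by
    rw [← hx]; exact contDiffAt_ringInverse ℝ x
  have h3 : ContDiff ℝ ∞ (ContinuousMap.toLp 2 (volume : Measure Torus) ℂ : C(Torus, ℂ) → L2C) :=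
    ((ContinuousMap.toLp 2 (volume : Measure Torus) ℂ : C(Torus, ℂ) →L[ℂ] L2C).restrictScalars ℝ).contDiff
  exact h3.contDiffAt.comp z (h2.comp z h1.contDiffAt)

theorem contDiffAt_szego (p : L2C) {z : ℂ} (hz : z ∈ disc) :
    ContDiffAt ℝ ∞ (fun q : L2C × ℂ => szego q.1 q.2) (p, z) := by
  unfold szego
  refine contDiffAt_const.mul (ContDiffAt.inner ℂ ?_ contDiffAt_fst)
  exact ContDiffAt.comp (g := szegoKernel) (p, z) (contDiffAt_szegoKernel hz) contDiffAt_snd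

theorem szegoKernel_ae {z : ℂ} (hz : z ∈ disc) :
    szegoKernel z =ᵐ[volume] fun θ => (1 - (starRingEnd ℂ) z * expi θ)⁻¹ := by
  filter_upwards [ContinuousMap.coeFn_toLp (p := 2) (𝕜 := ℂ) (volume : Measure Torus)
    (Ring.inverse (szegoDenom z))] with θ hθ
  rw [szegoKernel, hθ]
  have h1 := congrArg (fun f : C(Torus, ℂ) => f θ) (Ring.mul_inverse_cancel _ (isUnit_szegoDenom hz))
  simp only [ContinuousMap.mul_apply, ContinuousMap.one_apply] at h1
  exact eq_inv_of_mul_eq_one_right h1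

theorem szego_eq_integral (p : L2C) {z : ℂ} (hz : z ∈ disc) :
    szego p z = (2 * π : ℂ)⁻¹ * ∫ θ : Torus, p θ * ((starRingEnd ℂ) (1 - (starRingEnd ℂ) z * expi θ))⁻¹ := by
  rw [szego, L2.inner_def]
  congr 1
  refine integral_congr_ae ?_
  filter_upwards [szegoKernel_ae hz] with θ hθ
  rw [hθ, RCLike.inner_apply, map_inv₀]

/-- The Szegő projection reproduces the functions holomorphic in the disc. -/
theorem szego_eq_of_diffContOnCl {u : ℂ → ℂ} (hu : DiffContOnCl ℂ u disc) {p : L2C}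
    (hp : p =ᵐ[volume] fun θ => u (expi θ)) {z : ℂ} (hz : z ∈ disc) : szego p z = u z := by
  rw [szego_eq_integral p hz, ← hu.two_pi_i_inv_smul_circleIntegral_sub_inv_smul hz,
    circleIntegral, smul_eq_mul]
  have h1 : ∫ θ : Torus, p θ * ((starRingEnd ℂ) (1 - (starRingEnd ℂ) z * expi θ))⁻¹ =
      ∫ θ : Torus, expi θ * ((expi θ - z)⁻¹ * u (expi θ)) := by
    refine integral_congr_ae ?_
    filter_upwards [hp] with θ hθ
    have h2 : (starRingEnd ℂ) (1 - (starRingEnd ℂ) z * expi θ) * expi θ = expi θ - z := by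
      have h3 : (starRingEnd ℂ) (expi θ) * expi θ = 1 := by
        rw [mul_comm, Complex.mul_conj, Complex.normSq_eq_norm_sq, norm_expi]; simp
      rw [map_sub, map_one, map_mul, Complex.conj_conj, sub_mul, one_mul, mul_assoc, h3, mul_one]
    have h4 : expi θ ≠ 0 := expi_ne_zero θ
    rw [hθ, ← h2, mul_inv]
    field_simp
  have h5 := AddCircle.intervalIntegral_preimage (2 * π) 0
    (fun θ : Torus => expi θ * ((expi θ - z)⁻¹ * u (expi θ)))
  rw [h1, ← h5, zero_add, mul_inv, mul_inv, mul_inv, mul_assoc _ (Complex.I⁻¹)]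
  congr 1
  rw [← intervalIntegral.integral_const_mul]
  refine intervalIntegral.integral_congr fun t _ => ?_
  have h6 : circleMap 0 1 t = expi (t : Torus) := by rw [expi_coe, circleMap]; simp
  simp only [deriv_circleMap, h6, smul_eq_mul]
  rw [mul_comm (expi _) Complex.I, mul_assoc, inv_mul_cancel_left₀ Complex.I_ne_zero]

theorem integral_mul_fourier_neg (u : Torus → ℂ) (n : ℤ) :
    ∫ θ : Torus, u θ * fourier (-n) θ = 2 * π * fourierCoeff u n := by
  rw [fourierCoeff, volume_torus, integral_smul_measure, ENNReal.toReal_ofReal two_pi_pos.le]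
  simp only [smul_eq_mul, mul_comm (u _)]
  rw [Complex.real_smul]
  push_cast; rfl

/-- The kernel is a geometric series in the algebra of continuous functions; the continuous
functional given by `p` is applied termwise. -/
theorem hasSum_szego (p : L2C) {z : ℂ} (hz : z ∈ disc) :
    HasSum (fun n : ℕ => fourierCoeff p n * z ^ n) (szego p z) := by
  set t := (starRingEnd ℂ) z • (⟨expi, continuous_expi⟩ : C(Torus, ℂ)) with ht
  have h1 : HasSum (fun n : ℕ => t ^ n) (Ring.inverse (szegoDenom z)) := by
    have h2 := NormedRing.inverse_one_sub t (norm_conj_smul_expi_lt hz)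
    rw [szegoDenom, ← ht, h2]
    exact (summable_geometric_of_norm_lt_one (norm_conj_smul_expi_lt hz)).hasSum
  have h2 := (h1.mapL (ContinuousMap.toLp 2 (volume : Measure Torus) ℂ)).mapL (innerSL ℂ p)
  have h3 := (Complex.conjCLE.hasSum'.2 h2).mul_left (2 * π : ℂ)⁻¹
  have e1 : (2 * π : ℂ)⁻¹ * (starRingEnd ℂ) (inner ℂ p (szegoKernel z)) = szego p z := by
    rw [szego, inner_conj_symm]
  have e2 : ∀ n : ℕ, (2 * π : ℂ)⁻¹ * (starRingEnd ℂ) (inner ℂ p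
      (ContinuousMap.toLp 2 (volume : Measure Torus) ℂ (t ^ n) : L2C)) = fourierCoeff p n * z ^ n := by
    intro n
    have h4 : inner ℂ (ContinuousMap.toLp 2 (volume : Measure Torus) ℂ (t ^ n) : L2C) p =
        z ^ n * ∫ θ : Torus, p θ * fourier (-n) θ := by
      rw [L2.inner_def, ← integral_const_mul]
      refine integral_congr_ae ?_
      filter_upwards [ContinuousMap.coeFn_toLp (p := 2) (𝕜 := ℂ) (volume : Measure Torus) (t ^ n)] with θ hθ
      rw [hθ, RCLike.inner_apply]
      have h5 : (t ^ n) θ = ((starRingEnd ℂ) z * expi θ) ^ n := rfl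
      rw [h5, mul_pow, map_mul, map_pow, map_pow, Complex.conj_conj, fourier_neg, fourier_eq_expi_zpow,
        zpow_natCast, map_pow]
      ring
    rw [inner_conj_symm, h4, integral_mul_fourier_neg]
    have : (2 * π : ℂ) ≠ 0 := by exact_mod_cast two_pi_pos.ne'
    field_simp
  rw [← e1, ← funext e2]
  exact h3

/-! ### The energy as a smooth function of square integrable parameters. -/

theorem isOpen_config {A : Set ℂ} (hA : IsOpen A) (k : ℕ) : IsOpen (Config A k) := by
  have e : Config A k = (⋂ j, {a : Fin k → ℂ | a j ∈ A}) ∩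
      ⋂ j, ⋂ l, ⋂ (_ : j ≠ l), {a : Fin k → ℂ | a j ≠ a l} := by
    ext a; simp [Config]
  rw [e]
  refine IsOpen.inter (isOpen_iInter_of_finite fun j => hA.preimage (continuous_apply j)) ?_
  refine isOpen_iInter_of_finite fun j => isOpen_iInter_of_finite fun l =>
    isOpen_iInter_of_finite fun _ => isOpen_ne_fun (continuous_apply j) (continuous_apply l)

/-- The renormalized energy in conformal coordinates, as a function of square integrable
parameters. -/
def confK {k : ℕ} (d : Fin k → ℤ) (B : ℂ → ℂ) (p : L2C × L2C) (α : Fin k → ℂ) : ℝ :=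
  confEnergy d (szego p.1) (fun z => B z + 2 * Complex.I * szego p.2 z) α

/-- The set on which `confK` is smooth. -/
def confDomain (k : ℕ) : Set ((L2C × L2C) × (Fin k → ℂ)) :=
  {q | q.2 ∈ Config disc k ∧ ∀ j, szego q.1.1 (q.2 j) ≠ 0}

section smooth

variable {k : ℕ} {d : Fin k → ℤ}

theorem contDiffAt_szego_fst {q : (L2C × L2C) × (Fin k → ℂ)} (hq : ∀ j, q.2 j ∈ disc) (j : Fin k) :
    ContDiffAt ℝ ∞ (fun q : (L2C × L2C) × (Fin k → ℂ) => szego q.1.1 (q.2 j)) q :=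
  ContDiffAt.comp (g := fun x : L2C × ℂ => szego x.1 x.2)
    (f := fun q : (L2C × L2C) × (Fin k → ℂ) => (q.1.1, q.2 j)) q (contDiffAt_szego _ (hq j)) (by fun_prop)

theorem contDiffAt_szego_snd {q : (L2C × L2C) × (Fin k → ℂ)} (hq : ∀ j, q.2 j ∈ disc) (j : Fin k) :
    ContDiffAt ℝ ∞ (fun q : (L2C × L2C) × (Fin k → ℂ) => szego q.1.2 (q.2 j)) q :=
  ContDiffAt.comp (g := fun x : L2C × ℂ => szego x.1 x.2)
    (f := fun q : (L2C × L2C) × (Fin k → ℂ) => (q.1.2, q.2 j)) q (contDiffAt_szego _ (hq j)) (by fun_prop)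

theorem isOpen_confDomain (k : ℕ) : IsOpen (confDomain k) := by
  refine isOpen_iff_mem_nhds.2 fun q hq => ?_
  have h1 : ∀ᶠ x in 𝓝 q, x.2 ∈ Config disc k :=
    continuousAt_snd.eventually ((isOpen_config Metric.isOpen_ball k).mem_nhds hq.1)
  have h2 : ∀ᶠ x : (L2C × L2C) × (Fin k → ℂ) in 𝓝 q, ∀ j, szego x.1.1 (x.2 j) ≠ 0 :=
    eventually_all.2 fun j => (contDiffAt_szego_fst hq.1.1 j).continuousAt.eventually_ne (hq.2 j)
  filter_upwards [h1, h2] with x hx1 hx2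
  exact ⟨hx1, hx2⟩

theorem ContDiffAt.log_norm {E : Type*} [NormedAddCommGroup E] [NormedSpace ℝ E] {f : E → ℂ} {x : E}
    (hf : ContDiffAt ℝ ∞ f x) (h0 : f x ≠ 0) : ContDiffAt ℝ ∞ (fun y => Real.log ‖f y‖) x :=
  (hf.norm ℂ h0).log (norm_ne_zero_iff.2 h0)

/-- Evaluation of a Szegő projection at a moving point is jointly smooth. Every logarithm has a
nonzero argument on the domain: points are distinct, F' is represented by a projection without zeros
there, and |ᾱ_l α_j| < 1. -/
theorem contDiffAt_confK {B : ℂ → ℂ} (hB : AnalyticOnNhd ℂ B disc) {q : (L2C × L2C) × (Fin k → ℂ)}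
    (hq : q ∈ confDomain k) : ContDiffAt ℝ ∞ (Function.uncurry (confK d B)) q := by
  have hp : ∀ j, ContDiffAt ℝ ∞ (fun q : (L2C × L2C) × (Fin k → ℂ) => q.2 j) q := fun j => by fun_prop
  have hBj : ∀ j, ContDiffAt ℝ ∞ (fun q : (L2C × L2C) × (Fin k → ℂ) => B (q.2 j)) q := fun j =>
    ContDiffAt.comp (g := B) q ((hB _ (hq.1.1 j)).contDiffAt.restrict_scalars ℝ) (hp j)
  have hre : ∀ {f : (L2C × L2C) × (Fin k → ℂ) → ℂ}, ContDiffAt ℝ ∞ f q →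
      ContDiffAt ℝ ∞ (fun x => (f x).re) q := fun hf => Complex.reCLM.contDiff.contDiffAt.comp q hf
  unfold Function.uncurry confK confEnergy
  refine (((contDiffAt_const.mul (.sum fun j _ => .sum fun l _ => ?_)).sub
    (contDiffAt_const.mul (.sum fun j _ => contDiffAt_const.mul (hre ?_)))).add
    (contDiffAt_const.mul (.sum fun j _ => contDiffAt_const.mul ?_))).sub
    (contDiffAt_const.mul (.sum fun j _ => .sum fun l _ => contDiffAt_const.mul ?_))
  · by_cases hjl : j = l
    · simp only [hjl, ne_eq, not_true_eq_false, if_false]; exact contDiffAt_const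
    · simp only [ne_eq, hjl, not_false_eq_true, if_true]
      exact contDiffAt_const.mul (ContDiffAt.log_norm ((hp j).sub (hp l)) (sub_ne_zero.2 (hq.1.2 j l hjl)))
  · exact (hBj j).add (contDiffAt_const.mul (contDiffAt_szego_snd hq.1.1 j))
  · exact ContDiffAt.log_norm (contDiffAt_szego_fst hq.1.1 j) (hq.2 j)
  · refine ContDiffAt.log_norm (contDiffAt_const.sub
      ((Complex.conjCLE.contDiff.contDiffAt.comp q (hp l)).mul (hp j))) ?_
    exact one_sub_conj_mul_ne_zero (hq.1.1 l) (disc_subset_cdisc (hq.1.1 j))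

end smooth

/-! ### The holomorphic function of a twisted datum. -/

section twist

theorem twist_zero (g : Torus → ℂ) : twist g (fun _ => 0) = g := by
  funext θ; simp [twist]

variable {g : Torus → ℂ} {ψ : Torus → ℝ}

/-- The added term ∂ψ has zero mean, so the degree is unchanged. -/
theorem wedgeCoeff_twist_zero (hg : MemH g) (hg1 : ∀ᵐ θ : Torus, ‖g θ‖ = 1)
    (hψ : MemH fun θ => (ψ θ : ℂ)) : wedgeCoeff (twist g ψ) 0 = wedgeCoeff g 0 := by
  rw [wedgeCoeff_twist hg hg1 hψ (hg.twist hg1 hψ), bracket_fourier]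
  simp

/-- The derivative of ψ contributes 2π i n ψ̂(n) to the coefficient of the current, and division by
π n leaves 2i ψ̂(n). -/
theorem bCoeff_twist (hg : MemH g) (hg1 : ∀ᵐ θ : Torus, ‖g θ‖ = 1)
    (hψ : MemH fun θ => (ψ θ : ℂ)) {n : ℕ} (hn : n ≠ 0) :
    bCoeff (twist g ψ) n = bCoeff g n + 2 * Complex.I * fourierCoeff (fun θ => (ψ θ : ℂ)) n := by
  rw [bCoeff, wedgeCoeff_twist hg hg1 hψ (hg.twist hg1 hψ), bracket_fourier, add_div, bCoeff, neg_neg]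
  congr 1
  have h1 : (π : ℂ) ≠ 0 := by exact_mod_cast pi_ne_zero
  have h2 : (n : ℂ) ≠ 0 := by exact_mod_cast hn
  push_cast
  field_simp

theorem FiniteEnergy.twist (he : FiniteEnergy g) (hg : MemH g) (hg1 : ∀ᵐ θ : Torus, ‖g θ‖ = 1)
    (hψ : MemH fun θ => (ψ θ : ℂ)) : FiniteEnergy (twist g ψ) := by
  have h1 : Summable fun n : ℕ => (n : ℝ) * ‖fourierCoeff (fun θ => (ψ θ : ℂ)) n‖ ^ 2 := by
    have := hψ.2.comp_injective (i := fun n : ℕ => (n : ℤ)) Nat.cast_injective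
    refine this.congr fun n => ?_
    simp
  refine Summable.of_nonneg_of_le (fun n => by positivity) (fun n => ?_)
    ((he.mul_left 2).add (h1.mul_left 8))
  rcases Nat.eq_zero_or_pos n with rfl | hn
  · simp
  rw [bCoeff_twist hg hg1 hψ hn.ne']
  set x := bCoeff g n
  set y := fourierCoeff (fun θ => (ψ θ : ℂ)) n
  have h2 : ‖x + 2 * Complex.I * y‖ ≤ ‖x‖ + 2 * ‖y‖ := by
    refine (norm_add_le _ _).trans ?_
    simp
  have h3 : ‖x + 2 * Complex.I * y‖ ^ 2 ≤ 2 * ‖x‖ ^ 2 + 8 * ‖y‖ ^ 2 := by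
    have := pow_le_pow_left₀ (norm_nonneg _) h2 2
    nlinarith [sq_nonneg (‖x‖ - 2 * ‖y‖)]
  calc (n : ℝ) * ‖x + 2 * Complex.I * y‖ ^ 2 ≤ n * (2 * ‖x‖ ^ 2 + 8 * ‖y‖ ^ 2) := by gcongr
    _ = _ := by ring

/-- The two series agree except at n = 0, where the projection contributes 2i ψ̂(0). This is purely
imaginary since ψ is real, so equality holds for real parts, which is all that the energy sees. -/
theorem bFun_twist (he : FiniteEnergy g) (hg : MemH g) (hg1 : ∀ᵐ θ : Torus, ‖g θ‖ = 1)
    (hψ : MemH fun θ => (ψ θ : ℂ)) {p : L2C} (hp : p =ᵐ[volume] fun θ => (ψ θ : ℂ)) {z : ℂ}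
    (hz : z ∈ disc) : (bFun (twist g ψ) z).re = (bFun g z + 2 * Complex.I * szego p z).re := by
  have hc : ∀ n : ℤ, fourierCoeff p n = fourierCoeff (fun θ => (ψ θ : ℂ)) n :=
    congrFun (fourierCoeff_congr_ae (ae_haar_iff.2 hp))
  have h1 := (he.hasPower z hz).add ((hasSum_szego p hz).mul_left (2 * Complex.I))
  have h2 := (he.twist hg hg1 hψ).hasPower z hz
  have h3 : HasSum (fun n : ℕ => if n = 0 then 2 * Complex.I * fourierCoeff p 0 else 0)
      (2 * Complex.I * fourierCoeff p 0) := by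
    have := hasSum_ite_eq 0 (2 * Complex.I * fourierCoeff p 0)
    exact this
  have h4 := h2.add h3
  have e : (fun n : ℕ => bCoeff (twist g ψ) n * z ^ n +
      if n = 0 then 2 * Complex.I * fourierCoeff p 0 else 0) =
      fun n => bCoeff g n * z ^ n + 2 * Complex.I * (fourierCoeff p n * z ^ n) := by
    funext n
    rcases Nat.eq_zero_or_pos n with rfl | hn
    · simp [bCoeff_zero]
    · rw [bCoeff_twist hg hg1 hψ hn.ne', if_neg hn.ne', hc]; ring
  rw [e] at h4
  rw [h1.unique h4, Complex.add_re]
  have h5 : (starRingEnd ℂ) (fourierCoeff p 0) = fourierCoeff p 0 := by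
    have := fourierCoeff_ofReal_neg ψ 0
    rw [neg_zero] at this
    rw [hc, ← this]
  have h6 : (fourierCoeff p 0).im = 0 := Complex.conj_eq_iff_im.1 h5
  simp [h6]

end twist

/-! ### From the domain to conformal coordinates. -/

section coordinates

variable {k : ℕ} {d : Fin k → ℤ} {F F' : ℂ → ℂ} {c : ℝ} {α : Fin k → ℂ}

theorem DiscC1.diffContOnCl (h : DiscC1 F F') : DiffContOnCl ℂ F' disc := by
  refine ⟨?_, ?_⟩
  · refine (h.differentiableOn.deriv Metric.isOpen_ball).congr fun z hz => ?_
    exact (h.hasDerivAt z hz).deriv.symm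
  · rw [closure_disc]; exact h.cont'

/-- The renormalized energy of `g e^{iψ}` in conformal coordinates. -/
theorem WConf_twist_eq {g : Torus → ℂ} {ψ : Torus → ℝ} (he : FiniteEnergy g) (hg : MemH g)
    (hg1 : ∀ᵐ θ : Torus, ‖g θ‖ = 1) (hψ : MemH fun θ => (ψ θ : ℂ))
    (h0 : wedgeCoeff g 0 = ((2 * π * ∑ j, (d j : ℝ) : ℝ) : ℂ)) (h : DiscC1 F F')
    (hl : DiscC1.LowerLip F c) {p : L2C × L2C} (hp1 : p.1 =ᵐ[volume] fun θ => F' (expi θ))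
    (hp2 : p.2 =ᵐ[volume] fun θ => (ψ θ : ℂ)) :
    ∃ C : ℝ, ∀ α ∈ Config disc k, WConf d F (twist g ψ) (F ∘ α) = confK d (bFun g) p α + C := by
  refine ⟨π / 2 * ∑' n : ℕ, (n : ℝ) * ‖bCoeff (twist g ψ) n‖ ^ 2, fun α hα => ?_⟩
  rw [WConf_eq h hl hα (he.twist hg hg1 hψ) (by rw [wedgeCoeff_twist_zero hg hg1 hψ, h0])]
  congr 1
  have e1 : ∀ j, szego p.1 (α j) = F' (α j) := fun j =>
    szego_eq_of_diffContOnCl h.diffContOnCl hp1 (hα.1 j)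
  have e2 : ∀ j, (bFun (twist g ψ) (α j)).re = (bFun g (α j) + 2 * Complex.I * szego p.2 (α j)).re :=
    fun j => bFun_twist he hg hg1 hψ hp2 (hα.1 j)
  simp only [confK, confEnergy, e1, e2]

theorem contDiffAt_comp_pi {f : ℂ → ℂ} {a : Fin k → ℂ} (hf : ∀ j, AnalyticAt ℂ f (a j)) :
    ContDiffAt ℝ ∞ (fun b : Fin k → ℂ => f ∘ b) a :=
  contDiffAt_pi.2 fun j => ContDiffAt.comp (g := f) (f := fun b : Fin k → ℂ => b j) a
    ((hf j).contDiffAt.restrict_scalars ℝ) (by fun_prop)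

theorem injective_fderiv_of_leftInverse {A : Type*} [NormedAddCommGroup A] [NormedSpace ℝ A]
    {Ψ Φ : A → A} {a : A} (hΨ : DifferentiableAt ℝ Ψ a) (hΦ : DifferentiableAt ℝ Φ (Ψ a))
    (h : Φ ∘ Ψ =ᶠ[𝓝 a] id) : Function.Injective (fderiv ℝ Ψ a) := by
  have h1 := (hΦ.hasFDerivAt.comp a hΨ.hasFDerivAt).congr_of_eventuallyEq h.symm
  have h2 := h1.unique (hasFDerivAt_id a)
  refine Function.LeftInverse.injective (g := fderiv ℝ Φ (Ψ a)) fun v => ?_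
  have := congrArg (fun S : A →L[ℝ] A => S v) h2
  simpa using this

theorem mem_config_image_iff (hinj : InjOn F disc) {a : Fin k → ℂ} :
    a ∈ Config (F '' disc) k ↔ ∃ α ∈ Config disc k, a = F ∘ α := by
  constructor
  · rintro ⟨h1, h2⟩
    choose α hα hαa using h1
    refine ⟨α, ⟨hα, fun j l hjl he => h2 j l hjl ?_⟩, funext fun j => (hαa j).symm⟩
    rw [← hαa, ← hαa, he]
  · rintro ⟨α, hα, rfl⟩
    exact ⟨fun j => mem_image_of_mem F (hα.1 j), fun j l hjl he =>
      hα.2 j l hjl (hinj (hα.1 j) (hα.1 l) he)⟩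

theorem discInv_comp (hl : DiscC1.LowerLip F c) (hα : ∀ j, α j ∈ disc) : discInv F ∘ (F ∘ α) = α :=
  funext fun j => DiscC1.discInv_apply hl.injOn (disc_subset_cdisc (hα j))

/-- Critical points and their nondegeneracy in conformal coordinates. -/
theorem critical_iff_of_conf (h : DiscC1 F F') (hl : DiscC1.LowerLip F c) {G Q : (Fin k → ℂ) → ℝ} {C : ℝ}
    (hGQ : ∀ α ∈ Config disc k, G (F ∘ α) = Q α + C) (hα : α ∈ Config disc k)
    (hQ : ContDiffAt ℝ ∞ Q α) :
    (IsCritical G (F ∘ α) ↔ fderiv ℝ Q α = 0) ∧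
    (IsNondegenerateCritical G (F ∘ α) ↔
      fderiv ℝ Q α = 0 ∧ ∀ v, (∀ w, fderiv ℝ (fderiv ℝ Q) α v w = 0) → v = 0) := by
  set Ψ : (Fin k → ℂ) → Fin k → ℂ := fun b => F ∘ b with hΨ
  set Φ : (Fin k → ℂ) → Fin k → ℂ := fun b => discInv F ∘ b with hΦ
  have ho : IsOpen (F '' disc) := h.isOpen_image fun z hz => hl.deriv_ne_zero h (disc_subset_cdisc hz)
  have hΦα : Φ (Ψ α) = α := discInv_comp hl hα.1
  have sΨ : ContDiffAt ℝ ∞ Ψ α := contDiffAt_comp_pi fun j =>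
    h.differentiableOn.analyticAt (Metric.isOpen_ball.mem_nhds (hα.1 j))
  have sΦ : ContDiffAt ℝ ∞ Φ (Ψ α) := contDiffAt_comp_pi fun j =>
    (h.differentiableOn_discInv hl).analyticAt (ho.mem_nhds (mem_image_of_mem F (hα.1 j)))
  have dΨ : DifferentiableAt ℝ Ψ α := sΨ.differentiableAt (by simp)
  have dΦ : DifferentiableAt ℝ Φ (Ψ α) := sΦ.differentiableAt (by simp)
  have hC : ∀ᶠ β in 𝓝 α, β ∈ Config disc k := (isOpen_config Metric.isOpen_ball k).mem_nhds hα
  have hC' : ∀ᶠ b in 𝓝 (Ψ α), b ∈ Config (F '' disc) k := (isOpen_config ho k).mem_nhds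
    ((mem_config_image_iff (hl.injOn.mono disc_subset_cdisc)).2 ⟨α, hα, rfl⟩)
  have e1 : Φ ∘ Ψ =ᶠ[𝓝 α] id := by
    filter_upwards [hC] with β hβ
    exact discInv_comp hl hβ.1
  have e2 : Ψ ∘ Φ =ᶠ[𝓝 (Ψ α)] id := by
    filter_upwards [hC'] with b hb
    obtain ⟨β, hβ, rfl⟩ := (mem_config_image_iff (hl.injOn.mono disc_subset_cdisc)).1 hb
    simp only [Function.comp_apply, hΨ, hΦ, discInv_comp hl hβ.1, id]
  -- Locally Q + C is G ∘ Ψ and G is (Q + C) ∘ Φ, with mutually inverse smooth Ψ and Φ. Each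
  -- implication is then an instance of invariance under composition.
  have e3 : (fun β => Q β + C) =ᶠ[𝓝 α] G ∘ Ψ := by
    filter_upwards [hC] with β hβ
    exact (hGQ β hβ).symm
  have e4 : G =ᶠ[𝓝 (Ψ α)] (fun β => Q β + C) ∘ Φ := by
    filter_upwards [hC'] with b hb
    obtain ⟨β, hβ, rfl⟩ := (mem_config_image_iff (hl.injOn.mono disc_subset_cdisc)).1 hb
    simp only [Function.comp_apply, hΦ, discInv_comp hl hβ.1, hGQ β hβ]
  have i1 := injective_fderiv_of_leftInverse dΨ dΦ e1
  have i2 := injective_fderiv_of_leftInverse (Ψ := Φ) (Φ := Ψ) dΦ (by rw [hΦα]; exact dΨ) e2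
  have hfd : fderiv ℝ (fun β => Q β + C) = fderiv ℝ Q := by
    funext β; exact fderiv_add_const _
  have s2 : ∀ {f : (Fin k → ℂ) → Fin k → ℂ} {x}, ContDiffAt ℝ ∞ f x → ContDiffAt ℝ 2 f x := fun hf =>
    hf.of_le ENat.LEInfty.out
  constructor
  · constructor
    · intro hG
      have := ((hG.comp (Ψ := Ψ) dΨ).congr e3).fderiv
      rwa [hfd] at this
    · intro hQ0
      refine IsCritical.congr (IsCritical.comp ?_ dΦ) e4
      rw [hΦα, IsCritical, ← hQ0]
      exact (hQ.differentiableAt (by simp)).hasFDerivAt.add_const C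
  · have key := isNondegenerateCritical_iff (hQ.add (contDiffAt_const (c := C)))
    rw [← hfd, ← key]
    exact ⟨fun hG => (hG.comp (Ψ := Ψ) (s2 sΨ) i1).congr e3,
      fun hQ' => (IsNondegenerateCritical.comp (by rw [hΦα]; exact hQ') (s2 sΦ) i2).congr e4⟩

/-- With infinite energy there would be no regular part for any configuration, and the energy would
take its default value 0 everywhere. The zero Hessian is degenerate as soon as the configuration
space has positive dimension. -/
theorem finiteEnergy_of_nondegenerate (h : DiscC1 F F') (hl : DiscC1.LowerLip F c)
    (hα : α ∈ Config disc k) (hk : k ≠ 0) {g : Torus → ℂ}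
    (hn : IsNondegenerateCritical (WConf d F g) (F ∘ α)) : FiniteEnergy g := by
  by_contra hne
  have h0 : ∀ β ∈ Config disc k, WConf d F g (F ∘ β) = (fun _ : Fin k → ℂ => (0 : ℝ)) β + 0 := by
    intro β hβ
    rw [WConf, W, dif_neg, add_zero]
    rintro ⟨p, hp⟩
    exact hne (hp.pullback h hl hβ.1).1
  obtain ⟨-, h1⟩ := ((critical_iff_of_conf h hl h0 hα contDiffAt_const).2).1 hn
  have h2 := h1 (fun _ => 1) fun w => by simp
  have h3 := congrFun h2 ⟨0, Nat.pos_of_ne_zero hk⟩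
  exact one_ne_zero h3

end coordinates

/-! ### The branch of critical points over the space of parameters. -/

section vortexBranch

variable {k : ℕ} {d : Fin k → ℤ} {F F' : ℂ → ℂ} {c : ℝ} {α₀ : Fin k → ℂ} {g : Torus → ℂ}

/-- The parameters `p` represent the conformal representation `F`, through the boundary values of its
derivative, and the phase `ψ`. -/
structure Represents (p : L2C × L2C) (F' : ℂ → ℂ) (ψ : Torus → ℝ) : Prop where
  fst : p.1 =ᵐ[volume] fun θ => F' (expi θ)
  snd : p.2 =ᵐ[volume] fun θ => (ψ θ : ℂ)

theorem isNondegenerateCritical_of_subsingleton [Subsingleton (Fin k → ℂ)] (G : (Fin k → ℂ) → ℝ)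
    (a : Fin k → ℂ) : IsNondegenerateCritical G a :=
  ⟨hasFDerivAt_of_subsingleton G a, .of_forall fun b => (hasFDerivAt_of_subsingleton G b).differentiableAt,
    (hasFDerivAt_of_subsingleton _ a).differentiableAt, fun _ _ => Subsingleton.elim _ _⟩

/-- Nondegenerate critical points of the renormalized energy depend smoothly on the domain and the
boundary datum. -/
theorem exists_vortex_branch (hg : MemH g) (hg1 : ∀ᵐ θ : Torus, ‖g θ‖ = 1)
    (hdeg : degree g = ∑ j, (d j : ℝ)) (h : DiscC1 F F') (hl : DiscC1.LowerLip F c)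
    (hα₀ : α₀ ∈ Config disc k) (hn : IsNondegenerateCritical (WConf d F g) (F ∘ α₀))
    {p₀ : L2C × L2C} (hp₀ : Represents p₀ F' fun _ => 0) :
    ∃ (𝒰 : Set (L2C × L2C)) (a : L2C × L2C → Fin k → ℂ) (δ : ℝ),
      IsOpen 𝒰 ∧ p₀ ∈ 𝒰 ∧ a p₀ = α₀ ∧ 0 < δ ∧ ContDiffOn ℝ ∞ a 𝒰 ∧
      (∀ p ∈ 𝒰, a p ∈ Config disc k ∧ a p ∈ Metric.ball α₀ δ) ∧
      ∀ (p : L2C × L2C) (F F' : ℂ → ℂ) (c : ℝ) (ψ : Torus → ℝ), p ∈ 𝒰 → DiscC1 F F' →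
        DiscC1.LowerLip F c → MemH (fun θ => (ψ θ : ℂ)) → Represents p F' ψ →
        (∀ α ∈ Metric.ball α₀ δ, α ∈ Config disc k →
          (IsCritical (WConf d F (twist g ψ)) (F ∘ α) ↔ α = a p)) ∧
        IsNondegenerateCritical (WConf d F (twist g ψ)) (F ∘ a p) := by
  -- For k = 0 the configuration space is a point, everything is trivially critical and
  -- nondegenerate, and finite energy cannot be inferred.
  rcases eq_or_ne k 0 with rfl | hk
  · refine ⟨univ, fun _ => α₀, 1, isOpen_univ, mem_univ _, rfl, one_pos, contDiffOn_const,
      fun p _ => ⟨hα₀, Metric.mem_ball_self one_pos⟩, fun p F F' c ψ _ _ _ _ _ => ⟨fun α _ _ =>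
        ⟨fun _ => Subsingleton.elim _ _, fun _ => (isNondegenerateCritical_of_subsingleton _ _).1⟩,
        isNondegenerateCritical_of_subsingleton _ _⟩⟩
  have he := finiteEnergy_of_nondegenerate h hl hα₀ hk hn
  have h0 := wedgeCoeff_zero_of_degree hdeg
  have hK := fun (q : (L2C × L2C) × (Fin k → ℂ)) (hq : q ∈ confDomain k) =>
    contDiffAt_confK (d := d) he.hasPower.analyticOnNhd hq
  have hKp : ∀ (p : L2C × L2C) (α : Fin k → ℂ), (p, α) ∈ confDomain k →
      ContDiffAt ℝ ∞ (confK d (bFun g) p) α := fun p α hq =>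
    (hK _ hq).comp α (contDiffAt_const.prodMk contDiffAt_id)
  have hdom : ∀ {p : L2C × L2C} {F F' : ℂ → ℂ} {c : ℝ} {ψ : Torus → ℝ} {α : Fin k → ℂ}, DiscC1 F F' →
      DiscC1.LowerLip F c → Represents p F' ψ → α ∈ Config disc k → (p, α) ∈ confDomain k := by
    intro p F F' c ψ α h hl hp hα
    refine ⟨hα, fun j => ?_⟩
    rw [szego_eq_of_diffContOnCl h.diffContOnCl hp.fst (hα.1 j)]
    exact hl.deriv_ne_zero h (disc_subset_cdisc (hα.1 j))
  have hψ0 : MemH fun _ : Torus => ((0 : ℝ) : ℂ) := by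
    refine memH_of_lipschitz (memLp_of_continuous continuous_const) (L := 0) fun θ t => ?_
    simp
  obtain ⟨C, hC⟩ := WConf_twist_eq (d := d) he hg hg1 hψ0 h0 h hl hp₀.fst hp₀.snd
  rw [twist_zero] at hC
  have hq₀ := hdom h hl hp₀ hα₀
  obtain ⟨hc1, hc2⟩ := ((critical_iff_of_conf h hl hC hα₀ (hKp _ _ hq₀)).2).1 hn
  obtain ⟨𝒰, a, δ, h1, h2, h3, h4, h5, h6⟩ := exists_critical_branch (isOpen_confDomain k) hK hq₀ hc1 hc2
  refine ⟨𝒰, a, δ, h1, h2, h3, h4, h5, fun p hp => ⟨((h6 p hp).2.1 _ (h6 p hp).1).1.1, (h6 p hp).1⟩,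
    fun p F F' c ψ hp h hl hψ hr => ?_⟩
  obtain ⟨C, hC⟩ := WConf_twist_eq (d := d) he hg hg1 hψ h0 h hl hr.fst hr.snd
  obtain ⟨h7, h8, h9⟩ := h6 p hp
  refine ⟨fun α hα hα' => ?_, ?_⟩
  · rw [(critical_iff_of_conf h hl hC hα' (hKp _ _ (h8 α hα).1)).1]
    exact (h8 α hα).2
  · have h10 := (h8 _ h7).1
    rw [(critical_iff_of_conf h hl hC h10.1 (hKp _ _ h10)).2]
    exact ⟨(h8 _ h7).2.2 rfl, h9⟩

/-- The critical points of the renormalized energy near a nondegenerate one. -/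
theorem setOf_critical_eq (hl : DiscC1.LowerLip F c) {G : (Fin k → ℂ) → ℝ} {α : Fin k → ℂ} {δ : ℝ}
    (hα : α ∈ Config disc k) (hαδ : α ∈ Metric.ball α₀ δ)
    (hG : ∀ β ∈ Metric.ball α₀ δ, β ∈ Config disc k → (IsCritical G (F ∘ β) ↔ β = α)) :
    {a | a ∈ Config (F '' disc) k ∧ IsCritical G a ∧ ‖discInv F ∘ a - α₀‖ < δ} = {F ∘ α} := by
  have hinj := hl.injOn.mono disc_subset_cdisc
  ext a
  simp only [mem_ofPred_eq, mem_singleton_iff]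
  constructor
  · rintro ⟨h1, h2, h3⟩
    obtain ⟨β, hβ, rfl⟩ := (mem_config_image_iff hinj).1 h1
    rw [discInv_comp hl hβ.1] at h3
    rw [(hG β (mem_ball_iff_norm.2 h3) hβ).1 h2]
  · rintro rfl
    refine ⟨(mem_config_image_iff hinj).2 ⟨α, hα, rfl⟩, (hG α hαδ hα).2 rfl, ?_⟩
    rw [discInv_comp hl hα.1]
    exact mem_ball_iff_norm.1 hαδ

end vortexBranch

/-! ### Continuous linear maps into the space of parameters. -/

section parameters

/-- The restriction to the unit circle, as a square integrable function. -/
def circleL2 : C(cdisc, ℂ) →L[ℝ] L2C :=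
  ((ContinuousMap.toLp 2 (volume : Measure Torus) ℂ : C(Torus, ℂ) →L[ℂ] L2C).restrictScalars ℝ).comp
    { toLinearMap := (ContinuousMap.compRightAlgHom ℝ ℂ
        (⟨fun θ => ⟨expi θ, expi_mem_cdisc θ⟩, by exact continuous_expi.subtype_mk _⟩ :
          C(Torus, cdisc))).toLinearMap
      cont := ContinuousMap.compRightAlgHom_continuous ℝ ℂ _ }

theorem circleL2_ae (u : C(cdisc, ℂ)) : circleL2 u =ᵐ[volume] fun θ => extendZero u (expi θ) := by
  filter_upwards [ContinuousMap.coeFn_toLp (p := 2) (𝕜 := ℂ) (volume : Measure Torus)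
    (u.comp (⟨fun θ => ⟨expi θ, expi_mem_cdisc θ⟩, by exact continuous_expi.subtype_mk _⟩ :
      C(Torus, cdisc)))] with θ hθ
  rw [extendZero, dif_pos (expi_mem_cdisc θ)]
  exact hθ

/-- The inclusion of real into complex square integrable functions. -/
def ofRealL2 : Lp ℝ 2 (volume : Measure Torus) →L[ℝ] L2C := Complex.ofRealCLM.compLpL 2 volume

theorem ofRealL2_ae (ψ : Lp ℝ 2 (volume : Measure Torus)) :
    ofRealL2 ψ =ᵐ[volume] fun θ => (ψ θ : ℂ) := Complex.ofRealCLM.coeFn_compLpL ψ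

theorem H12.memH_fn (w : H12 ℂ) : MemH w.fn :=
  w.memH (Lp.stronglyMeasurable _).measurable (Lp.memLp _) fun _ _ => rfl

theorem H12.memH_ofReal (w : H12 ℝ) : MemH fun θ => (w.fn θ : ℂ) :=
  w.memH (Complex.measurable_ofReal.comp (Lp.stronglyMeasurable _).measurable) (Lp.memLp w.1.1).ofReal
    fun x y => by rw [← Complex.ofReal_sub, Complex.norm_real]

/-- The boundary derivative of an element of `X`. -/
def HolC1.derivL2 : HolC1 →L[ℝ] L2C :=
  circleL2.comp ((ContinuousLinearMap.snd ℝ _ _).comp (Submodule.subtypeL HolC1Graph))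

/-- The square integrable function underlying an element of `H^{1/2}(𝕊¹; ℝ)`. -/
def H12.toL2 : H12 ℝ →L[ℝ] L2C :=
  ofRealL2.comp ((ContinuousLinearMap.fst ℝ _ _).comp (Submodule.subtypeL (H12Graph ℝ)))

variable {β : ℝ}

/-- The square integrable function underlying an element of `C^{1,β}(𝕊¹; ℝ)`. -/
def C1Holder.toL2 : C1Holder β ℝ →L[ℝ] L2C :=
  ofRealL2.comp ((ContinuousMap.toLp 2 (volume : Measure Torus) ℝ).comp
    ((ContinuousLinearMap.fst ℝ _ _).comp (Submodule.subtypeL (C1HolderGraph β ℝ))))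

theorem HolC1.derivL2_ae (f : HolC1) :
    HolC1.derivL2 f =ᵐ[volume] fun θ => extendZero f.1.2 (expi θ) := circleL2_ae _

theorem H12.toL2_ae (ψ : H12 ℝ) : H12.toL2 ψ =ᵐ[volume] fun θ => (ψ.fn θ : ℂ) := ofRealL2_ae _

theorem C1Holder.toL2_ae (ψ : C1Holder β ℝ) : C1Holder.toL2 ψ =ᵐ[volume] fun θ => (ψ.fn θ : ℂ) := by
  filter_upwards [ofRealL2_ae (ContinuousMap.toLp 2 (volume : Measure Torus) ℝ ψ.1.1),
    ContinuousMap.coeFn_toLp (p := 2) (𝕜 := ℝ) (volume : Measure Torus) ψ.1.1] with θ h1 h2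
  rw [h2] at h1
  exact h1

end parameters

/-! ### Hölder classes on the circle. -/

section holder

/-- Hölder continuous functions on the circle. -/
structure IsHolder {E : Type} [NormedAddCommGroup E] (β : ℝ) (u : Torus → E) : Prop where
  continuous : Continuous u
  exists_bound : ∃ C : ℝ, ∀ x y, ‖u x - u y‖ ≤ C * dist x y ^ β

theorem isHolder_of_lipschitz {β : ℝ} {E : Type} [NormedAddCommGroup E] (hβ0 : 0 < β) (hβ1 : β < 1) {u : Torus → E} (hu : Continuous u) {L : ℝ}
    (hL : ∀ x y, ‖u x - u y‖ ≤ L * dist x y) : IsHolder β u := by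
  refine ⟨hu, |L| * π ^ (1 - β), fun x y => ?_⟩
  have h1 : dist x y ≤ π := by
    have := AddCircle.norm_le_half_period (2 * π) (x := x - y) two_pi_pos.ne'
    rw [abs_of_pos two_pi_pos] at this
    rw [dist_eq_norm]; linarith
  have h2 : dist x y = dist x y ^ (1 - β) * dist x y ^ β := by
    rcases eq_or_lt_of_le (dist_nonneg (x := x) (y := y)) with h | h
    · rw [← h, Real.zero_rpow hβ0.ne', mul_zero]
    · rw [← Real.rpow_add h]; simp
  calc ‖u x - u y‖ ≤ L * dist x y := hL x y
    _ ≤ |L| * dist x y := by gcongr; exact le_abs_self L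
    _ = |L| * dist x y ^ (1 - β) * dist x y ^ β := by rw [mul_assoc, ← h2]
    _ ≤ |L| * π ^ (1 - β) * dist x y ^ β := by
      have h3 : dist x y ^ (1 - β) ≤ π ^ (1 - β) :=
        Real.rpow_le_rpow dist_nonneg h1 (by linarith)
      gcongr

variable {β : ℝ} {E : Type} [NormedAddCommGroup E] [NormedSpace ℝ E]

theorem C1Holder.continuous (u : C1Holder β E) : Continuous u.fn := u.1.1.continuous

theorem C1Holder.norm_add_sub_le (u : C1Holder β E) (θ : Torus) (t : ℝ) :
    ‖u.fn (θ + (t : Torus)) - u.fn θ‖ ≤ ‖u.1.2.1‖ * |t| := by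
  obtain ⟨s, rfl⟩ := QuotientAddGroup.mk_surjective θ
  have h1 := convex_univ.norm_image_sub_le_of_norm_hasDerivWithin_le (f := fun s : ℝ => u.fn (s : Torus))
    (f' := fun s : ℝ => u.1.2.1 (s : Torus)) (C := ‖u.1.2.1‖)
    (fun x _ => (u.2.1 x).hasDerivWithinAt) (fun x _ => u.1.2.1.norm_coe_le_norm _)
    (mem_univ s) (mem_univ (s + t))
  rw [add_sub_cancel_left, AddCircle.coe_add] at h1
  exact h1

theorem C1Holder.memLp (u : C1Holder β ℂ) : MemLp u.fn 2 volume := memLp_of_continuous u.continuous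

theorem C1Holder.memH_fn (u : C1Holder β ℂ) : MemH u.fn :=
  memH_of_lipschitz u.memLp u.norm_add_sub_le

theorem C1Holder.memH_ofReal (u : C1Holder β ℝ) : MemH fun θ => (u.fn θ : ℂ) :=
  memH_of_lipschitz (memLp_of_continuous (Complex.continuous_ofReal.comp u.continuous)) fun θ t => by
    rw [← Complex.ofReal_sub, Complex.norm_real]
    exact u.norm_add_sub_le θ t

/-- Subtracting the nearest multiple of the period gives the representative of x - y of least
absolute value, which realizes the quotient distance. -/
theorem exists_dist_eq (x y : Torus) : ∃ t : ℝ, x = y + (t : Torus) ∧ |t| = dist x y := by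
  obtain ⟨s, hs⟩ := QuotientAddGroup.mk_surjective (x - y)
  refine ⟨s - round ((2 * π)⁻¹ * s) * (2 * π), ?_, ?_⟩
  · have h1 : ((round ((2 * π)⁻¹ * s) * (2 * π) : ℝ) : Torus) = 0 := by
      rw [← zsmul_eq_mul, AddCircle.coe_zsmul, AddCircle.coe_period, smul_zero]
    rw [AddCircle.coe_sub, h1, sub_zero]
    have h2 : (s : Torus) = x - y := hs
    rw [h2, add_sub_cancel]
  · rw [dist_eq_norm, ← hs]
    exact (AddCircle.norm_eq (2 * π)).symm

theorem IsHolder.mul {u v : Torus → ℂ} (hu : IsHolder β u) (hv : IsHolder β v) :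
    IsHolder β fun θ => u θ * v θ := by
  obtain ⟨A, hA⟩ := (isCompact_univ (X := Torus)).exists_bound_of_continuousOn hu.continuous.continuousOn
  obtain ⟨B, hB⟩ := (isCompact_univ (X := Torus)).exists_bound_of_continuousOn hv.continuous.continuousOn
  obtain ⟨C, hC⟩ := hu.exists_bound
  obtain ⟨D, hD⟩ := hv.exists_bound
  refine ⟨hu.continuous.mul hv.continuous, A * D + B * C, fun x y => ?_⟩
  have e : u x * v x - u y * v y = u x * (v x - v y) + v y * (u x - u y) := by ring
  rw [e, add_mul]
  refine (norm_add_le _ _).trans (add_le_add ?_ ?_)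
  · rw [norm_mul, mul_assoc]
    exact mul_le_mul (hA x trivial) (hD x y) (norm_nonneg _) ((norm_nonneg _).trans (hA x trivial))
  · rw [norm_mul, mul_assoc]
    exact mul_le_mul (hB y trivial) (hC x y) (norm_nonneg _) ((norm_nonneg _).trans (hB y trivial))

theorem IsHolder.add {u v : Torus → ℂ} (hu : IsHolder β u) (hv : IsHolder β v) :
    IsHolder β fun θ => u θ + v θ := by
  obtain ⟨C, hC⟩ := hu.exists_bound
  obtain ⟨D, hD⟩ := hv.exists_bound
  refine ⟨hu.continuous.add hv.continuous, C + D, fun x y => ?_⟩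
  rw [add_sub_add_comm, add_mul]
  exact (norm_add_le _ _).trans (add_le_add (hC x y) (hD x y))

theorem C1Holder.norm_sub_le (u : C1Holder β E) (x y : Torus) :
    ‖u.fn x - u.fn y‖ ≤ ‖u.1.2.1‖ * dist x y := by
  obtain ⟨t, rfl, ht⟩ := exists_dist_eq x y
  rw [← ht]
  exact u.norm_add_sub_le y t

theorem C1Holder.isHolder (hβ0 : 0 < β) (hβ1 : β < 1) (u : C1Holder β E) : IsHolder β u.fn :=
  isHolder_of_lipschitz hβ0 hβ1 u.continuous u.norm_sub_le

theorem C1Holder.isHolder_deriv (u : C1Holder β E) : IsHolder β (u.1.2.1 : Torus → E) := by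
  refine ⟨u.1.2.1.continuous, ‖u.1.2.2‖, fun x y => ?_⟩
  rcases eq_or_ne x y with rfl | hne
  · rw [sub_self, norm_zero]; positivity
  · have h1 := u.2.2 (x, y)
    have h2 := lp.norm_apply_le_norm ENNReal.top_ne_zero u.1.2.2 (x, y)
    rw [h1, norm_smul, norm_inv, Real.norm_of_nonneg (by positivity),
      inv_mul_le_iff₀ (Real.rpow_pos_of_pos (dist_pos.2 hne) _)] at h2
    linarith

theorem exists_c1Holder {u u' : Torus → E} (hu : Continuous u)
    (hd : ∀ t : ℝ, HasDerivAt (fun s : ℝ => u (s : Torus)) (u' (t : Torus)) t) (hu' : IsHolder β u') :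
    ∃ g : C1Holder β E, g.fn = u := by
  obtain ⟨C, hC⟩ := hu'.exists_bound
  have hm : Memℓp (fun p : Torus × Torus => (dist p.1 p.2 ^ β)⁻¹ • (u' p.1 - u' p.2)) ⊤ := by
    refine memℓp_infty ⟨|C|, ?_⟩
    rintro _ ⟨p, rfl⟩
    simp only
    rw [norm_smul, norm_inv, Real.norm_of_nonneg (by positivity)]
    rcases eq_or_lt_of_le (Real.rpow_nonneg (dist_nonneg (x := p.1) (y := p.2)) β) with h | h
    -- Where the power of the distance vanishes, its inverse is 0 by convention and the quotient is
    -- 0.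
    · rw [← h]; simp
    · rw [inv_mul_le_iff₀ h, mul_comm]
      exact (hC _ _).trans (mul_le_mul_of_nonneg_right (le_abs_self C) h.le)
  exact ⟨⟨(⟨u, hu⟩, ⟨u', hu'.continuous⟩, ⟨_, hm⟩), hd, fun p => rfl⟩, rfl⟩

/-- The derivative g' e^{iψ} + g i ψ' e^{iψ} is Hölder, because g and e^{iψ} are Lipschitz on a
compact circle and Hölder functions form an algebra. -/
theorem C1Holder.exists_twist (hβ0 : 0 < β) (hβ1 : β < 1) (g : C1Holder β ℂ) (ψ : C1Holder β ℝ) :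
    ∃ h : C1Holder β ℂ, h.fn = twist g.fn ψ.fn := by
  have hec : Continuous fun θ : Torus => Complex.exp (Complex.I * ψ.fn θ) :=
    Complex.continuous_exp.comp (continuous_const.mul (Complex.continuous_ofReal.comp ψ.continuous))
  have he : IsHolder β fun θ : Torus => Complex.exp (Complex.I * ψ.fn θ) :=
    isHolder_of_lipschitz hβ0 hβ1 hec (L := ‖ψ.1.2.1‖) fun x y =>
      (norm_exp_I_sub_exp_I_le _ _).trans (ψ.norm_sub_le x y)
  have hψ' : IsHolder β fun θ : Torus => Complex.I * (ψ.1.2.1 θ : ℂ) := by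
    obtain ⟨C, hC⟩ := ψ.isHolder_deriv.exists_bound
    refine ⟨continuous_const.mul (Complex.continuous_ofReal.comp ψ.1.2.1.continuous), C, fun x y => ?_⟩
    rw [← mul_sub, norm_mul, Complex.norm_I, one_mul, ← Complex.ofReal_sub, Complex.norm_real]
    exact hC x y
  refine exists_c1Holder (g.continuous.mul hec) (fun t => ?_)
    ((g.isHolder_deriv.mul he).add ((g.isHolder hβ0 hβ1).mul (he.mul hψ')))
  have h1 : HasDerivAt (fun s : ℝ => (ψ.fn (s : Torus) : ℂ)) (ψ.1.2.1 (t : Torus) : ℂ) t :=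
    (ψ.2.1 t).ofReal_comp
  exact (g.2.1 t).mul (h1.const_mul Complex.I).cexp

end holder

/-- Smooth dependence of nondegenerate critical points, in spaces continuously embedded in the space
of square integrable parameters. -/
theorem exists_smooth_critical {k : ℕ} {d : Fin k → ℤ} {X Y : Type*} [NormedAddCommGroup X]
    [NormedSpace ℝ X] [NormedAddCommGroup Y] [NormedSpace ℝ Y] {S : Set X} (hS : IsOpen S)
    {fn fn' : X → ℂ → ℂ} (hfn : ∀ f, DiscC1 (fn f) (fn' f))
    (hl : ∀ f ∈ S, ∃ c, DiscC1.LowerLip (fn f) c) {ph : Y → Torus → ℝ}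
    (hph : ∀ ψ, MemH fun θ => (ph ψ θ : ℂ)) {L₁ : X →L[ℝ] L2C} {L₂ : Y →L[ℝ] L2C}
    (hL₁ : ∀ f, L₁ f =ᵐ[volume] fun θ => fn' f (expi θ))
    (hL₂ : ∀ ψ, L₂ ψ =ᵐ[volume] fun θ => (ph ψ θ : ℂ)) {f₀ : X} (hf₀ : f₀ ∈ S) {α₀ : Fin k → ℂ}
    (hα₀ : α₀ ∈ Config disc k) {g : Torus → ℂ} (hg : MemH g) (hg1 : ∀ᵐ θ : Torus, ‖g θ‖ = 1)
    (hdeg : degree g = ∑ j, (d j : ℝ)) (hn : IsNondegenerateCritical (WConf d (fn f₀) g) (fn f₀ ∘ α₀)) :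
    ∃ (𝒱 : Set (X × Y)) (α : X × Y → Fin k → ℂ) (δ : ℝ),
      IsOpen 𝒱 ∧ (f₀, 0) ∈ 𝒱 ∧ (∀ p ∈ 𝒱, p.1 ∈ S) ∧
      ContDiffOn ℝ ∞ α 𝒱 ∧ (∀ p ∈ 𝒱, α p ∈ Config disc k) ∧ 0 < δ ∧
      ∀ (f : X) (ψ : Y), (f, ψ) ∈ 𝒱 →
        {a | a ∈ Config (fn f '' disc) k ∧ IsCritical (WConf d (fn f) (twist g (ph ψ))) a ∧
            ‖discInv (fn f) ∘ a - α₀‖ < δ} = {fn f ∘ α (f, ψ)} ∧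
        IsNondegenerateCritical (WConf d (fn f) (twist g (ph ψ))) (fn f ∘ α (f, ψ)) := by
  obtain ⟨c, hc⟩ := hl f₀ hf₀
  have h0 : Represents (L₁ f₀, (0 : L2C)) (fn' f₀) fun _ => 0 := by
    refine ⟨hL₁ f₀, ?_⟩
    filter_upwards [Lp.coeFn_zero ℂ 2 (volume : Measure Torus)] with θ hθ
    rw [hθ]; simp
  obtain ⟨𝒰, a, δ, h1, h2, -, h4, h5, h6, h7⟩ :=
    exists_vortex_branch hg hg1 hdeg (hfn f₀) hc hα₀ hn h0
  -- The branch is pulled back by a continuous linear map, so smoothness in the finer norms is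
  -- automatic.
  set L : X × Y →L[ℝ] L2C × L2C := L₁.prodMap L₂ with hL
  refine ⟨Prod.fst ⁻¹' S ∩ L ⁻¹' 𝒰, a ∘ L, δ, (hS.preimage continuous_fst).inter (h1.preimage L.continuous),
    ⟨hf₀, ?_⟩, fun p hp => hp.1, h5.comp L.contDiff.contDiffOn fun p hp => hp.2,
    fun p hp => (h6 _ hp.2).1, h4, fun f ψ hp => ?_⟩
  · change (L₁ f₀, L₂ 0) ∈ 𝒰
    rwa [map_zero]
  · obtain ⟨c, hc⟩ := hl f hp.1
    obtain ⟨h8, h9⟩ := h7 (L (f, ψ)) (fn f) (fn' f) c (ph ψ) hp.2 (hfn f) hc (hph ψ) ⟨hL₁ f, hL₂ ψ⟩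
    exact ⟨setOf_critical_eq hc (h6 _ hp.2).1 (h6 _ hp.2).2 h8, h9⟩

/-! ### The phase of a unimodular datum relative to a nearby one. -/

section phase

/-- On the ball of radius 1/2 about 1 the real part exceeds 1/2, so the derivative 1/x of the
logarithm is at most 2; the ball is convex. -/
theorem norm_log_sub_log_le {z w : ℂ} (hz : ‖z - 1‖ < 1 / 2) (hw : ‖w - 1‖ < 1 / 2) :
    ‖Complex.log z - Complex.log w‖ ≤ 2 * ‖z - w‖ := by
  have hre : ∀ x ∈ Metric.ball (1 : ℂ) (1 / 2), 1 / 2 < x.re := fun x hx => by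
    have h1 := (Complex.abs_re_le_norm (x - 1)).trans_lt (mem_ball_iff_norm.1 hx)
    rw [Complex.sub_re, Complex.one_re, abs_lt] at h1
    linarith
  refine (convex_ball (1 : ℂ) (1 / 2)).norm_image_sub_le_of_norm_hasDerivWithin_le (f' := fun x => x⁻¹)
    (fun x hx => (Complex.hasDerivAt_log (Or.inl ?_)).hasDerivWithinAt) (fun x hx => ?_)
    (mem_ball_iff_norm.2 hw) (mem_ball_iff_norm.2 hz)
  · linarith [hre x hx]
  · rw [norm_inv]
    have h1 := (hre x hx).le.trans (Complex.re_le_norm x)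
    exact inv_le_of_inv_le₀ (by norm_num) (by linarith)

/-- The phase of `g` with respect to `g₀`. -/
def phase (g₀ g : Torus → ℂ) (θ : Torus) : ℝ := (Complex.log (g θ * (starRingEnd ℂ) (g₀ θ))).im

variable {g₀ g : Torus → ℂ}

theorem norm_mul_conj_sub_one {a b : ℂ} (hb : ‖b‖ = 1) : ‖a * (starRingEnd ℂ) b - 1‖ = ‖a - b‖ := by
  have h1 : b * (starRingEnd ℂ) b = 1 := by
    rw [Complex.mul_conj, Complex.normSq_eq_norm_sq, hb]; simp
  rw [← h1, ← sub_mul, norm_mul, RCLike.norm_conj, hb, mul_one]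

theorem twist_phase (h₀ : ∀ θ, ‖g₀ θ‖ = 1) (h : ∀ θ, ‖g θ‖ = 1) : twist g₀ (phase g₀ g) = g := by
  funext θ
  have h1 : (starRingEnd ℂ) (g₀ θ) * g₀ θ = 1 := by
    rw [mul_comm, Complex.mul_conj, Complex.normSq_eq_norm_sq, h₀]; simp
  have h2 : ‖g θ * (starRingEnd ℂ) (g₀ θ)‖ = 1 := by
    rw [norm_mul, RCLike.norm_conj, h, h₀, one_mul]
  have h3 : Complex.I * (phase g₀ g θ : ℂ) = Complex.log (g θ * (starRingEnd ℂ) (g₀ θ)) := by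
    apply Complex.ext
    · rw [Complex.log_re, h2, Real.log_one]; simp
    · simp [phase]
  rw [twist, h3, Complex.exp_log (norm_ne_zero_iff.1 (by rw [h2]; exact one_ne_zero)), mul_comm, mul_assoc, h1,
    mul_one]

/-- The principal logarithm inverts the exponential because the phase stays strictly within (-π, π).
-/
theorem phase_twist (h₀ : ∀ θ, ‖g₀ θ‖ = 1) {ψ : Torus → ℝ} (hψ : ∀ θ, |ψ θ| < π) :
    phase g₀ (twist g₀ ψ) = ψ := by
  funext θ
  have h1 : twist g₀ ψ θ * (starRingEnd ℂ) (g₀ θ) = Complex.exp (Complex.I * ψ θ) := by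
    rw [twist, mul_right_comm, Complex.mul_conj, Complex.normSq_eq_norm_sq, h₀]; simp
  have h2 := abs_lt.1 (hψ θ)
  rw [phase, h1, Complex.log_exp (by simpa using h2.1) (by simpa using h2.2.le)]
  simp

theorem abs_phase_sub_le (h₀ : ∀ θ, ‖g₀ θ‖ = 1) (h : ∀ θ, ‖g θ‖ = 1)
    (hs : ∀ θ, ‖g θ - g₀ θ‖ < 1 / 2) (x y : Torus) :
    |phase g₀ g x - phase g₀ g y| ≤ 2 * (‖g x - g y‖ + ‖g₀ x - g₀ y‖) := by
  rw [phase, phase, ← Complex.sub_im]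
  refine (Complex.abs_im_le_norm _).trans ((norm_log_sub_log_le
    (by rw [norm_mul_conj_sub_one (h₀ x)]; exact hs x)
    (by rw [norm_mul_conj_sub_one (h₀ y)]; exact hs y)).trans ?_)
  have e : g x * (starRingEnd ℂ) (g₀ x) - g y * (starRingEnd ℂ) (g₀ y) =
      (g x - g y) * (starRingEnd ℂ) (g₀ x) + g y * (starRingEnd ℂ) (g₀ x - g₀ y) := by
    rw [map_sub]; ring
  rw [e]
  refine mul_le_mul_of_nonneg_left ((norm_add_le _ _).trans_eq ?_) zero_le_two
  rw [norm_mul, norm_mul, RCLike.norm_conj, RCLike.norm_conj, h₀, h, mul_one, one_mul]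

theorem abs_phase_le (h₀ : ∀ θ, ‖g₀ θ‖ = 1) (hs : ∀ θ, ‖g θ - g₀ θ‖ < 1 / 2) (θ : Torus) :
    |phase g₀ g θ| ≤ 2 * ‖g θ - g₀ θ‖ := by
  have h1 := norm_log_sub_log_le (z := g θ * (starRingEnd ℂ) (g₀ θ)) (w := 1)
    (by rw [norm_mul_conj_sub_one (h₀ θ)]; exact hs θ) (by simp)
  rw [Complex.log_one, sub_zero, norm_mul_conj_sub_one (h₀ θ)] at h1
  exact (Complex.abs_im_le_norm _).trans h1

/-- Only Lipschitz regularity is needed: the logarithm is Lipschitz near 1, and both data are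
Lipschitz as C¹ functions. -/
theorem memH_phase {β : ℝ} {g₀ g : C1Holder β ℂ} (h₀ : ∀ θ, ‖g₀.fn θ‖ = 1) (h : ∀ θ, ‖g.fn θ‖ = 1)
    (hs : ∀ θ, ‖g.fn θ - g₀.fn θ‖ < 1 / 2) : MemH fun θ => (phase g₀.fn g.fn θ : ℂ) := by
  have hc : Continuous fun θ => phase g₀.fn g.fn θ := by
    refine Complex.continuous_im.comp (Continuous.clog (g.continuous.mul
      (Complex.continuous_conj.comp g₀.continuous)) fun θ => ?_)
    have h1 := (Complex.abs_re_le_norm (g.fn θ * (starRingEnd ℂ) (g₀.fn θ) - 1)).trans_lt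
      (by rw [norm_mul_conj_sub_one (h₀ θ)]; exact hs θ)
    rw [Complex.sub_re, Complex.one_re, abs_lt] at h1
    exact Or.inl (by linarith)
  refine memH_of_lipschitz (memLp_of_continuous (Complex.continuous_ofReal.comp hc))
    (L := 2 * (‖g.1.2.1‖ + ‖g₀.1.2.1‖)) fun θ t => ?_
  rw [← Complex.ofReal_sub, Complex.norm_real, mul_assoc, add_mul]
  refine (abs_phase_sub_le h₀ h hs _ _).trans (mul_le_mul_of_nonneg_left (add_le_add ?_ ?_) zero_le_two)
  · exact g.norm_add_sub_le θ t
  · exact g₀.norm_add_sub_le θ t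

end phase

/-- The phase of `g` with respect to `g₀`, as a square integrable function. -/
def phaseL2 (g₀ g : Torus → ℂ) : L2C :=
  open Classical in
  if h : MemLp (fun θ => (phase g₀ g θ : ℂ)) 2 (volume : Measure Torus) then h.toLp else 0

theorem phaseL2_ae {g₀ g : Torus → ℂ} (h : MemLp (fun θ => (phase g₀ g θ : ℂ)) 2 volume) :
    phaseL2 g₀ g =ᵐ[volume] fun θ => (phase g₀ g θ : ℂ) := by
  rw [phaseL2, dif_pos h]
  exact h.coeFn_toLp

/-- Smooth dependence of nondegenerate critical points on the boundary datum, in a fixed domain. -/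
theorem exists_critical_fixed_domain {k : ℕ} {d : Fin k → ℤ} {β : ℝ} (hβ0 : 0 < β) (hβ1 : β < 1)
    {f : HolC1Holder β} {a₀ : Fin k → ℂ} {g₀ : C1Holder β ℂ} (hf : f ∈ confC1Holder β)
    (ha₀ : a₀ ∈ Config (f.fn '' disc) k) (hg1 : ∀ θ : Torus, ‖g₀.fn θ‖ = 1)
    (hdeg : degree g₀.fn = ∑ j, (d j : ℝ)) (hn : IsNondegenerateCritical (WConf d f.fn g₀.fn) a₀) :
    ∃ (𝔄 : Set (C1Holder β ℂ)) (a : C1Holder β ℂ → Fin k → ℂ) (δ : ℝ),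
      IsOpen 𝔄 ∧ g₀ ∈ 𝔄 ∧ 0 < δ ∧
      (∀ g ∈ 𝔄, (∀ θ : Torus, ‖g.fn θ‖ = 1) →
        {b | b ∈ Config (f.fn '' disc) k ∧ IsCritical (WConf d f.fn g.fn) b ∧ ‖b - a₀‖ < δ} = {a g} ∧
        IsNondegenerateCritical (WConf d f.fn g.fn) (a g)) ∧
      ∃ (𝔅 : Set (C1Holder β ℝ)) (b : C1Holder β ℝ → Fin k → ℂ),
        IsOpen 𝔅 ∧ 0 ∈ 𝔅 ∧ ContDiffOn ℝ ∞ b 𝔅 ∧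
        ∀ ψ ∈ 𝔅, ∃ g ∈ 𝔄, g.fn = twist g₀.fn ψ.fn ∧ b ψ = a g := by
  have h : DiscC1 f.fn (extendZero f.1.2.1) := (HolC1Holder.toHolC1 f).discC1
  obtain ⟨c, hl⟩ : ∃ c, DiscC1.LowerLip f.fn c := mem_confC1_iff.1 ((mem_confC1Holder_iff hβ0).1 hf)
  have hinj := hl.injOn.mono disc_subset_cdisc
  have ho : IsOpen (f.fn '' disc) :=
    h.isOpen_image fun z hz => hl.deriv_ne_zero h (disc_subset_cdisc hz)
  obtain ⟨α₀, hα₀, rfl⟩ := (mem_config_image_iff hinj).1 ha₀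
  set F := f.fn with hF
  set q := HolC1.derivL2 (HolC1Holder.toHolC1 f) with hq
  have hqr : q =ᵐ[volume] fun θ => extendZero f.1.2.1 (expi θ) := HolC1.derivL2_ae _
  obtain ⟨𝒰, a, δ₀, h1, h2, h3, h4, h5, h6, h7⟩ := exists_vortex_branch (p₀ := (q, 0)) g₀.memH_fn
    (.of_forall hg1) hdeg h hl hα₀ hn ⟨hqr, by
      filter_upwards [Lp.coeFn_zero ℂ 2 (volume : Measure Torus)] with θ hθ
      rw [hθ]; simp⟩
  have hΨ : ∀ α ∈ Config disc k, ContDiffAt ℝ ∞ (fun b : Fin k → ℂ => F ∘ b) α := fun α hα =>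
    contDiffAt_comp_pi fun j => h.differentiableOn.analyticAt (Metric.isOpen_ball.mem_nhds (hα.1 j))
  -- The branch isolates critical points by a distance in disc coordinates, whereas δ is a distance
  -- in Ω; continuity of the inverse map at F ∘ α₀ converts one into the other.
  obtain ⟨δ, hδ, hδ'⟩ : ∃ δ > 0, ∀ b : Fin k → ℂ, ‖b - F ∘ α₀‖ < δ →
      discInv F ∘ b ∈ Metric.ball α₀ δ₀ := by
    have h8 : ContinuousAt (fun b : Fin k → ℂ => discInv F ∘ b) (F ∘ α₀) :=
      (contDiffAt_comp_pi fun j => (h.differentiableOn_discInv hl).analyticAt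
        (ho.mem_nhds (mem_image_of_mem F (hα₀.1 j)))).continuousAt
    have h9 := h8.preimage_mem_nhds (t := Metric.ball α₀ δ₀) (by
      simp only [discInv_comp hl hα₀.1]; exact Metric.ball_mem_nhds _ h4)
    obtain ⟨δ, hδ, hδ'⟩ := Metric.mem_nhds_iff.1 h9
    exact ⟨δ, hδ, fun b hb => hδ' (mem_ball_iff_norm.2 hb)⟩
  obtain ⟨r, hr, hr'⟩ : ∃ r > 0, ∀ p : L2C, ‖p‖ < r →
      (q, p) ∈ 𝒰 ∧ ‖F ∘ a (q, p) - F ∘ α₀‖ < δ := by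
    have h8 : ContinuousAt (fun p : L2C => a (q, p)) 0 :=
      ContinuousAt.comp (g := a) (f := fun p : L2C => (q, p)) ((h5.contDiffAt (h1.mem_nhds h2)).continuousAt)
        (by fun_prop)
    have h9 : ContinuousAt (fun p : L2C => F ∘ a (q, p)) 0 :=
      ContinuousAt.comp (g := fun b : Fin k → ℂ => F ∘ b) (f := fun p : L2C => a (q, p))
        (by rw [h3]; exact (hΨ α₀ hα₀).continuousAt) h8
    have h10 : ∀ᶠ p : L2C in 𝓝 0, F ∘ a (q, p) ∈ Metric.ball (F ∘ α₀) δ :=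
      h9.eventually (Metric.isOpen_ball.mem_nhds (by simp only [h3]; exact Metric.mem_ball_self hδ))
    have h11 : ∀ᶠ p : L2C in 𝓝 0, (q, p) ∈ 𝒰 :=
      (by fun_prop : ContinuousAt (fun p : L2C => (q, p)) 0).eventually (h1.mem_nhds h2)
    obtain ⟨r, hr, hr'⟩ := Metric.mem_nhds_iff.1 (h11.and h10)
    exact ⟨r, hr, fun p hp => (hr' (mem_ball_zero_iff.2 hp)).imp_right mem_ball_iff_norm.1⟩
  -- M compares the L² norm with the sup norm. The phase is at most twice |g - g₀| ≤ ε, so M · 2ε <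
  -- r makes its L² norm admissible, and ε ≤ 1/2 keeps the logarithm away from its cut.
  set M : ℝ := (measureUnivNNReal (volume : Measure Torus) : ℝ) ^ (2 : ℝ≥0∞).toReal⁻¹ with hM
  have hM0 : 0 ≤ M := by positivity
  set ε : ℝ := min (1 / 2) (r / (2 * (M + 1))) with hε
  have hε0 : 0 < ε := lt_min (by norm_num) (by positivity)
  have hεM : M * (2 * ε) < r := by
    have h8 : ε * (2 * (M + 1)) ≤ r := (le_div_iff₀ (by positivity)).1 (min_le_right _ _)
    nlinarith
  -- Closeness in the sup norm is enough, since the branch depends on the phase only through L².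
  set 𝔄 : Set (C1Holder β ℂ) := {g | ‖g.1.1 - g₀.1.1‖ < ε} with h𝔄
  have hsup : ∀ g ∈ 𝔄, ∀ θ, ‖g.fn θ - g₀.fn θ‖ < ε := fun g hg θ =>
    ((g.1.1 - g₀.1.1).norm_coe_le_norm θ).trans_lt hg
  have hmem : ∀ g ∈ 𝔄, (∀ θ, ‖g.fn θ‖ = 1) → MemH fun θ => (phase g₀.fn g.fn θ : ℂ) :=
    fun g hg hg' => memH_phase hg1 hg' fun θ => (hsup g hg θ).trans_le (min_le_left _ _)
  have hsmall : ∀ g ∈ 𝔄, (∀ θ, ‖g.fn θ‖ = 1) → ‖phaseL2 g₀.fn g.fn‖ < r := by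
    intro g hg hg'
    refine (Lp.norm_le_of_ae_bound (C := 2 * ε) (by positivity) ?_).trans_lt hεM
    filter_upwards [phaseL2_ae (hmem g hg hg').1] with θ hθ
    rw [hθ, Complex.norm_real]
    exact (abs_phase_le hg1 (fun θ => (hsup g hg θ).trans_le (min_le_left _ _)) θ).trans
      (mul_le_mul_of_nonneg_left (hsup g hg θ).le zero_le_two)
  refine ⟨𝔄, fun g => F ∘ a (q, phaseL2 g₀.fn g.fn), δ, ?_, by simp [h𝔄, hε0], hδ, fun g hg hg' => ?_,
    {ψ | ‖ψ.1.1‖ < ε} ∩ {ψ | (q, C1Holder.toL2 ψ) ∈ 𝒰}, fun ψ => F ∘ a (q, C1Holder.toL2 ψ),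
    ?_, ?_, ?_, ?_⟩
  · exact isOpen_lt (by fun_prop) continuous_const
  · obtain ⟨h8, h9⟩ := hr' _ (hsmall g hg hg')
    obtain ⟨h10, h11⟩ := h7 _ F _ c _ h8 h hl (hmem g hg hg') ⟨hqr, phaseL2_ae (hmem g hg hg').1⟩
    rw [twist_phase hg1 hg'] at h10 h11
    refine ⟨?_, h11⟩
    ext b
    simp only [mem_ofPred_eq, mem_singleton_iff]
    constructor
    · rintro ⟨h12, h13, h14⟩
      obtain ⟨γ, hγ, rfl⟩ := (mem_config_image_iff hinj).1 h12
      have h15 := hδ' _ h14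
      rw [discInv_comp hl hγ.1] at h15
      rw [(h10 γ h15 hγ).1 h13]
    · rintro rfl
      exact ⟨(mem_config_image_iff hinj).2 ⟨_, (h6 _ h8).1, rfl⟩, h11.1, h9⟩
  · refine IsOpen.inter (isOpen_lt (by fun_prop) continuous_const) ?_
    exact h1.preimage (continuous_const.prodMk C1Holder.toL2.continuous)
  · refine ⟨by simpa using hε0, ?_⟩
    change (q, C1Holder.toL2 0) ∈ 𝒰
    rwa [map_zero]
  · intro ψ hψ
    have h8 : ContDiffAt ℝ ∞ (fun ψ : C1Holder β ℝ => a (q, C1Holder.toL2 ψ)) ψ :=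
      ContDiffAt.comp (g := a) (f := fun ψ : C1Holder β ℝ => (q, C1Holder.toL2 ψ)) ψ
        (h5.contDiffAt (h1.mem_nhds hψ.2)) (contDiffAt_const.prodMk C1Holder.toL2.contDiff.contDiffAt)
    exact (ContDiffAt.comp (g := fun b : Fin k → ℂ => F ∘ b)
      (f := fun ψ : C1Holder β ℝ => a (q, C1Holder.toL2 ψ)) ψ (hΨ _ (h6 _ hψ.2).1) h8).contDiffWithinAt
  · intro ψ hψ
    obtain ⟨g, hg⟩ := C1Holder.exists_twist hβ0 hβ1 g₀ ψ
    have hψε : ∀ θ, |ψ.fn θ| ≤ ‖ψ.1.1‖ := fun θ => ψ.1.1.norm_coe_le_norm θ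
    have hψπ : ∀ θ, |ψ.fn θ| < π := fun θ => by
      have h8 := (hψε θ).trans_lt (lt_of_lt_of_le hψ.1 (min_le_left _ _))
      linarith [pi_gt_three]
    have hgA : g ∈ 𝔄 := by
      refine lt_of_le_of_lt ((ContinuousMap.norm_le _ (norm_nonneg ψ.1.1)).2 fun θ => ?_) hψ.1
      change ‖g.fn θ - g₀.fn θ‖ ≤ _
      have h8 := norm_exp_I_sub_exp_I_le (ψ.fn θ) 0
      rw [Complex.ofReal_zero, mul_zero, Complex.exp_zero, sub_zero] at h8
      rw [hg, twist, ← mul_sub_one, norm_mul, hg1, one_mul]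
      exact h8.trans (hψε θ)
    have hg1' : ∀ θ, ‖g.fn θ‖ = 1 := fun θ => by rw [hg, norm_twist, hg1]
    refine ⟨g, hgA, hg, ?_⟩
    -- For small ψ the phase of g₀ e^{iψ} relative to g₀ is ψ itself, so the smooth branch in ψ and
    -- the critical point attached to g are the same.
    have h8 : C1Holder.toL2 ψ = phaseL2 g₀.fn g.fn := by
      refine Lp.ext ?_
      filter_upwards [C1Holder.toL2_ae ψ, phaseL2_ae (hmem g hgA hg1').1] with θ h9 h10
      rw [h9, h10, hg, phase_twist hg1 hψπ]
    simp only [h8]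

end RenormEnergy

end

theorem mainTheorem9 {k : ℕ} (d : Fin k → ℤ) :
    -- rough boundary data
    (∀ (f₀ : HolC1) (α₀ : Fin k → ℂ) (g₀ : H12 ℂ),
      f₀ ∈ confC1 → α₀ ∈ Config disc k →
      (∀ᵐ θ : Torus, ‖g₀.fn θ‖ = 1) →
      degree g₀.fn = ∑ j, (d j : ℝ) →
      IsNondegenerateCritical (WConf d f₀.fn g₀.fn) (f₀.fn ∘ α₀) →
      ∃ (𝒱 : Set (HolC1 × H12 ℝ))
        (α : HolC1 × H12 ℝ → Fin k → ℂ) (δ : ℝ),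
        IsOpen 𝒱 ∧ (f₀, 0) ∈ 𝒱 ∧ (∀ p ∈ 𝒱, p.1 ∈ confC1) ∧
        ContDiffOn ℝ ∞ α 𝒱 ∧ (∀ p ∈ 𝒱, α p ∈ Config disc k) ∧ 0 < δ ∧
        ∀ (f : HolC1) (ψ : H12 ℝ), (f, ψ) ∈ 𝒱 →
          (∃ g : H12 ℂ, g.fn =ᵐ[volume] twist g₀.fn ψ.fn) ∧
          {a | a ∈ Config (f.fn '' disc) k ∧
              IsCritical
                (WConf d f.fn (twist g₀.fn ψ.fn)) a ∧
              ‖discInv f.fn ∘ a - α₀‖ < δ} = {f.fn ∘ α (f, ψ)} ∧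
          IsNondegenerateCritical
            (WConf d f.fn (twist g₀.fn ψ.fn)) (f.fn ∘ α (f, ψ))) ∧
    -- `C^{1,β}` boundary data
    (∀ β : ℝ, 0 < β → β < 1 →
      ∀ (f₀ : HolC1Holder β) (α₀ : Fin k → ℂ) (g₀ : C1Holder β ℂ),
      f₀ ∈ confC1Holder β → α₀ ∈ Config disc k →
      (∀ θ : Torus, ‖g₀.fn θ‖ = 1) →
      degree g₀.fn = ∑ j, (d j : ℝ) →
      IsNondegenerateCritical (WConf d f₀.fn g₀.fn) (f₀.fn ∘ α₀) →
      ∃ (𝒱 : Set (HolC1Holder β × C1Holder β ℝ))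
        (α : HolC1Holder β × C1Holder β ℝ → Fin k → ℂ) (δ : ℝ),
        IsOpen 𝒱 ∧ (f₀, 0) ∈ 𝒱 ∧ (∀ p ∈ 𝒱, p.1 ∈ confC1Holder β) ∧
        ContDiffOn ℝ ∞ α 𝒱 ∧ (∀ p ∈ 𝒱, α p ∈ Config disc k) ∧ 0 < δ ∧
        ∀ (f : HolC1Holder β) (ψ : C1Holder β ℝ), (f, ψ) ∈ 𝒱 →
          (∃ g : C1Holder β ℂ, g.fn = twist g₀.fn ψ.fn) ∧
          {a | a ∈ Config (f.fn '' disc) k ∧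
              IsCritical
                (WConf d f.fn (twist g₀.fn ψ.fn)) a ∧
              ‖discInv f.fn ∘ a - α₀‖ < δ} = {f.fn ∘ α (f, ψ)} ∧
          IsNondegenerateCritical
            (WConf d f.fn (twist g₀.fn ψ.fn)) (f.fn ∘ α (f, ψ))) ∧
    -- fixed domain `Ω = f(𝔻)`; functions on its boundary are written `u ∘ f⁻¹`, with `u` on the circle
    (∀ β : ℝ, 0 < β → β < 1 →
      ∀ (f : HolC1Holder β) (a₀ : Fin k → ℂ) (g₀ : C1Holder β ℂ),
      f ∈ confC1Holder β →
      a₀ ∈ Config (f.fn '' disc) k →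
      (∀ θ : Torus, ‖g₀.fn θ‖ = 1) →
      degree g₀.fn = ∑ j, (d j : ℝ) →
      IsNondegenerateCritical (WConf d f.fn g₀.fn) a₀ →
      ∃ (𝔄 : Set (C1Holder β ℂ)) (a : C1Holder β ℂ → Fin k → ℂ) (δ : ℝ),
        IsOpen 𝔄 ∧ g₀ ∈ 𝔄 ∧ 0 < δ ∧
        (∀ g ∈ 𝔄, (∀ θ : Torus, ‖g.fn θ‖ = 1) →
          {b | b ∈ Config (f.fn '' disc) k ∧
              IsCritical (WConf d f.fn g.fn) b ∧ ‖b - a₀‖ < δ} = {a g} ∧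
          IsNondegenerateCritical (WConf d f.fn g.fn) (a g)) ∧
        ∃ (𝔅 : Set (C1Holder β ℝ)) (b : C1Holder β ℝ → Fin k → ℂ),
          IsOpen 𝔅 ∧ 0 ∈ 𝔅 ∧ ContDiffOn ℝ ∞ b 𝔅 ∧
          ∀ ψ ∈ 𝔅, ∃ g ∈ 𝔄, g.fn = twist g₀.fn ψ.fn ∧ b ψ = a g) := by
  refine ⟨fun f₀ α₀ g₀ hf₀ hα₀ hg1 hdeg hn => ?_, fun β hβ0 hβ1 f₀ α₀ g₀ hf₀ hα₀ hg1 hdeg hn => ?_,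
    fun β hβ0 hβ1 f a₀ g₀ hf ha₀ hg1 hdeg hn =>
      exists_critical_fixed_domain hβ0 hβ1 hf ha₀ hg1 hdeg hn⟩
  · obtain ⟨𝒱, α, δ, h1, h2, h3, h4, h5, h6, h7⟩ := exists_smooth_critical (X := HolC1) (Y := H12 ℝ)
      isOpen_confC1 (fun f => f.discC1) (fun f hf => mem_confC1_iff.1 hf) (fun ψ => ψ.memH_ofReal)
      (fun f => HolC1.derivL2_ae f) (fun ψ => H12.toL2_ae ψ) hf₀ hα₀ g₀.memH_fn hg1 hdeg hn
    exact ⟨𝒱, α, δ, h1, h2, h3, h4, h5, h6, fun f ψ hp =>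
      ⟨(g₀.memH_fn.twist hg1 ψ.memH_ofReal).exists_H12, h7 f ψ hp⟩⟩
  · obtain ⟨𝒱, α, δ, h1, h2, h3, h4, h5, h6, h7⟩ := exists_smooth_critical (X := HolC1Holder β)
      (Y := C1Holder β ℝ) (isOpen_confC1Holder hβ0) (fun f => (HolC1Holder.toHolC1 f).discC1)
      (fun f hf => mem_confC1_iff.1 ((mem_confC1Holder_iff hβ0).1 hf)) (fun ψ => ψ.memH_ofReal)
      (L₁ := HolC1.derivL2.comp HolC1Holder.toHolC1) (fun f => HolC1.derivL2_ae _)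
      (fun ψ => C1Holder.toL2_ae ψ) hf₀ hα₀ g₀.memH_fn (.of_forall hg1) hdeg hn
    exact ⟨𝒱, α, δ, h1, h2, h3, h4, h5, h6, fun f ψ hp =>
      ⟨C1Holder.exists_twist hβ0 hβ1 g₀ ψ, h7 f ψ hp⟩⟩
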